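/- Let $H>0$ be the Hubble rate of the cosmological patch of de Sitter space, $ds^2=a(\eta)^2(-d\eta^2+d\vec x^2)$, $a(\eta)=-1/(H\eta)$, and consider a real, minimally coupled scalar field of mass $m>0$, $m<\tfrac32 H$, in the Bunch–Davies vacuum, i.e. the Fock vacuum of the modes $$e_k(\eta)=\sqrt{\tfrac{-\pi\eta}{4a(\eta)^2}}\;H^{(1)}_{\nu}(-k\eta),\qquad \nu=\sqrt{\tfrac94-\tfrac{m^2}{H^2}},$$ with canonical momentum $\Pi=a^2\partial_\eta\phi$. At the instant $a(\eta)=1$ let $\sigma_{H,m}(\gamma,\gamma')=\langle\{O_\gamma,O_{\gamma'}\}\rangle$ be its covariance metric, where $O_\gamma=\Phi(f)-\Pi(g)$ for $\gamma=(g,f)$. Let $A$ be a single-mode subsystem: $\Gamma_A=\mathrm{span}[\gamma_1,\gamma_2]$, where $\gamma_i=(g_i,f_i)$ are real, $g_i\in\dot H_{1/2}(\mathbb R^3)$, $f_i\in\dot H_{-1/2}(\mathbb R^3)$, both are supported in a closed ball of radius $R>0$, and $\omega(\gamma_2,\gamma_1)=\int(f_2g_1-g_2f_1)\,d^3x=1$.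 Assume that the field-smearing functions of $A$ do not all have zero average: $\int f_1\neq0$ or $\int f_2\ne 0$. Let $\nu_A=\sqrt{\det(\sigma_{H,m}(\gamma_i,\gamma_j))_{i,j}}$ and let $$S_A(H,m)=\tfrac{\nu_A+1}{2}\log_2\tfrac{\nu_A+1}{2}-\tfrac{\nu_A-1}{2}\log_2\tfrac{\nu_A-1}{2}$$ be the von Neumann entropy of $A$. Then $S_A$ grows monotonically with $H$ in the regime $RH\gg1$, $m/H\ll1$, in the following sense. (1) For every mass $m>0$ there are $\Lambda,\varepsilon>0$ such that $H\mapsto S_A(H,m)$ is strictly increasing on $\{H: RH>\Lambda,\ m/H<\varepsilon\}$. (2) There are $\Lambda,\varepsilon>0$ that depend only on the subsystem $A$ such that for every $m>0$ with $mR<\varepsilon$ the function $H\mapsto S_A(H,m)$ is strictly increasing on $\{H: RH>\Lambda\}$, and for every $r>0$ the function $H\mapsto S_A(H,rH)$ (fixed ratio $m/H=r$) is strictly increasing on $\{H: RH>\Lambda,\ rH\,R<\varepsilon\}$. -/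

import Mathlib

open MeasureTheory Filter Topology Set
open scoped SchwartzMap FourierTransform ComplexConjugate

noncomputable section

/-! ## Homogeneous Sobolev spaces on three-dimensional space -/

/-- Euclidean three-space, the abstract Cauchy surface. -/
abbrev Space3 : Type := EuclideanSpace ℝ (Fin 3)

/-- The tempered distribution `u` is real: it takes real values on real test functions. -/
def IsRealDistribution (u : 𝓢'(Space3, ℂ)) : Prop :=
  ∀ φ : 𝓢(Space3, ℂ), (∀ x, (φ x).im = 0) → (u φ).im = 0

/-- The Fourier transform of `u` is the locally integrable function `F`, as a distribution.
Mathlib's transform is `∫ h(x) e^{-2πi⟨x, ξ⟩} dx`; with `k = -2πξ` this is the transform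
`∫ h(x) e^{i⟨k, x⟩} dx`, and `d³k / (2π)³` becomes `dξ`. -/
def HasFourierFunction (u : 𝓢'(Space3, ℂ)) (F : Space3 → ℂ) : Prop :=
  LocallyIntegrable F volume ∧
    ∀ φ : 𝓢(Space3, ℂ), HasCompactSupport φ → (𝓕 u) φ = ∫ ξ, φ ξ * F ξ

open Classical in
/-- The Fourier transform of `u` as a function, if it is locally integrable
(unique up to null sets). -/
def fourierFunction (u : 𝓢'(Space3, ℂ)) : Space3 → ℂ :=
  if h : ∃ F, HasFourierFunction u F then h.choose else 0

/-- The wave number `|k| = 2π|ξ|`. -/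
def waveNumber (ξ : Space3) : ℝ := 2 * Real.pi * ‖ξ‖

/-- `u` lies in the homogeneous Sobolev space of order `s`: its Fourier transform is locally
integrable and `∫ |k|^{2s} |ũ(k)|² dk < ∞`. -/
def MemHomogeneousSobolev (s : ℝ) (u : 𝓢'(Space3, ℂ)) : Prop :=
  (∃ F, HasFourierFunction u F) ∧
    Integrable (fun ξ => waveNumber ξ ^ (2 * s) * ‖fourierFunction u ξ‖ ^ 2) volume

/-- `u` has vanishing spatial average, `∫ u = 0`.  The integral of a compactly supported
distribution is its value on a test function `χ` that is `1` near the support. -/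
def HasZeroAverage (u : 𝓢'(Space3, ℂ)) : Prop :=
  ∀ (K U : Set Space3) (χ : 𝓢(Space3, ℂ)), IsCompact K → IsOpen U → K ⊆ U →
    Distribution.IsVanishingOn u Kᶜ → (∀ x ∈ U, χ x = 1) → u χ = 0

/-! ## Classical phase space -/

/-- A pair `γ = (g, f)`; it labels the smeared operator `O_γ = Φ(f) - Π(g)`. -/
structure PhasePoint where
  /-- the function that smears the momentum -/
  g : 𝓢'(Space3, ℂ)
  /-- the function that smears the field -/
  f : 𝓢'(Space3, ℂ)

/-- `γ` is a real element of the completed phase space (`g` of Sobolev order `1/2`, `f` of order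
`-1/2`), and it is supported in the closed ball of radius `R` around `x₀`. -/
structure PhasePoint.IsLocalized (γ : PhasePoint) (x₀ : Space3) (R : ℝ) : Prop where
  real_g : IsRealDistribution γ.g
  real_f : IsRealDistribution γ.f
  sobolev_g : MemHomogeneousSobolev (1 / 2) γ.g
  sobolev_f : MemHomogeneousSobolev (-(1 / 2)) γ.f
  support_g : Distribution.IsVanishingOn γ.g (Metric.closedBall x₀ R)ᶜ
  support_f : Distribution.IsVanishingOn γ.f (Metric.closedBall x₀ R)ᶜ

/-- `∫ Re (ũ(k) conj ṽ(k)) w(|k|) d³k / (2π)³`. -/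
def weightedProduct (w : ℝ → ℝ) (u v : 𝓢'(Space3, ℂ)) : ℝ :=
  ∫ ξ, w (waveNumber ξ) * (fourierFunction u ξ * conj (fourierFunction v ξ)).re

/-- The symplectic form `ω(γ₁, γ₂) = ∫ (f₁ g₂ - g₁ f₂) d³x`, written in Fourier space
(Plancherel), where it converges absolutely on the whole completed phase space. -/
def symplecticForm (γ₁ γ₂ : PhasePoint) : ℝ :=
  weightedProduct (fun _ => 1) γ₁.f γ₂.g - weightedProduct (fun _ => 1) γ₁.g γ₂.f

/-! ## Bessel and Hankel functions of real order and positive argument -/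

/-- The Bessel function of the first kind, by its power series
(`1 / Γ` vanishes at the poles of `Γ`, as it should). -/
def besselJ (α x : ℝ) : ℝ :=
  ∑' j : ℕ, (-1 : ℝ) ^ j / ((j.factorial : ℝ) * Real.Gamma ((j : ℝ) + α + 1)) *
    (x / 2) ^ (2 * (j : ℝ) + α)

/-- `(J_α(x) cos πα - J_{-α}(x)) / sin πα`. -/
def besselYQuotient (α x : ℝ) : ℝ :=
  (besselJ α x * Real.cos (Real.pi * α) - besselJ (-α) x) / Real.sin (Real.pi * α)

open Classical in
/-- The Bessel function of the second kind (at integer order, by its limit in the order). -/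
def besselY (α x : ℝ) : ℝ :=
  if Real.sin (Real.pi * α) = 0 then limUnder (𝓝[≠] α) (fun β => besselYQuotient β x)
  else besselYQuotient α x

/-- The Hankel function of the first kind. -/
def hankelOne (α x : ℝ) : ℂ := (besselJ α x : ℂ) + Complex.I * (besselY α x : ℂ)

/-! ## The Bunch–Davies vacuum of a light field of mass `m`, for Hubble rate `H` -/

/-- The scale factor in conformal time `η < 0`. -/
def scaleFactor (H η : ℝ) : ℝ := -1 / (H * η)

/-- The order `√(9/4 - m²/H²)` of the mode functions (for `m ≤ 3H/2`). -/
def modeOrder (H m : ℝ) : ℝ := Real.sqrt (9 / 4 - m ^ 2 / H ^ 2)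

/-- The Bunch–Davies mode function of wave number `k` at conformal time `η`. -/
def bdMode (H m k η : ℝ) : ℂ :=
  (Real.sqrt (-(Real.pi * η) / (4 * scaleFactor H η ^ 2)) : ℂ) *
    hankelOne (modeOrder H m) (-(k * η))

/-- The mode function of the canonical momentum `Π = √h nᵃ∇ₐφ = a² ∂φ/∂η`. -/
def bdMomentumMode (H m k η : ℝ) : ℂ :=
  (scaleFactor H η ^ 2 : ℂ) * deriv (fun t : ℝ => bdMode H m k t) η

/-- The instant at which the scale factor equals one. -/
def unitTime (H : ℝ) : ℝ := -1 / H

/-- `⟨{Φ[f], Φ[f']}⟩` in the Bunch–Davies vacuum. -/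
def bdFieldField (H m : ℝ) (f f' : 𝓢'(Space3, ℂ)) : ℝ :=
  weightedProduct (fun k => 2 * ‖bdMode H m k (unitTime H)‖ ^ 2) f f'

/-- `⟨{Π[g], Π[g']}⟩` in the Bunch–Davies vacuum. -/
def bdMomentumMomentum (H m : ℝ) (g g' : 𝓢'(Space3, ℂ)) : ℝ :=
  weightedProduct (fun k => 2 * ‖bdMomentumMode H m k (unitTime H)‖ ^ 2) g g'

/-- `⟨{Φ[f], Π[g]}⟩` in the Bunch–Davies vacuum. -/
def bdFieldMomentum (H m : ℝ) (f g : 𝓢'(Space3, ℂ)) : ℝ :=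
  weightedProduct (fun k =>
    2 * (bdMode H m k (unitTime H) * conj (bdMomentumMode H m k (unitTime H))).re) f g

/-- The covariance metric `σ(γ, γ') = ⟨{O_γ, O_γ'}⟩` of the Bunch–Davies vacuum (whose first
moments vanish), with `O_γ = Φ(f) - Π(g)`. -/
def bdCovariance (H m : ℝ) (γ γ' : PhasePoint) : ℝ :=
  bdFieldField H m γ.f γ'.f - bdFieldMomentum H m γ.f γ'.g - bdFieldMomentum H m γ'.f γ.g +
    bdMomentumMomentum H m γ.g γ'.g

/-! ## Von Neumann entropy of a single-mode subsystem -/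

/-- The symplectic eigenvalue `√(det σ_A)` of the mode spanned by the Darboux basis `γ₁, γ₂`. -/
def symplecticEigenvalue (H m : ℝ) (γ₁ γ₂ : PhasePoint) : ℝ :=
  Real.sqrt (!![bdCovariance H m γ₁ γ₁, bdCovariance H m γ₁ γ₂;
    bdCovariance H m γ₂ γ₁, bdCovariance H m γ₂ γ₂]).det

/-- The von Neumann entropy (in bits) of a one-mode Gaussian state with symplectic
eigenvalue `ν`. -/
def gaussianEntropy (ν : ℝ) : ℝ :=
  (ν + 1) / 2 * Real.logb 2 ((ν + 1) / 2) - (ν - 1) / 2 * Real.logb 2 ((ν - 1) / 2)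

/-- The von Neumann entropy of the mode spanned by `γ₁, γ₂` in the Bunch–Davies vacuum of a field
of mass `m`, for Hubble rate `H`. -/
def bdEntropy (H m : ℝ) (γ₁ γ₂ : PhasePoint) : ℝ :=
  gaussianEntropy (symplecticEigenvalue H m γ₁ γ₂)

end

/-! Put δ = 3/2 − ν, so that δ(3 − δ) = m²/H² and δ → 0 for a light field. The entropy is a strictly
increasing function of det σ, so the claim is that the determinant of the 2×2 covariance matrix
grows with H. Up to the factor H⁴/Γ(2 − δ)⁴ this is the Gram determinant of two vector fields on
momentum space. The growth comes from the nearly scale invariant spectrum: long waves carry the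
weight k^(−3+2δ) d³k, whose integral over k < 1 is a multiple of 1/δ.

The Hankel functions are written as Laplace-type integrals (`hankelOne_eq`). The vector of the phase
point (g, f) becomes k^(−3/2) (f̂ φ + ĝ H (δ φ + (k/H)² π)) with two amplitudes φ, π that tend to 1.
Compact support makes f̂ and ĝ Lipschitz near k = 0 (`exists_fourierFunction_near_zero`), so the
vector is (∫f + δH ∫g) X plus a remainder that is square integrable uniformly in the parameters.
Here X is an explicit infrared vector, and δ ‖X‖² has a positive limit.

One of the two averages ∫f is nonzero, say that of the vector a. A shear of the basis makes the
other average zero, and subtracting a further multiple of the vector a removes the infrared part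
that remains in the vector b. What is left has the form H^(−e) Y, where Y tends to some Y₀ ≠ 0.
Hence det σ = H^(4−2e) s/δ, where s has a positive limit and H ∂s/∂H → 0. Since H ∂(log δ)/∂H → −κ₀,
the logarithmic derivative H ∂(log det σ)/∂H tends to 4 − 2e + κ₀. At fixed mass κ₀ = 2, at fixed
ratio m/H it is 0.

The exponent is e = 0 if f_b ≠ 0. If f_b = 0, then e = 1, unless (q + k²) ĝ_b is a certain multiple
of f̂_a, where q = lim δH². In that exceptional case e = 2; it can only occur for q ≠ 0, where κ₀ =
2, so 4 − 2e + κ₀ is positive in all cases. This is `IsRegime.exists_isSlow_gramDet_modeVector`;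
`IsRegime.eventually_hasDerivAt_pos` turns it into a positive derivative.

All limits are taken along filters on pairs of parameters. Constants that do not depend on m or r,
as in (2), are then obtained from a set in a filter that lets both parameters vary. -/

noncomputable section

/-! ## Bessel functions of the first kind by their power series -/

/-- The coefficients of the entire function `z ↦ ∑ (-1)^j z^j / (j! Γ(j + β + 1))`. -/
def besselCoeff (β : ℝ) (j : ℕ) : ℝ :=
  (-1 : ℝ) ^ j / ((j.factorial : ℝ) * Real.Gamma ((j : ℝ) + β + 1))

/-- The entire function `z ↦ ∑ (-1)^j z^j / (j! Γ(j + β + 1))`. -/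
def besselEntire (β z : ℝ) : ℝ := ∑' j : ℕ, besselCoeff β j * z ^ j

theorem one_le_Gamma_of_two_le {x : ℝ} (hx : 2 ≤ x) : 1 ≤ Real.Gamma x := by
  have := Real.Gamma_strictMonoOn_Ici.monotoneOn (by simp : (2 : ℝ) ∈ Ici 2) hx hx
  simpa [Real.Gamma_two] using this

theorem eventually_abs_besselCoeff_le (β : ℝ) :
    ∀ᶠ j : ℕ in atTop, |besselCoeff β j| ≤ 1 / (j.factorial : ℝ) := by
  filter_upwards [eventually_ge_atTop ⌈1 - β⌉₊] with j hj
  have h1 : 1 - β ≤ (j : ℝ) := (Nat.le_ceil _).trans (by exact_mod_cast hj)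
  have h2 : 1 ≤ Real.Gamma ((j : ℝ) + β + 1) := one_le_Gamma_of_two_le (by linarith)
  have h3 : (0 : ℝ) < j.factorial := by positivity
  rw [besselCoeff, abs_div, abs_pow, abs_neg, abs_one, one_pow, abs_of_pos (by positivity)]
  apply one_div_le_one_div_of_le h3
  nlinarith

theorem summable_besselCoeff (β z : ℝ) : Summable fun j : ℕ => besselCoeff β j * z ^ j := by
  have h1 := Real.summable_pow_div_factorial |z|
  refine Summable.of_norm_bounded_eventually_nat h1 ?_
  filter_upwards [eventually_abs_besselCoeff_le β] with j hj
  rw [norm_mul, norm_pow, Real.norm_eq_abs, Real.norm_eq_abs]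
  calc _ ≤ 1 / (j.factorial : ℝ) * |z| ^ j := by gcongr
    _ = _ := by ring

theorem succ_mul_besselCoeff_succ (β : ℝ) (j : ℕ) :
    ((j : ℝ) + 1) * besselCoeff β (j + 1) = -besselCoeff (β + 1) j := by
  have h : (j.factorial : ℝ) ≠ 0 := by positivity
  have h' : (j : ℝ) + 1 ≠ 0 := by positivity
  simp only [besselCoeff, Nat.factorial_succ, pow_succ]
  push_cast
  rw [show (j : ℝ) + 1 + β + 1 = j + (β + 1) + 1 by ring]
  by_cases hG : Real.Gamma ((j : ℝ) + (β + 1) + 1) = 0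
  · simp [hG]
  · field_simp

theorem besselCoeff_sub_one (β : ℝ) (j : ℕ) :
    besselCoeff (β - 1) j = ((j : ℝ) + β) * besselCoeff β j := by
  have h : (j.factorial : ℝ) ≠ 0 := by positivity
  simp only [besselCoeff]
  rw [show (j : ℝ) + (β - 1) + 1 = j + β by ring]
  -- At this pole `Real.Gamma 0 = 0` and division by zero gives 0, so both sides vanish. This keeps
  -- the recurrence valid for negative orders.
  by_cases h0 : (j : ℝ) + β = 0
  · simp [h0, Real.Gamma_zero]
  · rw [Real.Gamma_add_one h0]
    by_cases hG : Real.Gamma ((j : ℝ) + β) = 0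
    · simp [hG]
    · field_simp

/-- Termwise differentiation on a ball that contains z. By `succ_mul_besselCoeff_succ` the derived
series is, up to sign, the series with parameter β + 1, so the dominating series converges like the
original one. -/
theorem hasDerivAt_besselEntire (β z : ℝ) :
    HasDerivAt (besselEntire β) (-besselEntire (β + 1) z) z := by
  set r : ℝ := |z| + 1 with hr
  have hr0 : 0 < r := by positivity
  have hsum : Summable fun j : ℕ => |(j : ℝ) * besselCoeff β j| * r ^ (j - 1) := by
    rw [← summable_nat_add_iff 1]
    have h2 := (summable_besselCoeff (β + 1) r).abs
    refine h2.congr fun j => ?_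
    push_cast
    rw [succ_mul_besselCoeff_succ, abs_neg, abs_mul, abs_pow, abs_of_pos hr0]
  have key := hasDerivAt_tsum_of_isPreconnected hsum (Metric.isOpen_ball (x := (0 : ℝ)) (ε := r))
    (convex_ball (0 : ℝ) r).isPreconnected
    (g := fun j y => besselCoeff β j * y ^ j)
    (g' := fun j y => besselCoeff β j * ((j : ℝ) * y ^ (j - 1)))
    (fun j y _ => (hasDerivAt_pow j y).const_mul _)
    (fun j y hy => by
      rw [Metric.mem_ball, dist_zero_right] at hy
      rw [norm_mul, norm_mul, norm_pow, abs_mul, mul_comm |(j : ℝ)|, ← mul_assoc]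
      simp only [Real.norm_eq_abs] at hy ⊢
      gcongr)
    (y₀ := 0) (by simp [hr0]) (summable_besselCoeff β 0) (y := z)
    (by rw [Metric.mem_ball, dist_zero_right, Real.norm_eq_abs]; linarith)
  have hz : (∑' j : ℕ, besselCoeff β j * ((j : ℝ) * z ^ (j - 1))) = -besselEntire (β + 1) z := by
    have hs : Summable fun j : ℕ => besselCoeff β j * ((j : ℝ) * z ^ (j - 1)) := by
      refine Summable.of_norm_bounded hsum fun j => ?_
      rw [norm_mul, norm_mul, norm_pow, abs_mul, mul_comm |(j : ℝ)|, ← mul_assoc]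
      simp only [Real.norm_eq_abs]
      gcongr
      linarith
    rw [hs.tsum_eq_zero_add, besselEntire, ← tsum_neg]
    simp only [CharP.cast_eq_zero, zero_mul, mul_zero, zero_add]
    refine tsum_congr fun j => ?_
    have := succ_mul_besselCoeff_succ β j
    push_cast
    linear_combination z ^ j * this
  rw [hz] at key
  exact key

theorem besselEntire_sub_one (β z : ℝ) :
    besselEntire (β - 1) z = β * besselEntire β z - z * besselEntire (β + 1) z := by
  have h1 := summable_besselCoeff β z
  have h2 := summable_besselCoeff (β + 1) z
  have h3 : Summable fun j : ℕ => (j : ℝ) * besselCoeff β j * z ^ j := by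
    rw [← summable_nat_add_iff 1]
    refine (h2.mul_left (-z)).congr fun j => ?_
    have := succ_mul_besselCoeff_succ β j
    push_cast
    linear_combination -z ^ (j + 1) * this
  have h4 : ∑' j : ℕ, (j : ℝ) * besselCoeff β j * z ^ j = -(z * besselEntire (β + 1) z) := by
    rw [h3.tsum_eq_zero_add, besselEntire, ← tsum_mul_left, ← tsum_neg]
    simp only [CharP.cast_eq_zero, zero_mul, zero_add]
    refine tsum_congr fun j => ?_
    have := succ_mul_besselCoeff_succ β j
    push_cast
    linear_combination z ^ (j + 1) * this
  calc besselEntire (β - 1) z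
      = ∑' j : ℕ, (β * (besselCoeff β j * z ^ j) + (j : ℝ) * besselCoeff β j * z ^ j) := by
        rw [besselEntire]
        refine tsum_congr fun j => ?_
        rw [besselCoeff_sub_one]
        ring
    _ = _ := by
        rw [(h1.mul_left β).tsum_add h3, h4, tsum_mul_left, ← sub_eq_add_neg]
        rfl

theorem besselJ_eq_besselEntire (β : ℝ) {x : ℝ} (hx : 0 < x) :
    besselJ β x = (x / 2) ^ β * besselEntire β ((x / 2) ^ 2) := by
  rw [besselJ, besselEntire, ← tsum_mul_left]
  refine tsum_congr fun j => ?_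
  rw [besselCoeff, Real.rpow_add (by positivity), Real.rpow_mul (by positivity),
    Real.rpow_two, Real.rpow_natCast]
  ring

theorem besselJ_recurrence (β : ℝ) {x : ℝ} (hx : 0 < x) :
    besselJ (β - 1) x = 2 * β / x * besselJ β x - besselJ (β + 1) x := by
  have h2 : 0 < x / 2 := by positivity
  rw [besselJ_eq_besselEntire _ hx, besselJ_eq_besselEntire _ hx, besselJ_eq_besselEntire _ hx,
    besselEntire_sub_one, Real.rpow_sub_one h2.ne', Real.rpow_add_one h2.ne']
  field_simp

theorem hasDerivAt_besselJ (β : ℝ) {x : ℝ} (hx : 0 < x) :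
    HasDerivAt (besselJ β) (β / x * besselJ β x - besselJ (β + 1) x) x := by
  have h2 : 0 < x / 2 := by positivity
  have hd : HasDerivAt (fun y : ℝ => (y / 2) ^ β * besselEntire β ((y / 2) ^ 2))
      (1 / 2 * β * (x / 2) ^ (β - 1) * besselEntire β ((x / 2) ^ 2)
        + (x / 2) ^ β * (-besselEntire (β + 1) ((x / 2) ^ 2) * (2 * (x / 2) * (1 / 2)))) x := by
    have hb : HasDerivAt (fun y : ℝ => y / 2) (1 / 2) x := (hasDerivAt_id x).div_const 2
    refine (hb.rpow_const (Or.inl h2.ne')).mul ?_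
    refine (hasDerivAt_besselEntire β _).comp x ?_
    exact (hb.pow 2).congr_deriv (by norm_num)
  have he : besselJ β =ᶠ[𝓝 x] fun y : ℝ => (y / 2) ^ β * besselEntire β ((y / 2) ^ 2) := by
    filter_upwards [lt_mem_nhds hx] with y hy using besselJ_eq_besselEntire β hy
  refine (hd.congr_of_eventuallyEq he).congr_deriv ?_
  rw [besselJ_eq_besselEntire _ hx, besselJ_eq_besselEntire _ hx, Real.rpow_sub_one h2.ne',
    Real.rpow_add_one h2.ne']
  field_simp
  ring

theorem hasDerivAt_besselJ_succ (β : ℝ) {x : ℝ} (hx : 0 < x) :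
    HasDerivAt (besselJ (β + 1)) (besselJ β x - (β + 1) / x * besselJ (β + 1) x) x := by
  refine (hasDerivAt_besselJ (β + 1) hx).congr_deriv ?_
  have := besselJ_recurrence (β + 1) hx
  rw [show β + 1 - 1 = β by ring] at this
  rw [this]
  ring

/-- The derivative of `√x J_β(x)`. -/
def sqrtBesselJDeriv (β x : ℝ) : ℝ :=
  Real.sqrt x * ((β + 1 / 2) / x * besselJ β x - besselJ (β + 1) x)

theorem hasDerivAt_sqrt_mul_besselJ (β : ℝ) {x : ℝ} (hx : 0 < x) :
    HasDerivAt (fun y => Real.sqrt y * besselJ β y) (sqrtBesselJDeriv β x) x := by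
  refine ((Real.hasDerivAt_sqrt hx.ne').mul (hasDerivAt_besselJ β hx)).congr_deriv ?_
  have hs : Real.sqrt x ≠ 0 := (Real.sqrt_pos.2 hx).ne'
  have hsq : Real.sqrt x ^ 2 = x := Real.sq_sqrt hx.le
  rw [sqrtBesselJDeriv]
  field_simp
  rw [hsq]
  ring

/-- The factor √x removes the first-order term of Bessel's equation. The remaining coefficient
depends on β² only, so the orders β and −β solve the same equation; for β = ±(α + 1/2) one has β² −
1/4 = α(α + 1), which is the equation of `hankelWave`. -/
theorem hasDerivAt_sqrtBesselJDeriv (β : ℝ) {x : ℝ} (hx : 0 < x) :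
    HasDerivAt (sqrtBesselJDeriv β)
      (-(1 - (β ^ 2 - 1 / 4) / x ^ 2) * (Real.sqrt x * besselJ β x)) x := by
  have hs : Real.sqrt x ≠ 0 := (Real.sqrt_pos.2 hx).ne'
  have hsq : Real.sqrt x ^ 2 = x := Real.sq_sqrt hx.le
  have hi : HasDerivAt (fun y : ℝ => (β + 1 / 2) / y) (-(β + 1 / 2) / x ^ 2) x := by
    refine ((hasDerivAt_inv hx.ne').const_mul (β + 1 / 2)).congr_deriv ?_
    field_simp
  refine ((Real.hasDerivAt_sqrt hx.ne').mul
    ((hi.mul (hasDerivAt_besselJ β hx)).sub (hasDerivAt_besselJ_succ β hx))).congr_deriv ?_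
  simp only [Pi.mul_apply, Pi.sub_apply]
  field_simp
  rw [hsq]
  ring

/-! ## The Laplace-type integrals `∫ e^{-u} u^a (u/2 - ix)^b du` -/

/-- The complex number `u/2 - ix`. -/
def laplaceBase (u x : ℝ) : ℂ := ((u / 2 : ℝ) : ℂ) - Complex.I * (x : ℂ)

/-- The integrand `e^{-u} u^a (u/2 - ix)^b`. -/
def laplaceIntegrand (a b x u : ℝ) : ℂ :=
  ((Real.exp (-u) * u ^ a : ℝ) : ℂ) * laplaceBase u x ^ (b : ℂ)

/-- The integral `∫ e^{-u} u^a (u/2 - ix)^b du` over `u > 0`. -/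
def laplaceIntegral (a b x : ℝ) : ℂ := ∫ u in Ioi (0 : ℝ), laplaceIntegrand a b x u

@[simp] theorem laplaceBase_re (u x : ℝ) : (laplaceBase u x).re = u / 2 := by
  simp [laplaceBase, -Complex.ofReal_div]

@[simp] theorem laplaceBase_im (u x : ℝ) : (laplaceBase u x).im = -x := by
  simp [laplaceBase, -Complex.ofReal_div]

theorem laplaceBase_mem_slitPlane (u : ℝ) {x : ℝ} (hx : 0 < x) :
    laplaceBase u x ∈ Complex.slitPlane :=
  Or.inr (by simp [hx.ne'])

theorem laplaceBase_ne_zero (u : ℝ) {x : ℝ} (hx : 0 < x) : laplaceBase u x ≠ 0 :=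
  Complex.slitPlane_ne_zero (laplaceBase_mem_slitPlane u hx)

theorem le_norm_laplaceBase (u : ℝ) {x : ℝ} (hx : 0 < x) : x ≤ ‖laplaceBase u x‖ := by
  have := Complex.abs_im_le_norm (laplaceBase u x)
  rwa [laplaceBase_im, abs_neg, abs_of_pos hx] at this

theorem half_le_norm_laplaceBase (u x : ℝ) : u / 2 ≤ ‖laplaceBase u x‖ := by
  have := Complex.abs_re_le_norm (laplaceBase u x)
  rw [laplaceBase_re] at this
  exact (le_abs_self _).trans this

theorem norm_laplaceBase_le {u x : ℝ} (hu : 0 ≤ u) (hx : 0 ≤ x) :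
    ‖laplaceBase u x‖ ≤ u / 2 + x := by
  refine (Complex.norm_le_abs_re_add_abs_im _).trans ?_
  rw [laplaceBase_re, laplaceBase_im, abs_neg, abs_of_nonneg hx, abs_of_nonneg (by positivity)]

theorem rpow_le_rpow_neg_abs_add_rpow_abs {t : ℝ} (ht : 0 < t) (b : ℝ) :
    t ^ b ≤ t ^ (-|b|) + t ^ |b| := by
  rcases le_total 0 b with h | h
  · rw [abs_of_nonneg h]
    linarith [Real.rpow_nonneg ht.le (-b)]
  · rw [abs_of_nonpos h, neg_neg]
    linarith [Real.rpow_nonneg ht.le (-b)]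

/-- The modulus of u/2 − ix lies between c and max(2C, u). Adding the powers with exponents −|b| and
|b| avoids a distinction by the sign of b and gives a bound uniform for x in [c, C]. -/
theorem norm_laplaceBase_cpow_le {u x c C b : ℝ} (hu : 0 ≤ u) (hc : 0 < c) (hx : c ≤ x)
    (hC : x ≤ C) :
    ‖laplaceBase u x ^ (b : ℂ)‖ ≤ c ^ (-|b|) + (2 * C) ^ |b| + u ^ |b| := by
  have hx0 := hc.trans_le hx
  have hl := hx.trans (le_norm_laplaceBase u hx0)
  rw [Complex.norm_cpow_real]
  refine (rpow_le_rpow_neg_abs_add_rpow_abs (hc.trans_le hl) b).trans ?_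
  rw [add_assoc]
  gcongr ?_ + ?_
  · exact Real.rpow_le_rpow_of_nonpos hc hl (by simp)
  · have h1 : ‖laplaceBase u x‖ ≤ max (2 * C) u := by
      refine (norm_laplaceBase_le hu hx0.le).trans ?_
      rcases le_total (2 * C) u with h | h
      · rw [max_eq_right h]; linarith
      · rw [max_eq_left h]; linarith
    refine (Real.rpow_le_rpow (norm_nonneg _) h1 (abs_nonneg b)).trans ?_
    rcases le_total (2 * C) u with h | h
    · rw [max_eq_right h]
      linarith [Real.rpow_nonneg (show 0 ≤ 2 * C by linarith) |b|]
    · rw [max_eq_left h]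
      linarith [Real.rpow_nonneg hu |b|]

theorem integrableOn_exp_neg_mul_rpow {a : ℝ} (ha : -1 < a) :
    IntegrableOn (fun u : ℝ => Real.exp (-u) * u ^ a) (Ioi 0) := by
  have := Real.GammaIntegral_convergent (s := a + 1) (by linarith)
  simpa using this

/-- A dominating function for `laplaceIntegrand a b x`, uniform for `c ≤ x ≤ C`. -/
def laplaceBound (a b c C u : ℝ) : ℝ :=
  Real.exp (-u) * u ^ a * (c ^ (-|b|) + (2 * C) ^ |b| + u ^ |b|)

theorem integrableOn_laplaceBound {a : ℝ} (ha : -1 < a) (b c C : ℝ) :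
    IntegrableOn (laplaceBound a b c C) (Ioi 0) := by
  have h1 := (integrableOn_exp_neg_mul_rpow ha).mul_const (c ^ (-|b|) + (2 * C) ^ |b|)
  have h2 := integrableOn_exp_neg_mul_rpow (a := a + |b|) (by linarith [abs_nonneg b])
  refine IntegrableOn.congr_fun (Integrable.add h1 h2) (fun u hu => ?_) measurableSet_Ioi
  simp only [laplaceBound, Pi.add_apply]
  rw [Real.rpow_add hu]
  ring

theorem norm_laplaceIntegrand_le {a b c C x u : ℝ} (hu : 0 ≤ u) (hc : 0 < c) (hx : c ≤ x)
    (hC : x ≤ C) : ‖laplaceIntegrand a b x u‖ ≤ laplaceBound a b c C u := by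
  rw [laplaceIntegrand, laplaceBound, norm_mul, Complex.norm_real, Real.norm_eq_abs,
    abs_of_nonneg (mul_nonneg (Real.exp_pos _).le (Real.rpow_nonneg hu _))]
  gcongr
  exact norm_laplaceBase_cpow_le hu hc hx hC

theorem measurable_laplaceIntegrand (a b x : ℝ) : Measurable (laplaceIntegrand a b x) := by
  unfold laplaceIntegrand laplaceBase
  fun_prop

theorem integrableOn_laplaceIntegrand {a x : ℝ} (ha : -1 < a) (b : ℝ) (hx : 0 < x) :
    IntegrableOn (laplaceIntegrand a b x) (Ioi 0) := by
  refine (integrableOn_laplaceBound ha b x x).mono'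
    (measurable_laplaceIntegrand a b x).aestronglyMeasurable ?_
  filter_upwards [ae_restrict_mem measurableSet_Ioi] with u hu
  exact norm_laplaceIntegrand_le (le_of_lt hu) hx le_rfl le_rfl

theorem hasDerivAt_laplaceBase_right (u x : ℝ) :
    HasDerivAt (fun y : ℝ => laplaceBase u y) (-Complex.I) x := by
  unfold laplaceBase
  simpa using (((hasDerivAt_id x).ofReal_comp.const_mul Complex.I).const_sub ((u / 2 : ℝ) : ℂ))

theorem hasDerivAt_laplaceBase_left (u x : ℝ) :
    HasDerivAt (fun v : ℝ => laplaceBase v x) (1 / 2) u := by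
  unfold laplaceBase
  simpa using ((((hasDerivAt_id u).div_const 2).ofReal_comp).sub_const (Complex.I * (x : ℂ)))

theorem HasDerivAt.ofReal_cpow_const {f : ℝ → ℂ} {f' : ℂ} {x : ℝ} (hf : HasDerivAt f f' x)
    (h0 : f x ∈ Complex.slitPlane) (c : ℂ) :
    HasDerivAt (fun y => f y ^ c) (c * f x ^ (c - 1) * f') x := by
  have h := ((hasDerivAt_id (f x)).cpow_const (c := c) h0)
  exact (h.comp x hf).congr_deriv (by simp)

theorem hasDerivAt_laplaceIntegrand (a b u : ℝ) {x : ℝ} (hx : 0 < x) :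
    HasDerivAt (fun y : ℝ => laplaceIntegrand a b y u)
      (-Complex.I * b * laplaceIntegrand a (b - 1) x u) x := by
  have h := ((hasDerivAt_laplaceBase_right u x).ofReal_cpow_const
    (laplaceBase_mem_slitPlane u hx) (b : ℂ)).const_mul (((Real.exp (-u) * u ^ a : ℝ) : ℂ))
  refine h.congr_deriv ?_
  simp only [laplaceIntegrand]
  push_cast
  ring

theorem hasDerivAt_laplaceIntegral {a x : ℝ} (ha : -1 < a) (b : ℝ) (hx : 0 < x) :
    HasDerivAt (laplaceIntegral a b) (-Complex.I * b * laplaceIntegral a (b - 1) x) x := by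
  have hb := ((integrableOn_laplaceBound ha (b - 1) (x / 2) (2 * x)).const_mul |b|)
  have := hasDerivAt_integral_of_dominated_loc_of_deriv_le
    (μ := volume.restrict (Ioi (0 : ℝ))) (s := Icc (x / 2) (2 * x))
    (F := fun y u => laplaceIntegrand a b y u)
    (F' := fun y u => -Complex.I * b * laplaceIntegrand a (b - 1) y u)
    (bound := fun u => |b| * laplaceBound a (b - 1) (x / 2) (2 * x) u)
    (Icc_mem_nhds (by linarith) (by linarith))
    (Eventually.of_forall fun y => (measurable_laplaceIntegrand a b y).aestronglyMeasurable)
    (integrableOn_laplaceIntegrand ha b hx)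
    ((measurable_laplaceIntegrand a (b - 1) x).const_mul _).aestronglyMeasurable
    (by
      filter_upwards [ae_restrict_mem measurableSet_Ioi] with u hu y hy
      rw [norm_mul, norm_mul, norm_neg, Complex.norm_I, one_mul, Complex.norm_real,
        Real.norm_eq_abs]
      gcongr
      exact norm_laplaceIntegrand_le (le_of_lt hu) (by linarith) hy.1 hy.2)
    hb
    (by
      filter_upwards with u y hy
      exact hasDerivAt_laplaceIntegrand a b u (by linarith [hy.1]))
  refine this.2.congr_deriv ?_
  rw [laplaceIntegral, integral_const_mul]

theorem laplaceIntegral_add_one {a x : ℝ} (ha : -1 < a) (b : ℝ) (hx : 0 < x) :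
    laplaceIntegral a (b + 1) x =
      laplaceIntegral (a + 1) b x / 2 - Complex.I * x * laplaceIntegral a b x := by
  have h1 := (integrableOn_laplaceIntegrand (a := a + 1) (by linarith) b hx).const_mul (1 / 2)
  have h2 := (integrableOn_laplaceIntegrand ha b hx).const_mul (Complex.I * x)
  have : laplaceIntegral a (b + 1) x = ∫ u in Ioi (0 : ℝ),
      (1 / 2 * laplaceIntegrand (a + 1) b x u - Complex.I * x * laplaceIntegrand a b x u) := by
    refine setIntegral_congr_fun measurableSet_Ioi fun u hu => ?_
    simp only [laplaceIntegrand]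
    push_cast
    rw [Complex.cpow_add _ _ (laplaceBase_ne_zero u hx), Complex.cpow_one,
      Real.rpow_add_one (ne_of_gt hu)]
    nth_rewrite 2 [laplaceBase]
    push_cast
    ring
  rw [this, integral_sub h1 h2, integral_const_mul, integral_const_mul, laplaceIntegral,
    laplaceIntegral]
  ring

theorem hasDerivAt_laplaceIntegrand_left (a b : ℝ) {x u : ℝ} (hx : 0 < x) (hu : 0 < u) :
    HasDerivAt (laplaceIntegrand (a + 1) b x)
      ((a + 1) * laplaceIntegrand a b x u - laplaceIntegrand (a + 1) b x u
        + b / 2 * laplaceIntegrand (a + 1) (b - 1) x u) u := by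
  have h1 : HasDerivAt (fun v : ℝ => Real.exp (-v) * v ^ (a + 1))
      (Real.exp (-u) * (-1) * u ^ (a + 1) + Real.exp (-u) * ((a + 1) * u ^ (a + 1 - 1))) u :=
    ((hasDerivAt_neg u).exp).mul (Real.hasDerivAt_rpow_const (Or.inl hu.ne'))
  have h2 := h1.ofReal_comp.mul ((hasDerivAt_laplaceBase_left u x).ofReal_cpow_const
    (laplaceBase_mem_slitPlane u hx) (b : ℂ))
  refine h2.congr_deriv ?_
  simp only [laplaceIntegrand]
  push_cast
  rw [show a + 1 - 1 = a by ring]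
  ring

/-- The combination is the integral of the derivative of e^(−u) u^(a+1) (u/2 − ix)^b, which vanishes
at u = 0 because a + 1 > 0, and at infinity. -/
theorem laplaceIntegral_by_parts {a x : ℝ} (ha : -1 < a) (b : ℝ) (hx : 0 < x) :
    (a + 1) * laplaceIntegral a b x - laplaceIntegral (a + 1) b x
      + b / 2 * laplaceIntegral (a + 1) (b - 1) x = 0 := by
  have i1 := (integrableOn_laplaceIntegrand ha b hx).const_mul (a + 1 : ℂ)
  have i2 := integrableOn_laplaceIntegrand (a := a + 1) (by linarith) b hx
  have i3 := (integrableOn_laplaceIntegrand (a := a + 1) (by linarith) (b - 1) hx).const_mul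
    (b / 2 : ℂ)
  have hint : IntegrableOn (fun u => (a + 1 : ℂ) * laplaceIntegrand a b x u
      - laplaceIntegrand (a + 1) b x u + b / 2 * laplaceIntegrand (a + 1) (b - 1) x u)
      (Ioi 0) := (i1.sub i2).add i3
  have h0 : laplaceIntegrand (a + 1) b x 0 = 0 := by
    simp [laplaceIntegrand, Real.zero_rpow (show a + 1 ≠ 0 by linarith)]
  have hc : ContinuousWithinAt (laplaceIntegrand (a + 1) b x) (Ici 0) 0 := by
    apply Continuous.continuousWithinAt
    unfold laplaceIntegrand
    refine (Complex.continuous_ofReal.comp ?_).mul ?_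
    · exact (by fun_prop : Continuous fun u : ℝ => Real.exp (-u)).mul
        (Real.continuous_rpow_const (by linarith))
    · refine Continuous.cpow (by unfold laplaceBase; fun_prop) continuous_const
        fun u => laplaceBase_mem_slitPlane u hx
  have hlim := tendsto_zero_of_hasDerivAt_of_integrableOn_Ioi (a := (0 : ℝ))
    (fun u hu => hasDerivAt_laplaceIntegrand_left a b hx hu) hint i2
  have := integral_Ioi_of_hasDerivAt_of_tendsto hc
    (fun u hu => hasDerivAt_laplaceIntegrand_left a b hx hu) hint hlim
  rw [h0, sub_zero] at this
  have i12 : IntegrableOn (fun u => (a + 1 : ℂ) * laplaceIntegrand a b x u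
      - laplaceIntegrand (a + 1) b x u) (Ioi 0) := i1.sub i2
  rw [← this, integral_add i12 i3, integral_sub i1 i2, integral_const_mul, integral_const_mul]
  simp only [laplaceIntegral]

/-- The integral `∫ e^{-u} (u (u/2 - ix))^α du`; the Hankel function of order `α + 1/2` is an
elementary multiple of it. -/
def hankelIntegral (α x : ℝ) : ℂ := laplaceIntegral α α x

/-- The integral `α ∫ e^{-u} (u (u/2 - ix))^(α - 1) du`. -/
def hankelCompanion (α x : ℝ) : ℂ := α * laplaceIntegral (α - 1) (α - 1) x

/-- Differentiation in x lowers only the second exponent; partial integration and the expansion of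
one factor u/2 − ix restore equal exponents. With `hasDerivAt_mul_hankelCompanion` this is a closed
first-order system, from which the second-order equation of `hankelWave` follows by algebra. -/
theorem hasDerivAt_hankelIntegral {α x : ℝ} (hα : 0 < α) (hx : 0 < x) :
    HasDerivAt (hankelIntegral α)
      (x * hankelCompanion α x - Complex.I * hankelIntegral α x) x := by
  refine (hasDerivAt_laplaceIntegral (by linarith) α hx).congr_deriv ?_
  have h1 := laplaceIntegral_by_parts (a := α - 1) (by linarith) α hx
  have h2 := laplaceIntegral_add_one (a := α - 1) (by linarith) (α - 1) hx
  simp only [sub_add_cancel] at h1 h2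
  push_cast at h1
  simp only [hankelCompanion, hankelIntegral]
  have hI := Complex.I_sq
  linear_combination -Complex.I * h1 + Complex.I * α * h2
    - x * α * laplaceIntegral (α - 1) (α - 1) x * hI

theorem hasDerivAt_mul_hankelCompanion {α x : ℝ} (hα : 0 < α) (hx : 0 < x) :
    HasDerivAt (fun y : ℝ => (y : ℂ) * hankelCompanion α y)
      (2 * α * hankelCompanion α x - Complex.I * x * hankelCompanion α x - hankelIntegral α x)
      x := by
  have hd := (hasDerivAt_laplaceIntegral (a := α - 1) (by linarith) (α - 1) hx).const_mul (α : ℂ)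
  have h := (hasDerivAt_id x).ofReal_comp.mul hd
  refine h.congr_deriv ?_
  have h1 := laplaceIntegral_by_parts (a := α - 1) (by linarith) (α - 1) hx
  have h2 := laplaceIntegral_add_one (a := α - 1) (by linarith) (α - 1) hx
  have h3 := laplaceIntegral_add_one (a := α - 1) (by linarith) (α - 1 - 1) hx
  have h4 := laplaceIntegral_by_parts (a := α - 1) (by linarith) α hx
  simp only [sub_add_cancel] at h1 h2 h3 h4
  push_cast at h1 h4
  simp only [hankelCompanion, hankelIntegral]
  push_cast
  simp only [id]
  linear_combination -α * h1 + α * h2 - α * (α - 1) * h3 - h4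

/-! ## Poisson's integral and its contour deformation -/

theorem continuous_pow_mul_one_sub_sq_rpow (n : ℕ) {α : ℝ} (hα : 0 < α) :
    Continuous fun t : ℝ => t ^ n * (1 - t ^ 2) ^ α :=
  (by fun_prop : Continuous fun t : ℝ => t ^ n).mul
    ((by fun_prop : Continuous fun t : ℝ => 1 - t ^ 2).rpow_const fun _ => Or.inr hα.le)

/-- The even moments of `(1 - t^2)^α` on `[-1, 1]`. -/
def poissonMoment (α : ℝ) (j : ℕ) : ℝ := ∫ t in (-1 : ℝ)..1, t ^ (2 * j) * (1 - t ^ 2) ^ α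

/-- Integrates the derivative of t^(2j+1) (1 − t²)^(α+1), which vanishes at both end points. -/
theorem poissonMoment_succ {α : ℝ} (hα : 0 < α) (j : ℕ) :
    (2 * j + 2 * α + 3) * poissonMoment α (j + 1) = (2 * j + 1) * poissonMoment α j := by
  have hd : ∀ t ∈ Ioo (-1 : ℝ) 1, HasDerivAt (fun t : ℝ => t ^ (2 * j + 1) * (1 - t ^ 2) ^ (α + 1))
      ((2 * j + 1) * (t ^ (2 * j) * (1 - t ^ 2) ^ α)
        - (2 * j + 2 * α + 3) * (t ^ (2 * (j + 1)) * (1 - t ^ 2) ^ α)) t := by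
    intro t ht
    have h0 : 0 < 1 - t ^ 2 := by nlinarith [ht.1, ht.2]
    have hb : HasDerivAt (fun t : ℝ => 1 - t ^ 2) (-(2 * t)) t := by
      simpa using (hasDerivAt_pow 2 t).const_sub 1
    refine ((hasDerivAt_pow (2 * j + 1) t).mul
      (hb.rpow_const (p := α + 1) (Or.inl h0.ne'))).congr_deriv ?_
    rw [Real.rpow_add_one h0.ne', show α + 1 - 1 = α by ring, Nat.add_sub_cancel]
    push_cast
    ring
  have i1 : IntervalIntegrable (fun t : ℝ => (2 * j + 1) * (t ^ (2 * j) * (1 - t ^ 2) ^ α))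
      volume (-1) 1 :=
    ((continuous_pow_mul_one_sub_sq_rpow (2 * j) hα).const_mul _).intervalIntegrable _ _
  have i2 : IntervalIntegrable
      (fun t : ℝ => (2 * j + 2 * α + 3) * (t ^ (2 * (j + 1)) * (1 - t ^ 2) ^ α)) volume (-1) 1 :=
    ((continuous_pow_mul_one_sub_sq_rpow (2 * (j + 1)) hα).const_mul _).intervalIntegrable _ _
  have := intervalIntegral.integral_eq_sub_of_hasDerivAt_of_le (by norm_num)
    (continuous_pow_mul_one_sub_sq_rpow (2 * j + 1) (by linarith : 0 < α + 1)).continuousOn hd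
    (i1.sub i2)
  rw [intervalIntegral.integral_sub i1 i2, intervalIntegral.integral_const_mul,
    intervalIntegral.integral_const_mul] at this
  simp only [poissonMoment]
  have h0 : (0 : ℝ) ^ (α + 1) = 0 := Real.zero_rpow (by linarith)
  norm_num [h0] at this
  linarith

/-- The substitution t = 2s − 1 produces the Beta integral B(α + 1, α + 1), and the duplication
formula eliminates Γ(2α + 2). -/
theorem poissonMoment_zero {α : ℝ} (hα : 0 < α) :
    poissonMoment α 0 = Real.sqrt Real.pi * Real.Gamma (α + 1) / Real.Gamma (α + 3 / 2) := by
  have h1 : poissonMoment α 0 = 2 * 4 ^ α * ∫ s in (0 : ℝ)..1, s ^ α * (1 - s) ^ α := by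
    have := intervalIntegral.integral_comp_mul_sub (a := 0) (b := 1)
      (fun t : ℝ => t ^ (2 * 0) * (1 - t ^ 2) ^ α) (c := 2) (by norm_num) 1
    norm_num at this
    rw [poissonMoment]
    simp only [mul_zero, pow_zero, one_mul]
    have h2 : ∫ t in (-1 : ℝ)..1, (1 - t ^ 2) ^ α
        = 2 * ∫ s in (0 : ℝ)..1, (1 - (2 * s - 1) ^ 2) ^ α := by linarith
    rw [h2, mul_assoc, ← intervalIntegral.integral_const_mul (4 ^ α)]
    congr 1
    refine intervalIntegral.integral_congr fun s hs => ?_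
    rw [uIcc_of_le zero_le_one] at hs
    have h3 : 0 ≤ 1 - s := by linarith [hs.2]
    rw [← Real.mul_rpow hs.1 h3, ← Real.mul_rpow (by norm_num) (mul_nonneg hs.1 h3)]
    ring_nf
  have h2 : ((∫ s in (0 : ℝ)..1, s ^ α * (1 - s) ^ α : ℝ) : ℂ)
      = Complex.betaIntegral (α + 1) (α + 1) := by
    rw [Complex.betaIntegral, ← intervalIntegral.integral_ofReal]
    refine intervalIntegral.integral_congr fun s hs => ?_
    rw [uIcc_of_le zero_le_one] at hs
    have h3 : 0 ≤ 1 - s := by linarith [hs.2]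
    rw [Complex.ofReal_mul, Complex.ofReal_cpow hs.1, Complex.ofReal_cpow h3]
    push_cast
    simp
  have h3 := Complex.Gamma_mul_Gamma_eq_betaIntegral (s := (α + 1 : ℂ)) (t := (α + 1 : ℂ))
    (by norm_num; linarith) (by norm_num; linarith)
  rw [← h2] at h3
  have h4 : Real.Gamma (α + 1) * Real.Gamma (α + 1)
      = Real.Gamma (2 * (α + 1)) * ∫ s in (0 : ℝ)..1, s ^ α * (1 - s) ^ α := by
    rw [← Complex.ofReal_inj]
    push_cast
    rw [← Complex.Gamma_ofReal, ← Complex.Gamma_ofReal]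
    push_cast
    rw [show (2 * ((α : ℂ) + 1)) = α + 1 + (α + 1) by ring]
    exact h3
  have h5 := Real.Gamma_mul_Gamma_add_half (α + 1)
  rw [show α + 1 + 1 / 2 = α + 3 / 2 by ring] at h5
  have g1 := Real.Gamma_pos_of_pos (show 0 < α + 1 by linarith)
  have g2 := Real.Gamma_pos_of_pos (show 0 < α + 3 / 2 by linarith)
  have g3 := Real.Gamma_pos_of_pos (show 0 < 2 * (α + 1) by linarith)
  have h6 : (2 : ℝ) ^ (1 - 2 * (α + 1)) * (2 * 4 ^ α) = 1 := by
    rw [show (4 : ℝ) = 2 ^ (2 : ℝ) by norm_num, ← Real.rpow_mul (by norm_num),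
      ← mul_assoc, mul_comm _ (2 : ℝ), mul_assoc, ← Real.rpow_add (by norm_num)]
    rw [show 1 - 2 * (α + 1) + 2 * α = -1 by ring]
    norm_num [Real.rpow_neg_one]
  rw [h1, eq_div_iff g2.ne']
  apply mul_left_cancel₀ g3.ne'
  calc _ = 2 * 4 ^ α * (Real.Gamma (2 * (α + 1)) * ∫ s in (0 : ℝ)..1, s ^ α * (1 - s) ^ α)
        * Real.Gamma (α + 3 / 2) := by ring
    _ = 2 * 4 ^ α * Real.Gamma (α + 1) * (Real.Gamma (α + 1) * Real.Gamma (α + 3 / 2)) := by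
        rw [← h4]; ring
    _ = (2 ^ (1 - 2 * (α + 1)) * (2 * 4 ^ α)) * Real.Gamma (2 * (α + 1)) * Real.sqrt Real.pi
        * Real.Gamma (α + 1) := by rw [h5]; ring
    _ = _ := by rw [h6]; ring

theorem poissonMoment_eq {α : ℝ} (hα : 0 < α) (j : ℕ) :
    poissonMoment α j = Real.sqrt Real.pi * Real.Gamma (α + 1) * ((2 * j).factorial : ℝ)
      / (4 ^ j * (j.factorial : ℝ) * Real.Gamma (j + (α + 1 / 2) + 1)) := by
  induction j with
  | zero =>
    rw [poissonMoment_zero hα]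
    norm_num
    ring_nf
  | succ j ih =>
    have h := poissonMoment_succ hα j
    have hp : (0 : ℝ) < 2 * j + 2 * α + 3 := by positivity
    have hG : Real.Gamma (((j + 1 : ℕ) : ℝ) + (α + 1 / 2) + 1)
        = (j + (α + 1 / 2) + 1) * Real.Gamma (j + (α + 1 / 2) + 1) := by
      rw [← Real.Gamma_add_one (by positivity)]
      push_cast
      ring_nf
    have g := Real.Gamma_pos_of_pos (show 0 < (j : ℝ) + (α + 1 / 2) + 1 by positivity)
    rw [hG]
    apply mul_left_cancel₀ hp.ne'
    rw [h, ih, show 2 * (j + 1) = 2 * j + 1 + 1 by ring, Nat.factorial_succ, Nat.factorial_succ,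
      Nat.factorial_succ]
    push_cast
    field_simp
    ring

/-- Poisson's integral: the cosine series is integrated term by term, and the factor (2j)! of the
moments cancels that of the cosine. -/
theorem integral_one_sub_sq_rpow_mul_cos {α : ℝ} (hα : 0 < α) (x : ℝ) :
    ∫ t in (-1 : ℝ)..1, (1 - t ^ 2) ^ α * Real.cos (x * t)
      = Real.sqrt Real.pi * Real.Gamma (α + 1) * besselEntire (α + 1 / 2) ((x / 2) ^ 2) := by
  have hS : HasSum (fun j : ℕ => ∫ t in (-1 : ℝ)..1,
      (1 - t ^ 2) ^ α * ((-1) ^ j * (x * t) ^ (2 * j) / ((2 * j).factorial : ℝ)))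
      (∫ t in (-1 : ℝ)..1, (1 - t ^ 2) ^ α * Real.cos (x * t)) := by
    refine intervalIntegral.hasSum_integral_of_dominated_convergence
      (fun j _ => |x| ^ (2 * j) / ((2 * j).factorial : ℝ)) ?_ ?_ ?_ ?_ ?_
    · intro j
      have : Continuous fun t : ℝ => (1 - t ^ 2) ^ α
          * ((-1) ^ j * (x * t) ^ (2 * j) / ((2 * j).factorial : ℝ)) :=
        ((by fun_prop : Continuous fun t : ℝ => 1 - t ^ 2).rpow_const fun _ => Or.inr hα.le).mul
          (by fun_prop)
      exact this.aestronglyMeasurable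
    · intro j
      filter_upwards with t ht
      rw [uIoc_of_le (by norm_num)] at ht
      have h1 : |t| ≤ 1 := abs_le.2 ⟨ht.1.le, ht.2⟩
      have h2 : 0 ≤ 1 - t ^ 2 := by nlinarith [ht.1, ht.2]
      rw [norm_mul, norm_div, norm_mul, norm_pow, norm_pow, norm_neg, norm_one, one_pow, one_mul,
        norm_mul, mul_pow]
      simp only [Real.norm_eq_abs, Nat.abs_cast]
      rw [abs_of_nonneg (Real.rpow_nonneg h2 _)]
      have h3 : (1 - t ^ 2) ^ α ≤ 1 := Real.rpow_le_one h2 (by nlinarith [sq_nonneg t]) hα.le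
      have h4 : |t| ^ (2 * j) ≤ 1 := pow_le_one₀ (abs_nonneg _) h1
      calc _ ≤ 1 * (|x| ^ (2 * j) * 1 / ((2 * j).factorial : ℝ)) := by gcongr
        _ = _ := by ring
    · filter_upwards with t _
      exact (Real.summable_pow_div_factorial |x|).comp_injective
        (fun a b h => by simpa using h : Function.Injective fun j : ℕ => 2 * j)
    · exact intervalIntegrable_const
    · filter_upwards with t _
      exact (Real.hasSum_cos (x * t)).mul_left _
  rw [besselEntire, ← tsum_mul_left, ← hS.tsum_eq]
  refine tsum_congr fun j => ?_
  have h1 : ∫ t in (-1 : ℝ)..1,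
      (1 - t ^ 2) ^ α * ((-1) ^ j * (x * t) ^ (2 * j) / ((2 * j).factorial : ℝ))
      = (-1) ^ j * x ^ (2 * j) / ((2 * j).factorial : ℝ) * poissonMoment α j := by
    rw [poissonMoment, ← intervalIntegral.integral_const_mul]
    refine intervalIntegral.integral_congr fun t _ => ?_
    simp only [mul_pow]
    ring
  rw [h1, poissonMoment_eq hα, besselCoeff]
  have g := Real.Gamma_pos_of_pos (show 0 < (j : ℝ) + (α + 1 / 2) + 1 by positivity)
  have h4 : (4 : ℝ) ^ j = 2 ^ (2 * j) := by rw [pow_mul]; norm_num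
  rw [← pow_mul, div_pow, h4]
  field_simp

theorem Complex.ofReal_mul_cpow {r : ℝ} (hr : 0 < r) {z : ℂ} (hz : z ≠ 0) (c : ℂ) :
    ((r : ℂ) * z) ^ c = (r : ℂ) ^ c * z ^ c := by
  have hr' : (r : ℂ) ≠ 0 := by exact_mod_cast hr.ne'
  rw [Complex.cpow_def_of_ne_zero (mul_ne_zero hr' hz), Complex.cpow_def_of_ne_zero hr',
    Complex.cpow_def_of_ne_zero hz, Complex.log_ofReal_mul hr hz, ← Complex.exp_add,
    ← Complex.ofReal_log hr.le, add_mul]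

/-- The integrand `e^{ixz} (1 - z^2)^α` of Poisson's integral. -/
def poissonIntegrand (α x : ℝ) (z : ℂ) : ℂ :=
  Complex.exp (Complex.I * x * z) * (1 - z ^ 2) ^ (α : ℂ)

/-- On the vertical line z = 1 + iu/x one has 1 − z² = (2u/x²)(u/2 − ix) and e^(ixz) = e^(ix)
e^(−u). This is where the Laplace-type integral comes from. -/
theorem poissonIntegrand_right {α x u : ℝ} (hα : 0 < α) (hx : 0 < x) (hu : 0 ≤ u) :
    poissonIntegrand α x ((1 : ℝ) + ((u / x : ℝ) : ℂ) * Complex.I)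
      = Complex.exp (Complex.I * x) * ((2 / x ^ 2) ^ α : ℝ) * laplaceIntegrand α α x u := by
  have hx' : (x : ℂ) ≠ 0 := by exact_mod_cast hx.ne'
  have hα' : (α : ℂ) ≠ 0 := by exact_mod_cast hα.ne'
  have h1 : 1 - (((1 : ℝ) : ℂ) + ((u / x : ℝ) : ℂ) * Complex.I) ^ 2
      = ((2 / x ^ 2 * u : ℝ) : ℂ) * laplaceBase u x := by
    simp only [laplaceBase]
    push_cast
    field_simp
    linear_combination -(u : ℂ) ^ 2 * Complex.I_sq
  have h2 : Complex.exp (Complex.I * x * (((1 : ℝ) : ℂ) + ((u / x : ℝ) : ℂ) * Complex.I))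
      = Complex.exp (Complex.I * x) * (Real.exp (-u) : ℝ) := by
    rw [Complex.ofReal_exp, ← Complex.exp_add]
    congr 1
    push_cast
    field_simp
    linear_combination u * Complex.I_sq
  rw [poissonIntegrand, h1, h2, laplaceIntegrand]
  rcases hu.eq_or_lt with rfl | hu
  · simp [Real.zero_rpow hα.ne', Complex.zero_cpow hα']
  · rw [Complex.ofReal_mul_cpow (by positivity) (laplaceBase_ne_zero u hx),
      ← Complex.ofReal_cpow (by positivity), Real.mul_rpow (by positivity) hu.le]
    push_cast
    ring

theorem poissonIntegrand_left {α x : ℝ} (y : ℝ) (hα : 0 < α) :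
    poissonIntegrand α x (((-1 : ℝ) : ℂ) + (y : ℂ) * Complex.I)
      = conj (poissonIntegrand α x (((1 : ℝ) : ℂ) + (y : ℂ) * Complex.I)) := by
  have hα' : (α : ℂ) ≠ 0 := by exact_mod_cast hα.ne'
  rw [poissonIntegrand, poissonIntegrand, map_mul, ← Complex.exp_conj]
  congr 1
  · congr 1
    simp only [map_mul, map_add, Complex.conj_I, Complex.conj_ofReal]
    push_cast
    ring
  · rcases eq_or_ne y 0 with rfl | hy
    · simp [Complex.zero_cpow hα']
    · have harg : (1 - (((1 : ℝ) : ℂ) + (y : ℂ) * Complex.I) ^ 2).arg ≠ Real.pi := by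
        have : (1 - (((1 : ℝ) : ℂ) + (y : ℂ) * Complex.I) ^ 2) ∈ Complex.slitPlane := by
          refine Or.inr ?_
          simp [pow_two, hy]
        exact Complex.slitPlane_arg_ne_pi this
      have hc := Complex.conj_cpow _ (α : ℂ) harg
      rw [Complex.conj_ofReal] at hc
      rw [← hc]
      simp only [map_sub, map_pow, map_add, map_mul, map_one, Complex.conj_I, Complex.conj_ofReal]
      congr 1
      push_cast
      ring

theorem norm_poissonIntegrand_le {α x t Y : ℝ} (hα : 0 < α) (ht : |t| ≤ 1) :
    ‖poissonIntegrand α x ((t : ℂ) + (Y : ℂ) * Complex.I)‖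
      ≤ Real.exp (-(x * Y)) * (2 + Y ^ 2) ^ α := by
  rw [poissonIntegrand, norm_mul, Complex.norm_exp, Complex.norm_cpow_real]
  have h1 : (Complex.I * x * ((t : ℂ) + (Y : ℂ) * Complex.I)).re = -(x * Y) := by
    simp
  rw [h1]
  gcongr
  refine (norm_sub_le _ _).trans ?_
  rw [norm_one, norm_pow, ← Complex.normSq_eq_norm_sq]
  have : Complex.normSq ((t : ℂ) + (Y : ℂ) * Complex.I) = t ^ 2 + Y ^ 2 := by
    simp [Complex.normSq_apply]
    ring
  rw [this]
  nlinarith [abs_le.1 ht, sq_abs t, abs_nonneg t]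

/-- Cauchy's theorem on the rectangle of height Y over [−1, 1]. The integrand takes conjugate values
on the two vertical sides, which therefore contribute twice an imaginary part, and the top side
decays as Y → ∞. In the strip Re(1 − z²) ≥ 0, so the principal power is continuous up to the branch
points ±1, where it vanishes. -/
theorem integral_poissonIntegrand {α x : ℝ} (hα : 0 < α) (hx : 0 < x) :
    ∫ t in (-1 : ℝ)..1, poissonIntegrand α x t
      = ((2 / x * (2 / x ^ 2) ^ α
        * (Complex.exp (Complex.I * x) * hankelIntegral α x).im : ℝ) : ℂ) := by
  set c : ℂ := Complex.exp (Complex.I * x) * ((2 / x ^ 2) ^ α : ℝ) with hc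
  set G : ℝ → ℂ := fun Y => ∫ y in (0 : ℝ)..Y,
    poissonIntegrand α x ((1 : ℝ) + (y : ℂ) * Complex.I) with hG
  have hrect : ∀ Y : ℝ, 0 < Y → (∫ t in (-1 : ℝ)..1, poissonIntegrand α x t)
      = (∫ t in (-1 : ℝ)..1, poissonIntegrand α x ((t : ℂ) + (Y : ℂ) * Complex.I))
        + ((2 * (G Y).im : ℝ) : ℂ) := by
    intro Y hY
    have hre : ∀ z : ℂ, z.re ∈ Icc (-1 : ℝ) 1 → 0 ≤ (1 - z ^ 2).re := by
      intro z hz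
      simp only [pow_two, Complex.sub_re, Complex.one_re, Complex.mul_re]
      nlinarith [hz.1, hz.2, sq_nonneg z.im]
    have := Complex.integral_boundary_rect_eq_zero_of_continuousOn_of_differentiableOn
      (poissonIntegrand α x) ((-1 : ℝ) : ℂ) (((1 : ℝ) : ℂ) + (Y : ℂ) * Complex.I) ?_ ?_
    · simp only [Complex.ofReal_re, Complex.ofReal_im, Complex.add_re, Complex.mul_re,
        Complex.I_re, Complex.I_im, Complex.add_im, Complex.mul_im, mul_zero, mul_one, zero_mul,
        sub_zero, add_zero, zero_add, Complex.ofReal_zero, smul_eq_mul] at this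
      have hl : (∫ y in (0 : ℝ)..Y, poissonIntegrand α x (((-1 : ℝ) : ℂ) + (y : ℂ) * Complex.I))
          = conj (G Y) := by
        simp only [hG]
        rw [intervalIntegral.intervalIntegral_eq_integral_uIoc,
          intervalIntegral.intervalIntegral_eq_integral_uIoc, Complex.real_smul,
          Complex.real_smul, map_mul, Complex.conj_ofReal, ← integral_conj]
        congr 2
        ext y
        exact poissonIntegrand_left y hα
      rw [hl] at this
      have hGY : G Y - conj (G Y) = ((2 * (G Y).im : ℝ) : ℂ) * Complex.I := by
        rw [Complex.sub_conj]
      linear_combination this - Complex.I * hGY - ((2 * (G Y).im : ℝ) : ℂ) * Complex.I_sq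
    · intro z hz
      simp only [Complex.ofReal_re, Complex.add_re, Complex.mul_re, Complex.I_re, Complex.I_im,
        mul_zero, Complex.ofReal_im, zero_mul, sub_zero, add_zero] at hz
      have hz1 : z.re ∈ Icc (-1 : ℝ) 1 := by
        have := hz.1
        rwa [Set.mem_preimage, uIcc_of_le (by norm_num)] at this
      apply ContinuousAt.continuousWithinAt
      unfold poissonIntegrand
      refine ContinuousAt.mul (by fun_prop) ?_
      exact ContinuousAt.comp (f := fun z : ℂ => 1 - z ^ 2) (g := fun w : ℂ => w ^ (α : ℂ))
        (Complex.continuousAt_cpow_const_of_re_pos (Or.inl (hre z hz1)) (by simpa using hα))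
        (by fun_prop)
    · intro z hz
      simp only [Complex.ofReal_re, Complex.add_re, Complex.mul_re, Complex.I_re, Complex.I_im,
        mul_zero, Complex.ofReal_im, zero_mul, sub_zero, add_zero] at hz
      have hz1 : z.re ∈ Ioo (-1 : ℝ) 1 := by
        have := hz.1
        rwa [Set.mem_preimage, min_eq_left (by norm_num), max_eq_right (by norm_num)] at this
      apply DifferentiableAt.differentiableWithinAt
      unfold poissonIntegrand
      refine DifferentiableAt.mul (by fun_prop) ?_
      refine DifferentiableAt.cpow_const (by fun_prop) (Or.inl ?_)
      simp only [pow_two, Complex.sub_re, Complex.one_re, Complex.mul_re]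
      nlinarith [hz1.1, hz1.2, sq_nonneg z.im]
  have htop : Tendsto (fun Y : ℝ => ∫ t in (-1 : ℝ)..1,
      poissonIntegrand α x ((t : ℂ) + (Y : ℂ) * Complex.I)) atTop (𝓝 0) := by
    have hb : Tendsto (fun Y : ℝ => Real.exp (-(x * Y)) * (3 * Y ^ 2) ^ α * 2) atTop (𝓝 0) := by
      have h1 := (tendsto_rpow_mul_exp_neg_mul_atTop_nhds_zero (2 * α) x hx).const_mul (3 ^ α * 2)
      rw [mul_zero] at h1
      refine h1.congr' ?_
      filter_upwards [eventually_gt_atTop 0] with Y hY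
      rw [Real.mul_rpow (by norm_num) (by positivity), ← Real.rpow_natCast Y 2,
        ← Real.rpow_mul hY.le]
      push_cast
      ring_nf
    refine squeeze_zero_norm' ?_ hb
    filter_upwards [eventually_ge_atTop 1] with Y hY
    have := intervalIntegral.norm_integral_le_of_norm_le_const (a := (-1 : ℝ)) (b := 1)
      (f := fun t : ℝ => poissonIntegrand α x ((t : ℂ) + (Y : ℂ) * Complex.I))
      (C := Real.exp (-(x * Y)) * (3 * Y ^ 2) ^ α) (fun t ht => by
        rw [uIoc_of_le (by norm_num)] at ht
        refine (norm_poissonIntegrand_le hα (abs_le.2 ⟨ht.1.le, ht.2⟩)).trans ?_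
        gcongr
        nlinarith)
    norm_num at this ⊢
    linarith
  have hGlim : Tendsto G atTop (𝓝 ((x⁻¹ : ℝ) * (c * hankelIntegral α x))) := by
    have h1 : ∀ᶠ Y : ℝ in atTop, (x⁻¹ : ℝ) * (c * ∫ u in (0 : ℝ)..(x * Y),
        laplaceIntegrand α α x u) = G Y := by
      filter_upwards [eventually_ge_atTop 0] with Y hY
      have h2 := intervalIntegral.integral_comp_div (a := 0) (b := x * Y)
        (fun y : ℝ => poissonIntegrand α x ((1 : ℝ) + (y : ℂ) * Complex.I)) hx.ne'
      rw [zero_div, mul_div_cancel_left₀ Y hx.ne'] at h2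
      have h3 : ∫ u in (0 : ℝ)..(x * Y),
          poissonIntegrand α x ((1 : ℝ) + ((u / x : ℝ) : ℂ) * Complex.I)
          = c * ∫ u in (0 : ℝ)..(x * Y), laplaceIntegrand α α x u := by
        rw [← intervalIntegral.integral_const_mul]
        refine intervalIntegral.integral_congr fun u hu => ?_
        rw [uIcc_of_le (by positivity)] at hu
        exact poissonIntegrand_right hα hx hu.1
      rw [← h3, h2, Complex.real_smul, ← mul_assoc, ← Complex.ofReal_mul, inv_mul_cancel₀ hx.ne']
      simp [hG]
    refine Tendsto.congr' h1 ?_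
    refine Tendsto.const_mul _ (Tendsto.const_mul _ ?_)
    exact intervalIntegral_tendsto_integral_Ioi 0
      (integrableOn_laplaceIntegrand (by linarith) α hx) (tendsto_id.const_mul_atTop hx)
  have hlim : Tendsto (fun _ : ℝ => ∫ t in (-1 : ℝ)..1, poissonIntegrand α x t) atTop
      (𝓝 (0 + ((2 * ((x⁻¹ : ℝ) * (c * hankelIntegral α x) : ℂ).im : ℝ) : ℂ))) := by
    refine Tendsto.congr' ?_ (htop.add ((Complex.continuous_ofReal.tendsto _).comp
      (((Complex.continuous_im.tendsto _).comp hGlim).const_mul 2)))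
    filter_upwards [eventually_gt_atTop 0] with Y hY
    exact (hrect Y hY).symm
  rw [tendsto_nhds_unique tendsto_const_nhds hlim, zero_add]
  congr 1
  rw [hc, Complex.im_ofReal_mul, show Complex.exp (Complex.I * x) * (((2 / x ^ 2) ^ α : ℝ) : ℂ)
    * hankelIntegral α x = (((2 / x ^ 2) ^ α : ℝ) : ℂ)
      * (Complex.exp (Complex.I * x) * hankelIntegral α x) by ring, Complex.im_ofReal_mul]
  ring

/-! ## The Hankel function as a Laplace-type integral -/

theorem laplaceBase_div (u : ℝ) {x : ℝ} (hx : 0 < x) :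
    laplaceBase u x = (x : ℂ) * laplaceBase (u / x) 1 := by
  have hx' : (x : ℂ) ≠ 0 := by exact_mod_cast hx.ne'
  simp only [laplaceBase]
  push_cast
  field_simp

/-- Writing u/2 − ix = x (u/(2x) − i) exposes the power x^b. The second factor tends to −i, and for
x ≥ 1 it is dominated by the bound with c = C = 1. -/
theorem tendsto_rpow_mul_laplaceIntegral {a : ℝ} (ha : -1 < a) (b : ℝ) :
    Tendsto (fun x : ℝ => ((x ^ (-b) : ℝ) : ℂ) * laplaceIntegral a b x) atTop
      (𝓝 (Real.Gamma (a + 1) * (-Complex.I) ^ (b : ℂ))) := by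
  have hlim : ∫ u in Ioi (0 : ℝ), ((Real.exp (-u) * u ^ a : ℝ) : ℂ) * (-Complex.I) ^ (b : ℂ)
      = Real.Gamma (a + 1) * (-Complex.I) ^ (b : ℂ) := by
    rw [integral_mul_const, integral_complex_ofReal, Real.Gamma_eq_integral (by linarith)]
    simp
  rw [← hlim]
  have hD : Tendsto (fun x : ℝ => ∫ u in Ioi (0 : ℝ),
      ((Real.exp (-u) * u ^ a : ℝ) : ℂ) * laplaceBase (u / x) 1 ^ (b : ℂ)) atTop
      (𝓝 (∫ u in Ioi (0 : ℝ), ((Real.exp (-u) * u ^ a : ℝ) : ℂ) * (-Complex.I) ^ (b : ℂ))) := by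
    refine tendsto_integral_filter_of_dominated_convergence (laplaceBound a b 1 1) ?_ ?_
      (integrableOn_laplaceBound ha b 1 1) ?_
    · filter_upwards with x
      refine Measurable.aestronglyMeasurable ?_
      unfold laplaceBase
      fun_prop
    · filter_upwards [eventually_ge_atTop 1] with x hx
      filter_upwards [ae_restrict_mem measurableSet_Ioi] with u hu
      have hu' : (0 : ℝ) < u := hu
      have h0 : 0 ≤ Real.exp (-u) * u ^ a := mul_nonneg (Real.exp_pos _).le (Real.rpow_nonneg hu'.le _)
      rw [norm_mul, Complex.norm_real, Real.norm_eq_abs, abs_of_nonneg h0, laplaceBound]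
      refine mul_le_mul_of_nonneg_left ?_ h0
      refine (norm_laplaceBase_cpow_le (c := 1) (C := 1) (by positivity) one_pos le_rfl
        le_rfl).trans ?_
      gcongr
      exact div_le_self hu'.le hx
    · filter_upwards with u
      refine Tendsto.const_mul _ ?_
      have h1 : Tendsto (fun x : ℝ => laplaceBase (u / x) 1) atTop (𝓝 (-Complex.I)) := by
        have h2 : Tendsto (fun x : ℝ => u / x / 2) atTop (𝓝 0) := by
          simpa using (tendsto_const_nhds (x := u)).div_atTop tendsto_id |>.div_const 2
        have h3 := ((Complex.continuous_ofReal.tendsto _).comp h2).sub_const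
          (Complex.I * ((1 : ℝ) : ℂ))
        simpa [laplaceBase, Function.comp_def] using h3
      exact ((continuousAt_cpow_const (Or.inr (by simp))).tendsto).comp h1
  refine hD.congr' ?_
  filter_upwards [eventually_gt_atTop 0] with x hx
  rw [laplaceIntegral, ← integral_const_mul]
  refine setIntegral_congr_fun measurableSet_Ioi fun u hu => ?_
  simp only [laplaceIntegrand]
  rw [laplaceBase_div u hx, Complex.ofReal_mul_cpow hx (laplaceBase_ne_zero _ one_pos),
    ← Complex.ofReal_cpow hx.le, Real.rpow_neg hx.le]
  have : ((x ^ b : ℝ) : ℂ) ≠ 0 := by exact_mod_cast (Real.rpow_pos_of_pos hx b).ne'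
  push_cast at this ⊢
  field_simp

/-- The solution `e^{ix} x^{-α} ∫ e^{-u} (u (u/2 - ix))^α du` of the reduced Bessel equation
`y'' = -(1 - α(α+1)/x²) y`. -/
def hankelWave (α x : ℝ) : ℂ :=
  Complex.exp (Complex.I * x) * (((x ^ (-α) : ℝ) : ℂ) * hankelIntegral α x)

/-- The derivative of `hankelWave`. -/
def hankelWaveDeriv (α x : ℝ) : ℂ :=
  Complex.exp (Complex.I * x) *
    (((x ^ (-α) : ℝ) : ℂ) * (x * hankelCompanion α x - α / x * hankelIntegral α x))

theorem hasDerivAt_exp_I_mul (x : ℝ) :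
    HasDerivAt (fun y : ℝ => Complex.exp (Complex.I * y))
      (Complex.I * Complex.exp (Complex.I * x)) x := by
  have := (((hasDerivAt_id x).ofReal_comp).const_mul Complex.I).cexp
  refine this.congr_deriv ?_
  simp only [id, Complex.ofReal_one, mul_one]
  ring

theorem hasDerivAt_ofReal_rpow_neg (α : ℝ) {x : ℝ} (hx : 0 < x) :
    HasDerivAt (fun y : ℝ => ((y ^ (-α) : ℝ) : ℂ)) (-(α / x) * ((x ^ (-α) : ℝ) : ℂ)) x := by
  refine ((Real.hasDerivAt_rpow_const (p := -α) (Or.inl hx.ne')).ofReal_comp).congr_deriv ?_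
  rw [Real.rpow_sub_one hx.ne']
  push_cast
  ring

theorem hasDerivAt_hankelWave {α x : ℝ} (hα : 0 < α) (hx : 0 < x) :
    HasDerivAt (hankelWave α) (hankelWaveDeriv α x) x := by
  refine ((hasDerivAt_exp_I_mul x).mul ((hasDerivAt_ofReal_rpow_neg α hx).mul
    (hasDerivAt_hankelIntegral hα hx))).congr_deriv ?_
  simp only [hankelWaveDeriv, Pi.mul_apply]
  ring

theorem hasDerivAt_hankelWaveDeriv {α x : ℝ} (hα : 0 < α) (hx : 0 < x) :
    HasDerivAt (hankelWaveDeriv α) (-((1 - α * (α + 1) / x ^ 2 : ℝ) : ℂ) * hankelWave α x) x := by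
  have hx' : (x : ℂ) ≠ 0 := by exact_mod_cast hx.ne'
  have hi : HasDerivAt (fun y : ℝ => (α : ℂ) / (y : ℂ)) (-(α : ℂ) / x ^ 2) x := by
    have := ((hasDerivAt_inv hx.ne').const_mul α).ofReal_comp
    refine (this.congr_deriv ?_).congr_of_eventuallyEq ?_
    · push_cast
      ring
    · filter_upwards with y
      push_cast
      ring
  refine ((hasDerivAt_exp_I_mul x).mul ((hasDerivAt_ofReal_rpow_neg α hx).mul
    ((hasDerivAt_mul_hankelCompanion hα hx).sub
      (hi.mul (hasDerivAt_hankelIntegral hα hx))))).congr_deriv ?_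
  simp only [hankelWave, Pi.mul_apply, Pi.sub_apply]
  push_cast
  field_simp
  ring

theorem tendsto_exp_neg_mul_hankelWave {α : ℝ} (hα : 0 < α) :
    Tendsto (fun x : ℝ => Complex.exp (-(Complex.I * x)) * hankelWave α x) atTop
      (𝓝 (Real.Gamma (α + 1) * (-Complex.I) ^ (α : ℂ))) := by
  refine (tendsto_rpow_mul_laplaceIntegral (by linarith) α).congr fun x => ?_
  rw [hankelWave, ← mul_assoc, ← Complex.exp_add, neg_add_cancel, Complex.exp_zero, one_mul]
  rfl

theorem tendsto_exp_neg_mul_hankelWaveDeriv {α : ℝ} (hα : 0 < α) :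
    Tendsto (fun x : ℝ => Complex.exp (-(Complex.I * x)) * hankelWaveDeriv α x) atTop
      (𝓝 (Complex.I * (Real.Gamma (α + 1) * (-Complex.I) ^ (α : ℂ)))) := by
  have h1 := (tendsto_rpow_mul_laplaceIntegral (a := α - 1) (by linarith) (α - 1)).const_mul (α : ℂ)
  have h2 := tendsto_rpow_mul_laplaceIntegral (a := α) (by linarith) α
  have h3 : Tendsto (fun x : ℝ => ((α / x : ℝ) : ℂ)) atTop (𝓝 0) := by
    have : Tendsto (fun x : ℝ => α / x) atTop (𝓝 0) := tendsto_const_nhds.div_atTop tendsto_id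
    simpa [Function.comp_def] using (Complex.continuous_ofReal.tendsto _).comp this
  have h4 := h1.sub (h3.mul h2)
  have hval : (α : ℂ) * (Real.Gamma (α - 1 + 1) * (-Complex.I) ^ ((α - 1 : ℝ) : ℂ))
      - 0 * (Real.Gamma (α + 1) * (-Complex.I) ^ (α : ℂ))
      = Complex.I * (Real.Gamma (α + 1) * (-Complex.I) ^ (α : ℂ)) := by
    rw [sub_add_cancel, Real.Gamma_add_one hα.ne', zero_mul, sub_zero]
    push_cast
    rw [Complex.cpow_sub _ _ (by simp), Complex.cpow_one]
    field_simp
    linear_combination -(α : ℂ) * (Real.Gamma α : ℂ) * Complex.I_sq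
  rw [hval] at h4
  refine h4.congr' ?_
  filter_upwards [eventually_gt_atTop 0] with x hx
  rw [hankelWaveDeriv, ← mul_assoc (Complex.exp _), ← Complex.exp_add, neg_add_cancel,
    Complex.exp_zero, one_mul, hankelCompanion, hankelIntegral,
    show -(α - 1) = -α + 1 by ring, Real.rpow_add_one hx.ne']
  push_cast
  ring

/-! ### Wronskians and the solution space of the reduced Bessel equation -/

theorem wronskian_eq {f f₁ g g₁ : ℝ → ℂ} {q : ℝ → ℂ}
    (hf : ∀ x, 0 < x → HasDerivAt f (f₁ x) x) (hf₁ : ∀ x, 0 < x → HasDerivAt f₁ (q x * f x) x)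
    (hg : ∀ x, 0 < x → HasDerivAt g (g₁ x) x) (hg₁ : ∀ x, 0 < x → HasDerivAt g₁ (q x * g x) x)
    {x y : ℝ} (hx : 0 < x) (hy : 0 < y) :
    f x * g₁ x - f₁ x * g x = f y * g₁ y - f₁ y * g y := by
  have hd : ∀ z ∈ Ioi (0 : ℝ), HasDerivAt (fun z => f z * g₁ z - f₁ z * g z) 0 z := by
    intro z hz
    refine (((hf z hz).mul (hg₁ z hz)).sub ((hf₁ z hz).mul (hg z hz))).congr_deriv ?_
    ring
  exact isOpen_Ioi.is_const_of_deriv_eq_zero isPreconnected_Ioi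
    (fun z hz => (hd z hz).differentiableAt.differentiableWithinAt)
    (fun z hz => (hd z hz).deriv) hx hy

theorem HasDerivAt.complex_conj {f : ℝ → ℂ} {f' : ℂ} {x : ℝ} (hf : HasDerivAt f f' x) :
    HasDerivAt (fun y => conj (f y)) (conj f') x :=
  (Complex.conjCLE.toContinuousLinearMap.hasFDerivAt).comp_hasDerivAt x hf

theorem conj_exp_neg_I_mul (x : ℝ) :
    conj (Complex.exp (-(Complex.I * x))) = Complex.exp (Complex.I * x) := by
  rw [← Complex.exp_conj]
  simp

theorem norm_neg_I_cpow (α : ℝ) : ‖(-Complex.I) ^ (α : ℂ)‖ = 1 := by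
  rw [Complex.norm_cpow_real]
  simp

/-- The Wronskian is constant, so its value can be read off at infinity. There the wave behaves like
Γ(α + 1)(−i)^α e^(ix), and its derivative like i times this. -/
theorem wronskian_hankelWave {α x : ℝ} (hα : 0 < α) (hx : 0 < x) :
    hankelWave α x * conj (hankelWaveDeriv α x) - hankelWaveDeriv α x * conj (hankelWave α x)
      = -(2 * Real.Gamma (α + 1) ^ 2 : ℝ) * Complex.I := by
  set A : ℂ := Real.Gamma (α + 1) * (-Complex.I) ^ (α : ℂ) with hA
  have hlim := ((tendsto_exp_neg_mul_hankelWave hα).mul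
    ((Complex.continuous_conj.tendsto _).comp (tendsto_exp_neg_mul_hankelWaveDeriv hα))).sub
    ((tendsto_exp_neg_mul_hankelWaveDeriv hα).mul
    ((Complex.continuous_conj.tendsto _).comp (tendsto_exp_neg_mul_hankelWave hα)))
  rw [← hA] at hlim
  have hval : A * conj (Complex.I * A) - Complex.I * A * conj A
      = -(2 * Real.Gamma (α + 1) ^ 2 : ℝ) * Complex.I := by
    have h1 : A * conj A = ((Real.Gamma (α + 1) ^ 2 : ℝ) : ℂ) := by
      rw [Complex.mul_conj, Complex.normSq_eq_norm_sq, hA, norm_mul, norm_neg_I_cpow, mul_one,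
        Complex.norm_real, Real.norm_eq_abs, sq_abs]
    rw [map_mul, Complex.conj_I]
    push_cast at h1 ⊢
    linear_combination (-2 * Complex.I) * h1
  rw [hval] at hlim
  refine tendsto_nhds_unique ((tendsto_const_nhds (f := atTop (α := ℝ))).congr' ?_) hlim
  filter_upwards [eventually_gt_atTop 0] with y hy
  have hw := wronskian_eq (q := fun x => -((1 - α * (α + 1) / x ^ 2 : ℝ) : ℂ))
    (fun x hx => hasDerivAt_hankelWave hα hx) (fun x hx => hasDerivAt_hankelWaveDeriv hα hx)
    (fun x hx => (hasDerivAt_hankelWave hα hx).complex_conj)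
    (fun x hx => ((hasDerivAt_hankelWaveDeriv hα hx).complex_conj).congr_deriv (by
      rw [map_mul, map_neg, Complex.conj_ofReal])) hx hy
  rw [hw]
  simp only [Function.comp_apply, map_mul, conj_exp_neg_I_mul]
  have he : Complex.exp (-(Complex.I * y)) * Complex.exp (Complex.I * y) = 1 := by
    rw [← Complex.exp_add, neg_add_cancel, Complex.exp_zero]
  linear_combination -(hankelWave α y * conj (hankelWaveDeriv α y)
    - hankelWaveDeriv α y * conj (hankelWave α y)) * he

/-- Every solution of the reduced Bessel equation is a combination of `hankelWave` and its
complex conjugate. -/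
theorem exists_eq_hankelWave {α : ℝ} (hα : 0 < α) {f f₁ : ℝ → ℂ}
    (hf : ∀ x, 0 < x → HasDerivAt f (f₁ x) x)
    (hf₁ : ∀ x, 0 < x → HasDerivAt f₁ (-((1 - α * (α + 1) / x ^ 2 : ℝ) : ℂ) * f x) x) :
    ∃ a b : ℂ, ∀ x, 0 < x → f x = a * hankelWave α x + b * conj (hankelWave α x) := by
  have hG : Real.Gamma (α + 1) ≠ 0 := (Real.Gamma_pos_of_pos (by linarith)).ne'
  set w : ℂ := -(2 * Real.Gamma (α + 1) ^ 2 : ℝ) * Complex.I with hw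
  have hw0 : w ≠ 0 := by
    rw [hw]
    simp [hG]
  -- Cramer's rule: the coefficients are the Wronskians of f with the two basis solutions, taken at
  -- the point 1, over the Wronskian w of the basis.
  refine ⟨(f 1 * conj (hankelWaveDeriv α 1) - f₁ 1 * conj (hankelWave α 1)) / w,
    -(f 1 * hankelWaveDeriv α 1 - f₁ 1 * hankelWave α 1) / w, fun x hx => ?_⟩
  have h1 := wronskian_eq (q := fun x => -((1 - α * (α + 1) / x ^ 2 : ℝ) : ℂ)) hf hf₁
    (fun x hx => hasDerivAt_hankelWave hα hx) (fun x hx => hasDerivAt_hankelWaveDeriv hα hx)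
    one_pos hx
  have h2 := wronskian_eq (q := fun x => -((1 - α * (α + 1) / x ^ 2 : ℝ) : ℂ)) hf hf₁
    (fun x hx => (hasDerivAt_hankelWave hα hx).complex_conj)
    (fun x hx => ((hasDerivAt_hankelWaveDeriv hα hx).complex_conj).congr_deriv (by
      rw [map_mul, map_neg, Complex.conj_ofReal])) one_pos hx
  have h3 := wronskian_hankelWave hα hx
  rw [← hw] at h3
  rw [h1, h2]
  field_simp
  rw [← h3]
  ring

/-- Along s + 2πn the expression is constant in n, so it vanishes at every s. The points s = 0 and s
= π/2 separate A from B. -/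
theorem eq_zero_of_tendsto_exp {A B : ℂ}
    (h : Tendsto (fun x : ℝ => Complex.exp (Complex.I * x) * A + Complex.exp (-(Complex.I * x)) * B)
      atTop (𝓝 0)) : A = 0 ∧ B = 0 := by
  have hseq : ∀ s : ℝ, Tendsto (fun n : ℕ => s + n * (2 * Real.pi)) atTop atTop := fun s =>
    tendsto_atTop_add_const_left _ _
      (tendsto_natCast_atTop_atTop.atTop_mul_const (by positivity))
  have hval : ∀ s : ℝ, Complex.exp (Complex.I * s) * A + Complex.exp (-(Complex.I * s)) * B = 0 := by
    intro s
    refine tendsto_nhds_unique ((tendsto_const_nhds (f := atTop (α := ℕ))).congr fun n => ?_)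
      (h.comp (hseq s))
    have h1 : Complex.exp (Complex.I * ((s + n * (2 * Real.pi) : ℝ) : ℂ))
        = Complex.exp (Complex.I * s) := by
      rw [← (Complex.exp_periodic.nat_mul n) (Complex.I * s)]
      congr 1
      push_cast
      ring
    simp only [Function.comp_apply]
    rw [Complex.exp_neg, Complex.exp_neg, h1]
  have h1 := hval 0
  have h2 := hval (Real.pi / 2)
  have h3 : Complex.I * ((Real.pi / 2 : ℝ) : ℂ) = Real.pi / 2 * Complex.I := by
    push_cast
    ring
  rw [h3, Complex.exp_neg, Complex.exp_pi_div_two_mul_I, Complex.inv_I] at h2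
  simp only [Complex.ofReal_zero, mul_zero, neg_zero, Complex.exp_zero, one_mul] at h1
  have h4 : A - B = 0 := by linear_combination -Complex.I * h2 + (A - B) * Complex.I_sq
  constructor
  · linear_combination (h1 + h4) / 2
  · linear_combination (h1 - h4) / 2

/-- Compares two values of Poisson's integral, the Bessel series and the result of the contour
deformation. -/
theorem sqrt_mul_besselJ_eq_im_hankelWave {α x : ℝ} (hα : 0 < α) (hx : 0 < x) :
    Real.sqrt x * besselJ (α + 1 / 2) x
      = Real.sqrt (2 / Real.pi) / Real.Gamma (α + 1) * (hankelWave α x).im := by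
  have h1 := integral_one_sub_sq_rpow_mul_cos hα x
  have h2 := integral_poissonIntegrand hα hx
  have h3 : (∫ t in (-1 : ℝ)..1, (1 - t ^ 2) ^ α * Real.cos (x * t))
      = (∫ t in (-1 : ℝ)..1, poissonIntegrand α x t).re := by
    have hc : ContinuousOn (fun t : ℝ => poissonIntegrand α x t) (uIcc (-1) 1) := by
      intro t ht
      rw [uIcc_of_le (by norm_num)] at ht
      have h0 : 0 ≤ 1 - t ^ 2 := by nlinarith [ht.1, ht.2]
      apply ContinuousAt.continuousWithinAt
      unfold poissonIntegrand
      refine ContinuousAt.mul (by fun_prop) ?_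
      refine ContinuousAt.comp (f := fun t : ℝ => 1 - (t : ℂ) ^ 2)
        (g := fun w : ℂ => w ^ (α : ℂ)) ?_ (by fun_prop)
      refine Complex.continuousAt_cpow_const_of_re_pos (Or.inl ?_) (by simpa using hα)
      rw [show (1 - (t : ℂ) ^ 2) = ((1 - t ^ 2 : ℝ) : ℂ) by push_cast; ring, Complex.ofReal_re]
      exact h0
    rw [← Complex.reCLM_apply, ← ContinuousLinearMap.intervalIntegral_comp_comm _
      hc.intervalIntegrable]
    refine intervalIntegral.integral_congr fun t ht => ?_
    rw [uIcc_of_le (by norm_num)] at ht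
    have h0 : 0 ≤ 1 - t ^ 2 := by nlinarith [ht.1, ht.2]
    simp only [Complex.reCLM_apply, poissonIntegrand]
    rw [show (1 - (t : ℂ) ^ 2) = ((1 - t ^ 2 : ℝ) : ℂ) by push_cast; ring,
      ← Complex.ofReal_cpow h0, Complex.re_mul_ofReal,
      show Complex.I * (x : ℂ) * t = ((x * t : ℝ) : ℂ) * Complex.I by push_cast; ring,
      Complex.exp_ofReal_mul_I_re, mul_comm]
  rw [h3, h2, Complex.ofReal_re] at h1
  have g := Real.Gamma_pos_of_pos (show 0 < α + 1 by linarith)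
  have hpi := Real.sqrt_pos.2 Real.pi_pos
  have hw : (hankelWave α x).im
      = x ^ (-α) * (Complex.exp (Complex.I * x) * hankelIntegral α x).im := by
    rw [hankelWave, mul_left_comm, Complex.im_ofReal_mul]
  rw [besselJ_eq_besselEntire _ hx, hw]
  set m := (Complex.exp (Complex.I * x) * hankelIntegral α x).im
  have hB : besselEntire (α + 1 / 2) ((x / 2) ^ 2)
      = 2 / x * (2 / x ^ 2) ^ α * m / (Real.sqrt Real.pi * Real.Gamma (α + 1)) := by
    rw [eq_div_iff (by positivity), h1]
    ring
  have hx2 : (2 / x ^ 2) ^ α = 2 ^ α * x ^ (-α) * x ^ (-α) := by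
    rw [Real.div_rpow (by norm_num) (by positivity), Real.rpow_neg hx.le,
      ← Real.rpow_natCast x 2, ← Real.rpow_mul hx.le, mul_comm _ α, Real.rpow_mul hx.le]
    push_cast
    rw [Real.rpow_two]
    field_simp
  have hx3 : (x / 2) ^ (α + 1 / 2) = x ^ α * Real.sqrt x / (2 ^ α * Real.sqrt 2) := by
    rw [Real.div_rpow hx.le (by norm_num), Real.rpow_add hx, Real.rpow_add (by norm_num),
      ← Real.sqrt_eq_rpow, ← Real.sqrt_eq_rpow]
  rw [hB, hx2, hx3, Real.rpow_neg hx.le, Real.sqrt_div (by norm_num)]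
  have hxa := Real.rpow_pos_of_pos hx α
  have h2a := Real.rpow_pos_of_pos (show (0 : ℝ) < 2 by norm_num) α
  have hs := Real.sqrt_pos.2 hx
  have hsx : Real.sqrt x ^ 2 = x := Real.sq_sqrt hx.le
  have hs2 : Real.sqrt 2 ^ 2 = 2 := Real.sq_sqrt (by norm_num)
  have hs2' : 0 < Real.sqrt 2 := Real.sqrt_pos.2 (by norm_num)
  field_simp
  rw [hsx, hs2]
  ring

theorem tendsto_im_hankelWave_sub {α : ℝ} (hα : 0 < α) :
    Tendsto (fun x : ℝ => (hankelWave α x).im / Real.Gamma (α + 1)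
      - (Complex.exp (Complex.I * x) * (-Complex.I) ^ (α : ℂ)).im) atTop (𝓝 0) := by
  have hG : (Real.Gamma (α + 1) : ℂ) ≠ 0 := by
    exact_mod_cast (Real.Gamma_pos_of_pos (show 0 < α + 1 by linarith)).ne'
  have h1 := ((tendsto_exp_neg_mul_hankelWave hα).div_const (Real.Gamma (α + 1) : ℂ)).sub_const
    ((-Complex.I) ^ (α : ℂ))
  rw [mul_div_cancel_left₀ _ hG, sub_self] at h1
  rw [tendsto_zero_iff_norm_tendsto_zero] at h1 ⊢
  refine squeeze_zero (fun _ => norm_nonneg _) (fun x => ?_) h1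
  have h2 : (hankelWave α x).im / Real.Gamma (α + 1)
      - (Complex.exp (Complex.I * x) * (-Complex.I) ^ (α : ℂ)).im
      = (Complex.exp (Complex.I * x) * (Complex.exp (-(Complex.I * x)) * hankelWave α x
        / (Real.Gamma (α + 1) : ℂ) - (-Complex.I) ^ (α : ℂ))).im := by
    have he : Complex.exp (Complex.I * x) * Complex.exp (-(Complex.I * x)) = 1 := by
      rw [← Complex.exp_add, add_neg_cancel, Complex.exp_zero]
    rw [mul_sub, Complex.sub_im, mul_div_assoc, ← mul_assoc, he, one_mul, Complex.div_ofReal_im]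
  rw [h2, Real.norm_eq_abs]
  refine (Complex.abs_im_le_norm _).trans ?_
  rw [norm_mul, mul_comm Complex.I, Complex.norm_exp_ofReal_mul_I, one_mul, mul_comm (x : ℂ)]

theorem isBoundedUnder_sqrt_mul_besselJ {α : ℝ} (hα : 0 < α) :
    IsBoundedUnder (· ≤ ·) atTop (fun x : ℝ => ‖Real.sqrt x * besselJ (α + 1 / 2) x‖) := by
  have h1 := (tendsto_exp_neg_mul_hankelWave hα).norm.isBoundedUnder_le
  obtain ⟨C, hC⟩ := h1
  rw [eventually_map] at hC
  refine ⟨|Real.sqrt (2 / Real.pi) / Real.Gamma (α + 1)| * C, ?_⟩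
  rw [eventually_map]
  filter_upwards [hC, eventually_gt_atTop 0] with x hx hx0
  rw [sqrt_mul_besselJ_eq_im_hankelWave hα hx0, norm_mul, Real.norm_eq_abs]
  gcongr
  refine le_trans ?_ hx
  rw [norm_mul, show -(Complex.I * (x : ℂ)) = ((-x : ℝ) : ℂ) * Complex.I by push_cast; ring,
    Complex.norm_exp_ofReal_mul_I, one_mul]
  exact Complex.abs_im_le_norm _

/-- The Poisson representation does not apply at the order −(3/2 − δ). Two steps of the three-term
recurrence lead to the orders δ + 1/2 and δ + 3/2, where it does. All terms but −J of order δ + 1/2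
carry a factor 1/x and disappear at infinity. -/
theorem tendsto_sqrt_mul_besselJ_neg {δ : ℝ} (hδ : 0 < δ) :
    Tendsto (fun x : ℝ => Real.sqrt x * besselJ (-(3 / 2 - δ)) x + Real.sqrt (2 / Real.pi)
      * (Complex.exp (Complex.I * x) * (-Complex.I) ^ (δ : ℂ)).im) atTop (𝓝 0) := by
  have hi : Tendsto (fun x : ℝ => x⁻¹) atTop (𝓝 0) := tendsto_inv_atTop_zero
  have b1 := hi.zero_mul_isBoundedUnder_le (isBoundedUnder_sqrt_mul_besselJ hδ)
  have b2 := hi.zero_mul_isBoundedUnder_le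
    (isBoundedUnder_sqrt_mul_besselJ (show 0 < δ + 1 by linarith))
  have h1 := (hi.mul b1).const_mul (2 * (δ - 1 / 2) * (2 * (δ + 1 / 2)))
  have h2 := b2.const_mul (-(2 * (δ - 1 / 2)))
  have h3 := (tendsto_im_hankelWave_sub hδ).const_mul (-Real.sqrt (2 / Real.pi))
  have h4 := (h1.add h2).add h3
  simp only [mul_zero, add_zero] at h4
  refine h4.congr' ?_
  filter_upwards [eventually_gt_atTop 0] with x hx
  have r1 := besselJ_recurrence (δ - 1 / 2) hx
  have r2 := besselJ_recurrence (δ + 1 / 2) hx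
  rw [show δ - 1 / 2 - 1 = -(3 / 2 - δ) by ring, show δ - 1 / 2 + 1 = δ + 1 / 2 by ring] at r1
  rw [show δ + 1 / 2 - 1 = δ - 1 / 2 by ring, show δ + 1 / 2 + 1 = δ + 1 + 1 / 2 by ring] at r2
  have e1 := sqrt_mul_besselJ_eq_im_hankelWave hδ hx
  rw [r1, r2]
  simp only [div_eq_mul_inv] at e1 ⊢
  linear_combination e1

/-- The left side solves the same equation as the wave with α = 1 − δ, so it is a combination of
that wave and its conjugate. The oscillations e^(ix) and e^(−ix) at infinity, known from
`tendsto_sqrt_mul_besselJ_neg`, fix the two coefficients. -/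
theorem sqrt_mul_besselJ_neg_eq {δ x : ℝ} (hδ : 0 < δ) (hδ' : δ < 1) (hx : 0 < x) :
    Real.sqrt x * besselJ (-(3 / 2 - δ)) x
      = Real.sqrt (2 / Real.pi) / Real.Gamma (2 - δ)
        * (Complex.exp (Complex.I * (Real.pi * (3 / 2 - δ))) * hankelWave (1 - δ) x).im := by
  set κ : ℝ := Real.sqrt (2 / Real.pi) with hκ
  set α : ℝ := 1 - δ with hα
  have hα0 : 0 < α := by linarith
  have hG : (Real.Gamma (α + 1) : ℂ) ≠ 0 := by
    exact_mod_cast (Real.Gamma_pos_of_pos (show 0 < α + 1 by linarith)).ne'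
  obtain ⟨a, b, hab⟩ := exists_eq_hankelWave hα0
    (f := fun x : ℝ => ((Real.sqrt x * besselJ (-(3 / 2 - δ)) x : ℝ) : ℂ))
    (f₁ := fun x : ℝ => ((sqrtBesselJDeriv (-(3 / 2 - δ)) x : ℝ) : ℂ))
    (fun x hx => (hasDerivAt_sqrt_mul_besselJ _ hx).ofReal_comp)
    (fun x hx => ((hasDerivAt_sqrtBesselJDeriv _ hx).ofReal_comp).congr_deriv (by
      rw [hα]
      push_cast
      ring))
  set A : ℂ := Real.Gamma (α + 1) * (-Complex.I) ^ (α : ℂ) with hA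
  set B : ℂ := (-Complex.I) ^ (δ : ℂ) with hB
  have hA0 : A ≠ 0 := mul_ne_zero hG (by simp [Complex.cpow_eq_zero_iff])
  have hV := tendsto_exp_neg_mul_hankelWave hα0
  rw [← hA] at hV
  -- the asymptotics at infinity determine the two coefficients
  have hlim : Tendsto (fun x : ℝ => Complex.exp (Complex.I * x) * (a * A + κ * B / (2 * Complex.I))
      + Complex.exp (-(Complex.I * x)) * (b * conj A - κ * conj B / (2 * Complex.I)))
      atTop (𝓝 0) := by
    have h1 : Tendsto (fun x : ℝ => Complex.exp (Complex.I * x)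
        * (a * (A - Complex.exp (-(Complex.I * x)) * hankelWave α x))) atTop (𝓝 0) := by
      have h := (hV.const_sub A).const_mul a
      rw [sub_self, mul_zero, tendsto_zero_iff_norm_tendsto_zero] at h
      rw [tendsto_zero_iff_norm_tendsto_zero]
      refine h.congr fun x => ?_
      rw [norm_mul (Complex.exp _), mul_comm Complex.I, Complex.norm_exp_ofReal_mul_I, one_mul]
    have h2 : Tendsto (fun x : ℝ => Complex.exp (-(Complex.I * x))
        * (b * (conj A - conj (Complex.exp (-(Complex.I * x)) * hankelWave α x)))) atTop
        (𝓝 0) := by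
      have h := (((Complex.continuous_conj.tendsto _).comp hV).const_sub (conj A)).const_mul b
      rw [sub_self, mul_zero, tendsto_zero_iff_norm_tendsto_zero] at h
      rw [tendsto_zero_iff_norm_tendsto_zero]
      refine h.congr fun x => ?_
      have hn : ‖Complex.exp (-(Complex.I * (x : ℂ)))‖ = 1 := by
        rw [show -(Complex.I * (x : ℂ)) = ((-x : ℝ) : ℂ) * Complex.I by push_cast; ring,
          Complex.norm_exp_ofReal_mul_I]
      rw [norm_mul (Complex.exp _), hn, one_mul]
      rfl
    have h3 := (Complex.continuous_ofReal.tendsto _).comp (tendsto_sqrt_mul_besselJ_neg hδ)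
    have h4 := (h1.add h2).add h3
    simp only [Complex.ofReal_zero, add_zero] at h4
    refine h4.congr' ?_
    filter_upwards [eventually_gt_atTop 0] with x hx
    have he : Complex.exp (Complex.I * x) * Complex.exp (-(Complex.I * x)) = 1 := by
      rw [← Complex.exp_add, add_neg_cancel, Complex.exp_zero]
    have hI2 : (((Complex.exp (Complex.I * x) * B).im : ℝ) : ℂ)
        = (Complex.exp (Complex.I * x) * B - Complex.exp (-(Complex.I * x)) * conj B)
          / (2 * Complex.I) := by
      have := Complex.sub_conj (Complex.exp (Complex.I * x) * B)
      have h5 : conj (Complex.exp (Complex.I * x)) = Complex.exp (-(Complex.I * x)) := by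
        rw [← Complex.exp_conj]
        simp
      rw [map_mul, h5] at this
      rw [this]
      push_cast
      field_simp
    simp only [Function.comp_apply, ← hκ, ← hB, Complex.ofReal_add, Complex.ofReal_mul κ]
    rw [hab x hx, hI2, map_mul _ (Complex.exp (-(Complex.I * x))), conj_exp_neg_I_mul]
    linear_combination (-a * hankelWave α x - b * conj (hankelWave α x)) * he
  obtain ⟨h1, h2⟩ := eq_zero_of_tendsto_exp hlim
  -- The powers (−i)^δ and (−i)^(1−δ) differ by a phase. The two exponents agree up to 2πi, hence
  -- the integer −1 below.
  have hR : B / A = ((1 / Real.Gamma (α + 1) : ℝ) : ℂ)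
      * -Complex.exp (Complex.I * (Real.pi * (3 / 2 - δ))) := by
    have h5 : (-Complex.I) ^ (δ : ℂ)
        = (-Complex.I) ^ (α : ℂ) * -Complex.exp (Complex.I * (Real.pi * (3 / 2 - δ))) := by
      rw [Complex.cpow_def_of_ne_zero (by simp), Complex.cpow_def_of_ne_zero (by simp),
        Complex.log_neg_I, neg_eq_neg_one_mul (Complex.exp _), ← Complex.exp_pi_mul_I,
        ← Complex.exp_add, ← Complex.exp_add, Complex.exp_eq_exp_iff_exists_int]
      refine ⟨-1, ?_⟩
      rw [hα]
      push_cast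
      ring
    rw [hA, hB, h5]
    have : (-Complex.I) ^ (α : ℂ) ≠ 0 := by simp [Complex.cpow_eq_zero_iff]
    push_cast
    field_simp
  have hx1 := hab x hx
  have ha : a = -(κ * (B / A)) / (2 * Complex.I) := by
    field_simp
    field_simp at h1
    linear_combination h1
  have hb : b = κ * conj (B / A) / (2 * Complex.I) := by
    have hcA : conj A ≠ 0 := by simpa using hA0
    rw [map_div₀]
    field_simp
    field_simp at h2
    linear_combination h2
  have hIm : ∀ z : ℂ, (z.im : ℂ) = (z - conj z) / (2 * Complex.I) := by
    intro z
    rw [Complex.sub_conj]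
    push_cast
    field_simp
  have hfin : ((Real.sqrt x * besselJ (-(3 / 2 - δ)) x : ℝ) : ℂ)
      = ((-(κ * (B / A * hankelWave α x).im) : ℝ) : ℂ) := by
    rw [hx1, Complex.ofReal_neg, Complex.ofReal_mul, hIm, ha, hb, map_mul]
    ring
  rw [Complex.ofReal_inj] at hfin
  rw [hfin, hR, show (2 : ℝ) - δ = α + 1 by rw [hα]; ring, mul_assoc, Complex.im_ofReal_mul,
    neg_mul, Complex.neg_im]
  ring

/-- The order lies strictly between 1 and 3/2, so sin πν ≠ 0 and Y is given by the quotient. In it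
the cosine term cancels, and J and −Y become the imaginary and the real part of one wave. -/
theorem hankelOne_eq {δ x : ℝ} (hδ : 0 < δ) (hδ' : δ < 1 / 2) (hx : 0 < x) :
    hankelOne (3 / 2 - δ) x = -Complex.I * ((Real.sqrt (2 / Real.pi) / Real.Gamma (2 - δ)
      / Real.sqrt x : ℝ) : ℂ) * hankelWave (1 - δ) x := by
  have hs : Real.sqrt x ≠ 0 := (Real.sqrt_pos.2 hx).ne'
  set c : ℝ := Real.sqrt (2 / Real.pi) / Real.Gamma (2 - δ) with hc
  have h1 := sqrt_mul_besselJ_eq_im_hankelWave (show 0 < 1 - δ by linarith) hx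
  have h2 := sqrt_mul_besselJ_neg_eq hδ (by linarith) hx
  rw [show 1 - δ + 1 / 2 = 3 / 2 - δ by ring, show 1 - δ + 1 = 2 - δ by ring] at h1
  rw [← hc] at h1 h2
  have hexp : Complex.exp (Complex.I * (Real.pi * (3 / 2 - δ)))
      = (Real.cos (Real.pi * (3 / 2 - δ)) : ℂ)
        + (Real.sin (Real.pi * (3 / 2 - δ)) : ℂ) * Complex.I := by
    rw [mul_comm, show ((Real.pi : ℂ) * (3 / 2 - δ)) = ((Real.pi * (3 / 2 - δ) : ℝ) : ℂ) by
      push_cast; ring, Complex.exp_mul_I, Complex.ofReal_cos, Complex.ofReal_sin]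
  have hsin : Real.sin (Real.pi * (3 / 2 - δ)) ≠ 0 := by
    have : 0 < Real.sin (Real.pi * (3 / 2 - δ) - Real.pi) :=
      Real.sin_pos_of_pos_of_lt_pi (by nlinarith [Real.pi_pos]) (by nlinarith [Real.pi_pos])
    rw [Real.sin_sub_pi] at this
    linarith
  rw [hexp] at h2
  simp only [Complex.mul_im, Complex.add_re, Complex.add_im, Complex.ofReal_re, Complex.ofReal_im,
    Complex.mul_re, Complex.I_re, Complex.I_im, mul_zero, mul_one, add_zero,
    zero_add, sub_self] at h2
  have hY : besselY (3 / 2 - δ) x = -(c / Real.sqrt x * (hankelWave (1 - δ) x).re) := by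
    rw [besselY, if_neg hsin, besselYQuotient, div_eq_iff hsin]
    apply mul_left_cancel₀ hs
    rw [mul_sub, ← mul_assoc, h1, h2]
    field_simp
    ring
  have hJ : besselJ (3 / 2 - δ) x = c / Real.sqrt x * (hankelWave (1 - δ) x).im := by
    apply mul_left_cancel₀ hs
    rw [h1]
    field_simp
  rw [hankelOne, hJ, hY]
  apply Complex.ext
  · simp
  · simp

/-! ## The Bunch–Davies modes in terms of two amplitudes -/

/-- The logarithm of `u (u y / 2 - i)`. -/
def laplacePhase (u y : ℝ) : ℂ := (Real.log u : ℂ) + Complex.log (laplaceBase (u * y) 1)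

/-- The integral `∫ e^{-u} u^n (u (u y / 2 - i))^{-δ} du` over `u > 0`. -/
def phaseMoment (n : ℕ) (δ y : ℝ) : ℂ :=
  ∫ u in Ioi (0 : ℝ), ((Real.exp (-u) * u ^ n : ℝ) : ℂ) * Complex.exp (-(δ * laplacePhase u y))

/-- The amplitude of the field modes; `y` is the inverse of the physical wave number in Hubble
units. -/
def fieldAmplitude (δ y : ℝ) : ℂ :=
  phaseMoment 2 δ y / 2 - Complex.I * ((y⁻¹ : ℝ) : ℂ) * phaseMoment 1 δ y

/-- The amplitude of the part of the momentum modes that is not proportional to the field. -/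
def momentumAmplitude (δ y : ℝ) : ℂ := (1 - δ) * phaseMoment 0 δ y

theorem rpow_mul_laplaceBase_cpow {u x : ℝ} (δ : ℝ) (hu : 0 < u) (hx : 0 < x) :
    ((x ^ δ * u ^ (-δ) : ℝ) : ℂ) * laplaceBase u x ^ ((-δ : ℝ) : ℂ)
      = Complex.exp (-(δ * laplacePhase u x⁻¹)) := by
  have h1 : laplaceBase (u / x) 1 ≠ 0 := laplaceBase_ne_zero _ one_pos
  have hx' : (x : ℂ) ≠ 0 := by exact_mod_cast hx.ne'
  rw [laplaceBase_div u hx, Complex.ofReal_mul_cpow hx h1, Complex.cpow_def_of_ne_zero h1,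
    Complex.cpow_def_of_ne_zero hx', ← Complex.ofReal_log hx.le, Real.rpow_def_of_pos hx,
    Real.rpow_def_of_pos hu, laplacePhase, ← div_eq_mul_inv]
  push_cast
  rw [← Complex.exp_add, ← Complex.exp_add, ← Complex.exp_add]
  congr 1
  ring

theorem rpow_mul_hankelCompanion {δ x : ℝ} (hx : 0 < x) :
    ((x ^ δ : ℝ) : ℂ) * hankelCompanion (1 - δ) x = momentumAmplitude δ x⁻¹ := by
  rw [hankelCompanion, momentumAmplitude, phaseMoment, laplaceIntegral, mul_left_comm,
    ← integral_const_mul]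
  congr 1
  · push_cast
    ring
  refine setIntegral_congr_fun measurableSet_Ioi fun u hu => ?_
  have hu' : (0 : ℝ) < u := hu
  simp only [laplaceIntegrand]
  rw [← rpow_mul_laplaceBase_cpow δ hu' hx, show 1 - δ - 1 = -δ by ring]
  push_cast
  ring

/-- From the power 1 − δ one full factor u (u/2 − ix) is split off. Its two terms give the moments
of order 2 and 1, and what remains is e^(−δL) with the logarithmic phase L. -/
theorem rpow_mul_hankelIntegral {δ x : ℝ} (hδ : δ < 1) (hx : 0 < x) :
    ((x ^ δ : ℝ) : ℂ) * hankelIntegral (1 - δ) x = fieldAmplitude δ x⁻¹ := by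
  have hint : ∀ n : ℕ, IntegrableOn (fun u : ℝ => ((Real.exp (-u) * u ^ n : ℝ) : ℂ)
      * Complex.exp (-(δ * laplacePhase u x⁻¹))) (Ioi 0) := by
    intro n
    have := (integrableOn_laplaceIntegrand (a := n - δ) (x := x)
      (by have := n.cast_nonneg (α := ℝ); linarith) (-δ) hx).const_mul ((x ^ δ : ℝ) : ℂ)
    refine IntegrableOn.congr_fun this (fun u hu => ?_) measurableSet_Ioi
    have hu' : (0 : ℝ) < u := hu
    simp only [laplaceIntegrand]
    rw [← rpow_mul_laplaceBase_cpow δ hu' hx, sub_eq_add_neg, Real.rpow_add hu',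
      Real.rpow_natCast]
    push_cast
    ring
  rw [hankelIntegral, fieldAmplitude, phaseMoment, phaseMoment, laplaceIntegral,
    ← integral_const_mul, ← integral_const_mul, ← integral_div, ← integral_sub]
  · refine setIntegral_congr_fun measurableSet_Ioi fun u hu => ?_
    have hu' : (0 : ℝ) < u := hu
    simp only [laplaceIntegrand]
    rw [← rpow_mul_laplaceBase_cpow δ hu' hx, inv_inv, show ((1 - δ : ℝ) : ℂ)
      = ((-δ : ℝ) : ℂ) + 1 by push_cast; ring, Complex.cpow_add _ _ (laplaceBase_ne_zero _ hx),
      Complex.cpow_one, show 1 - δ = -δ + 1 by ring, Real.rpow_add_one hu'.ne']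
    nth_rw 2 [laplaceBase]
    push_cast
    ring
  · exact (hint 2).div_const 2
  · exact (hint 1).const_mul _

/-- The common prefactor of the modes at the instant of unit scale factor. -/
def modePrefactor (H δ k : ℝ) : ℂ :=
  ((1 / (Real.sqrt 2 * Real.Gamma (2 - δ) * Real.sqrt k) : ℝ) : ℂ)
    * (Complex.exp (Complex.I * ((k / H : ℝ) : ℂ)) * ((H / k : ℝ) : ℂ))

theorem bdMode_eq {H m δ k t : ℝ} (hH : 0 < H) (hδ : 0 < δ) (hδ' : δ < 1 / 2)
    (hm : modeOrder H m = 3 / 2 - δ) (hk : 0 < k) (ht : t < 0) :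
    bdMode H m k t = -Complex.I * ((H / (Real.sqrt 2 * Real.Gamma (2 - δ) * Real.sqrt k) : ℝ) : ℂ)
      * ((-t : ℝ) * hankelWave (1 - δ) (-t * k)) := by
  have hk' := Real.sqrt_pos.2 hk
  have ht' : 0 < -t := by linarith
  have hG : 0 < Real.Gamma (2 - δ) := Real.Gamma_pos_of_pos (by linarith)
  have hs : Real.sqrt (-(Real.pi * t) / (4 * scaleFactor H t ^ 2))
      = Real.sqrt Real.pi / 2 * H * (-t) * Real.sqrt (-t) := by
    have h1 : -(Real.pi * t) / (4 * scaleFactor H t ^ 2)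
        = Real.pi * (-t) * ((H * (-t) / 2) ^ 2) := by
      have : t ≠ 0 := ht.ne
      rw [scaleFactor]
      field_simp
      norm_num
    rw [h1, Real.sqrt_mul (by positivity), Real.sqrt_mul (by positivity),
      Real.sqrt_sq (by positivity)]
    ring
  have hpi : Real.sqrt (2 / Real.pi) = 2 / (Real.sqrt 2 * Real.sqrt Real.pi) := by
    rw [Real.sqrt_div (by norm_num)]
    have := Real.sq_sqrt (show (0 : ℝ) ≤ 2 by norm_num)
    have h2 : 0 < Real.sqrt 2 := by positivity
    have h3 : 0 < Real.sqrt Real.pi := Real.sqrt_pos.2 Real.pi_pos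
    field_simp
    exact this
  rw [bdMode, hm, hs, show -(k * t) = -t * k by ring, hankelOne_eq hδ hδ' (mul_pos ht' hk),
    hpi, Real.sqrt_mul ht'.le]
  have h3 : ((Real.sqrt Real.pi : ℝ) : ℂ) ≠ 0 := by
    exact_mod_cast (Real.sqrt_pos.2 Real.pi_pos).ne'
  have h4 : ((Real.sqrt (-t) : ℝ) : ℂ) ≠ 0 := by exact_mod_cast (Real.sqrt_pos.2 ht').ne'
  have h5 : ((Real.sqrt k : ℝ) : ℂ) ≠ 0 := by exact_mod_cast hk'.ne'
  have h6 : ((Real.Gamma (2 - δ) : ℝ) : ℂ) ≠ 0 := by exact_mod_cast hG.ne'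
  have h7 : ((Real.sqrt 2 : ℝ) : ℂ) ≠ 0 := by
    exact_mod_cast (Real.sqrt_pos.2 (show (0 : ℝ) < 2 by norm_num)).ne'
  push_cast at h4 ⊢
  field_simp

theorem hankelWave_one_sub {δ x : ℝ} (hδ' : δ < 1) (hx : 0 < x) :
    hankelWave (1 - δ) x
      = Complex.exp (Complex.I * x) * ((x⁻¹ : ℝ) : ℂ) * fieldAmplitude δ x⁻¹ := by
  rw [hankelWave, ← rpow_mul_hankelIntegral hδ' hx, show -(1 - δ) = -1 + δ by ring,
    Real.rpow_add hx, Real.rpow_neg_one]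
  push_cast
  ring

theorem bdMode_unitTime {H m δ k : ℝ} (hH : 0 < H) (hδ : 0 < δ) (hδ' : δ < 1 / 2)
    (hm : modeOrder H m = 3 / 2 - δ) (hk : 0 < k) :
    bdMode H m k (unitTime H) = modePrefactor H δ k * (-Complex.I * fieldAmplitude δ (H / k)) := by
  have hx : 0 < k / H := div_pos hk hH
  rw [bdMode_eq hH hδ hδ' hm hk (by rw [unitTime, neg_div]; exact neg_neg_of_pos (by positivity)),
    show -unitTime H * k = k / H by rw [unitTime]; field_simp, hankelWave_one_sub (by linarith) hx,
    modePrefactor, inv_div, unitTime]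
  have hH' : (H : ℂ) ≠ 0 := by exact_mod_cast hH.ne'
  push_cast
  field_simp

/-- The derivative of the factor −t cancels the term −α/x in the derivative of the wave up to δ = 1
− α. So in a long wave the momentum is the field times δH, up to a term suppressed by (k/H)². -/
theorem bdMomentumMode_unitTime {H m δ k : ℝ} (hH : 0 < H) (hδ : 0 < δ) (hδ' : δ < 1 / 2)
    (hm : modeOrder H m = 3 / 2 - δ) (hk : 0 < k) :
    bdMomentumMode H m k (unitTime H) = modePrefactor H δ k * (Complex.I * H *
      (δ * fieldAmplitude δ (H / k) + ((k / H) ^ 2 : ℝ) * momentumAmplitude δ (H / k))) := by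
  have hx : 0 < k / H := div_pos hk hH
  have hH' : (H : ℂ) ≠ 0 := by exact_mod_cast hH.ne'
  have hk' : (k : ℂ) ≠ 0 := by exact_mod_cast hk.ne'
  have hη : unitTime H < 0 := by rw [unitTime, neg_div]; exact neg_neg_of_pos (by positivity)
  have hηk : -unitTime H * k = k / H := by rw [unitTime]; field_simp
  have ha : scaleFactor H (unitTime H) = 1 := by rw [scaleFactor, unitTime]; field_simp
  have hid : HasDerivAt (fun t : ℝ => ((-t : ℝ) : ℂ)) (-1) (unitTime H) := by
    simpa using ((hasDerivAt_id (unitTime H)).neg).ofReal_comp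
  have hlin : HasDerivAt (fun t : ℝ => -t * k) (-k) (unitTime H) := by
    simpa using ((hasDerivAt_id (unitTime H)).neg).mul_const k
  have hW : HasDerivAt (fun t : ℝ => hankelWave (1 - δ) (-t * k))
      ((-k : ℝ) • hankelWaveDeriv (1 - δ) (-unitTime H * k)) (unitTime H) :=
    HasDerivAt.scomp (unitTime H)
      (hasDerivAt_hankelWave (by linarith) (by rw [hηk]; exact hx)) hlin
  have hd := (hid.mul hW).const_mul
    (-Complex.I * ((H / (Real.sqrt 2 * Real.Gamma (2 - δ) * Real.sqrt k) : ℝ) : ℂ))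
  have he : (fun t : ℝ => bdMode H m k t) =ᶠ[𝓝 (unitTime H)] fun t =>
      -Complex.I * ((H / (Real.sqrt 2 * Real.Gamma (2 - δ) * Real.sqrt k) : ℝ) : ℂ)
      * ((-t : ℝ) * hankelWave (1 - δ) (-t * k)) := by
    filter_upwards [Iio_mem_nhds hη] with t ht
    exact bdMode_eq hH hδ hδ' hm hk ht
  have hwd : hankelWaveDeriv (1 - δ) (k / H) = Complex.exp (Complex.I * ((k / H : ℝ) : ℂ))
      * (momentumAmplitude δ (H / k) - (1 - δ) * ((H / k) ^ 2 : ℝ)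
        * fieldAmplitude δ (H / k)) := by
    rw [hankelWaveDeriv, ← inv_div k H, ← rpow_mul_hankelIntegral (by linarith) hx,
      ← rpow_mul_hankelCompanion hx, show -(1 - δ) = -1 + δ by ring,
      Real.rpow_add hx, Real.rpow_neg_one, inv_div]
    push_cast
    field_simp
  rw [bdMomentumMode, ha, he.deriv_eq.trans hd.deriv, hηk, hwd, hankelWave_one_sub (by linarith) hx,
    modePrefactor, inv_div, unitTime]
  simp only [Complex.real_smul]
  push_cast
  field_simp
  ring

theorem norm_modePrefactor_sq {H δ k : ℝ} (hk : 0 < k) :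
    2 * ‖modePrefactor H δ k‖ ^ 2 = (Real.Gamma (2 - δ))⁻¹ ^ 2 * (H ^ 2 / k ^ 3) := by
  rw [modePrefactor, norm_mul, norm_mul, mul_comm Complex.I, Complex.norm_exp_ofReal_mul_I,
    one_mul, Complex.norm_real, Complex.norm_real, mul_pow, Real.norm_eq_abs, Real.norm_eq_abs,
    sq_abs, sq_abs, div_pow, mul_pow, mul_pow, Real.sq_sqrt hk.le, Real.sq_sqrt zero_le_two]
  by_cases hG : Real.Gamma (2 - δ) = 0
  · simp [hG]
  field_simp

/-! ## Exponential moments of a logarithmic phase -/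

/-- A bound for the modulus of `e^{-δL}`. -/
def phaseExpBound (u : ℝ) : ℝ := 2 * (1 + u ^ (-(1 / 2) : ℝ))

/-- The growth in `u` of a logarithmic phase. -/
def phaseGrowth (u : ℝ) : ℝ := 4 * u ^ (-(1 / 4) : ℝ) + 2 * u + 5

/-- The growth of a logarithmic phase in its second argument. -/
def logGrowth (y : ℝ) : ℝ := 1 + Real.log (1 + y)

theorem one_le_logGrowth {y : ℝ} (hy : 0 ≤ y) : 1 ≤ logGrowth y := by
  have := Real.log_nonneg (show 1 ≤ 1 + y by linarith)
  rw [logGrowth]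
  linarith

theorem logGrowth_mono {y z : ℝ} (hy : 0 ≤ y) (h : y ≤ z) : logGrowth y ≤ logGrowth z := by
  rw [logGrowth, logGrowth]
  gcongr

theorem one_le_phaseExpBound {u : ℝ} (hu : 0 ≤ u) : 1 ≤ phaseExpBound u := by
  have := Real.rpow_nonneg hu (-(1 / 2))
  rw [phaseExpBound]
  linarith

theorem one_le_phaseGrowth {u : ℝ} (hu : 0 ≤ u) : 1 ≤ phaseGrowth u := by
  have := Real.rpow_nonneg hu (-(1 / 4))
  rw [phaseGrowth]
  linarith

/-- The integrable weight that dominates all moments of order `n`. -/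
def phaseWeight (n : ℕ) (u : ℝ) : ℝ := Real.exp (-u) * u ^ n * (phaseExpBound u * phaseGrowth u)

theorem phaseWeight_nonneg (n : ℕ) {u : ℝ} (hu : 0 ≤ u) : 0 ≤ phaseWeight n u := by
  have h1 := one_le_phaseExpBound hu
  have h2 := one_le_phaseGrowth hu
  rw [phaseWeight]
  positivity

/-- The worst singularity at u = 0 is u^(−1/2−1/4), which is integrable even for n = 0. The
exponents in `phaseExpBound` and `phaseGrowth` are chosen for this. -/
theorem integrableOn_phaseWeight (n : ℕ) : IntegrableOn (phaseWeight n) (Ioi 0) := by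
  have hn := n.cast_nonneg (α := ℝ)
  have h : ∀ s : ℝ, -1 < s → IntegrableOn (fun u : ℝ => Real.exp (-u) * u ^ (n + s)) (Ioi 0) :=
    fun s hs => integrableOn_exp_neg_mul_rpow (by linarith)
  have := ((((((h (-(1 / 4)) (by norm_num)).const_mul 8).add
    ((h 1 (by norm_num)).const_mul 4)).add ((h 0 (by norm_num)).const_mul 10)).add
    ((h (-(1 / 2) + -(1 / 4)) (by norm_num)).const_mul 8)).add
    ((h (-(1 / 2) + 1) (by norm_num)).const_mul 4)).add
    ((h (-(1 / 2)) (by norm_num)).const_mul 10)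
  refine IntegrableOn.congr_fun this (fun u hu => ?_) measurableSet_Ioi
  have hu' : (0 : ℝ) < u := hu
  simp only [Pi.add_apply, phaseWeight, phaseExpBound, phaseGrowth]
  rw [Real.rpow_add hu', Real.rpow_add hu', Real.rpow_add hu', Real.rpow_add hu',
    Real.rpow_add hu', Real.rpow_add hu', Real.rpow_add hu', Real.rpow_add hu', Real.rpow_one,
    Real.rpow_zero, Real.rpow_natCast]
  ring

/-- A constant that bounds the moments of order at most two. -/
def phaseConst : ℝ := ∑ n ∈ Finset.range 3, ∫ u in Ioi (0 : ℝ), 8 * phaseWeight n u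

theorem integral_phaseWeight_nonneg (n : ℕ) : 0 ≤ ∫ u in Ioi (0 : ℝ), 8 * phaseWeight n u :=
  setIntegral_nonneg measurableSet_Ioi fun u hu => by
    have := phaseWeight_nonneg n (le_of_lt (show (0 : ℝ) < u from hu))
    positivity

theorem integral_phaseWeight_le {n : ℕ} (hn : n < 3) :
    ∫ u in Ioi (0 : ℝ), 8 * phaseWeight n u ≤ phaseConst :=
  Finset.single_le_sum (f := fun n => ∫ u in Ioi (0 : ℝ), 8 * phaseWeight n u)
    (fun n _ => integral_phaseWeight_nonneg n) (Finset.mem_range.2 hn)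

theorem phaseConst_nonneg : 0 ≤ phaseConst :=
  Finset.sum_nonneg fun n _ => integral_phaseWeight_nonneg n

/-- A phase `L u y` that depends logarithmically on both arguments, for `y` in `Y`; `S` is its
logarithmic derivative in `y`. -/
structure IsLogPhase (L S : ℝ → ℝ → ℂ) (Y : Set ℝ) : Prop where
  isOpen : IsOpen Y
  pos : ∀ y ∈ Y, 0 < y
  measurable : ∀ y, Measurable fun u => L u y
  measurable_slope : ∀ y, Measurable fun u => S u y
  hasDerivAt : ∀ u, 0 < u → ∀ y ∈ Y, HasDerivAt (L u) (S u y / y) y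
  norm_exp_le : ∀ δ, 0 ≤ δ → δ ≤ 1 / 4 → ∀ u, 0 < u → ∀ y ∈ Y,
    ‖Complex.exp (-((δ : ℝ) * L u y))‖ ≤ phaseExpBound u
  norm_le : ∀ u, 0 < u → ∀ y ∈ Y, ‖L u y‖ ≤ 2 * (phaseGrowth u * logGrowth y)
  norm_slope_le : ∀ u, 0 < u → ∀ y ∈ Y, ‖S u y‖ ≤ 1

/-- The integral `∫ e^{-u} u^n e^{-δL} du` over `u > 0`. -/
def expMoment (L : ℝ → ℝ → ℂ) (n : ℕ) (δ y : ℝ) : ℂ :=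
  ∫ u in Ioi (0 : ℝ), ((Real.exp (-u) * u ^ n : ℝ) : ℂ) * Complex.exp (-(δ * L u y))

/-- The derivative of `e^{-δL}` along a path on which `y` grows like `H` and `δ` has the
logarithmic derivative `-κ`. -/
def phaseRate (L S : ℝ → ℝ → ℂ) (δ κ y u : ℝ) : ℂ :=
  (κ * δ * L u y - δ * S u y) * Complex.exp (-(δ * L u y))

/-- The derivative of `expMoment` along such a path. -/
def expMomentRate (L S : ℝ → ℝ → ℂ) (n : ℕ) (δ κ y : ℝ) : ℂ :=
  ∫ u in Ioi (0 : ℝ), ((Real.exp (-u) * u ^ n : ℝ) : ℂ) * phaseRate L S δ κ y u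

/-- Mean value inequality on the half plane Re v ≤ log E, which is convex and on which the
exponential has modulus at most E. -/
theorem norm_exp_sub_exp_le {z w : ℂ} {E : ℝ} (hE : 0 < E) (hz : ‖Complex.exp z‖ ≤ E)
    (hw : ‖Complex.exp w‖ ≤ E) : ‖Complex.exp z - Complex.exp w‖ ≤ E * ‖z - w‖ := by
  have hset : ∀ v : ℂ, ‖Complex.exp v‖ ≤ E ↔ v.re ≤ Real.log E := fun v => by
    rw [Complex.norm_exp, Real.le_log_iff_exp_le hE]
  refine Convex.norm_image_sub_le_of_norm_hasDerivWithin_le (s := {v : ℂ | v.re ≤ Real.log E})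
    (f' := Complex.exp) (fun v _ => (Complex.hasDerivAt_exp v).hasDerivWithinAt)
    (fun v hv => (hset v).2 hv) (convex_halfSpace_re_le _) ((hset w).1 hw) ((hset z).1 hz)

section

variable {L S : ℝ → ℝ → ℂ} {Y : Set ℝ} {δ κ y u : ℝ}

theorem IsLogPhase.norm_exp_sub_one_le (h : IsLogPhase L S Y) (hδ : 0 ≤ δ) (hδ' : δ ≤ 1 / 4)
    (hu : 0 < u) (hy : y ∈ Y) : ‖Complex.exp (-(δ * L u y)) - 1‖
      ≤ 2 * δ * logGrowth y * (phaseExpBound u * phaseGrowth u) := by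
  have hE := one_le_phaseExpBound hu.le
  have h1 := norm_exp_sub_exp_le (by linarith) (h.norm_exp_le δ hδ hδ' u hu y hy)
    (w := 0) (by simpa using hE)
  rw [Complex.exp_zero, sub_zero, norm_neg, norm_mul, Complex.norm_real, Real.norm_eq_abs,
    abs_of_nonneg hδ] at h1
  refine h1.trans ?_
  have h2 := h.norm_le u hu y hy
  calc phaseExpBound u * (δ * ‖L u y‖)
      ≤ phaseExpBound u * (δ * (2 * (phaseGrowth u * logGrowth y))) := by gcongr
    _ = _ := by ring

theorem IsLogPhase.norm_phaseRate_le (h : IsLogPhase L S Y) (hδ : 0 ≤ δ) (hδ' : δ ≤ 1 / 4)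
    (hκ : |κ| ≤ 3) (hu : 0 < u) (hy : y ∈ Y) :
    ‖phaseRate L S δ κ y u‖ ≤ 7 * δ * logGrowth y * (phaseExpBound u * phaseGrowth u) := by
  have hE := one_le_phaseExpBound hu.le
  have hg := one_le_phaseGrowth hu.le
  have hl := one_le_logGrowth (h.pos y hy).le
  have h1 := h.norm_le u hu y hy
  have h2 := h.norm_slope_le u hu y hy
  have h3 := h.norm_exp_le δ hδ hδ' u hu y hy
  have h4 : ‖(κ : ℂ) * δ * L u y - δ * S u y‖ ≤ 7 * δ * logGrowth y * phaseGrowth u := by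
    refine (norm_sub_le _ _).trans ?_
    rw [norm_mul, norm_mul, norm_mul, Complex.norm_real, Complex.norm_real, Real.norm_eq_abs,
      Real.norm_eq_abs, abs_of_nonneg hδ]
    have h5 : 1 ≤ phaseGrowth u * logGrowth y := by nlinarith
    calc |κ| * δ * ‖L u y‖ + δ * ‖S u y‖
        ≤ 3 * δ * (2 * (phaseGrowth u * logGrowth y)) + δ * (phaseGrowth u * logGrowth y) := by
          gcongr
          exact h2.trans h5
      _ = _ := by ring
  rw [phaseRate, norm_mul]
  calc _ ≤ 7 * δ * logGrowth y * phaseGrowth u * phaseExpBound u := by gcongr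
    _ = _ := by ring

theorem norm_exp_mul_pow_le {n : ℕ} {w : ℂ} {c : ℝ} (hu : 0 < u)
    (hw : ‖w‖ ≤ c * (phaseExpBound u * phaseGrowth u)) :
    ‖((Real.exp (-u) * u ^ n : ℝ) : ℂ) * w‖ ≤ c * phaseWeight n u := by
  rw [norm_mul, Complex.norm_real, Real.norm_eq_abs, abs_of_nonneg (by positivity), phaseWeight]
  calc _ ≤ Real.exp (-u) * u ^ n * (c * (phaseExpBound u * phaseGrowth u)) := by gcongr
    _ = _ := by ring

theorem norm_integral_exp_mul_pow_le {n : ℕ} (hn : n < 3) {w : ℝ → ℂ} {c : ℝ} (hc : 0 ≤ c)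
    (hw : ∀ u, 0 < u → ‖w u‖ ≤ 8 * c * (phaseExpBound u * phaseGrowth u)) :
    ‖∫ u in Ioi (0 : ℝ), ((Real.exp (-u) * u ^ n : ℝ) : ℂ) * w u‖ ≤ phaseConst * c := by
  calc _ ≤ ∫ u in Ioi (0 : ℝ), c * (8 * phaseWeight n u) := by
        refine norm_integral_le_of_norm_le (((integrableOn_phaseWeight n).const_mul 8).const_mul c)
          ?_
        filter_upwards [ae_restrict_mem measurableSet_Ioi] with u hu
        exact (norm_exp_mul_pow_le hu (hw u hu)).trans_eq (by ring)
    _ = c * ∫ u in Ioi (0 : ℝ), 8 * phaseWeight n u := integral_const_mul _ _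
    _ ≤ c * phaseConst := mul_le_mul_of_nonneg_left (integral_phaseWeight_le hn) hc
    _ = _ := mul_comm _ _

theorem integrableOn_exp_mul_pow {n : ℕ} {w : ℝ → ℂ} (hm : Measurable w) (c : ℝ)
    (hw : ∀ u, 0 < u → ‖w u‖ ≤ c * (phaseExpBound u * phaseGrowth u)) :
    IntegrableOn (fun u : ℝ => ((Real.exp (-u) * u ^ n : ℝ) : ℂ) * w u) (Ioi 0) := by
  refine Integrable.mono' ((integrableOn_phaseWeight n).const_mul c) ?_ ?_
  · refine Measurable.aestronglyMeasurable ?_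
    fun_prop
  · filter_upwards [ae_restrict_mem measurableSet_Ioi] with u hu
    exact norm_exp_mul_pow_le hu (hw u hu)

theorem IsLogPhase.integrableOn (h : IsLogPhase L S Y) (n : ℕ) (hδ : 0 ≤ δ) (hδ' : δ ≤ 1 / 4)
    (hy : y ∈ Y) : IntegrableOn (fun u : ℝ => ((Real.exp (-u) * u ^ n : ℝ) : ℂ)
      * Complex.exp (-(δ * L u y))) (Ioi 0) := by
  have := h.measurable y
  refine integrableOn_exp_mul_pow (by fun_prop) 1 fun u hu => ?_
  have hE := one_le_phaseExpBound hu.le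
  have hg := one_le_phaseGrowth hu.le
  have := h.norm_exp_le δ hδ hδ' u hu y hy
  nlinarith

theorem IsLogPhase.measurable_phaseRate (h : IsLogPhase L S Y) (δ κ y : ℝ) :
    Measurable (phaseRate L S δ κ y) := by
  have h1 := h.measurable y
  have h2 := h.measurable_slope y
  unfold phaseRate
  fun_prop

theorem IsLogPhase.integrableOn_rate (h : IsLogPhase L S Y) (n : ℕ) (hδ : 0 ≤ δ)
    (hδ' : δ ≤ 1 / 4) (hκ : |κ| ≤ 3) (hy : y ∈ Y) :
    IntegrableOn (fun u : ℝ => ((Real.exp (-u) * u ^ n : ℝ) : ℂ) * phaseRate L S δ κ y u)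
      (Ioi 0) :=
  integrableOn_exp_mul_pow (h.measurable_phaseRate _ _ _) _ fun _ hu =>
    h.norm_phaseRate_le hδ hδ' hκ hu hy

/-- Without the phase the moment is Γ(n + 1) = n!. The factor e^(−δL) − 1 is linear in δL, so the
deviation is of order δ log y with a constant that does not depend on δ or y. -/
theorem IsLogPhase.norm_expMoment_sub_le (h : IsLogPhase L S Y) {n : ℕ} (hn : n < 3) (hδ : 0 ≤ δ)
    (hδ' : δ ≤ 1 / 4) (hy : y ∈ Y) :
    ‖expMoment L n δ y - (n.factorial : ℂ)‖ ≤ phaseConst * (δ * logGrowth y) := by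
  have hl := one_le_logGrowth (h.pos y hy).le
  have h1 : (n.factorial : ℂ) = ∫ u in Ioi (0 : ℝ), ((Real.exp (-u) * u ^ n : ℝ) : ℂ) := by
    rw [integral_complex_ofReal]
    have := Real.Gamma_nat_eq_factorial n
    rw [Real.Gamma_eq_integral (by positivity)] at this
    simp only [add_sub_cancel_right, Real.rpow_natCast] at this
    rw [this]
    norm_cast
  have h2 : IntegrableOn (fun u : ℝ => ((Real.exp (-u) * u ^ n : ℝ) : ℂ)) (Ioi 0) := by
    have := integrableOn_exp_mul_pow (n := n) (w := fun _ => 1) measurable_const 1 fun u hu => by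
      have hE := one_le_phaseExpBound hu.le
      have hg := one_le_phaseGrowth hu.le
      rw [norm_one]
      nlinarith
    simpa using this
  rw [h1, expMoment, ← integral_sub (h.integrableOn n hδ hδ' hy) h2]
  simp only [← mul_sub_one]
  refine norm_integral_exp_mul_pow_le hn (by positivity) fun u hu => ?_
  have hE := one_le_phaseExpBound hu.le
  have hg := one_le_phaseGrowth hu.le
  refine (h.norm_exp_sub_one_le hδ hδ' hu hy).trans ?_
  have : 0 ≤ δ * logGrowth y * (phaseExpBound u * phaseGrowth u) := by positivity
  nlinarith

theorem IsLogPhase.norm_expMomentRate_le (h : IsLogPhase L S Y) {n : ℕ} (hn : n < 3) (hδ : 0 ≤ δ)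
    (hδ' : δ ≤ 1 / 4) (hκ : |κ| ≤ 3) (hy : y ∈ Y) :
    ‖expMomentRate L S n δ κ y‖ ≤ phaseConst * (δ * logGrowth y) := by
  have hl := one_le_logGrowth (h.pos y hy).le
  refine norm_integral_exp_mul_pow_le hn (by positivity) fun u hu => ?_
  have hE := one_le_phaseExpBound hu.le
  have hg := one_le_phaseGrowth hu.le
  refine (h.norm_phaseRate_le hδ hδ' hκ hu hy).trans ?_
  have : 0 ≤ δ * logGrowth y * (phaseExpBound u * phaseGrowth u) := by positivity
  nlinarith

end

/-- A path in the space of parameters, on the open set `s` of Hubble rates: `δ = 3/2 - ν` has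
the logarithmic derivative `-κ` and `δH² ≤ M`. -/
structure IsLightPath (δ κ : ℝ → ℝ) (M : ℝ) (s : Set ℝ) : Prop where
  isOpen : IsOpen s
  one_lt : ∀ H ∈ s, 1 < H
  pos : ∀ H ∈ s, 0 < δ H
  le : ∀ H ∈ s, δ H ≤ 1 / 4
  abs_le : ∀ H ∈ s, |κ H| ≤ 3
  mul_sq_le : ∀ H ∈ s, δ H * H ^ 2 ≤ M
  hasDerivAt : ∀ H ∈ s, HasDerivAt δ (-(κ H * δ H) / H) H

theorem IsLogPhase.hasDerivAt_expMoment {L S : ℝ → ℝ → ℂ} {Y : Set ℝ} (h : IsLogPhase L S Y)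
    (n : ℕ) {δ κ : ℝ → ℝ} {M : ℝ} {s : Set ℝ} (hp : IsLightPath δ κ M s) {k : ℝ} (hk : 0 < k)
    {H : ℝ} (hH : H ∈ s) (hHY : H / k ∈ Y) :
    HasDerivAt (fun H => expMoment L n (δ H) (H / k))
      (expMomentRate L S n (δ H) (κ H) (H / k) / H) H := by
  have hH1 := hp.one_lt H hH
  -- The cap at 2H bounds `logGrowth (H' / k)` by a constant, which makes the dominating function
  -- independent of H'.
  set t : Set ℝ := s ∩ Iio (2 * H) ∩ (fun H => H / k) ⁻¹' Y with ht
  have hto : IsOpen t := (hp.isOpen.inter isOpen_Iio).inter (h.isOpen.preimage (by fun_prop))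
  have htH : t ∈ 𝓝 H := hto.mem_nhds ⟨⟨hH, by simp only [mem_Iio]; linarith⟩, hHY⟩
  have hmeas : ∀ (δ y : ℝ), Measurable fun u : ℝ => ((Real.exp (-u) * u ^ n : ℝ) : ℂ)
      * Complex.exp (-(δ * L u y)) := by
    intro δ y
    have := h.measurable y
    fun_prop
  have hl := one_le_logGrowth (show 0 ≤ 2 * H / k by positivity)
  have key := hasDerivAt_integral_of_dominated_loc_of_deriv_le (μ := volume.restrict (Ioi 0))
    (F := fun H u => ((Real.exp (-u) * u ^ n : ℝ) : ℂ) * Complex.exp (-(δ H * L u (H / k))))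
    (F' := fun H u => ((Real.exp (-u) * u ^ n : ℝ) : ℂ)
      * (phaseRate L S (δ H) (κ H) (H / k) u / H))
    (x₀ := H) (bound := fun u => 7 * (1 / 4) * logGrowth (2 * H / k) * phaseWeight n u) htH ?_
    (h.integrableOn n (hp.pos H hH).le (hp.le H hH) hHY) ?_ ?_
    ((integrableOn_phaseWeight n).const_mul _) ?_
  · refine key.2.congr_deriv ?_
    rw [expMomentRate, ← integral_div]
    refine integral_congr_ae (Eventually.of_forall fun u => ?_)
    simp only
    ring
  · exact Eventually.of_forall fun H => (hmeas _ _).aestronglyMeasurable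
  · have := h.measurable_phaseRate (δ H) (κ H) (H / k)
    exact Measurable.aestronglyMeasurable (by fun_prop)
  · filter_upwards [ae_restrict_mem measurableSet_Ioi] with u hu H' hH'
    have hH1' := hp.one_lt H' hH'.1.1
    refine norm_exp_mul_pow_le hu ?_
    have hE := one_le_phaseExpBound (le_of_lt (show (0 : ℝ) < u from hu))
    have hg := one_le_phaseGrowth (le_of_lt (show (0 : ℝ) < u from hu))
    rw [norm_div, Complex.norm_real, Real.norm_eq_abs, abs_of_pos (by linarith)]
    refine (div_le_self (norm_nonneg _) hH1'.le).trans ?_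
    refine (h.norm_phaseRate_le (hp.pos H' hH'.1.1).le (hp.le H' hH'.1.1) (hp.abs_le H' hH'.1.1) hu
      hH'.2).trans ?_
    have h1 : logGrowth (H' / k) ≤ logGrowth (2 * H / k) := by
      refine logGrowth_mono (by positivity) ?_
      have := hH'.1.2
      simp only [mem_Iio] at this
      gcongr
    have h2 := hp.le H' hH'.1.1
    have h3 := (hp.pos H' hH'.1.1).le
    have h4 := one_le_logGrowth (show 0 ≤ H' / k by positivity)
    gcongr
  · filter_upwards [ae_restrict_mem measurableSet_Ioi] with u hu H' hH'
    have hH1' := hp.one_lt H' hH'.1.1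
    have hd := (hp.hasDerivAt H' hH'.1.1).ofReal_comp
    have hy : HasDerivAt (fun H : ℝ => H / k) (1 / k) H' := (hasDerivAt_id H').div_const k
    have hL := HasDerivAt.scomp H' (h.hasDerivAt u hu (H' / k) hH'.2) hy
    have := ((((hd.mul hL).neg).cexp).const_mul ((Real.exp (-u) * u ^ n : ℝ) : ℂ))
    refine this.congr_deriv ?_
    simp only [Function.comp_apply, Pi.mul_apply, Pi.neg_apply, phaseRate, Complex.real_smul]
    have h1 : (H' : ℂ) ≠ 0 := by exact_mod_cast (by linarith : H' ≠ 0)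
    have h2 : (k : ℂ) ≠ 0 := by exact_mod_cast hk.ne'
    push_cast
    field_simp
    ring

/-! ## Estimates for the amplitudes of the modes -/

/-- The logarithmic derivative of `laplacePhase u y` in `y`. -/
def laplaceSlope (u y : ℝ) : ℂ := ((u * y / 2 : ℝ) : ℂ) / laplaceBase (u * y) 1

/-- The leading part `log (u² y / 2)` of `laplacePhase u y` for large `u y`. -/
def leadingPhase (u y : ℝ) : ℂ := ((Real.log u + Real.log (u * y / 2) : ℝ) : ℂ)

theorem abs_log_le {u : ℝ} (hu : 0 < u) : |Real.log u| ≤ 4 * u ^ (-(1 / 4) : ℝ) + u := by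
  have h1 := Real.log_le_sub_one_of_pos hu
  have h2 := Real.log_le_sub_one_of_pos (Real.rpow_pos_of_pos hu (-(1 / 4)))
  rw [Real.log_rpow hu] at h2
  have h3 := Real.rpow_pos_of_pos hu (-(1 / 4))
  rw [abs_le]
  constructor <;> linarith

theorem log_one_add_mul_le {u y : ℝ} (hu : 0 < u) (hy : 0 < y) :
    Real.log (1 + u * y) ≤ u + Real.log (1 + y) := by
  have h1 : Real.log (1 + u * y) ≤ Real.log ((1 + u) * (1 + y)) :=
    Real.log_le_log (by positivity) (by nlinarith)
  rw [Real.log_mul (by positivity) (by positivity)] at h1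
  have := Real.log_le_sub_one_of_pos (show 0 < 1 + u by linarith)
  linarith

theorem rpow_neg_le_phaseExpBound {u s : ℝ} (hu : 0 < u) (hs : 0 ≤ s) (hs' : s ≤ 1 / 2) :
    2 * u ^ (-s) ≤ phaseExpBound u := by
  rw [phaseExpBound]
  have h := Real.rpow_pos_of_pos hu (-(1 / 2))
  rcases le_total 1 u with h1 | h1
  · have := Real.rpow_le_one_of_one_le_of_nonpos h1 (show -s ≤ 0 by linarith)
    linarith
  · have := Real.rpow_le_rpow_of_exponent_ge hu h1 (show -(1 / 2) ≤ -s by linarith)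
    linarith

theorem norm_exp_neg_laplacePhase (δ : ℝ) {u : ℝ} (hu : 0 < u) (y : ℝ) :
    ‖Complex.exp (-((δ : ℝ) * laplacePhase u y))‖
      = u ^ (-δ) * ‖laplaceBase (u * y) 1‖ ^ (-δ) := by
  have h0 : 0 < ‖laplaceBase (u * y) 1‖ := norm_pos_iff.2 (laplaceBase_ne_zero _ one_pos)
  rw [Complex.norm_exp, laplacePhase, Real.rpow_def_of_pos hu, Real.rpow_def_of_pos h0,
    ← Real.exp_add]
  simp only [Complex.neg_re, Complex.re_ofReal_mul, Complex.add_re, Complex.ofReal_re,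
    Complex.log_re]
  congr 1
  ring

theorem isLogPhase_laplacePhase : IsLogPhase laplacePhase laplaceSlope (Ioi 0) where
  isOpen := isOpen_Ioi
  pos _ hy := hy
  measurable y := by
    unfold laplacePhase laplaceBase
    fun_prop
  measurable_slope y := by
    unfold laplaceSlope laplaceBase
    fun_prop
  hasDerivAt u hu y hy := by
    have hy' : (0 : ℝ) < y := hy
    have h1 : HasDerivAt (fun y : ℝ => laplaceBase (u * y) 1) ((u / 2 : ℝ) : ℂ) y := by
      have := (((hasDerivAt_id y).const_mul u).div_const 2).ofReal_comp.sub_const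
        (Complex.I * ((1 : ℝ) : ℂ))
      simpa [laplaceBase] using this
    have h2 := (h1.clog_real (laplaceBase_mem_slitPlane _ one_pos)).const_add (Real.log u : ℂ)
    refine h2.congr_deriv ?_
    have h3 : laplaceBase (u * y) 1 ≠ 0 := laplaceBase_ne_zero _ one_pos
    have h4 : (y : ℂ) ≠ 0 := by exact_mod_cast hy'.ne'
    rw [laplaceSlope]
    push_cast
    field_simp
  norm_exp_le δ hδ hδ' u hu y hy := by
    rw [norm_exp_neg_laplacePhase δ hu]
    have h1 := rpow_neg_le_phaseExpBound hu hδ (by linarith)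
    have h2 := Real.rpow_le_one_of_one_le_of_nonpos
      (le_norm_laplaceBase (u * y) one_pos) (show -δ ≤ 0 by linarith)
    have h3 := Real.rpow_pos_of_pos hu (-δ)
    nlinarith
  norm_le u hu y hy := by
    have hy' : (0 : ℝ) < y := hy
    have h0 := le_norm_laplaceBase (u * y) one_pos
    have h1 : ‖Complex.log (laplaceBase (u * y) 1)‖ ≤ Real.log (1 + u * y) + 4 := by
      refine (Complex.norm_le_abs_re_add_abs_im _).trans ?_
      rw [Complex.log_re, Complex.log_im, abs_of_nonneg (Real.log_nonneg h0)]
      have h2 := (Complex.abs_arg_le_pi (laplaceBase (u * y) 1)).trans Real.pi_le_four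
      have h3 : Real.log ‖laplaceBase (u * y) 1‖ ≤ Real.log (1 + u * y) := by
        refine Real.log_le_log (by linarith) ?_
        refine (norm_laplaceBase_le (by positivity) zero_le_one).trans ?_
        have : 0 < u * y := by positivity
        linarith
      linarith
    have h4 : ‖laplacePhase u y‖ ≤ |Real.log u| + (Real.log (1 + u * y) + 4) := by
      refine (norm_add_le _ _).trans ?_
      rw [Complex.norm_real, Real.norm_eq_abs]
      gcongr
    have h5 := abs_log_le hu
    have h6 := log_one_add_mul_le hu hy'
    have h7 := one_le_logGrowth hy'.le
    have h8 := one_le_phaseGrowth hu.le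
    have h9 := Real.rpow_pos_of_pos hu (-(1 / 4))
    rw [phaseGrowth] at h8 ⊢
    have h10 : Real.log (1 + y) = logGrowth y - 1 := by rw [logGrowth]; ring
    nlinarith
  norm_slope_le u hu y hy := by
    have hy' : (0 : ℝ) < y := hy
    have h0 := half_le_norm_laplaceBase (u * y) 1
    rw [laplaceSlope, norm_div, Complex.norm_real, Real.norm_eq_abs, abs_of_pos (by positivity)]
    exact div_le_one_of_le₀ h0 (norm_nonneg _)

theorem exp_neg_leadingPhase (δ : ℝ) {u y : ℝ} (hu : 0 < u) (hy : 0 < y) :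
    Complex.exp (-((δ : ℝ) * leadingPhase u y)) = ((u ^ (-δ) * (u * y / 2) ^ (-δ) : ℝ) : ℂ) := by
  rw [leadingPhase, Real.rpow_def_of_pos hu, Real.rpow_def_of_pos (by positivity),
    ← Real.exp_add]
  push_cast
  congr 1
  ring

theorem isLogPhase_leadingPhase : IsLogPhase leadingPhase (fun _ _ => 1) (Ioi 1) where
  isOpen := isOpen_Ioi
  pos _ hy := zero_lt_one.trans hy
  measurable y := by
    unfold leadingPhase
    fun_prop
  measurable_slope y := measurable_const
  hasDerivAt u hu y hy := by
    have hy' : (0 : ℝ) < y := zero_lt_one.trans hy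
    have h1 : HasDerivAt (fun y : ℝ => Real.log u + Real.log (u * y / 2)) (1 / y) y := by
      have := ((((hasDerivAt_id y).const_mul u).div_const 2).log
        (by simp only [id]; positivity)).const_add (Real.log u)
      refine this.congr_deriv ?_
      simp only [id]
      field_simp
    refine h1.ofReal_comp.congr_deriv ?_
    push_cast
    rfl
  norm_exp_le δ hδ hδ' u hu y hy := by
    have hy' : (1 : ℝ) < y := hy
    rw [exp_neg_leadingPhase δ hu (by linarith), Complex.norm_real, Real.norm_eq_abs,
      abs_of_nonneg (by positivity)]
    have h1 : u ^ (-δ) * (u * y / 2) ^ (-δ) = u ^ (-(2 * δ)) * (y / 2) ^ (-δ) := by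
      rw [mul_div_assoc, Real.mul_rpow hu.le (by positivity), ← mul_assoc, ← Real.rpow_add hu]
      congr 2
      ring
    have h2 : (y / 2) ^ (-δ) ≤ 2 := by
      calc (y / 2) ^ (-δ) ≤ (1 / 2 : ℝ) ^ (-δ) :=
            Real.rpow_le_rpow_of_nonpos (by norm_num) (by linarith) (by linarith)
        _ = 2 ^ δ := by
            rw [one_div, Real.inv_rpow zero_le_two, Real.rpow_neg zero_le_two, inv_inv]
        _ ≤ 2 ^ (1 : ℝ) := Real.rpow_le_rpow_of_exponent_le one_le_two (by linarith)
        _ = 2 := Real.rpow_one 2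
    rw [h1]
    have h3 := rpow_neg_le_phaseExpBound hu (show 0 ≤ 2 * δ by linarith) (by linarith)
    have h4 := Real.rpow_pos_of_pos hu (-(2 * δ))
    nlinarith
  norm_le u hu y hy := by
    have hy' : (1 : ℝ) < y := hy
    have hl : Real.log (u * y / 2) = Real.log u + (Real.log y - Real.log 2) := by
      rw [mul_div_assoc, Real.log_mul hu.ne' (by positivity),
        Real.log_div (by positivity) two_ne_zero]
    have h1 := abs_log_le hu
    have h2 : |Real.log y - Real.log 2| ≤ logGrowth y := by
      have := Real.log_pos hy'
      have h2 := Real.log_pos one_lt_two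
      have h3 := Real.log_two_lt_d9
      have h4 : Real.log y ≤ Real.log (1 + y) := Real.log_le_log (by linarith) (by linarith)
      rw [logGrowth, abs_le]
      constructor <;> linarith
    have h3 := one_le_logGrowth (show 0 ≤ y by linarith)
    have h9 := Real.rpow_pos_of_pos hu (-(1 / 4))
    rw [leadingPhase, Complex.norm_real, Real.norm_eq_abs, hl, phaseGrowth]
    have h4 : |Real.log u + (Real.log u + (Real.log y - Real.log 2))|
        ≤ |Real.log u| + (|Real.log u| + |Real.log y - Real.log 2|) :=
      (abs_add_le _ _).trans (by gcongr; exact abs_add_le _ _)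
    nlinarith
  norm_slope_le u hu y hy := by simp

/-! ### Comparison of the exact phase with its leading part -/

theorem norm_log_laplaceBase_sub_le {v : ℝ} (hv : 0 < v) :
    ‖Complex.log (laplaceBase v 1) - (Real.log (v / 2) : ℂ)‖ ≤ 2 / v := by
  have hb : ∀ w : ℂ, w ∈ {w : ℂ | v / 2 ≤ w.re} → v / 2 ≤ ‖w‖ := fun w hw =>
    (show v / 2 ≤ w.re from hw).trans (Complex.re_le_norm w)
  have h := Convex.norm_image_sub_le_of_norm_hasDerivWithin_le (s := {w : ℂ | v / 2 ≤ w.re})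
    (f := Complex.log) (f' := fun w => w⁻¹) (C := 2 / v) (x := ((v / 2 : ℝ) : ℂ))
    (y := laplaceBase v 1) (fun w hw => (Complex.hasDerivAt_log (Or.inl (lt_of_lt_of_le
      (by positivity) (show v / 2 ≤ w.re from hw)))).hasDerivWithinAt) (fun w hw => by
        rw [norm_inv, ← inv_div]
        exact inv_anti₀ (by positivity) (hb w hw)) (convex_halfSpace_re_ge _) (by simp) (by simp)
  rw [← Complex.ofReal_log (by positivity)] at h
  refine h.trans_eq ?_
  simp [laplaceBase]

section

variable {δ κ u y : ℝ}

theorem norm_laplacePhase_sub_le (hu : 0 < u) (hy : 0 < y) :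
    ‖laplacePhase u y - leadingPhase u y‖ ≤ 2 / (u * y) := by
  refine le_trans (le_of_eq ?_) (norm_log_laplaceBase_sub_le (mul_pos hu hy))
  rw [laplacePhase, leadingPhase]
  congr 1
  push_cast
  ring

theorem norm_laplaceSlope_sub_one_le (hu : 0 < u) (hy : 0 < y) :
    ‖laplaceSlope u y - 1‖ ≤ 2 / (u * y) := by
  have h1 : laplaceBase (u * y) 1 ≠ 0 := laplaceBase_ne_zero _ one_pos
  have h2 : laplaceSlope u y - 1 = Complex.I / laplaceBase (u * y) 1 := by
    rw [laplaceSlope]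
    field_simp
    rw [laplaceBase]
    push_cast
    ring
  rw [h2, norm_div, Complex.norm_I, one_div, ← inv_div]
  exact inv_anti₀ (by positivity) (half_le_norm_laplaceBase _ _)

theorem norm_exp_laplacePhase_sub_le (hδ : 0 ≤ δ) (hδ' : δ ≤ 1 / 4) (hu : 0 < u) (hy : 1 < y) :
    ‖Complex.exp (-(δ * laplacePhase u y)) - Complex.exp (-(δ * leadingPhase u y))‖
      ≤ 2 * δ / (u * y) * phaseExpBound u := by
  have hE := one_le_phaseExpBound hu.le
  have h1 := norm_exp_sub_exp_le (by linarith)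
    (isLogPhase_laplacePhase.norm_exp_le δ hδ hδ' u hu y (zero_lt_one.trans hy))
    (isLogPhase_leadingPhase.norm_exp_le δ hδ hδ' u hu y hy)
  rw [neg_sub_neg, ← mul_sub, norm_mul, norm_sub_rev (leadingPhase u y),
    Complex.norm_real, Real.norm_eq_abs,
    abs_of_nonneg hδ] at h1
  refine h1.trans ?_
  have h2 := norm_laplacePhase_sub_le hu (zero_lt_one.trans hy)
  calc _ ≤ phaseExpBound u * (δ * (2 / (u * y))) := by gcongr
    _ = _ := by ring

/-- Telescoping: the difference of the coefficients times the exact exponential, plus the leading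
coefficient times the difference of the exponentials. Each part contains a factor 1/(uy). The 1/u is
affordable because the estimate is used under a second moment. -/
theorem norm_phaseRate_sub_le (hδ : 0 ≤ δ) (hδ' : δ ≤ 1 / 4) (hκ : |κ| ≤ 3) (hu : 0 < u)
    (hy : 1 < y) :
    ‖phaseRate laplacePhase laplaceSlope δ κ y u - phaseRate leadingPhase (fun _ _ => 1) δ κ y u‖
      ≤ 8 * (logGrowth y / y) * (phaseExpBound u * phaseGrowth u) / u := by
  have hy0 : 0 < y := zero_lt_one.trans hy
  have hE := one_le_phaseExpBound hu.le
  have hg := one_le_phaseGrowth hu.le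
  have hl := one_le_logGrowth hy0.le
  have hlg : 1 ≤ phaseGrowth u * logGrowth y := by nlinarith
  have h1 := norm_laplacePhase_sub_le hu hy0
  have h2 := norm_laplaceSlope_sub_one_le hu hy0
  have h3 := norm_exp_laplacePhase_sub_le hδ hδ' hu hy
  have h4 := isLogPhase_laplacePhase.norm_exp_le δ hδ hδ' u hu y hy0
  have h5 := isLogPhase_leadingPhase.norm_le u hu y hy
  set e := Complex.exp (-(δ * laplacePhase u y))
  set e₀ := Complex.exp (-(δ * leadingPhase u y))
  have h6 : phaseRate laplacePhase laplaceSlope δ κ y u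
      - phaseRate leadingPhase (fun _ _ => 1) δ κ y u
      = δ * ((κ * (laplacePhase u y - leadingPhase u y) - (laplaceSlope u y - 1)) * e)
        + δ * ((κ * leadingPhase u y - 1) * (e - e₀)) := by
    simp only [phaseRate]
    ring
  have h7 : ‖(κ : ℂ) * (laplacePhase u y - leadingPhase u y) - (laplaceSlope u y - 1)‖
      ≤ 8 / (u * y) := by
    refine (norm_sub_le _ _).trans ?_
    rw [norm_mul, Complex.norm_real, Real.norm_eq_abs]
    calc _ ≤ 3 * (2 / (u * y)) + 2 / (u * y) := by gcongr
      _ = _ := by ring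
  have h8 : ‖(κ : ℂ) * leadingPhase u y - 1‖ ≤ 7 * (phaseGrowth u * logGrowth y) := by
    refine (norm_sub_le _ _).trans ?_
    rw [norm_mul, Complex.norm_real, Real.norm_eq_abs, norm_one]
    calc _ ≤ 3 * (2 * (phaseGrowth u * logGrowth y)) + phaseGrowth u * logGrowth y := by gcongr
      _ = _ := by ring
  have h9 : 0 ≤ logGrowth y / y * (phaseExpBound u * phaseGrowth u) / u := by positivity
  have h10 : phaseExpBound u / (u * y) ≤ logGrowth y / y * (phaseExpBound u * phaseGrowth u) / u := by
    rw [show logGrowth y / y * (phaseExpBound u * phaseGrowth u) / u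
      = phaseExpBound u * (phaseGrowth u * logGrowth y) / (u * y) by field_simp]
    gcongr
    nlinarith
  have h11 : 0 ≤ phaseExpBound u / (u * y) := by positivity
  rw [h6]
  refine (norm_add_le _ _).trans ?_
  rw [norm_mul, norm_mul, norm_mul, norm_mul, Complex.norm_real, Real.norm_eq_abs,
    abs_of_nonneg hδ]
  calc _ ≤ δ * (8 / (u * y) * phaseExpBound u)
        + δ * (7 * (phaseGrowth u * logGrowth y) * (2 * δ / (u * y) * phaseExpBound u)) := by
        gcongr
    _ = 8 * δ * (phaseExpBound u / (u * y))
        + 14 * δ ^ 2 * (logGrowth y / y * (phaseExpBound u * phaseGrowth u) / u) := by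
        field_simp
        ring
    _ ≤ 8 * (1 / 4) * (logGrowth y / y * (phaseExpBound u * phaseGrowth u) / u)
        + 14 * (1 / 4) ^ 2 * (logGrowth y / y * (phaseExpBound u * phaseGrowth u) / u) := by
        gcongr
    _ ≤ 8 * (logGrowth y / y * (phaseExpBound u * phaseGrowth u) / u) := by linarith
    _ = _ := by ring

end

/-- The derivative of `fieldAmplitude` along a path of parameters. -/
def fieldRate (δ κ y : ℝ) : ℂ :=
  expMomentRate laplacePhase laplaceSlope 2 δ κ y / 2
    - Complex.I * ((y⁻¹ : ℝ) : ℂ) * (expMomentRate laplacePhase laplaceSlope 1 δ κ y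
      - expMoment laplacePhase 1 δ y)

/-- The derivative of `momentumAmplitude` along a path of parameters. -/
def momentumRate (δ κ y : ℝ) : ℂ :=
  κ * δ * expMoment laplacePhase 0 δ y
    + (1 - δ) * expMomentRate laplacePhase laplaceSlope 0 δ κ y

/-- The amplitude of the field modes of long wave length. -/
def leadingAmplitude (δ y : ℝ) : ℂ := expMoment leadingPhase 2 δ y / 2

/-- The derivative of `leadingAmplitude` along a path of parameters. -/
def leadingRate (δ κ y : ℝ) : ℂ := expMomentRate leadingPhase (fun _ _ => 1) 2 δ κ y / 2

/-- The constant in the estimates of the amplitudes. -/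
def amplitudeConst : ℝ := 4 * (phaseConst + 1)

theorem amplitudeConst_pos : 0 < amplitudeConst := by
  have := phaseConst_nonneg
  rw [amplitudeConst]
  linarith

section

variable {δ κ y : ℝ}

theorem norm_expMoment_laplacePhase_le {n : ℕ} (hn : n < 3) (hδ : 0 ≤ δ) (hδ' : δ ≤ 1 / 4)
    (hy : 0 < y) : ‖expMoment laplacePhase n δ y‖ ≤ phaseConst := by
  refine (norm_integral_exp_mul_pow_le hn zero_le_one fun u hu => ?_).trans_eq (mul_one _)
  have hE := one_le_phaseExpBound hu.le
  have hg := one_le_phaseGrowth hu.le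
  refine (isLogPhase_laplacePhase.norm_exp_le δ hδ hδ' u hu y hy).trans ?_
  nlinarith

theorem norm_momentumAmplitude_sub_le (hδ : 0 ≤ δ) (hδ' : δ ≤ 1 / 4) (hy : 0 < y) :
    ‖momentumAmplitude δ y - 1‖ ≤ amplitudeConst * (δ * logGrowth y) := by
  have h1 := isLogPhase_laplacePhase.norm_expMoment_sub_le (n := 0) (by norm_num) hδ hδ' hy
  have hl := one_le_logGrowth hy.le
  have hp := phaseConst_nonneg
  have h2 : momentumAmplitude δ y - 1
      = ((1 - δ : ℝ) : ℂ) * (expMoment laplacePhase 0 δ y - (Nat.factorial 0 : ℂ)) - (δ : ℂ) := by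
    rw [momentumAmplitude, phaseMoment, expMoment, Nat.factorial_zero]
    push_cast
    ring
  rw [h2]
  refine (norm_sub_le _ _).trans ?_
  rw [norm_mul, Complex.norm_real, Complex.norm_real, Real.norm_eq_abs, Real.norm_eq_abs,
    abs_of_nonneg hδ, abs_of_nonneg (by linarith), amplitudeConst]
  have h3 : 0 ≤ phaseConst * (δ * logGrowth y) := by positivity
  have h4 : 0 ≤ δ * logGrowth y := by positivity
  have h5 : δ ≤ δ * logGrowth y := by nlinarith
  have h6 : (1 - δ) * ‖expMoment laplacePhase 0 δ y - (Nat.factorial 0 : ℂ)‖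
      ≤ 1 * (phaseConst * (δ * logGrowth y)) := by
    gcongr
    linarith
  nlinarith

theorem norm_momentumRate_le (hδ : 0 ≤ δ) (hδ' : δ ≤ 1 / 4) (hκ : |κ| ≤ 3) (hy : 0 < y) :
    ‖momentumRate δ κ y‖ ≤ amplitudeConst * (δ * logGrowth y) := by
  have h1 := isLogPhase_laplacePhase.norm_expMomentRate_le (n := 0) (by norm_num) hδ hδ' hκ hy
  have h2 := norm_expMoment_laplacePhase_le (n := 0) (by norm_num) hδ hδ' hy
  have hl := one_le_logGrowth hy.le
  have hp := phaseConst_nonneg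
  have h3 : ‖(1 - δ : ℂ)‖ ≤ 1 := by
    rw [show (1 - δ : ℂ) = ((1 - δ : ℝ) : ℂ) by push_cast; ring, Complex.norm_real,
      Real.norm_eq_abs, abs_of_nonneg (by linarith)]
    linarith
  rw [momentumRate]
  refine (norm_add_le _ _).trans ?_
  rw [norm_mul, norm_mul, norm_mul, Complex.norm_real, Complex.norm_real, Real.norm_eq_abs,
    Real.norm_eq_abs, abs_of_nonneg hδ, amplitudeConst]
  have h4 : 0 ≤ δ * logGrowth y := by positivity
  have h5 : δ * phaseConst ≤ δ * logGrowth y * phaseConst := by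
    gcongr
    nlinarith
  calc _ ≤ 3 * δ * phaseConst + 1 * (phaseConst * (δ * logGrowth y)) := by gcongr
    _ ≤ _ := by nlinarith

theorem norm_fieldAmplitude_sub_le (hδ : 0 ≤ δ) (hδ' : δ ≤ 1 / 4) (hy : 0 < y) :
    ‖fieldAmplitude δ y - (1 - Complex.I * ((y⁻¹ : ℝ) : ℂ))‖
      ≤ amplitudeConst * ((1 + y⁻¹) * (δ * logGrowth y)) := by
  have h1 := isLogPhase_laplacePhase.norm_expMoment_sub_le (n := 1) (by norm_num) hδ hδ' hy
  have h2 := isLogPhase_laplacePhase.norm_expMoment_sub_le (n := 2) (by norm_num) hδ hδ' hy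
  have hl := one_le_logGrowth hy.le
  have hp := phaseConst_nonneg
  have h3 : fieldAmplitude δ y - (1 - Complex.I * ((y⁻¹ : ℝ) : ℂ))
      = (expMoment laplacePhase 2 δ y - (Nat.factorial 2 : ℂ)) / 2
        - Complex.I * ((y⁻¹ : ℝ) : ℂ) * (expMoment laplacePhase 1 δ y - (Nat.factorial 1 : ℂ)) := by
    rw [fieldAmplitude, phaseMoment, phaseMoment, expMoment, expMoment]
    simp only [Nat.factorial_one, Nat.factorial_two]
    push_cast
    ring
  rw [h3]
  refine (norm_sub_le _ _).trans ?_
  rw [norm_div, norm_mul, norm_mul, Complex.norm_I, Complex.norm_real, Real.norm_eq_abs,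
    abs_of_pos (by positivity), one_mul, Complex.norm_ofNat, amplitudeConst]
  have h4 : 0 ≤ (1 + y⁻¹) * (δ * logGrowth y) := by positivity
  have h5 : 0 ≤ δ * logGrowth y := by positivity
  calc _ ≤ phaseConst * (δ * logGrowth y) + y⁻¹ * (phaseConst * (δ * logGrowth y)) := by
        gcongr
        refine (div_le_self (norm_nonneg _) one_le_two).trans h2
    _ = phaseConst * ((1 + y⁻¹) * (δ * logGrowth y)) := by ring
    _ ≤ _ := by nlinarith

theorem norm_fieldRate_sub_le (hδ : 0 ≤ δ) (hδ' : δ ≤ 1 / 4) (hκ : |κ| ≤ 3) (hy : 0 < y) :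
    ‖fieldRate δ κ y - Complex.I * ((y⁻¹ : ℝ) : ℂ)‖
      ≤ amplitudeConst * ((1 + y⁻¹) * (δ * logGrowth y)) := by
  have h1 := isLogPhase_laplacePhase.norm_expMoment_sub_le (n := 1) (by norm_num) hδ hδ' hy
  have h2 := isLogPhase_laplacePhase.norm_expMomentRate_le (n := 1) (by norm_num) hδ hδ' hκ hy
  have h3 := isLogPhase_laplacePhase.norm_expMomentRate_le (n := 2) (by norm_num) hδ hδ' hκ hy
  have hl := one_le_logGrowth hy.le
  have hp := phaseConst_nonneg
  have h4 : fieldRate δ κ y - Complex.I * ((y⁻¹ : ℝ) : ℂ)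
      = expMomentRate laplacePhase laplaceSlope 2 δ κ y / 2
        - Complex.I * ((y⁻¹ : ℝ) : ℂ) * (expMomentRate laplacePhase laplaceSlope 1 δ κ y
          - (expMoment laplacePhase 1 δ y - (Nat.factorial 1 : ℂ))) := by
    rw [fieldRate, Nat.factorial_one]
    push_cast
    ring
  rw [h4]
  refine (norm_sub_le _ _).trans ?_
  rw [norm_div, norm_mul, norm_mul, Complex.norm_I, Complex.norm_real, Real.norm_eq_abs,
    abs_of_pos (by positivity), one_mul, Complex.norm_ofNat, amplitudeConst]
  have h5 : 0 ≤ (1 + y⁻¹) * (δ * logGrowth y) := by positivity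
  have h6 : 0 ≤ δ * logGrowth y := by positivity
  calc _ ≤ 2 * (phaseConst * (δ * logGrowth y)) + y⁻¹ * (phaseConst * (δ * logGrowth y)
          + phaseConst * (δ * logGrowth y)) := by
        gcongr
        · refine (div_le_self (norm_nonneg _) one_le_two).trans (h3.trans ?_)
          have : 0 ≤ phaseConst * (δ * logGrowth y) := by positivity
          linarith
        · exact (norm_sub_le _ _).trans (add_le_add h2 h1)
    _ = 2 * phaseConst * ((1 + y⁻¹) * (δ * logGrowth y)) := by ring
    _ ≤ _ := by nlinarith

theorem norm_leadingAmplitude_sub_le (hδ : 0 ≤ δ) (hδ' : δ ≤ 1 / 4) (hy : 1 < y) :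
    ‖leadingAmplitude δ y - 1‖ ≤ amplitudeConst * (δ * logGrowth y) := by
  have h1 := isLogPhase_leadingPhase.norm_expMoment_sub_le (n := 2) (by norm_num) hδ hδ' hy
  have hl := one_le_logGrowth (zero_lt_one.trans hy).le
  have hp := phaseConst_nonneg
  have h4 : leadingAmplitude δ y - 1
      = (expMoment leadingPhase 2 δ y - (Nat.factorial 2 : ℂ)) / 2 := by
    rw [leadingAmplitude, Nat.factorial_two]
    push_cast
    ring
  rw [h4, norm_div, Complex.norm_ofNat, amplitudeConst]
  have h5 : 0 ≤ δ * logGrowth y := by positivity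
  refine (div_le_self (norm_nonneg _) one_le_two).trans (h1.trans ?_)
  gcongr
  linarith

theorem norm_leadingRate_le (hδ : 0 ≤ δ) (hδ' : δ ≤ 1 / 4) (hκ : |κ| ≤ 3) (hy : 1 < y) :
    ‖leadingRate δ κ y‖ ≤ amplitudeConst * (δ * logGrowth y) := by
  have h1 := isLogPhase_leadingPhase.norm_expMomentRate_le (n := 2) (by norm_num) hδ hδ' hκ hy
  have hl := one_le_logGrowth (zero_lt_one.trans hy).le
  have hp := phaseConst_nonneg
  rw [leadingRate, norm_div, Complex.norm_ofNat, amplitudeConst]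
  have h5 : 0 ≤ δ * logGrowth y := by positivity
  refine (div_le_self (norm_nonneg _) one_le_two).trans (h1.trans ?_)
  gcongr
  linarith

/-- Replacing the phase in the second moment costs 1/(uy). One power of u absorbs the 1/u and leaves
a first moment. The other term of the field amplitude has the explicit factor 1/y. -/
theorem norm_fieldAmplitude_sub_leadingAmplitude_le (hδ : 0 ≤ δ) (hδ' : δ ≤ 1 / 4) (hy : 1 < y) :
    ‖fieldAmplitude δ y - leadingAmplitude δ y‖ ≤ amplitudeConst * y⁻¹ := by
  have hy0 : 0 < y := zero_lt_one.trans hy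
  have hp := phaseConst_nonneg
  have h1 := norm_expMoment_laplacePhase_le (n := 1) (by norm_num) hδ hδ' hy0
  have h2 : ‖expMoment laplacePhase 2 δ y - expMoment leadingPhase 2 δ y‖ ≤ phaseConst * y⁻¹ := by
    rw [expMoment, expMoment, ← integral_sub (isLogPhase_laplacePhase.integrableOn 2 hδ hδ' hy0)
      (isLogPhase_leadingPhase.integrableOn 2 hδ hδ' hy)]
    have := norm_integral_exp_mul_pow_le (n := 1) (by norm_num) (c := y⁻¹) (by positivity)
      (w := fun u => u * (Complex.exp (-(δ * laplacePhase u y))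
        - Complex.exp (-(δ * leadingPhase u y)))) fun u hu => ?_
    · refine le_trans (le_of_eq ?_) this
      congr 1
      refine setIntegral_congr_fun measurableSet_Ioi fun u _ => ?_
      push_cast
      ring
    · have hE := one_le_phaseExpBound hu.le
      have hg := one_le_phaseGrowth hu.le
      rw [norm_mul, Complex.norm_real, Real.norm_eq_abs, abs_of_pos hu]
      calc _ ≤ u * (2 * δ / (u * y) * phaseExpBound u) := by
            gcongr
            exact norm_exp_laplacePhase_sub_le hδ hδ' hu hy
        _ = (2 * δ) * y⁻¹ * (phaseExpBound u * 1) := by field_simp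
        _ ≤ 8 * y⁻¹ * (phaseExpBound u * phaseGrowth u) := by
            gcongr
            linarith
  have h3 : fieldAmplitude δ y - leadingAmplitude δ y
      = (expMoment laplacePhase 2 δ y - expMoment leadingPhase 2 δ y) / 2
        - Complex.I * ((y⁻¹ : ℝ) : ℂ) * expMoment laplacePhase 1 δ y := by
    simp only [fieldAmplitude, phaseMoment, leadingAmplitude, expMoment]
    ring
  rw [h3]
  refine (norm_sub_le _ _).trans ?_
  rw [norm_div, norm_mul, norm_mul, Complex.norm_I, Complex.norm_real, Real.norm_eq_abs,
    abs_of_pos (by positivity), one_mul, Complex.norm_ofNat, amplitudeConst]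
  calc _ ≤ phaseConst * y⁻¹ + y⁻¹ * phaseConst := by
        gcongr
        exact (div_le_self (norm_nonneg _) one_le_two).trans h2
    _ = 2 * phaseConst * y⁻¹ := by ring
    _ ≤ _ := by
        gcongr <;> linarith

theorem norm_fieldRate_sub_leadingRate_le (hδ : 0 ≤ δ) (hδ' : δ ≤ 1 / 4) (hκ : |κ| ≤ 3)
    (hy : 1 < y) :
    ‖fieldRate δ κ y - leadingRate δ κ y‖ ≤ amplitudeConst * (logGrowth y / y) := by
  have hy0 : 0 < y := zero_lt_one.trans hy
  have hp := phaseConst_nonneg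
  have hl := one_le_logGrowth hy0.le
  have h1 := norm_expMoment_laplacePhase_le (n := 1) (by norm_num) hδ hδ' hy0
  have h2 : ‖expMomentRate laplacePhase laplaceSlope 2 δ κ y
      - expMomentRate leadingPhase (fun _ _ => 1) 2 δ κ y‖ ≤ phaseConst * (logGrowth y / y) := by
    rw [expMomentRate, expMomentRate,
      ← integral_sub (isLogPhase_laplacePhase.integrableOn_rate 2 hδ hδ' hκ hy0)
      (isLogPhase_leadingPhase.integrableOn_rate 2 hδ hδ' hκ hy)]
    have := norm_integral_exp_mul_pow_le (n := 1) (by norm_num) (c := logGrowth y / y)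
      (by positivity) (w := fun u => u * (phaseRate laplacePhase laplaceSlope δ κ y u
        - phaseRate leadingPhase (fun _ _ => 1) δ κ y u)) fun u hu => ?_
    · refine le_trans (le_of_eq ?_) this
      congr 1
      refine setIntegral_congr_fun measurableSet_Ioi fun u _ => ?_
      push_cast
      ring
    · rw [norm_mul, Complex.norm_real, Real.norm_eq_abs, abs_of_pos hu]
      calc _ ≤ u * (8 * (logGrowth y / y) * (phaseExpBound u * phaseGrowth u) / u) := by
            gcongr
            exact norm_phaseRate_sub_le hδ hδ' hκ hu hy
        _ = _ := by field_simp
  have h3 : fieldRate δ κ y - leadingRate δ κ y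
      = (expMomentRate laplacePhase laplaceSlope 2 δ κ y
          - expMomentRate leadingPhase (fun _ _ => 1) 2 δ κ y) / 2
        - Complex.I * ((y⁻¹ : ℝ) : ℂ) * (expMomentRate laplacePhase laplaceSlope 1 δ κ y
      - expMoment laplacePhase 1 δ y) := by
    rw [fieldRate, leadingRate]
    ring
  have h4 := isLogPhase_laplacePhase.norm_expMomentRate_le (n := 1) (by norm_num) hδ hδ' hκ hy0
  rw [h3]
  refine (norm_sub_le _ _).trans ?_
  rw [norm_div, norm_mul, norm_mul, Complex.norm_I, Complex.norm_real, Real.norm_eq_abs,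
    abs_of_pos (by positivity), one_mul, Complex.norm_ofNat, amplitudeConst]
  calc _ ≤ phaseConst * (logGrowth y / y)
        + y⁻¹ * (phaseConst * (1 * logGrowth y) + phaseConst * logGrowth y) := by
        gcongr
        · exact (div_le_self (norm_nonneg _) one_le_two).trans h2
        · refine (norm_sub_le _ _).trans (add_le_add (h4.trans ?_) (h1.trans ?_))
          · gcongr
            linarith
          · nlinarith
    _ = 3 * phaseConst * (logGrowth y / y) := by
        field_simp
        ring
    _ ≤ _ := by
        gcongr <;> linarith

/-- For the leading phase e^(−δL) is the pure power u^(−2δ) (y/2)^(−δ), so the moment is a Gamma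
integral. The closed form is needed because the norm of the infrared vector diverges as δ → 0 and
must be computed exactly. -/
theorem leadingAmplitude_eq (hδ : δ < 1) (hy : 0 < y) :
    leadingAmplitude δ y = ((y ^ (-δ) * (2 ^ (δ - 1) * Real.Gamma (3 - 2 * δ)) : ℝ) : ℂ) := by
  rw [leadingAmplitude, expMoment, Real.Gamma_eq_integral (by linarith), ← integral_const_mul,
    ← integral_const_mul, ← integral_complex_ofReal, ← integral_div]
  refine setIntegral_congr_fun measurableSet_Ioi fun u hu => ?_
  have hu' : (0 : ℝ) < u := hu
  rw [exp_neg_leadingPhase δ hu' hy, ← Complex.ofReal_mul]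
  rw [show (2 : ℂ) = ((2 : ℝ) : ℂ) by norm_num, ← Complex.ofReal_div, Complex.ofReal_inj,
    mul_div_assoc u, Real.mul_rpow hu'.le (by positivity), Real.div_rpow hy.le zero_le_two,
    Real.rpow_neg zero_le_two, Real.rpow_sub two_pos, Real.rpow_one,
    show 3 - 2 * δ - 1 = 2 + -δ + -δ by ring, Real.rpow_add hu', Real.rpow_add hu',
    Real.rpow_two]
  field_simp

end

/-! ### Derivatives of the amplitudes along a path of parameters -/

section

variable {δ κ : ℝ → ℝ} {M : ℝ} {s : Set ℝ} {k H : ℝ}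

theorem IsLightPath.hasDerivAt_momentumAmplitude (hp : IsLightPath δ κ M s) (hk : 0 < k)
    (hH : H ∈ s) : HasDerivAt (fun H => momentumAmplitude (δ H) (H / k))
      (momentumRate (δ H) (κ H) (H / k) / H) H := by
  have hH1 := hp.one_lt H hH
  have h1 := isLogPhase_laplacePhase.hasDerivAt_expMoment 0 hp hk hH
    (div_pos (by linarith) hk : 0 < H / k)
  have h2 := ((hp.hasDerivAt H hH).ofReal_comp).const_sub 1
  refine (h2.mul h1).congr_deriv ?_
  rw [momentumRate]
  push_cast
  ring

theorem IsLightPath.hasDerivAt_fieldAmplitude (hp : IsLightPath δ κ M s) (hk : 0 < k)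
    (hH : H ∈ s) : HasDerivAt (fun H => fieldAmplitude (δ H) (H / k))
      (fieldRate (δ H) (κ H) (H / k) / H) H := by
  have hH1 := hp.one_lt H hH
  have hy : 0 < H / k := div_pos (by linarith) hk
  have h1 := isLogPhase_laplacePhase.hasDerivAt_expMoment 1 hp hk hH hy
  have h2 := isLogPhase_laplacePhase.hasDerivAt_expMoment 2 hp hk hH hy
  have h3 : HasDerivAt (fun H : ℝ => (((H / k)⁻¹ : ℝ) : ℂ)) ((-(H / k)⁻¹ / H : ℝ) : ℂ) H := by
    have := (((hasDerivAt_id H).div_const k).inv hy.ne').ofReal_comp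
    refine this.congr_deriv ?_
    congr 1
    simp only [id]
    field_simp
  refine ((h2.div_const 2).sub ((h3.const_mul Complex.I).mul h1)).congr_deriv ?_
  rw [fieldRate]
  push_cast
  ring

theorem IsLightPath.hasDerivAt_leadingAmplitude (hp : IsLightPath δ κ M s) (hk : 0 < k)
    (hk' : k ≤ 1) (hH : H ∈ s) : HasDerivAt (fun H => leadingAmplitude (δ H) (H / k))
      (leadingRate (δ H) (κ H) (H / k) / H) H := by
  have hH1 := hp.one_lt H hH
  have h1 := isLogPhase_leadingPhase.hasDerivAt_expMoment 2 hp hk hH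
    (by simp only [mem_Ioi]; rw [lt_div_iff₀ hk]; linarith)
  refine (h1.div_const 2).congr_deriv ?_
  rw [leadingRate]
  ring

end

/-! ### Measurability of the amplitudes and of their rates -/

theorem measurable_expMoment {L : ℝ → ℝ → ℂ} (hL : Measurable (Function.uncurry L)) (n : ℕ)
    (δ : ℝ) : Measurable (expMoment L n δ) := by
  have : Measurable fun p : ℝ × ℝ => ((Real.exp (-p.2) * p.2 ^ n : ℝ) : ℂ)
      * Complex.exp (-(δ * L p.2 p.1)) := by
    have h : Measurable fun p : ℝ × ℝ => L p.2 p.1 := hL.comp measurable_swap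
    fun_prop
  exact (this.stronglyMeasurable.integral_prod_right' (ν := volume.restrict (Ioi 0))).measurable

theorem measurable_expMomentRate {L S : ℝ → ℝ → ℂ} (hL : Measurable (Function.uncurry L))
    (hS : Measurable (Function.uncurry S)) (n : ℕ) (δ κ : ℝ) :
    Measurable (expMomentRate L S n δ κ) := by
  have : Measurable fun p : ℝ × ℝ => ((Real.exp (-p.2) * p.2 ^ n : ℝ) : ℂ)
      * phaseRate L S δ κ p.1 p.2 := by
    have h : Measurable fun p : ℝ × ℝ => L p.2 p.1 := hL.comp measurable_swap
    have h' : Measurable fun p : ℝ × ℝ => S p.2 p.1 := hS.comp measurable_swap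
    unfold phaseRate
    fun_prop
  exact (this.stronglyMeasurable.integral_prod_right' (ν := volume.restrict (Ioi 0))).measurable

theorem measurable_laplacePhase : Measurable (Function.uncurry laplacePhase) := by
  unfold Function.uncurry laplacePhase laplaceBase
  fun_prop

theorem measurable_laplaceSlope : Measurable (Function.uncurry laplaceSlope) := by
  unfold Function.uncurry laplaceSlope laplaceBase
  fun_prop

theorem measurable_leadingPhase : Measurable (Function.uncurry leadingPhase) := by
  unfold Function.uncurry leadingPhase
  fun_prop

theorem measurable_fieldAmplitude (δ : ℝ) : Measurable (fieldAmplitude δ) := by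
  have h1 := measurable_expMoment measurable_laplacePhase 1 δ
  have h2 := measurable_expMoment measurable_laplacePhase 2 δ
  exact (h2.div_const 2).sub (((by fun_prop : Measurable fun y : ℝ =>
    Complex.I * ((y⁻¹ : ℝ) : ℂ))).mul h1)

theorem measurable_momentumAmplitude (δ : ℝ) : Measurable (momentumAmplitude δ) :=
  (measurable_expMoment measurable_laplacePhase 0 δ).const_mul _

theorem measurable_leadingAmplitude (δ : ℝ) : Measurable (leadingAmplitude δ) :=
  (measurable_expMoment measurable_leadingPhase 2 δ).div_const 2

theorem measurable_fieldRate (δ κ : ℝ) : Measurable (fieldRate δ κ) := by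
  have h0 := measurable_expMoment measurable_laplacePhase 1 δ
  have h1 := measurable_expMomentRate measurable_laplacePhase measurable_laplaceSlope 1 δ κ
  have h2 := measurable_expMomentRate measurable_laplacePhase measurable_laplaceSlope 2 δ κ
  exact (h2.div_const 2).sub (((by fun_prop : Measurable fun y : ℝ =>
    Complex.I * ((y⁻¹ : ℝ) : ℂ))).mul (h1.sub h0))

theorem measurable_momentumRate (δ κ : ℝ) : Measurable (momentumRate δ κ) :=
  ((measurable_expMoment measurable_laplacePhase 0 δ).const_mul _).add
    ((measurable_expMomentRate measurable_laplacePhase measurable_laplaceSlope 0 δ κ).const_mul _)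

theorem measurable_leadingRate (δ κ : ℝ) : Measurable (leadingRate δ κ) :=
  (measurable_expMomentRate measurable_leadingPhase measurable_const 2 δ κ).div_const 2

/-! ## Quantities that vary slowly with the Hubble rate -/

/-- A limit of large Hubble rates in the space of pairs `(H, m)`, in which `δ = 3/2 - ν` tends to
zero and `δH²` to `q`; the logarithmic derivative of `δ` in `H` is `-κ` and tends to `-κ₀`. -/
structure IsRegime (δ κ : ℝ → ℝ → ℝ) (q κ₀ : ℝ) (l : Filter (ℝ × ℝ)) : Prop where
  isCountablyGenerated : l.IsCountablyGenerated
  exists_isOpen : ∀ s ∈ l, ∃ U ∈ l, U ⊆ s ∧ ∀ m, IsOpen {H | (H, m) ∈ U}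
  tendsto_fst : Tendsto Prod.fst l atTop
  tendsto_delta : Tendsto (fun p => δ p.1 p.2) l (𝓝 0)
  delta_pos : ∀ᶠ p in l, 0 < δ p.1 p.2
  tendsto_mul_sq : Tendsto (fun p => δ p.1 p.2 * p.1 ^ 2) l (𝓝 q)
  tendsto_kappa : Tendsto (fun p => κ p.1 p.2) l (𝓝 κ₀)
  abs_kappa_lt : |κ₀| < 3
  kappa_mul : (2 - κ₀) * q = 0
  hasDerivAt : ∀ᶠ p in l,
    HasDerivAt (fun H => δ H p.2) (-(κ p.1 p.2 * δ p.1 p.2) / p.1) p.1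

/-- The function `s` of `H` and `m` tends to `c`, and `H ∂s/∂H` tends to zero. -/
def IsSlow (l : Filter (ℝ × ℝ)) (s : ℝ → ℝ → ℝ) (c : ℝ) : Prop :=
  ∃ s' : ℝ → ℝ → ℝ, (∀ᶠ p in l, HasDerivAt (fun H => s H p.2) (s' p.1 p.2 / p.1) p.1) ∧
    Tendsto (fun p => s p.1 p.2) l (𝓝 c) ∧ Tendsto (fun p => s' p.1 p.2) l (𝓝 0)

namespace IsSlow

variable {l : Filter (ℝ × ℝ)} {s t : ℝ → ℝ → ℝ} {c d : ℝ}

theorem tendsto (hs : IsSlow l s c) : Tendsto (fun p => s p.1 p.2) l (𝓝 c) := hs.choose_spec.2.1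

theorem const (l : Filter (ℝ × ℝ)) (c : ℝ) : IsSlow l (fun _ _ => c) c :=
  ⟨fun _ _ => 0, Eventually.of_forall fun p => by simpa using hasDerivAt_const p.1 c,
    tendsto_const_nhds, tendsto_const_nhds⟩

theorem add (hs : IsSlow l s c) (ht : IsSlow l t d) :
    IsSlow l (fun H m => s H m + t H m) (c + d) := by
  obtain ⟨s', hs1, hs2, hs3⟩ := hs
  obtain ⟨t', ht1, ht2, ht3⟩ := ht
  refine ⟨fun H m => s' H m + t' H m, ?_, hs2.add ht2, by simpa using hs3.add ht3⟩
  filter_upwards [hs1, ht1] with p h1 h2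
  exact (h1.add h2).congr_deriv (by ring)

theorem mul (hs : IsSlow l s c) (ht : IsSlow l t d) :
    IsSlow l (fun H m => s H m * t H m) (c * d) := by
  obtain ⟨s', hs1, hs2, hs3⟩ := hs
  obtain ⟨t', ht1, ht2, ht3⟩ := ht
  refine ⟨fun H m => s' H m * t H m + s H m * t' H m, ?_, hs2.mul ht2, ?_⟩
  · filter_upwards [hs1, ht1] with p h1 h2
    exact (h1.mul h2).congr_deriv (by ring)
  · simpa using (hs3.mul ht2).add (hs2.mul ht3)

theorem neg (hs : IsSlow l s c) : IsSlow l (fun H m => -s H m) (-c) := by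
  simpa using (const l (-1)).mul hs

theorem sub (hs : IsSlow l s c) (ht : IsSlow l t d) :
    IsSlow l (fun H m => s H m - t H m) (c - d) := by
  simpa [sub_eq_add_neg] using hs.add ht.neg

theorem pow (hs : IsSlow l s c) (n : ℕ) : IsSlow l (fun H m => s H m ^ n) (c ^ n) := by
  induction n with
  | zero => simpa using const l 1
  | succ n ih => simpa [pow_succ] using ih.mul hs

theorem inv (hs : IsSlow l s c) (hc : c ≠ 0) : IsSlow l (fun H m => (s H m)⁻¹) c⁻¹ := by
  obtain ⟨s', hs1, hs2, hs3⟩ := hs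
  refine ⟨fun H m => -s' H m / s H m ^ 2, ?_, hs2.inv₀ hc, ?_⟩
  · filter_upwards [hs1, hs2.eventually_ne hc] with p h1 h2
    exact (h1.inv h2).congr_deriv (by ring)
  · have h := hs3.neg.div (hs2.pow 2) (pow_ne_zero 2 hc)
    rw [neg_zero, zero_div] at h
    exact h

/-- A function with a bounded derivative of a slow quantity is slow. -/
theorem comp (hs : IsSlow l s c) {f f' : ℝ → ℝ} (hf : ∀ᶠ x in 𝓝 c, HasDerivAt f (f' x) x)
    (hf' : IsBoundedUnder (· ≤ ·) (𝓝 c) fun x => ‖f' x‖) :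
    IsSlow l (fun H m => f (s H m)) (f c) := by
  obtain ⟨s', hs1, hs2, hs3⟩ := hs
  refine ⟨fun H m => f' (s H m) * s' H m, ?_, ?_, ?_⟩
  · filter_upwards [hs1, hs2.eventually hf] with p h1 h2
    exact (h2.comp p.1 h1).congr_deriv (by ring)
  · exact hf.self_of_nhds.continuousAt.tendsto.comp hs2
  · obtain ⟨C, hC⟩ := hf'
    rw [eventually_map] at hC
    have h := hs3.norm.const_mul C
    rw [norm_zero, mul_zero] at h
    refine squeeze_zero_norm' ?_ h
    filter_upwards [hs2.eventually hC] with p hp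
    rw [norm_mul]
    gcongr

end IsSlow

/-- The vector field `V` depends slowly on `H`, uniformly bounded by multiples of `b`, and tends
to `V₀`. -/
def IsSlowField {Ω E : Type*} [MeasurableSpace Ω] [NormedAddCommGroup E] [NormedSpace ℝ E]
    (μ : Measure Ω) (l : Filter (ℝ × ℝ)) (V : ℝ → ℝ → Ω → E) (V₀ : Ω → E) (b : Ω → ℝ) : Prop :=
  ∃ V' : ℝ → ℝ → Ω → E, (∀ H m, AEStronglyMeasurable (V H m) μ) ∧
    (∀ H m, AEStronglyMeasurable (V' H m) μ) ∧
    (∃ C, ∃ U ∈ l, ∀ᵐ ω ∂μ, ∀ p ∈ U, ‖V p.1 p.2 ω‖ ≤ C * b ω ∧ ‖V' p.1 p.2 ω‖ ≤ C * b ω ∧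
      HasDerivAt (fun H => V H p.2 ω) (p.1⁻¹ • V' p.1 p.2 ω) p.1) ∧
    (∀ᵐ ω ∂μ, Tendsto (fun p => V p.1 p.2 ω) l (𝓝 (V₀ ω))) ∧
    ∀ᵐ ω ∂μ, Tendsto (fun p => V' p.1 p.2 ω) l (𝓝 0)

namespace IsSlowField

variable {Ω E : Type*} [MeasurableSpace Ω] [NormedAddCommGroup E] {μ : Measure Ω}
  {l : Filter (ℝ × ℝ)} {V W : ℝ → ℝ → Ω → E} {V₀ W₀ : Ω → E} {b b₁ : Ω → ℝ}

theorem add [NormedSpace ℝ E] (hV : IsSlowField μ l V V₀ b) (hW : IsSlowField μ l W W₀ b) :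
    IsSlowField μ l (fun H m ω => V H m ω + W H m ω) (fun ω => V₀ ω + W₀ ω) b := by
  obtain ⟨V', v1, v2, ⟨C, U, hU, v3⟩, v4, v5⟩ := hV
  obtain ⟨W', w1, w2, ⟨D, T, hT, w3⟩, w4, w5⟩ := hW
  refine ⟨fun H m ω => V' H m ω + W' H m ω, fun H m => (v1 H m).add (w1 H m),
    fun H m => (v2 H m).add (w2 H m), ⟨C + D, U ∩ T, inter_mem hU hT, ?_⟩, ?_, ?_⟩
  · filter_upwards [v3, w3] with ω hv hw p hp
    obtain ⟨a1, a2, a3⟩ := hv p hp.1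
    obtain ⟨b1, b2, b3⟩ := hw p hp.2
    refine ⟨?_, ?_, ?_⟩
    · rw [add_mul]
      exact (norm_add_le _ _).trans (add_le_add a1 b1)
    · rw [add_mul]
      exact (norm_add_le _ _).trans (add_le_add a2 b2)
    · rw [smul_add]
      exact a3.add b3
  · filter_upwards [v4, w4] with ω hv hw
    exact hv.add hw
  · filter_upwards [v5, w5] with ω hv hw
    simpa using hv.add hw

theorem smul [NormedSpace ℝ E] {s : ℝ → ℝ → ℝ} {c : ℝ} (hs : IsSlow l s c)
    (hV : IsSlowField μ l V V₀ b) :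
    IsSlowField μ l (fun H m ω => s H m • V H m ω) (fun ω => c • V₀ ω) b := by
  obtain ⟨V', v1, v2, ⟨C, U, hU, v3⟩, v4, v5⟩ := hV
  obtain ⟨s', s1, s2, s3⟩ := hs
  have e1 : ∀ᶠ p in l, ‖s p.1 p.2‖ ≤ |c| + 1 :=
    s2.norm.eventually_le_const (by rw [Real.norm_eq_abs]; linarith)
  have e2 : ∀ᶠ p in l, ‖s' p.1 p.2‖ ≤ 1 :=
    s3.norm.eventually_le_const (by rw [norm_zero]; exact one_pos)
  refine ⟨fun H m ω => s' H m • V H m ω + s H m • V' H m ω, fun H m => (v1 H m).const_smul _,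
    fun H m => ((v1 H m).const_smul _).add ((v2 H m).const_smul _),
    ⟨(|c| + 2) * C, _, inter_mem hU (s1.and (e1.and e2)), ?_⟩, ?_, ?_⟩
  · filter_upwards [v3] with ω hv p hp
    obtain ⟨a1, a2, a3⟩ := hv p hp.1
    obtain ⟨b1, b2, b3⟩ := hp.2
    have hb := (norm_nonneg _).trans a1
    refine ⟨?_, ?_, ?_⟩
    · rw [norm_smul]
      calc _ ≤ (|c| + 1) * (C * b ω) := by gcongr
        _ ≤ _ := by linarith
    · refine (norm_add_le _ _).trans ?_
      rw [norm_smul, norm_smul]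
      calc _ ≤ 1 * (C * b ω) + (|c| + 1) * (C * b ω) := by gcongr
        _ = _ := by ring
    · refine (b1.smul a3).congr_deriv ?_
      rw [smul_add, smul_smul, smul_smul, smul_smul, add_comm, div_eq_inv_mul,
        mul_comm (s p.1 p.2)]
  · filter_upwards [v4] with ω hv
    exact s2.smul hv
  · filter_upwards [v4, v5] with ω hv hv'
    simpa using (s3.smul hv).add (s2.smul hv')

/-- Differentiation and limits under the integral, all dominated by a multiple of b·b₁. The
derivative needs the bounds on a neighbourhood of H at fixed second parameter, which
`IsRegime.exists_isOpen` supplies. -/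
theorem inner [InnerProductSpace ℝ E] {δ κ : ℝ → ℝ → ℝ} {q κ₀ : ℝ} (hl : IsRegime δ κ q κ₀ l)
    (hV : IsSlowField μ l V V₀ b) (hW : IsSlowField μ l W W₀ b₁)
    (hb : Integrable (fun ω => b ω * b₁ ω) μ) :
    IsSlow l (fun H m => ∫ ω, Inner.inner ℝ (V H m ω) (W H m ω) ∂μ)
      (∫ ω, Inner.inner ℝ (V₀ ω) (W₀ ω) ∂μ) := by
  have := hl.isCountablyGenerated
  obtain ⟨V', v1, v2, ⟨C, U, hU, v3⟩, v4, v5⟩ := hV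
  obtain ⟨W', w1, w2, ⟨D, T, hT, w3⟩, w4, w5⟩ := hW
  have hbound : ∀ {x y : E} {a c : ℝ}, ‖x‖ ≤ a → ‖y‖ ≤ c → ‖Inner.inner ℝ x y‖ ≤ a * c :=
    fun {x y a c} hx hy => (norm_inner_le_norm x y).trans
      (mul_le_mul hx hy (norm_nonneg _) ((norm_nonneg _).trans hx))
  refine ⟨fun H m => ∫ ω, (Inner.inner ℝ (V H m ω) (W' H m ω)
    + Inner.inner ℝ (V' H m ω) (W H m ω)) ∂μ, ?_, ?_, ?_⟩
  · obtain ⟨O, hO, hOs, hOo⟩ := hl.exists_isOpen _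
      (inter_mem (inter_mem hU hT) (hl.tendsto_fst.eventually (eventually_gt_atTop 1)))
    filter_upwards [hO] with p hp
    have hnhds : {H | (H, p.2) ∈ O} ∈ 𝓝 p.1 := (hOo p.2).mem_nhds hp
    have key := hasDerivAt_integral_of_dominated_loc_of_deriv_le (μ := μ)
      (F := fun H ω => Inner.inner ℝ (V H p.2 ω) (W H p.2 ω))
      (F' := fun H ω => (Inner.inner ℝ (V H p.2 ω) (W' H p.2 ω)
        + Inner.inner ℝ (V' H p.2 ω) (W H p.2 ω)) / H)
      (x₀ := p.1) (bound := fun ω => 2 * (C * D) * (b ω * b₁ ω)) hnhds ?_ ?_ ?_ ?_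
      (hb.const_mul _) ?_
    · exact key.2.congr_deriv (integral_div _ _)
    · exact Eventually.of_forall fun H => (v1 _ _).inner (w1 _ _)
    · refine Integrable.mono' (hb.const_mul (C * D)) ((v1 _ _).inner (w1 _ _)) ?_
      filter_upwards [v3, w3] with ω hv hw
      exact (hbound (hv p (hOs hp).1.1).1 (hw p (hOs hp).1.2).1).trans_eq (by ring)
    · simp only [div_eq_mul_inv]
      exact AEStronglyMeasurable.mul_const
        (((v1 _ _).inner (w2 _ _)).add ((v2 _ _).inner (w1 _ _))) _
    · filter_upwards [v3, w3] with ω hv hw H hH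
      have hH' := hOs hH
      obtain ⟨a1, a2, a3⟩ := hv _ hH'.1.1
      obtain ⟨b1, b2, b3⟩ := hw _ hH'.1.2
      have h1 : 1 < H := hH'.2
      rw [norm_div, Real.norm_eq_abs H, abs_of_pos (by linarith)]
      refine (div_le_self (norm_nonneg _) h1.le).trans ((norm_add_le _ _).trans ?_)
      exact (add_le_add (hbound a1 b2) (hbound a2 b1)).trans_eq (by ring)
    · filter_upwards [v3, w3] with ω hv hw H hH
      have hH' := hOs hH
      obtain ⟨a1, a2, a3⟩ := hv _ hH'.1.1
      obtain ⟨b1, b2, b3⟩ := hw _ hH'.1.2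
      refine (a3.inner ℝ b3).congr_deriv ?_
      rw [real_inner_smul_left, real_inner_smul_right]
      ring
  · refine tendsto_integral_filter_of_dominated_convergence
      (fun ω => C * D * (b ω * b₁ ω)) ?_ ?_ (hb.const_mul _) ?_
    · exact Eventually.of_forall fun p => (v1 _ _).inner (w1 _ _)
    · filter_upwards [hU, hT] with p hpU hpT
      filter_upwards [v3, w3] with ω hv hw
      exact (hbound (hv p hpU).1 (hw p hpT).1).trans_eq (by ring)
    · filter_upwards [v4, w4] with ω hv hw
      exact hv.inner hw
  · have h0 : (0 : ℝ) = ∫ _ω, (0 : ℝ) ∂μ := by simp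
    rw [h0]
    refine tendsto_integral_filter_of_dominated_convergence
      (fun ω => 2 * (C * D) * (b ω * b₁ ω)) ?_ ?_ (hb.const_mul _) ?_
    · exact Eventually.of_forall fun p =>
        ((v1 _ _).inner (w2 _ _)).add ((v2 _ _).inner (w1 _ _))
    · filter_upwards [hU, hT] with p hpU hpT
      filter_upwards [v3, w3] with ω hv hw
      obtain ⟨a1, a2, a3⟩ := hv _ hpU
      obtain ⟨b1, b2, b3⟩ := hw _ hpT
      exact ((norm_add_le _ _).trans (add_le_add (hbound a1 b2) (hbound a2 b1))).trans_eq
        (by ring)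
    · filter_upwards [v4, w4, v5, w5] with ω hv hw hv' hw'
      simpa using (Tendsto.inner (𝕜 := ℝ) hv hw').add (Tendsto.inner (𝕜 := ℝ) hv' hw)

end IsSlowField

/-! ### The basic slow scalars -/

namespace IsRegime

variable {δ κ : ℝ → ℝ → ℝ} {q κ₀ : ℝ} {l : Filter (ℝ × ℝ)}

theorem eventually_one_lt (hl : IsRegime δ κ q κ₀ l) : ∀ᶠ p in l, 1 < p.1 :=
  hl.tendsto_fst.eventually (eventually_gt_atTop 1)

theorem isSlow_inv (hl : IsRegime δ κ q κ₀ l) : IsSlow l (fun H _ => H⁻¹) 0 := by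
  have h := tendsto_inv_atTop_zero.comp hl.tendsto_fst
  refine ⟨fun H _ => -H⁻¹, ?_, h, by simpa using h.neg⟩
  filter_upwards [hl.eventually_one_lt] with p hp
  refine (hasDerivAt_inv (by linarith)).congr_deriv ?_
  field_simp

theorem isSlow_delta (hl : IsRegime δ κ q κ₀ l) : IsSlow l δ 0 := by
  refine ⟨fun H m => -(κ H m * δ H m), hl.hasDerivAt, hl.tendsto_delta, ?_⟩
  simpa using (hl.tendsto_kappa.mul hl.tendsto_delta).neg

/-- The logarithmic derivative of δH² is 2 − κ, and `kappa_mul` says that (2 − κ₀) q = 0: either δ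
decays like H^(−2), or δH² tends to zero anyway. -/
theorem isSlow_mul_sq (hl : IsRegime δ κ q κ₀ l) : IsSlow l (fun H m => δ H m * H ^ 2) q := by
  refine ⟨fun H m => (2 - κ H m) * (δ H m * H ^ 2), ?_, hl.tendsto_mul_sq, ?_⟩
  · filter_upwards [hl.hasDerivAt, hl.eventually_one_lt] with p h1 h2
    refine (h1.mul (hasDerivAt_pow 2 p.1)).congr_deriv ?_
    have : p.1 ≠ 0 := by linarith
    field_simp
    ring
  · rw [← hl.kappa_mul]
    exact (hl.tendsto_kappa.const_sub 2).mul hl.tendsto_mul_sq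

theorem isSlow_mul (hl : IsRegime δ κ q κ₀ l) : IsSlow l (fun H m => δ H m * H) 0 := by
  refine ⟨fun H m => (1 - κ H m) * (δ H m * H), ?_, ?_, ?_⟩
  · filter_upwards [hl.hasDerivAt, hl.eventually_one_lt] with p h1 h2
    refine (h1.mul (hasDerivAt_id p.1)).congr_deriv ?_
    have : p.1 ≠ 0 := by linarith
    simp only [id]
    field_simp
    ring
  all_goals
    have h : Tendsto (fun p : ℝ × ℝ => δ p.1 p.2 * p.1) l (𝓝 0) := by
      have := hl.tendsto_mul_sq.mul (tendsto_inv_atTop_zero.comp hl.tendsto_fst)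
      rw [mul_zero] at this
      refine this.congr' ?_
      filter_upwards [hl.eventually_one_lt] with p h2
      have : p.1 ≠ 0 := by linarith
      simp only [Function.comp_apply]
      field_simp
  · exact h
  · simpa using (hl.tendsto_kappa.const_sub 1).mul h

end IsRegime

/-! ## The amplitudes vary slowly -/

/-- The amplitude `τ` of the mode of wave number `k` depends slowly on `H`, uniformly bounded by
multiples of `β`, and tends to `τ₀`, for `k` in `K`. -/
def IsSlowAmplitude (l : Filter (ℝ × ℝ)) (τ : ℝ → ℝ → ℝ → ℂ) (τ₀ : ℝ → ℂ) (K : Set ℝ)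
    (β : ℝ → ℝ) : Prop :=
  ∃ τ' : ℝ → ℝ → ℝ → ℂ, (∀ H m, Measurable (τ H m)) ∧ (∀ H m, Measurable (τ' H m)) ∧
    (∃ C, ∃ U ∈ l, ∀ k ∈ K, ∀ p ∈ U, ‖τ p.1 p.2 k‖ ≤ C * β k ∧ ‖τ' p.1 p.2 k‖ ≤ C * β k ∧
      HasDerivAt (fun H => τ H p.2 k) (τ' p.1 p.2 k / p.1) p.1) ∧
    (∀ k ∈ K, Tendsto (fun p => τ p.1 p.2 k) l (𝓝 (τ₀ k))) ∧
    ∀ k ∈ K, Tendsto (fun p => τ' p.1 p.2 k) l (𝓝 0)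

/-- The logarithmic growth of the modes of long wave length. -/
def infraredLog (k : ℝ) : ℝ := logGrowth k⁻¹

theorem one_le_infraredLog {k : ℝ} (hk : 0 < k) : 1 ≤ infraredLog k :=
  one_le_logGrowth (by positivity)

theorem logGrowth_div_le {H k : ℝ} (hH : 0 < H) (hk : 0 < k) :
    logGrowth (H / k) ≤ infraredLog k + Real.log (1 + H) := by
  have h1 : Real.log (1 + H / k) ≤ Real.log ((1 + k⁻¹) * (1 + H)) := by
    refine Real.log_le_log (by positivity) ?_
    rw [div_eq_mul_inv]
    have := inv_pos.2 hk
    nlinarith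
  rw [Real.log_mul (by positivity) (by positivity)] at h1
  rw [infraredLog, logGrowth, logGrowth]
  linarith

theorem log_one_add_le {H : ℝ} (hH : 0 < H) : Real.log (1 + H) ≤ H := by
  have := Real.log_le_sub_one_of_pos (show 0 < 1 + H by linarith)
  linarith

theorem tendsto_log_one_add_div : Tendsto (fun H : ℝ => Real.log (1 + H) / H) atTop (𝓝 0) := by
  have h1 : Tendsto (fun H : ℝ => 1 + H) atTop atTop := tendsto_atTop_add_const_left _ _ tendsto_id
  have h2 := (Real.isLittleO_log_id_atTop.comp_tendsto h1).tendsto_div_nhds_zero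
  have h3 : Tendsto (fun H : ℝ => (1 + H) / H) atTop (𝓝 1) := by
    have := (tendsto_inv_atTop_zero (𝕜 := ℝ)).add_const 1
    rw [zero_add] at this
    refine this.congr' ?_
    filter_upwards [eventually_gt_atTop 0] with H hH
    field_simp
  have h4 := h2.mul h3
  rw [zero_mul] at h4
  refine h4.congr' ?_
  filter_upwards [eventually_gt_atTop 0] with H hH
  simp only [Function.comp_apply, id]
  have : 1 + H ≠ 0 := by linarith
  field_simp

namespace IsRegime

variable {δ κ : ℝ → ℝ → ℝ} {q κ₀ : ℝ} {l : Filter (ℝ × ℝ)}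

theorem exists_isLightPath (hl : IsRegime δ κ q κ₀ l) : ∃ M, 0 ≤ M ∧ ∃ U ∈ l, ∀ p ∈ U,
    ∃ s, p.1 ∈ s ∧ IsLightPath (fun H => δ H p.2) (fun H => κ H p.2) M s := by
  have e1 := hl.eventually_one_lt
  have e2 := hl.delta_pos
  have e3 : ∀ᶠ p in l, δ p.1 p.2 ≤ 1 / 4 :=
    hl.tendsto_delta.eventually_le_const (by norm_num)
  have e4 : ∀ᶠ p in l, |κ p.1 p.2| ≤ 3 :=
    hl.tendsto_kappa.abs.eventually_le_const hl.abs_kappa_lt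
  have e5 : ∀ᶠ p in l, δ p.1 p.2 * p.1 ^ 2 ≤ |q| + 1 :=
    hl.tendsto_mul_sq.eventually_le_const (by linarith [le_abs_self q])
  obtain ⟨U, hU, hUs, hUo⟩ := hl.exists_isOpen _
    (e1.and (e2.and (e3.and (e4.and (e5.and hl.hasDerivAt)))))
  refine ⟨|q| + 1, by positivity, U, hU, fun p hp => ⟨{H | (H, p.2) ∈ U}, hp, ?_⟩⟩
  exact ⟨hUo p.2, fun H hH => (hUs hH).1, fun H hH => (hUs hH).2.1, fun H hH => (hUs hH).2.2.1,
    fun H hH => (hUs hH).2.2.2.1, fun H hH => (hUs hH).2.2.2.2.1, fun H hH => (hUs hH).2.2.2.2.2⟩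

/-- Since δH² converges and log(1 + H)/H → 0, the deviation δ log(H/k) of the amplitudes is
negligible even after multiplication by H. -/
theorem tendsto_mul_logGrowth (hl : IsRegime δ κ q κ₀ l) {k : ℝ} (hk : 0 < k) :
    Tendsto (fun p => p.1 * (δ p.1 p.2 * logGrowth (p.1 / k))) l (𝓝 0) := by
  have h1 := (hl.isSlow_mul.tendsto.mul_const (infraredLog k)).add
    (hl.tendsto_mul_sq.mul (tendsto_log_one_add_div.comp hl.tendsto_fst))
  rw [zero_mul, mul_zero, add_zero] at h1
  refine squeeze_zero' ?_ ?_ h1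
  · filter_upwards [hl.eventually_one_lt, hl.delta_pos] with p h2 h3
    have h4 := one_le_logGrowth (show 0 ≤ p.1 / k by positivity)
    have : 0 < p.1 := by linarith
    positivity
  · filter_upwards [hl.eventually_one_lt, hl.delta_pos] with p h2 h3
    have h0 : 0 < p.1 := by linarith
    have h4 := logGrowth_div_le h0 hk
    simp only [Function.comp_apply]
    calc _ ≤ p.1 * (δ p.1 p.2 * (infraredLog k + Real.log (1 + p.1))) := by gcongr
      _ = _ := by field_simp

theorem tendsto_logGrowth (hl : IsRegime δ κ q κ₀ l) {k : ℝ} (hk : 0 < k) :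
    Tendsto (fun p => δ p.1 p.2 * logGrowth (p.1 / k)) l (𝓝 0) := by
  refine squeeze_zero' ?_ ?_ (hl.tendsto_mul_logGrowth hk)
  all_goals
    filter_upwards [hl.eventually_one_lt, hl.delta_pos] with p h2 h3
    have h4 := one_le_logGrowth (show 0 ≤ p.1 / k by positivity)
    have h5 : 0 ≤ δ p.1 p.2 * logGrowth (p.1 / k) := by positivity
  · exact h5
  · nlinarith

theorem tendsto_inv_div (hl : IsRegime δ κ q κ₀ l) (k : ℝ) :
    Tendsto (fun p : ℝ × ℝ => (p.1 / k)⁻¹) l (𝓝 0) := by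
  have := (tendsto_inv_atTop_zero.comp hl.tendsto_fst).const_mul k
  rw [mul_zero] at this
  refine this.congr fun p => ?_
  rw [inv_div]
  rfl

end IsRegime

theorem IsLightPath.mul_logGrowth_le {δ κ : ℝ → ℝ} {M : ℝ} {s : Set ℝ} (hp : IsLightPath δ κ M s)
    {H k : ℝ} (hH : H ∈ s) (hk : 0 < k) :
    H * (δ H * logGrowth (H / k)) ≤ 2 * M * infraredLog k := by
  have h1 := hp.one_lt H hH
  have h2 := hp.pos H hH
  have h3 := hp.mul_sq_le H hH
  have h4 := logGrowth_div_le (show 0 < H by linarith) hk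
  have h5 := log_one_add_le (show 0 < H by linarith)
  have h6 := one_le_infraredLog hk
  have h7 : H * δ H ≤ M := by
    have : δ H * H ≤ δ H * H ^ 2 := mul_le_mul_of_nonneg_left (by nlinarith) h2.le
    linarith
  calc _ ≤ H * (δ H * (infraredLog k + H)) := by
        have : 0 < H := by linarith
        gcongr
        linarith
    _ = (H * δ H) * infraredLog k + δ H * H ^ 2 := by ring
    _ ≤ M * infraredLog k + M := by gcongr
    _ ≤ _ := by
      have : 0 ≤ M := le_trans (by have : 0 < H := by linarith
                                   positivity) h7
      nlinarith

theorem IsLightPath.logGrowth_le {δ κ : ℝ → ℝ} {M : ℝ} {s : Set ℝ} (hp : IsLightPath δ κ M s)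
    {H k : ℝ} (hH : H ∈ s) (hk : 0 < k) :
    δ H * logGrowth (H / k) ≤ 2 * M * infraredLog k := by
  have h1 := hp.one_lt H hH
  have h2 := hp.pos H hH
  have h4 := one_le_logGrowth (show 0 ≤ H / k from div_nonneg (by linarith) hk.le)
  have h5 : 0 ≤ δ H * logGrowth (H / k) := by positivity
  exact le_trans (by nlinarith) (hp.mul_logGrowth_le hH hk)

namespace IsRegime

variable {δ κ : ℝ → ℝ → ℝ} {q κ₀ : ℝ} {l : Filter (ℝ × ℝ)}

theorem isSlowAmplitude_momentum (hl : IsRegime δ κ q κ₀ l) :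
    IsSlowAmplitude l (fun H m k => momentumAmplitude (δ H m) (H / k)) (fun _ => 1) (Ioi 0)
      infraredLog := by
  obtain ⟨M, hM, U, hU, hUp⟩ := hl.exists_isLightPath
  have hA := amplitudeConst_pos
  refine ⟨fun H m k => momentumRate (δ H m) (κ H m) (H / k),
    fun H m => (measurable_momentumAmplitude _).comp (by fun_prop),
    fun H m => (measurable_momentumRate _ _).comp (by fun_prop),
    ⟨amplitudeConst * (2 * M) + 1, U, hU, ?_⟩, ?_, ?_⟩
  · intro k hk p hp
    have hk0 : (0 : ℝ) < k := hk
    obtain ⟨s, hs, hps⟩ := hUp p hp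
    have h1 := hps.one_lt _ hs
    have hy : 0 < p.1 / k := div_pos (by linarith) hk0
    have h2 := norm_momentumAmplitude_sub_le (hps.pos _ hs).le (hps.le _ hs) hy
    have h3 := norm_momentumRate_le (hps.pos _ hs).le (hps.le _ hs) (hps.abs_le _ hs) hy
    have h4 := mul_le_mul_of_nonneg_left (hps.logGrowth_le hs hk0) hA.le
    have h5 := one_le_infraredLog hk0
    refine ⟨?_, by linarith, hps.hasDerivAt_momentumAmplitude hk0 hs⟩
    have h6 := norm_le_norm_sub_add (momentumAmplitude (δ p.1 p.2) (p.1 / k)) 1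
    rw [norm_one] at h6
    linarith
  · intro k hk
    have hk0 : (0 : ℝ) < k := hk
    have h := (hl.tendsto_logGrowth hk0).const_mul amplitudeConst
    rw [mul_zero] at h
    rw [tendsto_iff_norm_sub_tendsto_zero]
    refine squeeze_zero' (Eventually.of_forall fun _ => norm_nonneg _) ?_ h
    filter_upwards [hU] with p hp
    obtain ⟨s, hs, hps⟩ := hUp p hp
    exact norm_momentumAmplitude_sub_le (hps.pos _ hs).le (hps.le _ hs)
      (div_pos (by linarith [hps.one_lt _ hs]) hk0)
  · intro k hk
    have hk0 : (0 : ℝ) < k := hk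
    have h := (hl.tendsto_logGrowth hk0).const_mul amplitudeConst
    rw [mul_zero] at h
    refine squeeze_zero_norm' ?_ h
    filter_upwards [hU] with p hp
    obtain ⟨s, hs, hps⟩ := hUp p hp
    exact norm_momentumRate_le (hps.pos _ hs).le (hps.le _ hs) (hps.abs_le _ hs)
      (div_pos (by linarith [hps.one_lt _ hs]) hk0)

/-- For δ = 0 the amplitude is 1 − ik/H and its rate is ik/H. Both corrections vanish in the limit
but grow with k, hence the factor 1 + k in the bound. -/
theorem isSlowAmplitude_field (hl : IsRegime δ κ q κ₀ l) :
    IsSlowAmplitude l (fun H m k => fieldAmplitude (δ H m) (H / k)) (fun _ => 1) (Ioi 0)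
      (fun k => (1 + k) * infraredLog k) := by
  obtain ⟨M, hM, U, hU, hUp⟩ := hl.exists_isLightPath
  have hA := amplitudeConst_pos
  have hIy : ∀ y : ℝ, 0 < y → ‖Complex.I * ((y⁻¹ : ℝ) : ℂ)‖ = y⁻¹ := fun y hy => by
    rw [norm_mul, Complex.norm_I, one_mul, Complex.norm_real, Real.norm_eq_abs,
      abs_of_pos (by positivity)]
  have hzero : ∀ k : ℝ, 0 < k → Tendsto (fun p : ℝ × ℝ =>
      amplitudeConst * ((1 + (p.1 / k)⁻¹) * (δ p.1 p.2 * logGrowth (p.1 / k)))) l (𝓝 0) := by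
    intro k hk
    have h := (((hl.tendsto_inv_div k).const_add 1).mul
      (hl.tendsto_logGrowth hk)).const_mul amplitudeConst
    rwa [mul_zero, mul_zero] at h
  have hIlim : ∀ k : ℝ, Tendsto (fun p : ℝ × ℝ => Complex.I * (((p.1 / k)⁻¹ : ℝ) : ℂ)) l
      (𝓝 0) := by
    intro k
    have h := ((Complex.continuous_ofReal.tendsto _).comp (hl.tendsto_inv_div k)).const_mul
      Complex.I
    rwa [Complex.ofReal_zero, mul_zero] at h
  refine ⟨fun H m k => fieldRate (δ H m) (κ H m) (H / k),
    fun H m => (measurable_fieldAmplitude _).comp (by fun_prop),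
    fun H m => (measurable_fieldRate _ _).comp (by fun_prop),
    ⟨amplitudeConst * (2 * M) + 1, U, hU, ?_⟩, ?_, ?_⟩
  · intro k hk p hp
    have hk0 : (0 : ℝ) < k := hk
    obtain ⟨s, hs, hps⟩ := hUp p hp
    have h1 := hps.one_lt _ hs
    have hy : 0 < p.1 / k := div_pos (by linarith) hk0
    have hx : (p.1 / k)⁻¹ ≤ k := by
      rw [inv_div]
      exact div_le_self hk0.le h1.le
    have hx0 : 0 < (p.1 / k)⁻¹ := by positivity
    have h5 := one_le_infraredLog hk0
    have hbd : amplitudeConst * ((1 + (p.1 / k)⁻¹) * (δ p.1 p.2 * logGrowth (p.1 / k)))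
        ≤ amplitudeConst * ((1 + k) * (2 * M * infraredLog k)) := by
      have := hps.logGrowth_le hs hk0
      have := (hps.pos _ hs).le
      have := one_le_logGrowth hy.le
      gcongr
    have h2 := norm_fieldAmplitude_sub_le (hps.pos _ hs).le (hps.le _ hs) hy
    have h3 := norm_fieldRate_sub_le (hps.pos _ hs).le (hps.le _ hs) (hps.abs_le _ hs) hy
    have h7 : (1 + k) ≤ (1 + k) * infraredLog k := by nlinarith
    refine ⟨?_, ?_, hps.hasDerivAt_fieldAmplitude hk0 hs⟩
    · have h6 := norm_le_norm_sub_add (fieldAmplitude (δ p.1 p.2) (p.1 / k))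
        (1 - Complex.I * (((p.1 / k)⁻¹ : ℝ) : ℂ))
      have h8 := norm_sub_le 1 (Complex.I * (((p.1 / k)⁻¹ : ℝ) : ℂ))
      rw [norm_one, hIy _ hy] at h8
      linarith
    · have h6 := norm_le_norm_sub_add (fieldRate (δ p.1 p.2) (κ p.1 p.2) (p.1 / k))
        (Complex.I * (((p.1 / k)⁻¹ : ℝ) : ℂ))
      rw [hIy _ hy] at h6
      linarith
  · intro k hk
    have hk0 : (0 : ℝ) < k := hk
    have h1 : Tendsto (fun p : ℝ × ℝ => fieldAmplitude (δ p.1 p.2) (p.1 / k)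
        - (1 - Complex.I * (((p.1 / k)⁻¹ : ℝ) : ℂ))) l (𝓝 0) := by
      refine squeeze_zero_norm' ?_ (hzero k hk0)
      filter_upwards [hU] with p hp
      obtain ⟨s, hs, hps⟩ := hUp p hp
      exact norm_fieldAmplitude_sub_le (hps.pos _ hs).le (hps.le _ hs)
        (div_pos (by linarith [hps.one_lt _ hs]) hk0)
    simpa using h1.add ((hIlim k).const_sub 1)
  · intro k hk
    have hk0 : (0 : ℝ) < k := hk
    have h1 : Tendsto (fun p : ℝ × ℝ => fieldRate (δ p.1 p.2) (κ p.1 p.2) (p.1 / k)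
        - Complex.I * (((p.1 / k)⁻¹ : ℝ) : ℂ)) l (𝓝 0) := by
      refine squeeze_zero_norm' ?_ (hzero k hk0)
      filter_upwards [hU] with p hp
      obtain ⟨s, hs, hps⟩ := hUp p hp
      exact norm_fieldRate_sub_le (hps.pos _ hs).le (hps.le _ hs) (hps.abs_le _ hs)
        (div_pos (by linarith [hps.one_lt _ hs]) hk0)
    simpa using h1.add (hIlim k)

/-- The two amplitudes differ by ik/H up to terms of order δ log(H/k), and these remain small after
multiplication by H. That the limit is imaginary is what later shows that the twice rescaled vector
does not vanish. -/
theorem isSlowAmplitude_difference (hl : IsRegime δ κ q κ₀ l) :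
    IsSlowAmplitude l (fun H m k => H * (momentumAmplitude (δ H m) (H / k)
      - fieldAmplitude (δ H m) (H / k))) (fun k => Complex.I * k) (Ioi 0)
      (fun k => (1 + k) * infraredLog k) := by
  obtain ⟨M, hM, U, hU, hUp⟩ := hl.exists_isLightPath
  have hA := amplitudeConst_pos
  have hI : ∀ H k : ℝ, 1 < H → (H : ℂ) * (Complex.I * (((H / k)⁻¹ : ℝ) : ℂ)) = Complex.I * k := by
    intro H k hH
    have : (H : ℂ) ≠ 0 := by exact_mod_cast (by linarith : H ≠ 0)
    push_cast
    field_simp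
  have hzero : ∀ k : ℝ, 0 < k → Tendsto (fun p : ℝ × ℝ => 2 * amplitudeConst
      * ((1 + (p.1 / k)⁻¹) * (p.1 * (δ p.1 p.2 * logGrowth (p.1 / k))))) l (𝓝 0) := by
    intro k hk
    have h := (((hl.tendsto_inv_div k).const_add 1).mul
      (hl.tendsto_mul_logGrowth hk)).const_mul (2 * amplitudeConst)
    rwa [mul_zero, mul_zero] at h
  have hest : ∀ k : ℝ, 0 < k → ∀ p ∈ U,
      ‖(p.1 : ℂ) * (momentumAmplitude (δ p.1 p.2) (p.1 / k)
        - fieldAmplitude (δ p.1 p.2) (p.1 / k)) - Complex.I * k‖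
        ≤ 2 * amplitudeConst * ((1 + (p.1 / k)⁻¹) * (p.1 * (δ p.1 p.2 * logGrowth (p.1 / k)))) ∧
      ‖(p.1 : ℂ) * (momentumRate (δ p.1 p.2) (κ p.1 p.2) (p.1 / k)
        - fieldRate (δ p.1 p.2) (κ p.1 p.2) (p.1 / k)) + Complex.I * k‖
        ≤ 2 * amplitudeConst
          * ((1 + (p.1 / k)⁻¹) * (p.1 * (δ p.1 p.2 * logGrowth (p.1 / k)))) := by
    intro k hk p hp
    obtain ⟨s, hs, hps⟩ := hUp p hp
    have h1 := hps.one_lt _ hs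
    have h0 : 0 < p.1 := by linarith
    have hy : 0 < p.1 / k := div_pos h0 hk
    have hd := (hps.pos _ hs).le
    have hl := one_le_logGrowth hy.le
    have hx0 : 0 < (p.1 / k)⁻¹ := by positivity
    have a1 := norm_momentumAmplitude_sub_le hd (hps.le _ hs) hy
    have a2 := norm_momentumRate_le hd (hps.le _ hs) (hps.abs_le _ hs) hy
    have a3 := norm_fieldAmplitude_sub_le hd (hps.le _ hs) hy
    have a4 := norm_fieldRate_sub_le hd (hps.le _ hs) (hps.abs_le _ hs) hy
    have a5 : amplitudeConst * (δ p.1 p.2 * logGrowth (p.1 / k))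
        ≤ amplitudeConst * ((1 + (p.1 / k)⁻¹) * (δ p.1 p.2 * logGrowth (p.1 / k))) := by
      have : 0 ≤ δ p.1 p.2 * logGrowth (p.1 / k) := by positivity
      exact mul_le_mul_of_nonneg_left (le_mul_of_one_le_left this (by linarith)) hA.le
    have hn : ‖(p.1 : ℂ)‖ = p.1 := by
      rw [Complex.norm_real, Real.norm_eq_abs, abs_of_pos h0]
    have hr : 2 * amplitudeConst * ((1 + (p.1 / k)⁻¹) * (p.1 * (δ p.1 p.2 * logGrowth (p.1 / k))))
        = p.1 * (2 * (amplitudeConst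
          * ((1 + (p.1 / k)⁻¹) * (δ p.1 p.2 * logGrowth (p.1 / k))))) := by ring
    constructor
    · rw [hr, ← hI _ _ h1, ← mul_sub, norm_mul, hn]
      refine mul_le_mul_of_nonneg_left ?_ h0.le
      rw [show momentumAmplitude (δ p.1 p.2) (p.1 / k) - fieldAmplitude (δ p.1 p.2) (p.1 / k)
        - Complex.I * (((p.1 / k)⁻¹ : ℝ) : ℂ) = (momentumAmplitude (δ p.1 p.2) (p.1 / k) - 1)
        - (fieldAmplitude (δ p.1 p.2) (p.1 / k) - (1 - Complex.I * (((p.1 / k)⁻¹ : ℝ) : ℂ)))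
        by ring]
      refine (norm_sub_le _ _).trans ?_
      linarith
    · rw [hr, ← hI _ _ h1, ← mul_add, norm_mul, hn]
      refine mul_le_mul_of_nonneg_left ?_ h0.le
      rw [show momentumRate (δ p.1 p.2) (κ p.1 p.2) (p.1 / k)
        - fieldRate (δ p.1 p.2) (κ p.1 p.2) (p.1 / k)
        + Complex.I * (((p.1 / k)⁻¹ : ℝ) : ℂ) = momentumRate (δ p.1 p.2) (κ p.1 p.2) (p.1 / k)
        - (fieldRate (δ p.1 p.2) (κ p.1 p.2) (p.1 / k) - Complex.I * (((p.1 / k)⁻¹ : ℝ) : ℂ))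
        by ring]
      refine (norm_sub_le _ _).trans ?_
      linarith
  -- Product rule for H(π − φ): the terms H(π − φ) and H(π′ − φ′) tend to ik and −ik. Inserting −ik
  -- + ik makes each bracket small by itself.
  refine ⟨fun H m k => (H * (momentumAmplitude (δ H m) (H / k) - fieldAmplitude (δ H m) (H / k))
      - Complex.I * k) + (H * (momentumRate (δ H m) (κ H m) (H / k)
      - fieldRate (δ H m) (κ H m) (H / k)) + Complex.I * k),
    fun H m => (((measurable_momentumAmplitude _).comp (by fun_prop)).sub
      ((measurable_fieldAmplitude _).comp (by fun_prop))).const_mul _,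
    fun H m => (((((measurable_momentumAmplitude _).comp (by fun_prop)).sub
      ((measurable_fieldAmplitude _).comp (by fun_prop))).const_mul _).sub (by fun_prop)).add
      (((((measurable_momentumRate _ _).comp (by fun_prop)).sub
      ((measurable_fieldRate _ _).comp (by fun_prop))).const_mul _).add (by fun_prop)),
    ⟨4 * amplitudeConst * (2 * M) + 1, U, hU, ?_⟩, ?_, ?_⟩
  · intro k hk p hp
    have hk0 : (0 : ℝ) < k := hk
    obtain ⟨s, hs, hps⟩ := hUp p hp
    obtain ⟨h2, h3⟩ := hest k hk0 p hp
    have h1 := hps.one_lt _ hs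
    have hy : 0 < p.1 / k := div_pos (by linarith) hk0
    have hx : (p.1 / k)⁻¹ ≤ k := by
      rw [inv_div]
      exact div_le_self hk0.le h1.le
    have hx0 : 0 < (p.1 / k)⁻¹ := by positivity
    have h5 := one_le_infraredLog hk0
    have hbd : 2 * amplitudeConst
          * ((1 + (p.1 / k)⁻¹) * (p.1 * (δ p.1 p.2 * logGrowth (p.1 / k))))
        ≤ 2 * amplitudeConst * ((1 + k) * (2 * M * infraredLog k)) := by
      have := hps.mul_logGrowth_le hs hk0
      have := (hps.pos _ hs).le
      have := one_le_logGrowth hy.le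
      have : 0 < p.1 := by linarith
      gcongr
    have h7 : k ≤ (1 + k) * infraredLog k := by nlinarith
    have hIk : ‖Complex.I * (k : ℂ)‖ = k := by
      rw [norm_mul, Complex.norm_I, one_mul, Complex.norm_real, Real.norm_eq_abs, abs_of_pos hk0]
    have hnn : 0 ≤ 2 * amplitudeConst * ((1 + k) * (2 * M * infraredLog k)) := by positivity
    refine ⟨?_, ?_, ?_⟩
    · have h6 := norm_le_norm_sub_add ((p.1 : ℂ) * (momentumAmplitude (δ p.1 p.2) (p.1 / k)
        - fieldAmplitude (δ p.1 p.2) (p.1 / k))) (Complex.I * k)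
      rw [hIk] at h6
      linarith
    · refine (norm_add_le _ _).trans ?_
      have : 0 ≤ (1 + k) * infraredLog k := by positivity
      linarith
    · have d1 := hps.hasDerivAt_momentumAmplitude hk0 hs
      have d2 := hps.hasDerivAt_fieldAmplitude hk0 hs
      have d3 : HasDerivAt (fun H : ℝ => (H : ℂ)) 1 p.1 := by
        simpa using (hasDerivAt_id p.1).ofReal_comp
      refine (d3.mul (d1.sub d2)).congr_deriv ?_
      have : (p.1 : ℂ) ≠ 0 := by exact_mod_cast (by linarith : p.1 ≠ 0)
      simp only [Pi.sub_apply]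
      field_simp
      ring
  · intro k hk
    rw [tendsto_iff_norm_sub_tendsto_zero]
    refine squeeze_zero' (Eventually.of_forall fun _ => norm_nonneg _) ?_ (hzero k hk)
    filter_upwards [hU] with p hp
    exact (hest k hk p hp).1
  · intro k hk
    have h := (hzero k hk).add (hzero k hk)
    rw [add_zero] at h
    refine squeeze_zero_norm' ?_ h
    filter_upwards [hU] with p hp
    exact (norm_add_le _ _).trans (add_le_add (hest k hk p hp).1 (hest k hk p hp).2)

theorem isSlowAmplitude_leading (hl : IsRegime δ κ q κ₀ l) :
    IsSlowAmplitude l (fun H m k => leadingAmplitude (δ H m) (H / k)) (fun _ => 1) (Ioo 0 1)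
      infraredLog := by
  obtain ⟨M, hM, U, hU, hUp⟩ := hl.exists_isLightPath
  have hA := amplitudeConst_pos
  have hy : ∀ H k : ℝ, 1 < H → k ∈ Ioo (0 : ℝ) 1 → 1 < H / k := by
    intro H k hH hk
    rw [lt_div_iff₀ hk.1]
    linarith [hk.2]
  refine ⟨fun H m k => leadingRate (δ H m) (κ H m) (H / k),
    fun H m => (measurable_leadingAmplitude _).comp (by fun_prop),
    fun H m => (measurable_leadingRate _ _).comp (by fun_prop),
    ⟨amplitudeConst * (2 * M) + 1, U, hU, ?_⟩, ?_, ?_⟩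
  · intro k hk p hp
    have hk0 : (0 : ℝ) < k := hk.1
    obtain ⟨s, hs, hps⟩ := hUp p hp
    have hy' := hy _ _ (hps.one_lt _ hs) hk
    have h2 := norm_leadingAmplitude_sub_le (hps.pos _ hs).le (hps.le _ hs) hy'
    have h3 := norm_leadingRate_le (hps.pos _ hs).le (hps.le _ hs) (hps.abs_le _ hs) hy'
    have h4 := mul_le_mul_of_nonneg_left (hps.logGrowth_le hs hk0) hA.le
    have h5 := one_le_infraredLog hk0
    refine ⟨?_, by linarith, hps.hasDerivAt_leadingAmplitude hk0 hk.2.le hs⟩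
    have h6 := norm_le_norm_sub_add (leadingAmplitude (δ p.1 p.2) (p.1 / k)) 1
    rw [norm_one] at h6
    linarith
  · intro k hk
    have h := (hl.tendsto_logGrowth hk.1).const_mul amplitudeConst
    rw [mul_zero] at h
    rw [tendsto_iff_norm_sub_tendsto_zero]
    refine squeeze_zero' (Eventually.of_forall fun _ => norm_nonneg _) ?_ h
    filter_upwards [hU] with p hp
    obtain ⟨s, hs, hps⟩ := hUp p hp
    exact norm_leadingAmplitude_sub_le (hps.pos _ hs).le (hps.le _ hs)
      (hy _ _ (hps.one_lt _ hs) hk)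
  · intro k hk
    have h := (hl.tendsto_logGrowth hk.1).const_mul amplitudeConst
    rw [mul_zero] at h
    refine squeeze_zero_norm' ?_ h
    filter_upwards [hU] with p hp
    obtain ⟨s, hs, hps⟩ := hUp p hp
    exact norm_leadingRate_le (hps.pos _ hs).le (hps.le _ hs) (hps.abs_le _ hs)
      (hy _ _ (hps.one_lt _ hs) hk)

/-- The factor k in the bound is the point, because it turns k^(−3/2) into the square integrable
k^(−1/2). It comes from comparing the exact with the leading amplitude; the separate bounds of the
two amplitudes would lose it. -/
theorem isSlowAmplitude_remainder (hl : IsRegime δ κ q κ₀ l) :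
    IsSlowAmplitude l (fun H m k => fieldAmplitude (δ H m) (H / k)
      - leadingAmplitude (δ H m) (H / k)) (fun _ => 0) (Ioo 0 1)
      (fun k => k * infraredLog k) := by
  obtain ⟨f', f1, f2, ⟨C, T, hT, f3⟩, f4, f5⟩ := hl.isSlowAmplitude_field
  obtain ⟨g', g1, g2, ⟨D, T', hT', g3⟩, g4, g5⟩ := hl.isSlowAmplitude_leading
  obtain ⟨M, hM, U, hU, hUp⟩ := hl.exists_isLightPath
  have hA := amplitudeConst_pos
  have hy : ∀ H k : ℝ, 1 < H → k ∈ Ioo (0 : ℝ) 1 → 1 < H / k := by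
    intro H k hH hk
    rw [lt_div_iff₀ hk.1]
    linarith [hk.2]
  refine ⟨fun H m k => f' H m k - g' H m k, fun H m => (f1 H m).sub (g1 H m),
    fun H m => (f2 H m).sub (g2 H m), ⟨2 * amplitudeConst, U ∩ (T ∩ T'),
      inter_mem hU (inter_mem hT hT'), ?_⟩, ?_, ?_⟩
  · intro k hk p hp
    have hk0 : (0 : ℝ) < k := hk.1
    obtain ⟨s, hs, hps⟩ := hUp p hp.1
    have h1 := hps.one_lt _ hs
    have h0 : p.1 ≠ 0 := by linarith
    have hy' := hy _ _ h1 hk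
    have h2 := norm_fieldAmplitude_sub_leadingAmplitude_le (hps.pos _ hs).le (hps.le _ hs) hy'
    have h3 := norm_fieldRate_sub_leadingRate_le (hps.pos _ hs).le (hps.le _ hs)
      (hps.abs_le _ hs) hy'
    have h5 := one_le_infraredLog hk0
    have d1 := (f3 k hk0 p hp.2.1).2.2
    have d2 := (g3 k hk p hp.2.2).2.2
    have hcancel : ∀ {a b : ℂ}, a / p.1 = b / p.1 → a = b := fun {a b} h => by
      have h0' : (p.1 : ℂ) ≠ 0 := by exact_mod_cast h0
      field_simp at h
      exact h
    -- The rates obtained from the two slow amplitudes are opaque. Uniqueness of derivatives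
    -- identifies them with the explicit rates, to which the comparison estimate applies.
    have e1 := hcancel (d1.unique (hps.hasDerivAt_fieldAmplitude hk0 hs))
    have e2 := hcancel (d2.unique (hps.hasDerivAt_leadingAmplitude hk0 hk.2.le hs))
    have hx : (p.1 / k)⁻¹ ≤ k := by
      rw [inv_div]
      exact div_le_self hk0.le h1.le
    have hz : logGrowth (p.1 / k) / (p.1 / k) ≤ 2 * (k * infraredLog k) := by
      have h6 := logGrowth_div_le (show 0 < p.1 by linarith) hk0
      have h7 := log_one_add_le (show 0 < p.1 by linarith)
      rw [div_div_eq_mul_div, div_le_iff₀ (by linarith)]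
      have h8 : logGrowth (p.1 / k) ≤ 2 * infraredLog k * p.1 := by nlinarith
      calc _ ≤ 2 * infraredLog k * p.1 * k := by gcongr
        _ = _ := by ring
    refine ⟨?_, ?_, ?_⟩
    · refine h2.trans ?_
      have : (p.1 / k)⁻¹ ≤ 2 * (k * infraredLog k) := by nlinarith
      calc _ ≤ amplitudeConst * (2 * (k * infraredLog k)) := by gcongr
        _ = _ := by ring
    · beta_reduce
      rw [e1, e2]
      refine h3.trans ?_
      calc _ ≤ amplitudeConst * (2 * (k * infraredLog k)) := by gcongr
        _ = _ := by ring
    · exact (d1.sub d2).congr_deriv (by ring)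
  · intro k hk
    simpa using (f4 k hk.1).sub (g4 k hk)
  · intro k hk
    simpa using (f5 k hk.1).sub (g5 k hk)

end IsRegime

/-! ## Tensor products of profiles and amplitudes -/

/-- The Hilbert space `ℂ ⊗ ℂ` over the real numbers. -/
abbrev TwoModes : Type := WithLp 2 (ℂ × ℂ)

/-- The elementary tensor `w ⊗ τ`. -/
def tensor (w τ : ℂ) : TwoModes := WithLp.toLp 2 ((τ.re : ℂ) * w, (τ.im : ℂ) * w)

/-- The integrands of the covariance are products of two real parts, one of the profiles and one of
the amplitudes. This is the inner product of ℂ ⊗ ℂ over ℝ, so the covariance matrix becomes a Gram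
matrix. -/
theorem inner_tensor (w τ w' τ' : ℂ) :
    inner ℝ (tensor w τ) (tensor w' τ') = (w * conj w').re * (τ * conj τ').re := by
  rw [WithLp.prod_inner_apply]
  simp only [tensor, Complex.inner, map_mul, Complex.conj_ofReal, Complex.mul_re, Complex.mul_im,
    Complex.ofReal_re, Complex.ofReal_im, Complex.conj_re, Complex.conj_im]
  ring

theorem norm_tensor (w τ : ℂ) : ‖tensor w τ‖ = ‖w‖ * ‖τ‖ := by
  rw [← sq_eq_sq₀ (norm_nonneg _) (by positivity), ← real_inner_self_eq_norm_sq, inner_tensor,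
    mul_pow, Complex.mul_conj, Complex.mul_conj, Complex.ofReal_re, Complex.ofReal_re,
    Complex.normSq_eq_norm_sq, Complex.normSq_eq_norm_sq]

theorem tensor_add_left (w w' τ : ℂ) : tensor (w + w') τ = tensor w τ + tensor w' τ := by
  rw [tensor, tensor, tensor, ← WithLp.toLp_add, Prod.mk_add_mk, mul_add, mul_add]

theorem tensor_add_right (w τ τ' : ℂ) : tensor w (τ + τ') = tensor w τ + tensor w τ' := by
  rw [tensor, tensor, tensor, ← WithLp.toLp_add, Prod.mk_add_mk, Complex.add_re, Complex.add_im]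
  push_cast
  rw [add_mul, add_mul]

theorem tensor_smul_left (c : ℝ) (w τ : ℂ) : tensor (c * w) τ = c • tensor w τ := by
  rw [tensor, tensor, ← WithLp.toLp_smul, Prod.smul_mk, Complex.real_smul, Complex.real_smul,
    mul_left_comm, mul_left_comm (τ.im : ℂ)]

theorem tensor_smul_right (c : ℝ) (w τ : ℂ) : tensor w (c * τ) = c • tensor w τ := by
  rw [tensor, tensor, ← WithLp.toLp_smul, Prod.smul_mk, Complex.real_smul, Complex.real_smul,
    Complex.re_ofReal_mul, Complex.im_ofReal_mul]
  push_cast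
  rw [mul_assoc, mul_assoc]

theorem tensor_zero_left (τ : ℂ) : tensor 0 τ = 0 := by
  rw [← norm_eq_zero, norm_tensor, norm_zero, zero_mul]

/-- The tensor product as a continuous bilinear map. -/
def tensorL : ℂ →L[ℝ] ℂ →L[ℝ] TwoModes :=
  LinearMap.mkContinuous₂ (LinearMap.mk₂ ℝ tensor tensor_add_left
    (fun c w τ => by rw [Complex.real_smul, tensor_smul_left]) tensor_add_right
    (fun c w τ => by rw [Complex.real_smul, tensor_smul_right])) 1
    (fun w τ => by rw [LinearMap.mk₂_apply, norm_tensor, one_mul])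

theorem tensorL_apply (w τ : ℂ) : tensorL w τ = tensor w τ := rfl

theorem continuous_waveNumber : Continuous waveNumber := by
  unfold waveNumber
  fun_prop

theorem waveNumber_nonneg (ξ : Space3) : 0 ≤ waveNumber ξ := by
  have := Real.pi_pos
  rw [waveNumber]
  positivity

theorem ae_waveNumber_pos : ∀ᵐ ξ : Space3, 0 < waveNumber ξ := by
  have h : ∀ᵐ ξ : Space3, ξ ≠ 0 := by
    rw [ae_iff]
    simp
  filter_upwards [h] with ξ hξ
  have := Real.pi_pos
  have := norm_pos_iff.2 hξ
  rw [waveNumber]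
  positivity

theorem aestronglyMeasurable_tensor {φ : Space3 → ℂ} (hφ : AEStronglyMeasurable φ volume)
    {τ : ℝ → ℂ} (hτ : Measurable τ) :
    AEStronglyMeasurable (fun ξ => tensor (φ ξ) (τ (waveNumber ξ))) volume :=
  tensorL.aestronglyMeasurable_comp₂ hφ
    (hτ.comp continuous_waveNumber.measurable).aestronglyMeasurable

/-- The condition k ∈ K is required only where the profile is nonzero. So amplitudes that are
controlled for k < 1 alone can be combined with low-pass profiles. -/
theorem IsSlowAmplitude.isSlowField {l : Filter (ℝ × ℝ)} {τ : ℝ → ℝ → ℝ → ℂ} {τ₀ : ℝ → ℂ}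
    {K : Set ℝ} {β : ℝ → ℝ} (hτ : IsSlowAmplitude l τ τ₀ K β) {φ : Space3 → ℂ} {b : Space3 → ℝ}
    (hφ : AEStronglyMeasurable φ volume) (hb0 : ∀ ξ, 0 ≤ b ξ) (hβ : ∀ k ∈ K, 0 ≤ β k) (D : ℝ)
    (hb : ∀ᵐ ξ, φ ξ ≠ 0 → waveNumber ξ ∈ K ∧ ‖φ ξ‖ * β (waveNumber ξ) ≤ D * b ξ) :
    IsSlowField volume l (fun H m ξ => tensor (φ ξ) (τ H m (waveNumber ξ)))
      (fun ξ => tensor (φ ξ) (τ₀ (waveNumber ξ))) b := by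
  obtain ⟨τ', t1, t2, ⟨C, U, hU, t3⟩, t4, t5⟩ := hτ
  refine ⟨fun H m ξ => tensor (φ ξ) (τ' H m (waveNumber ξ)),
    fun H m => aestronglyMeasurable_tensor hφ (t1 H m),
    fun H m => aestronglyMeasurable_tensor hφ (t2 H m), ⟨|C| * |D|, U, hU, ?_⟩, ?_, ?_⟩
  · filter_upwards [hb] with ξ hξ p hp
    by_cases h0 : φ ξ = 0
    · have := hb0 ξ
      simp only [h0, tensor_zero_left, norm_zero, smul_zero]
      exact ⟨by positivity, by positivity, hasDerivAt_const _ _⟩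
    · obtain ⟨hK, hD⟩ := hξ h0
      obtain ⟨a1, a2, a3⟩ := t3 _ hK p hp
      have hβ0 := hβ _ hK
      have key : ∀ z : ℂ, ‖z‖ ≤ C * β (waveNumber ξ) → ‖φ ξ‖ * ‖z‖ ≤ |C| * |D| * b ξ := by
        intro z hz
        have hb := hb0 ξ
        calc ‖φ ξ‖ * ‖z‖ ≤ ‖φ ξ‖ * (|C| * β (waveNumber ξ)) := by
              gcongr
              exact hz.trans (mul_le_mul_of_nonneg_right (le_abs_self C) hβ0)
          _ = |C| * (‖φ ξ‖ * β (waveNumber ξ)) := by ring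
          _ ≤ |C| * (|D| * b ξ) := mul_le_mul_of_nonneg_left
              (hD.trans (mul_le_mul_of_nonneg_right (le_abs_self D) hb)) (abs_nonneg C)
          _ = _ := by ring
      refine ⟨?_, ?_, ?_⟩
      · rw [norm_tensor]
        exact key _ a1
      · rw [norm_tensor]
        exact key _ a2
      · have := (tensorL (φ ξ)).hasFDerivAt.comp_hasDerivAt p.1 a3
        refine this.congr_deriv ?_
        rw [tensorL_apply, ← tensor_smul_right]
        congr 1
        push_cast
        ring
  · filter_upwards [hb] with ξ hξ
    by_cases h0 : φ ξ = 0
    · simp only [h0, tensor_zero_left]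
      exact tendsto_const_nhds
    · exact ((tensorL (φ ξ)).continuous.tendsto _).comp (t4 _ (hξ h0).1)
  · filter_upwards [hb] with ξ hξ
    by_cases h0 : φ ξ = 0
    · simp only [h0, tensor_zero_left]
      exact tendsto_const_nhds
    · have := ((tensorL (φ ξ)).continuous.tendsto _).comp (t5 _ (hξ h0).1)
      rwa [map_zero] at this

/-! ## Radial integrals -/

/-- The volume of the unit sphere in units of `(2π)³`. -/
def radialConst : ℝ := 3 * (volume : Measure Space3).real (Metric.ball 0 1) / (2 * Real.pi) ^ 3

theorem radialConst_pos : 0 < radialConst := by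
  have h : 0 < (volume : Measure Space3).real (Metric.ball 0 1) :=
    ENNReal.toReal_pos (Metric.measure_ball_pos volume _ one_pos).ne' measure_ball_lt_top.ne
  have := Real.pi_pos
  rw [radialConst]
  positivity

theorem integral_comp_waveNumber (f : ℝ → ℝ) :
    ∫ ξ : Space3, f (waveNumber ξ) = radialConst * ∫ k in Ioi (0 : ℝ), k ^ 2 * f k := by
  have hpi := Real.pi_pos
  have h1 := integral_fun_norm_addHaar (volume : Measure Space3) fun r => f (2 * Real.pi * r)
  have h2 := integral_comp_mul_left_Ioi (fun k => k ^ 2 * f k) 0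
    (show 0 < 2 * Real.pi by positivity)
  rw [mul_zero] at h2
  have h3 : ∫ y in Ioi (0 : ℝ), y ^ 2 * f (2 * Real.pi * y)
      = ((2 * Real.pi) ^ 2)⁻¹ * ∫ y in Ioi (0 : ℝ), (2 * Real.pi * y) ^ 2 * f (2 * Real.pi * y) := by
    rw [← integral_const_mul]
    refine integral_congr_ae (Eventually.of_forall fun y => ?_)
    simp only
    field_simp
  simp only [finrank_euclideanSpace_fin, nsmul_eq_mul, smul_eq_mul, Nat.reduceSub] at h1
  simp only [waveNumber]
  rw [h1, h3, h2, radialConst, smul_eq_mul]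
  push_cast
  field_simp

theorem integrable_comp_waveNumber {f : ℝ → ℝ}
    (hf : IntegrableOn (fun k => k ^ 2 * f k) (Ioi 0)) :
    Integrable (fun ξ : Space3 => f (waveNumber ξ)) := by
  have hpi := Real.pi_pos
  have h0 : 0 < 2 * Real.pi := by positivity
  refine (integrable_fun_norm_addHaar (volume : Measure Space3)
    (f := fun r => f (2 * Real.pi * r))).2 ?_
  have h := ((integrableOn_Ioi_comp_mul_left_iff (fun k => k ^ 2 * f k) 0 h0).2
    (by rwa [mul_zero])).const_mul ((2 * Real.pi) ^ 2)⁻¹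
  refine h.congr (Eventually.of_forall fun y => ?_)
  simp only [finrank_euclideanSpace_fin, Nat.reduceSub, smul_eq_mul]
  field_simp

/-- The indicator function of the wave numbers below one. -/
def lowPass (k : ℝ) : ℝ := if k < 1 then 1 else 0

theorem measurable_lowPass : Measurable lowPass :=
  Measurable.ite measurableSet_Iio measurable_const measurable_const

/-- Any small power would do: squared, the quarter power costs k^(−1/2), and k^(−2−1/2) is still
integrable at the origin of three-space. The 9 is 1 + 4·2, from log x ≤ 4 x^(1/4). -/
theorem infraredLog_le {k : ℝ} (hk : 0 < k) (hk' : k < 1) :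
    infraredLog k ≤ 9 * k ^ (-(1 / 4) : ℝ) := by
  have h1 := Real.log_le_rpow_div (x := 1 + k⁻¹) (by positivity) (show (0 : ℝ) < 1 / 4 by norm_num)
  have h3 : 1 ≤ k⁻¹ := (one_le_inv₀ hk).2 hk'.le
  have h2 : (1 + k⁻¹) ^ (1 / 4 : ℝ) ≤ 2 * k ^ (-(1 / 4) : ℝ) := by
    calc (1 + k⁻¹) ^ (1 / 4 : ℝ) ≤ (2 * k⁻¹) ^ (1 / 4 : ℝ) := by
          gcongr
          linarith
      _ = 2 ^ (1 / 4 : ℝ) * k ^ (-(1 / 4) : ℝ) := by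
          rw [Real.mul_rpow zero_le_two (by positivity), Real.inv_rpow hk.le, Real.rpow_neg hk.le]
      _ ≤ 2 ^ (1 : ℝ) * k ^ (-(1 / 4) : ℝ) := by
          gcongr
          · exact one_le_two
          · norm_num
      _ = _ := by rw [Real.rpow_one]
  have h4 : 1 ≤ k ^ (-(1 / 4) : ℝ) :=
    Real.one_le_rpow_of_pos_of_le_one_of_nonpos hk hk'.le (by norm_num)
  rw [infraredLog, logGrowth]
  linarith

theorem measurable_infraredLog : Measurable infraredLog := by
  unfold infraredLog logGrowth
  fun_prop

theorem integrable_lowPass_mul {f : ℝ → ℝ} (hf : Measurable f) {C r : ℝ} (hr : -3 < r)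
    (hC : ∀ k, 0 < k → k < 1 → |f k| ≤ C * k ^ r) :
    Integrable (fun ξ : Space3 => lowPass (waveNumber ξ) * f (waveNumber ξ)) := by
  refine integrable_comp_waveNumber (f := fun k => lowPass k * f k) ?_
  have h1 : IntegrableOn (fun k : ℝ => C * k ^ (2 + r)) (Ioo 0 1) :=
    ((intervalIntegral.integrableOn_Ioo_rpow_iff one_pos).2 (by linarith)).const_mul C
  have h2 : IntegrableOn (fun k : ℝ => k ^ 2 * (lowPass k * f k)) (Ioo 0 1) := by
    refine Integrable.mono' h1 ?_ ?_
    · have := measurable_lowPass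
      exact Measurable.aestronglyMeasurable (by fun_prop)
    · filter_upwards [ae_restrict_mem measurableSet_Ioo] with k hk
      rw [lowPass, if_pos hk.2, one_mul, Real.norm_eq_abs, abs_mul, abs_of_nonneg (sq_nonneg k),
        Real.rpow_add hk.1, Real.rpow_two, mul_left_comm]
      exact mul_le_mul_of_nonneg_left (hC k hk.1 hk.2) (sq_nonneg k)
  have h3 : IntegrableOn (fun k : ℝ => k ^ 2 * (lowPass k * f k)) (Ici 1) := by
    refine IntegrableOn.congr_fun (integrableOn_zero) (fun k hk => ?_) measurableSet_Ici
    rw [lowPass, if_neg (not_lt.2 hk)]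
    ring
  have := h2.union h3
  rwa [Ioo_union_Ici_eq_Ioi zero_lt_one] at this

/-- The bound for the infrared part of the modes. -/
def infraredBound (ξ : Space3) : ℝ :=
  lowPass (waveNumber ξ) * (waveNumber ξ ^ (-(3 / 2) : ℝ) * infraredLog (waveNumber ξ))

/-- The bound for the regular part of the modes; `N` bounds the short wave lengths. -/
def regularBound (N : Space3 → ℝ) (ξ : Space3) : ℝ :=
  lowPass (waveNumber ξ) * (waveNumber ξ ^ (-(1 / 2) : ℝ) * infraredLog (waveNumber ξ))
    + (1 - lowPass (waveNumber ξ)) * N ξ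

theorem lowPass_nonneg (k : ℝ) : 0 ≤ lowPass k := by
  rw [lowPass]
  split <;> norm_num

theorem lowPass_le_one (k : ℝ) : lowPass k ≤ 1 := by
  rw [lowPass]
  split <;> norm_num

theorem infraredLog_nonneg {k : ℝ} (hk : 0 ≤ k) : 0 ≤ infraredLog k :=
  zero_le_one.trans (one_le_logGrowth (by positivity))

theorem infraredBound_nonneg (ξ : Space3) : 0 ≤ infraredBound ξ := by
  have h1 := lowPass_nonneg (waveNumber ξ)
  have h2 := waveNumber_nonneg ξ
  have h3 := infraredLog_nonneg h2
  rw [infraredBound]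
  positivity

section

variable {N : Space3 → ℝ}

theorem regularBound_nonneg (hN : ∀ ξ, 0 ≤ N ξ) (ξ : Space3) : 0 ≤ regularBound N ξ := by
  have h1 := lowPass_nonneg (waveNumber ξ)
  have h2 := waveNumber_nonneg ξ
  have h3 := infraredLog_nonneg h2
  have h4 := sub_nonneg.2 (lowPass_le_one (waveNumber ξ))
  have h5 := hN ξ
  rw [regularBound]
  positivity

theorem regularBound_of_lt {ξ : Space3} (h : waveNumber ξ < 1) :
    regularBound N ξ = waveNumber ξ ^ (-(1 / 2) : ℝ) * infraredLog (waveNumber ξ) := by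
  rw [regularBound, lowPass, if_pos h]
  ring

theorem regularBound_of_le {ξ : Space3} (h : 1 ≤ waveNumber ξ) : regularBound N ξ = N ξ := by
  rw [regularBound, lowPass, if_neg (not_lt.2 h)]
  ring

theorem rpow_mul_infraredLog_sq_le {k r : ℝ} (hk : 0 < k) (hk' : k < 1) :
    |k ^ r * infraredLog k ^ 2| ≤ 81 * k ^ (r - 1 / 2) := by
  have h1 := infraredLog_le hk hk'
  have h2 := infraredLog_nonneg hk.le
  rw [abs_of_nonneg (by positivity)]
  calc _ ≤ k ^ r * (9 * k ^ (-(1 / 4) : ℝ)) ^ 2 := by gcongr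
    _ = 81 * (k ^ r * (k ^ (-(1 / 4) : ℝ) * k ^ (-(1 / 4) : ℝ))) := by ring
    _ = _ := by
        rw [← Real.rpow_add hk, ← Real.rpow_add hk]
        congr 2
        ring

/-- The cross term is k^(−2) up to logarithms, hence integrable near zero. The square k^(−3) of the
infrared bound is not, so the norm of the infrared vector cannot be treated by domination. -/
theorem integrable_infraredBound_mul (N : Space3 → ℝ) :
    Integrable (fun ξ => infraredBound ξ * regularBound N ξ) := by
  have hm := measurable_infraredLog
  refine (integrable_lowPass_mul (f := fun k => k ^ (-2 : ℝ) * infraredLog k ^ 2) (by fun_prop)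
    (show -3 < (-2 : ℝ) - 1 / 2 by norm_num)
    (fun k hk hk' => rpow_mul_infraredLog_sq_le hk hk')).congr ?_
  filter_upwards [ae_waveNumber_pos] with ξ hξ
  rcases lt_or_ge (waveNumber ξ) 1 with h | h
  · rw [regularBound_of_lt h, infraredBound, lowPass, if_pos h,
      show (-2 : ℝ) = -(3 / 2) + -(1 / 2) by norm_num, Real.rpow_add hξ]
    ring
  · rw [infraredBound, lowPass, if_neg (not_lt.2 h)]
    ring

theorem integrable_regularBound_mul_self (hN : Integrable fun ξ => N ξ ^ 2) :
    Integrable (fun ξ => regularBound N ξ * regularBound N ξ) := by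
  have hm := measurable_infraredLog
  have h1 := integrable_lowPass_mul (f := fun k => k ^ (-1 : ℝ) * infraredLog k ^ 2) (by fun_prop)
    (show -3 < (-1 : ℝ) - 1 / 2 by norm_num)
    (fun k hk hk' => rpow_mul_infraredLog_sq_le hk hk')
  have h2 : Integrable (fun ξ => (1 - lowPass (waveNumber ξ)) * N ξ ^ 2) := by
    refine Integrable.bdd_mul (c := 1) hN ?_ ?_
    · have := measurable_lowPass.comp continuous_waveNumber.measurable
      exact (measurable_const.sub this).aestronglyMeasurable
    · refine Eventually.of_forall fun ξ => ?_
      have a := lowPass_nonneg (waveNumber ξ)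
      have b := lowPass_le_one (waveNumber ξ)
      rw [Real.norm_eq_abs, abs_of_nonneg (by linarith)]
      linarith
  refine (h1.add h2).congr ?_
  filter_upwards [ae_waveNumber_pos] with ξ hξ
  simp only [Pi.add_apply]
  rcases lt_or_ge (waveNumber ξ) 1 with h | h
  · rw [regularBound_of_lt h, lowPass, if_pos h,
      show (-1 : ℝ) = -(1 / 2) + -(1 / 2) by norm_num, Real.rpow_add hξ]
    ring
  · rw [regularBound_of_le h, lowPass, if_neg (not_lt.2 h)]
    ring

end

/-- The radial integral of k^(2δ−1) over (0, 1) is 1/(2δ). This is the infrared enhancement that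
drives the growth of the determinant. -/
theorem integral_lowPass_rpow {δ : ℝ} (hδ : 0 < δ) :
    ∫ ξ : Space3, lowPass (waveNumber ξ) * waveNumber ξ ^ (-3 + 2 * δ)
      = radialConst / (2 * δ) := by
  rw [integral_comp_waveNumber fun k => lowPass k * k ^ (-3 + 2 * δ)]
  have h1 : ∫ k in Ioi (0 : ℝ), k ^ 2 * (lowPass k * k ^ (-3 + 2 * δ))
      = ∫ k in Ioc (0 : ℝ) 1, k ^ (2 * δ - 1) := by
    rw [← integral_indicator measurableSet_Ioi, integral_Ioc_eq_integral_Ioo,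
      ← integral_indicator measurableSet_Ioo]
    congr 1
    ext k
    simp only [indicator, mem_Ioi, mem_Ioo, lowPass]
    by_cases h0 : 0 < k
    · by_cases h1 : k < 1
      · rw [if_pos h0, if_pos h1, if_pos ⟨h0, h1⟩, one_mul, ← Real.rpow_two,
          ← Real.rpow_add h0]
        congr 1
        ring
      · simp [h1]
    · simp [h0]
  rw [h1, ← intervalIntegral.integral_of_le zero_le_one, integral_rpow (Or.inl (by linarith)),
    sub_add_cancel, Real.one_rpow, Real.zero_rpow (by linarith), sub_zero]
  ring

/-! ## The modes of a localized field as slow vector fields -/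

/-- Near zero wave number, `φ` is the constant `c` up to terms of first order; at short wave
lengths it is bounded by `N`. -/
def IsProfile (N : Space3 → ℝ) (φ : Space3 → ℂ) (c : ℝ) : Prop :=
  AEStronglyMeasurable φ volume ∧ ∃ C, ∀ᵐ ξ : Space3,
    (waveNumber ξ < 1 → ‖φ ξ - c‖ ≤ C * waveNumber ξ) ∧
    (1 ≤ waveNumber ξ → waveNumber ξ ^ (-(1 / 2) : ℝ) * ‖φ ξ‖ ≤ N ξ)

/-- The stronger form of `IsProfile` for the functions that smear the momentum. -/
def IsMomentumProfile (N : Space3 → ℝ) (φ : Space3 → ℂ) (c : ℝ) : Prop :=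
  AEStronglyMeasurable φ volume ∧ ∃ C, ∀ᵐ ξ : Space3,
    (waveNumber ξ < 1 → ‖φ ξ - c‖ ≤ C * waveNumber ξ) ∧
    (1 ≤ waveNumber ξ → waveNumber ξ ^ (1 / 2 : ℝ) * ‖φ ξ‖ ≤ N ξ)

theorem IsMomentumProfile.isProfile {N : Space3 → ℝ} {φ : Space3 → ℂ} {c : ℝ}
    (h : IsMomentumProfile N φ c) : IsProfile N φ c := by
  obtain ⟨h1, C, h2⟩ := h
  refine ⟨h1, C, ?_⟩
  filter_upwards [h2] with ξ hξ
  refine ⟨hξ.1, fun hk => le_trans ?_ (hξ.2 hk)⟩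
  gcongr
  norm_num

/-- The profile `φ` without its value `c` at long wave lengths. -/
def reduced (φ : Space3 → ℂ) (c : ℝ) (ξ : Space3) : ℂ :=
  φ ξ - ((c * lowPass (waveNumber ξ) : ℝ) : ℂ)

/-- The field modes with the profile `φ`. -/
def fieldVector (δ : ℝ → ℝ → ℝ) (φ : Space3 → ℂ) (H m : ℝ) (ξ : Space3) : TwoModes :=
  tensor (((waveNumber ξ ^ (-(3 / 2) : ℝ) : ℝ) : ℂ) * φ ξ)
    (fieldAmplitude (δ H m) (H / waveNumber ξ))

/-- The momentum modes with the profile `φ`. -/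
def momentumVector (δ : ℝ → ℝ → ℝ) (φ : Space3 → ℂ) (H m : ℝ) (ξ : Space3) : TwoModes :=
  tensor (((waveNumber ξ ^ (1 / 2 : ℝ) : ℝ) : ℂ) * φ ξ)
    (momentumAmplitude (δ H m) (H / waveNumber ξ))

/-- The modes with the profile `φ` and the difference of the two amplitudes. -/
def differenceVector (δ : ℝ → ℝ → ℝ) (φ : Space3 → ℂ) (H m : ℝ) (ξ : Space3) : TwoModes :=
  tensor (((waveNumber ξ ^ (1 / 2 : ℝ) : ℝ) : ℂ) * φ ξ)
    (H * (momentumAmplitude (δ H m) (H / waveNumber ξ)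
      - fieldAmplitude (δ H m) (H / waveNumber ξ)))

/-- The leading part of the modes of long wave length. -/
def infraredVector (δ : ℝ → ℝ → ℝ) (H m : ℝ) (ξ : Space3) : TwoModes :=
  tensor ((lowPass (waveNumber ξ) * waveNumber ξ ^ (-(3 / 2) : ℝ) : ℝ) : ℂ)
    (leadingAmplitude (δ H m) (H / waveNumber ξ))

/-- The correction to the modes of long wave length. -/
def remainderVector (δ : ℝ → ℝ → ℝ) (H m : ℝ) (ξ : Space3) : TwoModes :=
  tensor ((lowPass (waveNumber ξ) * waveNumber ξ ^ (-(3 / 2) : ℝ) : ℝ) : ℂ)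
    (fieldAmplitude (δ H m) (H / waveNumber ξ) - leadingAmplitude (δ H m) (H / waveNumber ξ))

/-- Isolates the only part that is not uniformly square integrable as δ → 0: the constant c below k
= 1, and of its amplitude only the leading part. -/
theorem fieldVector_eq (δ : ℝ → ℝ → ℝ) (φ : Space3 → ℂ) (c H m : ℝ) (ξ : Space3) :
    fieldVector δ φ H m ξ = fieldVector δ (reduced φ c) H m ξ
      + c • (infraredVector δ H m ξ + remainderVector δ H m ξ) := by
  rw [infraredVector, remainderVector, ← tensor_add_right, add_sub_cancel, ← tensor_smul_left,
    fieldVector, fieldVector, ← tensor_add_left, reduced]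
  congr 1
  push_cast
  ring

theorem infraredLog_le_one_add {k : ℝ} (hk : 1 ≤ k) : infraredLog k ≤ 2 := by
  have h1 : k⁻¹ ≤ 1 := inv_le_one_of_one_le₀ hk
  have h2 := Real.log_le_sub_one_of_pos (show 0 < 1 + k⁻¹ by positivity)
  rw [infraredLog, logGrowth]
  linarith

theorem norm_ofReal_rpow_mul {k : ℝ} (hk : 0 < k) (s : ℝ) (z : ℂ) :
    ‖((k ^ s : ℝ) : ℂ) * z‖ = k ^ s * ‖z‖ := by
  rw [norm_mul, Complex.norm_real, Real.norm_eq_abs, abs_of_pos (Real.rpow_pos_of_pos hk s)]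

theorem aestronglyMeasurable_rpow_mul {φ : Space3 → ℂ} (hφ : AEStronglyMeasurable φ volume)
    (s : ℝ) : AEStronglyMeasurable (fun ξ => ((waveNumber ξ ^ s : ℝ) : ℂ) * φ ξ) volume := by
  have h := continuous_waveNumber.measurable
  exact (Measurable.aestronglyMeasurable (by fun_prop)).mul hφ

theorem aestronglyMeasurable_reduced {φ : Space3 → ℂ} (hφ : AEStronglyMeasurable φ volume)
    (c : ℝ) : AEStronglyMeasurable (reduced φ c) volume := by
  have h := measurable_lowPass.comp continuous_waveNumber.measurable
  exact hφ.sub (Complex.measurable_ofReal.comp (h.const_mul c)).aestronglyMeasurable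

namespace IsRegime

variable {δ κ : ℝ → ℝ → ℝ} {q κ₀ : ℝ} {l : Filter (ℝ × ℝ)} {N : Space3 → ℝ} {φ : Space3 → ℂ}
  {c : ℝ}

/-- For k < 1 the Lipschitz bound on the reduced profile gains a factor k. For k ≥ 1 the growth 1 +
k of the amplitude bound turns k^(−3/2) into the Sobolev weight k^(−1/2). -/
theorem isSlowField_fieldVector (hl : IsRegime δ κ q κ₀ l) (hN : ∀ ξ, 0 ≤ N ξ)
    (hφ : IsProfile N φ c) :
    IsSlowField volume l (fieldVector δ (reduced φ c))
      (fun ξ => tensor (((waveNumber ξ ^ (-(3 / 2) : ℝ) : ℝ) : ℂ) * reduced φ c ξ) 1)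
      (regularBound N) := by
  obtain ⟨hm, C, hC⟩ := hφ
  refine hl.isSlowAmplitude_field.isSlowField
    (aestronglyMeasurable_rpow_mul (aestronglyMeasurable_reduced hm c) _)
    (regularBound_nonneg hN) (fun k hk => ?_) (2 * |C| + 4) ?_
  · have := infraredLog_nonneg (le_of_lt (show (0 : ℝ) < k from hk))
    have : (0 : ℝ) < k := hk
    positivity
  · filter_upwards [hC, ae_waveNumber_pos] with ξ hξ h0 _
    refine ⟨h0, ?_⟩
    set k := waveNumber ξ with hk
    have hlog := infraredLog_nonneg h0.le
    rw [norm_ofReal_rpow_mul h0]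
    rcases lt_or_ge k 1 with h | h
    · rw [regularBound_of_lt h, reduced, lowPass, ← hk, if_pos h, mul_one]
      have h1 : ‖φ ξ - c‖ ≤ |C| * k :=
        (hξ.1 h).trans (mul_le_mul_of_nonneg_right (le_abs_self C) h0.le)
      have h2 : k ^ (-(3 / 2) : ℝ) * k = k ^ (-(1 / 2) : ℝ) := by
        rw [← Real.rpow_add_one h0.ne']
        norm_num
      calc _ ≤ k ^ (-(3 / 2) : ℝ) * (|C| * k) * (2 * infraredLog k) := by
            gcongr
            linarith
        _ = 2 * |C| * (k ^ (-(3 / 2) : ℝ) * k * infraredLog k) := by ring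
        _ = 2 * |C| * (k ^ (-(1 / 2) : ℝ) * infraredLog k) := by rw [h2]
        _ ≤ _ := by
            gcongr
            linarith
    · rw [regularBound_of_le h, reduced, lowPass, ← hk, if_neg (not_lt.2 h), mul_zero,
        Complex.ofReal_zero, sub_zero]
      have h1 := hξ.2 h
      have h2 : k ^ (-(3 / 2) : ℝ) * k = k ^ (-(1 / 2) : ℝ) := by
        rw [← Real.rpow_add_one h0.ne']
        norm_num
      have h3 := infraredLog_le_one_add h
      have h4 := hN ξ
      calc _ ≤ k ^ (-(3 / 2) : ℝ) * ‖φ ξ‖ * ((2 * k) * 2) := by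
            gcongr
            linarith
        _ = 4 * (k ^ (-(3 / 2) : ℝ) * k * ‖φ ξ‖) := by ring
        _ ≤ 4 * N ξ := by
            rw [h2]
            gcongr
        _ ≤ _ := by
            gcongr
            linarith [abs_nonneg C]

theorem isSlowField_momentumVector (hl : IsRegime δ κ q κ₀ l) (hN : ∀ ξ, 0 ≤ N ξ)
    (hφ : IsMomentumProfile N φ c) :
    IsSlowField volume l (momentumVector δ φ)
      (fun ξ => tensor (((waveNumber ξ ^ (1 / 2 : ℝ) : ℝ) : ℂ) * φ ξ) 1)
      (regularBound N) := by
  obtain ⟨hm, C, hC⟩ := hφ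
  refine hl.isSlowAmplitude_momentum.isSlowField (aestronglyMeasurable_rpow_mul hm _)
    (regularBound_nonneg hN)
    (fun k hk => infraredLog_nonneg (le_of_lt (show (0 : ℝ) < k from hk))) (|C| + |c| + 2) ?_
  filter_upwards [hC, ae_waveNumber_pos] with ξ hξ h0 _
  refine ⟨h0, ?_⟩
  set k := waveNumber ξ with hk
  have hlog := infraredLog_nonneg h0.le
  rw [norm_ofReal_rpow_mul h0]
  rcases lt_or_ge k 1 with h | h
  · rw [regularBound_of_lt h, ← hk]
    have h1 : ‖φ ξ - c‖ ≤ |C| * k :=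
      (hξ.1 h).trans (mul_le_mul_of_nonneg_right (le_abs_self C) h0.le)
    have h2 : ‖φ ξ‖ ≤ |C| + |c| + 2 := by
      have h3 := norm_le_norm_sub_add (φ ξ) c
      rw [Complex.norm_real, Real.norm_eq_abs] at h3
      nlinarith [abs_nonneg C]
    have h3 : k ^ (1 / 2 : ℝ) ≤ k ^ (-(1 / 2) : ℝ) :=
      Real.rpow_le_rpow_of_exponent_ge h0 h.le (by norm_num)
    calc _ ≤ k ^ (-(1 / 2) : ℝ) * (|C| + |c| + 2) * infraredLog k := by gcongr
      _ = _ := by ring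
  · rw [regularBound_of_le h]
    have h1 := hξ.2 h
    have h3 := infraredLog_le_one_add h
    have h4 := hN ξ
    calc _ ≤ N ξ * 2 := by gcongr
      _ ≤ _ := by nlinarith [abs_nonneg C, abs_nonneg c]

/-- The amplitude grows like k, so short waves must be controlled with the weight k^(3/2), one power
more than the Sobolev order 1/2 provides. The extra decay is the assumption on D. -/
theorem isSlowField_differenceVector (hl : IsRegime δ κ q κ₀ l) (hN : ∀ ξ, 0 ≤ N ξ)
    (hφ : IsMomentumProfile N φ c) {D : ℝ}
    (hD : ∀ᵐ ξ : Space3, 1 ≤ waveNumber ξ → waveNumber ξ ^ (3 / 2 : ℝ) * ‖φ ξ‖ ≤ D * N ξ) :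
    IsSlowField volume l (differenceVector δ φ)
      (fun ξ => tensor (((waveNumber ξ ^ (1 / 2 : ℝ) : ℝ) : ℂ) * φ ξ)
        (Complex.I * waveNumber ξ)) (regularBound N) := by
  obtain ⟨hm, C, hC⟩ := hφ
  refine hl.isSlowAmplitude_difference.isSlowField (aestronglyMeasurable_rpow_mul hm _)
    (regularBound_nonneg hN) (fun k hk => ?_) (2 * (|C| + |c| + 2) + 4 * |D|) ?_
  · have := infraredLog_nonneg (le_of_lt (show (0 : ℝ) < k from hk))
    have : (0 : ℝ) < k := hk
    positivity
  filter_upwards [hC, hD, ae_waveNumber_pos] with ξ hξ hDξ h0 _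
  refine ⟨h0, ?_⟩
  set k := waveNumber ξ with hk
  have hlog := infraredLog_nonneg h0.le
  rw [norm_ofReal_rpow_mul h0]
  rcases lt_or_ge k 1 with h | h
  · rw [regularBound_of_lt h, ← hk]
    have h1 : ‖φ ξ - c‖ ≤ |C| * k :=
      (hξ.1 h).trans (mul_le_mul_of_nonneg_right (le_abs_self C) h0.le)
    have h2 : ‖φ ξ‖ ≤ |C| + |c| + 2 := by
      have h3 := norm_le_norm_sub_add (φ ξ) c
      rw [Complex.norm_real, Real.norm_eq_abs] at h3
      nlinarith [abs_nonneg C]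
    have h3 : k ^ (1 / 2 : ℝ) ≤ k ^ (-(1 / 2) : ℝ) :=
      Real.rpow_le_rpow_of_exponent_ge h0 h.le (by norm_num)
    have h5 : 0 ≤ k ^ (-(1 / 2) : ℝ) * infraredLog k := by positivity
    calc _ ≤ k ^ (-(1 / 2) : ℝ) * (|C| + |c| + 2) * (2 * infraredLog k) := by
          gcongr
          linarith
      _ = 2 * (|C| + |c| + 2) * (k ^ (-(1 / 2) : ℝ) * infraredLog k) := by ring
      _ ≤ _ := by
          gcongr
          linarith [abs_nonneg D]
  · rw [regularBound_of_le h]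
    have h1 := hDξ h
    have h3 := infraredLog_le_one_add h
    have h4 := hN ξ
    have h2 : k ^ (1 / 2 : ℝ) * k = k ^ (3 / 2 : ℝ) := by
      rw [← Real.rpow_add_one h0.ne']
      norm_num
    calc _ ≤ k ^ (1 / 2 : ℝ) * ‖φ ξ‖ * (2 * k * 2) := by
          gcongr
          linarith
      _ = 4 * (k ^ (1 / 2 : ℝ) * k * ‖φ ξ‖) := by ring
      _ ≤ 4 * (|D| * N ξ) := by
          rw [h2]
          have := h1.trans (mul_le_mul_of_nonneg_right (le_abs_self D) h4)
          linarith
      _ ≤ _ := by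
          have : 0 ≤ 2 * (|C| + |c| + 2) * N ξ := by positivity
          linarith

theorem aestronglyMeasurable_lowPass_mul : AEStronglyMeasurable (fun ξ : Space3 =>
    ((lowPass (waveNumber ξ) * waveNumber ξ ^ (-(3 / 2) : ℝ) : ℝ) : ℂ)) volume := by
  have h1 := measurable_lowPass.comp continuous_waveNumber.measurable
  have h2 : Measurable fun ξ : Space3 => waveNumber ξ ^ (-(3 / 2) : ℝ) :=
    continuous_waveNumber.measurable.pow_const _
  exact (Complex.measurable_ofReal.comp (h1.mul h2)).aestronglyMeasurable

theorem isSlowField_infraredVector (hl : IsRegime δ κ q κ₀ l) :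
    IsSlowField volume l (infraredVector δ)
      (fun ξ => tensor ((lowPass (waveNumber ξ) * waveNumber ξ ^ (-(3 / 2) : ℝ) : ℝ) : ℂ) 1)
      infraredBound := by
  refine hl.isSlowAmplitude_leading.isSlowField aestronglyMeasurable_lowPass_mul
    infraredBound_nonneg (fun k hk => infraredLog_nonneg hk.1.le) 1 ?_
  filter_upwards [ae_waveNumber_pos] with ξ h0 hne
  have h : waveNumber ξ < 1 := by
    by_contra hcon
    rw [lowPass, if_neg hcon, zero_mul, Complex.ofReal_zero] at hne
    exact hne rfl
  refine ⟨⟨h0, h⟩, ?_⟩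
  rw [infraredBound, lowPass, if_pos h, one_mul, one_mul, one_mul, Complex.norm_real,
    Real.norm_eq_abs, abs_of_nonneg (by positivity)]

theorem isSlowField_remainderVector (hl : IsRegime δ κ q κ₀ l) (hN : ∀ ξ, 0 ≤ N ξ) :
    IsSlowField volume l (remainderVector δ)
      (fun ξ => tensor ((lowPass (waveNumber ξ) * waveNumber ξ ^ (-(3 / 2) : ℝ) : ℝ) : ℂ) 0)
      (regularBound N) := by
  refine hl.isSlowAmplitude_remainder.isSlowField aestronglyMeasurable_lowPass_mul
    (regularBound_nonneg hN)
    (fun k hk => mul_nonneg hk.1.le (infraredLog_nonneg hk.1.le)) 1 ?_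
  filter_upwards [ae_waveNumber_pos] with ξ h0 hne
  have h : waveNumber ξ < 1 := by
    by_contra hcon
    rw [lowPass, if_neg hcon, zero_mul, Complex.ofReal_zero] at hne
    exact hne rfl
  refine ⟨⟨h0, h⟩, le_of_eq ?_⟩
  rw [regularBound_of_lt h, lowPass, if_pos h, one_mul, one_mul, Complex.norm_real,
    Real.norm_eq_abs, abs_of_nonneg (by positivity), ← mul_assoc, ← Real.rpow_add_one h0.ne']
  norm_num

end IsRegime

/-! ## The slow functions of the order -/

/-- Γ is holomorphic on the right half plane, so its complex derivative is continuous there; the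
real derivative is the real part of it. -/
theorem isBoundedUnder_deriv_Gamma {a : ℝ} (ha : 0 < a) :
    IsBoundedUnder (· ≤ ·) (𝓝 a) fun x => ‖deriv Real.Gamma x‖ := by
  have hopen : IsOpen {z : ℂ | 0 < z.re} := isOpen_lt continuous_const Complex.continuous_re
  have hd : DifferentiableOn ℂ Complex.Gamma {z : ℂ | 0 < z.re} := fun z hz =>
    (Complex.differentiableAt_Gamma z fun n hn => by
      have : z.re = -n := by rw [hn]; simp
      have hz' : 0 < z.re := hz
      have := n.cast_nonneg (α := ℝ)
      linarith).differentiableWithinAt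
  have hc : ContinuousAt (deriv Complex.Gamma) (a : ℂ) :=
    (hd.deriv hopen).differentiableAt (hopen.mem_nhds (by simpa using ha)) |>.continuousAt
  have hr : ∀ᶠ x : ℝ in 𝓝 a, deriv Real.Gamma x = (deriv Complex.Gamma x).re := by
    filter_upwards [eventually_gt_nhds ha] with x hx
    have h1 := ((hd.differentiableAt (hopen.mem_nhds (by simpa using hx :
      (x : ℂ) ∈ {z : ℂ | 0 < z.re}))).hasDerivAt).real_of_complex
    refine (h1.congr_of_eventuallyEq (Eventually.of_forall fun y => rfl)).deriv
  have h2 : Tendsto (fun x : ℝ => (deriv Complex.Gamma x).re) (𝓝 a)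
      (𝓝 (deriv Complex.Gamma a).re) :=
    (Complex.continuous_re.tendsto _).comp
      (hc.tendsto.comp (Complex.continuous_ofReal.tendsto a))
  exact (h2.congr' (by filter_upwards [hr] with x hx using hx.symm)).norm.isBoundedUnder_le

namespace IsRegime

variable {δ κ : ℝ → ℝ → ℝ} {q κ₀ : ℝ} {l : Filter (ℝ × ℝ)}

theorem isSlow_Gamma {s : ℝ → ℝ → ℝ} {a : ℝ} (hs : IsSlow l s a) (ha : 0 < a) :
    IsSlow l (fun H m => Real.Gamma (s H m)) (Real.Gamma a) := by
  refine hs.comp (f' := deriv Real.Gamma) ?_ (isBoundedUnder_deriv_Gamma ha)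
  filter_upwards [eventually_gt_nhds ha] with x hx
  refine (Real.differentiableAt_Gamma fun n => ?_).hasDerivAt
  have := n.cast_nonneg (α := ℝ)
  linarith

theorem isSlow_exp {s : ℝ → ℝ → ℝ} {a : ℝ} (hs : IsSlow l s a) :
    IsSlow l (fun H m => Real.exp (s H m)) (Real.exp a) :=
  hs.comp (f' := Real.exp) (Eventually.of_forall Real.hasDerivAt_exp)
    (Real.continuous_exp.norm.tendsto a).isBoundedUnder_le

theorem isSlow_mul_log (hl : IsRegime δ κ q κ₀ l) : IsSlow l (fun H m => δ H m * Real.log H) 0 := by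
  have h0 : Tendsto (fun p : ℝ × ℝ => δ p.1 p.2 * Real.log p.1) l (𝓝 0) := by
    have h1 := hl.isSlow_mul.tendsto
    refine squeeze_zero' ?_ ?_ h1
    · filter_upwards [hl.eventually_one_lt, hl.delta_pos] with p h2 h3
      have := Real.log_pos h2
      positivity
    · filter_upwards [hl.eventually_one_lt, hl.delta_pos] with p h2 h3
      have := Real.log_le_sub_one_of_pos (show 0 < p.1 by linarith)
      gcongr
      linarith
  refine ⟨fun H m => δ H m - κ H m * (δ H m * Real.log H), ?_, h0, ?_⟩
  · filter_upwards [hl.hasDerivAt, hl.eventually_one_lt] with p h1 h2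
    refine (h1.mul (Real.hasDerivAt_log (by linarith))).congr_deriv ?_
    field_simp
    ring
  · have := hl.tendsto_delta.sub (hl.tendsto_kappa.mul h0)
    rwa [mul_zero, sub_zero] at this

/-- The squared norm of the infrared part, multiplied by `δ`. -/
theorem isSlow_infrared (hl : IsRegime δ κ q κ₀ l) :
    ∃ n : ℝ → ℝ → ℝ, IsSlow l n (radialConst / 2) ∧ ∀ H m, 0 < H → 0 < δ H m → δ H m < 1 →
      ∫ ξ, inner ℝ (infraredVector δ H m ξ) (infraredVector δ H m ξ) = n H m / δ H m := by
  -- The leading amplitude factorizes as H^(−δ) k^δ T, and T tends to 2^(−1) Γ(3) = 1.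
  set T : ℝ → ℝ → ℝ := fun H m => Real.exp ((δ H m - 1) * Real.log 2)
    * Real.Gamma (3 - 2 * δ H m) with hT
  have h2 : IsSlow l (fun H m => 3 - 2 * δ H m) (3 - 2 * 0) :=
    (IsSlow.const l 3).sub ((IsSlow.const l 2).mul hl.isSlow_delta)
  have hTs : IsSlow l T 1 := by
    have h := (isSlow_exp ((hl.isSlow_delta.sub (IsSlow.const l 1)).mul
      (IsSlow.const l (Real.log 2)))).mul (isSlow_Gamma h2 (by norm_num))
    have h3 : Real.Gamma (3 - 2 * 0) = 2 := by
      norm_num [Real.Gamma_ofNat_eq_factorial]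
    have h4 : Real.exp ((0 - 1) * Real.log 2) = 1 / 2 := by
      rw [zero_sub, neg_one_mul, Real.exp_neg, Real.exp_log two_pos, one_div]
    rw [h3, h4] at h
    norm_num at h
    exact h
  refine ⟨fun H m => T H m ^ 2 * Real.exp (-2 * (δ H m * Real.log H)) * (radialConst / 2), ?_, ?_⟩
  · have h := ((hTs.pow 2).mul (isSlow_exp ((IsSlow.const l (-2)).mul hl.isSlow_mul_log))).mul
      (IsSlow.const l (radialConst / 2))
    simpa using h
  · intro H m hH hδ hδ'
    have hval : ∀ᵐ ξ : Space3, inner ℝ (infraredVector δ H m ξ) (infraredVector δ H m ξ)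
        = T H m ^ 2 * Real.exp (-2 * (δ H m * Real.log H))
          * (lowPass (waveNumber ξ) * waveNumber ξ ^ (-3 + 2 * δ H m)) := by
      filter_upwards [ae_waveNumber_pos] with ξ h0
      set k := waveNumber ξ
      have e1 : leadingAmplitude (δ H m) (H / k)
          = ((Real.exp (-(δ H m * Real.log H)) * k ^ δ H m * T H m : ℝ) : ℂ) := by
        rw [leadingAmplitude_eq hδ' (div_pos hH h0), Real.div_rpow hH.le h0.le,
          Real.rpow_neg h0.le, div_inv_eq_mul, Real.rpow_def_of_pos hH,
          Real.rpow_def_of_pos two_pos, hT]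
        congr 3
        · ring_nf
        · ring_nf
      have e2 : lowPass k * lowPass k = lowPass k := by
        rw [lowPass]
        split <;> norm_num
      have e3 : k ^ (-3 + 2 * δ H m)
          = (k ^ (-(3 / 2) : ℝ) * k ^ (-(3 / 2) : ℝ)) * (k ^ δ H m * k ^ δ H m) := by
        rw [← Real.rpow_add h0, ← Real.rpow_add h0, ← Real.rpow_add h0]
        congr 1
        ring
      have e4 : Real.exp (-2 * (δ H m * Real.log H))
          = Real.exp (-(δ H m * Real.log H)) * Real.exp (-(δ H m * Real.log H)) := by
        rw [← Real.exp_add]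
        congr 1
        ring
      rw [infraredVector, inner_tensor, e1, Complex.conj_ofReal, Complex.conj_ofReal,
        ← Complex.ofReal_mul, ← Complex.ofReal_mul, Complex.ofReal_re, Complex.ofReal_re, e3, e4]
      linear_combination (k ^ (-(3 / 2) : ℝ) * Real.exp (-(δ H m * Real.log H)) * k ^ δ H m
        * T H m) ^ 2 * e2
    rw [integral_congr_ae hval, integral_const_mul, integral_lowPass_rpow hδ]
    field_simp

end IsRegime

/-! ## Gram determinants -/

/-- The inner product of two vector fields. -/
def fieldInner (V W : Space3 → TwoModes) : ℝ := ∫ ξ, inner ℝ (V ξ) (W ξ)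

/-- The Gram determinant of two vector fields. -/
def gramDet (V W : Space3 → TwoModes) : ℝ :=
  fieldInner V V * fieldInner W W - fieldInner V W * fieldInner W V

/-- The inner product of the two vector fields converges absolutely. -/
def InnerIntegrable (V W : Space3 → TwoModes) : Prop := Integrable fun ξ => inner ℝ (V ξ) (W ξ)

theorem fieldInner_comm (V W : Space3 → TwoModes) : fieldInner V W = fieldInner W V := by
  simp only [fieldInner, real_inner_comm]

theorem InnerIntegrable.symm {V W : Space3 → TwoModes} (h : InnerIntegrable V W) :
    InnerIntegrable W V := by
  simpa only [InnerIntegrable, real_inner_comm] using h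

theorem InnerIntegrable.lin {V W Z X : Space3 → TwoModes} {a b : ℝ} (hV : InnerIntegrable V Z)
    (hW : InnerIntegrable W Z) (hX : ∀ᵐ ξ, X ξ = a • V ξ + b • W ξ) : InnerIntegrable X Z := by
  refine ((hV.const_mul a).add (hW.const_mul b)).congr ?_
  filter_upwards [hX] with ξ hξ
  rw [hξ, inner_add_left, real_inner_smul_left, real_inner_smul_left]
  rfl

theorem fieldInner_lin {V W Z X : Space3 → TwoModes} {a b : ℝ} (hV : InnerIntegrable V Z)
    (hW : InnerIntegrable W Z) (hX : ∀ᵐ ξ, X ξ = a • V ξ + b • W ξ) :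
    fieldInner X Z = a * fieldInner V Z + b * fieldInner W Z := by
  have h : ∀ᵐ ξ, inner ℝ (X ξ) (Z ξ) = a * inner ℝ (V ξ) (Z ξ) + b * inner ℝ (W ξ) (Z ξ) := by
    filter_upwards [hX] with ξ hξ
    rw [hξ, inner_add_left, real_inner_smul_left, real_inner_smul_left]
  rw [fieldInner, integral_congr_ae h, integral_add (hV.const_mul a) (hW.const_mul b),
    integral_const_mul, integral_const_mul]
  rfl

/-- Adding a multiple of A to B does not change the Gram determinant, so t drops out. The rest is
bilinear expansion, arranged to isolate the divergent product of X₀ with itself. -/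
theorem gramDet_eq {X₀ R Y A B : Space3 → TwoModes} {p h t : ℝ}
    (h00 : InnerIntegrable X₀ X₀) (h0R : InnerIntegrable X₀ R) (h0Y : InnerIntegrable X₀ Y)
    (hRR : InnerIntegrable R R) (hRY : InnerIntegrable R Y) (hYY : InnerIntegrable Y Y)
    (hA : ∀ᵐ ξ, A ξ = p • X₀ ξ + R ξ) (hB : ∀ᵐ ξ, B ξ = h • Y ξ + t • A ξ) :
    gramDet A B = h ^ 2 * ((p ^ 2 * fieldInner X₀ X₀ + (2 * p * fieldInner X₀ R + fieldInner R R))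
      * fieldInner Y Y - (p * fieldInner X₀ Y + fieldInner R Y) ^ 2) := by
  have hA' : ∀ᵐ ξ, A ξ = p • X₀ ξ + (1 : ℝ) • R ξ := by
    filter_upwards [hA] with ξ hξ
    rw [hξ, one_smul]
  have iA0 := h00.lin h0R.symm hA'
  have iAR := h0R.lin hRR hA'
  have iAY := h0Y.lin hRY hA'
  have iAA := iA0.symm.lin iAR.symm hA'
  have iBY := hYY.lin iAY hB
  have iBA := iAY.symm.lin iAA hB
  have e1 := fieldInner_lin h00 h0R.symm hA'
  have e2 := fieldInner_lin h0R hRR hA'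
  have e3 := fieldInner_lin h0Y hRY hA'
  have e4 := fieldInner_lin iA0.symm iAR.symm hA'
  have e5 := fieldInner_lin hYY iAY hB
  have e6 := fieldInner_lin iAY.symm iAA hB
  have e7 := fieldInner_lin iBY.symm iBA.symm hB
  rw [fieldInner_comm X₀ A, e1, fieldInner_comm R A, e2] at e4
  rw [fieldInner_comm Y B, e5, fieldInner_comm A B, e6] at e7
  rw [gramDet, fieldInner_comm A B, e7, e6, fieldInner_comm Y A, e3, e4, fieldInner_comm R X₀]
  ring

theorem IsSlowField.innerIntegrable {l : Filter (ℝ × ℝ)} {V W : ℝ → ℝ → Space3 → TwoModes}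
    {V₀ W₀ : Space3 → TwoModes} {b b₁ : Space3 → ℝ} (hV : IsSlowField volume l V V₀ b)
    (hW : IsSlowField volume l W W₀ b₁) (hb : Integrable fun ξ => b ξ * b₁ ξ) :
    ∀ᶠ p in l, InnerIntegrable (V p.1 p.2) (W p.1 p.2) := by
  obtain ⟨V', v1, v2, ⟨C, U, hU, v3⟩, v4, v5⟩ := hV
  obtain ⟨W', w1, w2, ⟨D, T, hT, w3⟩, w4, w5⟩ := hW
  filter_upwards [hU, hT] with p hpU hpT
  refine Integrable.mono' (hb.const_mul (C * D)) ((v1 _ _).inner (w1 _ _)) ?_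
  filter_upwards [v3, w3] with ξ hv hw
  refine (norm_inner_le_norm _ _).trans ?_
  calc _ ≤ C * b ξ * (D * b₁ ξ) :=
        mul_le_mul (hv p hpU).1 (hw p hpT).1 (norm_nonneg _)
          ((norm_nonneg _).trans (hv p hpU).1)
    _ = _ := by ring

section

variable {δ κ : ℝ → ℝ → ℝ} {q κ₀ : ℝ} {l : Filter (ℝ × ℝ)} {N : Space3 → ℝ}

/-- After multiplication by δ the divergent norm of the infrared vector becomes slow, and every
other term carries a factor δ. The limit c² (`radialConst` / 2) ‖Y₀‖² is positive. -/
theorem IsRegime.exists_isSlow_gramDet (hl : IsRegime δ κ q κ₀ l)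
    (hN : Integrable fun ξ => N ξ ^ 2) {a h t : ℝ → ℝ → ℝ} {c : ℝ} (ha : IsSlow l a c)
    (hc : c ≠ 0) {R Y A B : ℝ → ℝ → Space3 → TwoModes} {R₀ Y₀ : Space3 → TwoModes}
    (hR : IsSlowField volume l R R₀ (regularBound N))
    (hY : IsSlowField volume l Y Y₀ (regularBound N)) (hY₀ : 0 < fieldInner Y₀ Y₀)
    (hA : ∀ᶠ p in l, ∀ᵐ ξ, A p.1 p.2 ξ = a p.1 p.2 • infraredVector δ p.1 p.2 ξ + R p.1 p.2 ξ)
    (hB : ∀ᶠ p in l, ∀ᵐ ξ, B p.1 p.2 ξ = h p.1 p.2 • Y p.1 p.2 ξ + t p.1 p.2 • A p.1 p.2 ξ) :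
    ∃ s d, 0 < d ∧ IsSlow l s d ∧
      ∀ᶠ p in l, gramDet (A p.1 p.2) (B p.1 p.2) = h p.1 p.2 ^ 2 * (s p.1 p.2 / δ p.1 p.2) := by
  have hX := hl.isSlowField_infraredVector
  have hbb := integrable_regularBound_mul_self hN
  have hib := integrable_infraredBound_mul N
  obtain ⟨n, hn, hn'⟩ := hl.isSlow_infrared
  have s0R := hX.inner hl hR hib
  have s0Y := hX.inner hl hY hib
  have sRR := hR.inner hl hR hbb
  have sRY := hR.inner hl hY hbb
  have sYY := hY.inner hl hY hbb
  have hδ := hl.isSlow_delta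
  refine ⟨_, _, ?_, ((((ha.pow 2).mul hn).add (hδ.mul ((((IsSlow.const l 2).mul ha).mul s0R).add
    sRR))).mul sYY).sub (hδ.mul (((ha.mul s0Y).add sRY).pow 2)), ?_⟩
  · rw [zero_mul, zero_mul, add_zero, sub_zero]
    have := radialConst_pos
    have : 0 < c ^ 2 := by positivity
    have : 0 < ∫ ξ, inner ℝ (Y₀ ξ) (Y₀ ξ) := hY₀
    positivity
  · have hn0 : ∀ᶠ p in l, n p.1 p.2 ≠ 0 :=
      hn.tendsto.eventually_ne (by have := radialConst_pos; positivity)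
    filter_upwards [hA, hB, hX.innerIntegrable hR hib, hX.innerIntegrable hY hib,
      hR.innerIntegrable hR hbb, hR.innerIntegrable hY hbb, hY.innerIntegrable hY hbb,
      hl.eventually_one_lt, hl.delta_pos, hl.tendsto_delta.eventually_lt_const one_pos, hn0]
      with p pA pB p0R p0Y pRR pRY pYY p1 pδ pδ' pn
    have e := hn' p.1 p.2 (by linarith) pδ pδ'
    -- No dominating function is at hand. The integral is nonzero, and the Bochner integral of a
    -- non-integrable function would be 0.
    have p00 : InnerIntegrable (infraredVector δ p.1 p.2) (infraredVector δ p.1 p.2) := by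
      refine Integrable.of_integral_ne_zero ?_
      rw [e]
      exact div_ne_zero pn pδ.ne'
    rw [gramDet_eq p00 p0R p0Y pRR pRY pYY pA pB]
    simp only [fieldInner, e]
    field_simp

/-- The modes of the phase point whose smearing functions have the profiles `F` and `G`. -/
def modeVector (δ : ℝ → ℝ → ℝ) (F G : Space3 → ℂ) (H m : ℝ) (ξ : Space3) : TwoModes :=
  fieldVector δ F H m ξ + (δ H m * H) • fieldVector δ G H m ξ + H⁻¹ • momentumVector δ G H m ξ

/-- The regular part of `modeVector`. -/
def regularVector (δ : ℝ → ℝ → ℝ) (F G : Space3 → ℂ) (p g : ℝ) (H m : ℝ) (ξ : Space3) : TwoModes :=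
  fieldVector δ (reduced F p) H m ξ + (δ H m * H) • fieldVector δ (reduced G g) H m ξ
    + H⁻¹ • momentumVector δ G H m ξ

theorem modeVector_eq (F G : Space3 → ℂ) (p g H m : ℝ) (ξ : Space3) :
    modeVector δ F G H m ξ = regularVector δ F G p g H m ξ
      + (p + δ H m * H * g) • (infraredVector δ H m ξ + remainderVector δ H m ξ) := by
  rw [modeVector, regularVector, fieldVector_eq δ F p, fieldVector_eq δ G g]
  module

theorem IsRegime.isSlowField_regularVector (hl : IsRegime δ κ q κ₀ l) (hN : ∀ ξ, 0 ≤ N ξ)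
    {F G : Space3 → ℂ} {p g : ℝ} (hF : IsProfile N F p) (hG : IsMomentumProfile N G g) :
    ∃ V₀, IsSlowField volume l (regularVector δ F G p g) V₀ (regularBound N) :=
  ⟨_, ((hl.isSlowField_fieldVector hN hF).add (.smul hl.isSlow_mul
    (hl.isSlowField_fieldVector hN hG.isProfile))).add
    (.smul hl.isSlow_inv (hl.isSlowField_momentumVector hN hG))⟩

/-- The constant in front of the infrared part of the first phase point. -/
theorem IsRegime.isSlow_infraredCoeff (hl : IsRegime δ κ q κ₀ l) (p g : ℝ) :
    IsSlow l (fun H m => p + δ H m * H * g) p := by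
  simpa using (IsSlow.const l p).add (hl.isSlow_mul.mul (IsSlow.const l g))

theorem fieldInner_self_pos {V : Space3 → TwoModes} (hV : InnerIntegrable V V)
    (h : ¬ ∀ᵐ ξ, V ξ = 0) : 0 < fieldInner V V := by
  have hn : ∀ ξ, 0 ≤ inner ℝ (V ξ) (V ξ) := fun ξ => real_inner_self_nonneg
  refine lt_of_le_of_ne (integral_nonneg hn) fun h0 => h ?_
  have := (integral_eq_zero_iff_of_nonneg hn hV).1 h0.symm
  filter_upwards [this] with ξ hξ
  exact inner_self_eq_zero.1 hξ

theorem IsSlowField.limit_innerIntegrable {V : ℝ → ℝ → Space3 → TwoModes}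
    {V₀ : Space3 → TwoModes} {b : Space3 → ℝ} (hl : IsRegime δ κ q κ₀ l) [l.NeBot]
    (hV : IsSlowField volume l V V₀ b) (hb : Integrable fun ξ => b ξ * b ξ) :
    InnerIntegrable V₀ V₀ := by
  have := hl.isCountablyGenerated
  obtain ⟨V', v1, v2, ⟨C, U, hU, v3⟩, v4, v5⟩ := hV
  obtain ⟨x, hx⟩ := exists_seq_tendsto l
  have hm : AEStronglyMeasurable V₀ volume := by
    refine aestronglyMeasurable_of_tendsto_ae atTop (f := fun n => V (x n).1 (x n).2)
      (fun n => v1 _ _) ?_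
    filter_upwards [v4] with ξ hξ
    exact hξ.comp hx
  refine Integrable.mono' (hb.const_mul (C * C)) (hm.inner hm) ?_
  filter_upwards [v3, v4] with ξ hξ hξ'
  have h1 : ‖V₀ ξ‖ ≤ C * b ξ := by
    refine le_of_tendsto hξ'.norm ?_
    filter_upwards [hU] with p hp
    exact (hξ p hp).1
  refine (norm_inner_le_norm _ _).trans ?_
  calc _ ≤ C * b ξ * (C * b ξ) :=
        mul_le_mul h1 h1 (norm_nonneg _) ((norm_nonneg _).trans h1)
    _ = _ := by ring

theorem tensor_eq_zero_iff {w τ : ℂ} : tensor w τ = 0 ↔ w = 0 ∨ τ = 0 := by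
  rw [← norm_eq_zero, norm_tensor, mul_eq_zero, norm_eq_zero, norm_eq_zero]

/-- The infrared and remainder vectors enter the two modes with the coefficients a and δHg_b, so
subtracting δHg_b/a times the first mode removes them from the second. The size H^(−e) of what is
left decides how many powers of H survive. The three cases e = 0, 1, 2 are: F_b ≠ 0; F_b = 0 without
a relation between G_b and F_a; F_b = 0 with that relation. -/
theorem IsRegime.exists_isSlow_gramDet_modeVector (hl : IsRegime δ κ q κ₀ l) [l.NeBot]
    (hκ : 0 ≤ κ₀) (hq : q = 0 ∨ ∀ᶠ p in l, δ p.1 p.2 * p.1 ^ 2 * (3 - δ p.1 p.2) = 3 * q)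
    (hN : ∀ ξ, 0 ≤ N ξ) (hN2 : Integrable fun ξ => N ξ ^ 2)
    {Fa Ga Fb Gb : Space3 → ℂ} {pa ga gb : ℝ} (hFa : IsProfile N Fa pa)
    (hGa : IsMomentumProfile N Ga ga) (hFb : IsProfile N Fb 0) (hGb : IsMomentumProfile N Gb gb)
    (hpa : pa ≠ 0) (hne : ¬ ((∀ᵐ ξ, Fb ξ = 0) ∧ ∀ᵐ ξ, Gb ξ = 0)) :
    ∃ n : ℕ, 0 < n + κ₀ ∧ ∃ s d, 0 < d ∧ IsSlow l s d ∧ ∀ᶠ p in l,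
      p.1 ^ 4 * gramDet (modeVector δ Fa Ga p.1 p.2) (modeVector δ Fb Gb p.1 p.2)
        = p.1 ^ n * (s p.1 p.2 / δ p.1 p.2) := by
  have hbb := integrable_regularBound_mul_self hN2
  set a : ℝ → ℝ → ℝ := fun H m => pa + δ H m * H * ga with ha
  have has : IsSlow l a pa := hl.isSlow_infraredCoeff pa ga
  have ha0 : ∀ᶠ p in l, a p.1 p.2 ≠ 0 := has.tendsto.eventually_ne hpa
  obtain ⟨V₀, hV⟩ := hl.isSlowField_regularVector hN hFa hGa
  have hR := hV.add (.smul has (hl.isSlowField_remainderVector hN))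
  have hA : ∀ᶠ p in l, ∀ᵐ ξ, modeVector δ Fa Ga p.1 p.2 ξ
      = a p.1 p.2 • infraredVector δ p.1 p.2 ξ + (regularVector δ Fa Ga pa ga p.1 p.2 ξ
        + a p.1 p.2 • remainderVector δ p.1 p.2 ξ) := by
    refine Eventually.of_forall fun p => Eventually.of_forall fun ξ => ?_
    rw [modeVector_eq Fa Ga pa ga, ha]
    module
  -- the second vector without its infrared part
  have hB : ∀ p : ℝ × ℝ, a p.1 p.2 ≠ 0 → ∀ ξ, modeVector δ Fb Gb p.1 p.2 ξ
      = (regularVector δ Fb Gb 0 gb p.1 p.2 ξ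
        - (δ p.1 p.2 * p.1 * gb / a p.1 p.2) • regularVector δ Fa Ga pa ga p.1 p.2 ξ)
        + (δ p.1 p.2 * p.1 * gb / a p.1 p.2) • modeVector δ Fa Ga p.1 p.2 ξ := by
    intro p hp ξ
    rw [modeVector_eq Fb Gb 0 gb, modeVector_eq Fa Ga pa ga]
    have e : δ p.1 p.2 * p.1 * gb
        = (δ p.1 p.2 * p.1 * gb / a p.1 p.2) * (pa + δ p.1 p.2 * p.1 * ga) := by
      rw [div_mul_cancel₀]
      exact hp
    generalize δ p.1 p.2 * p.1 * gb / a p.1 p.2 = t at e ⊢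
    rw [zero_add, e]
    module
  have hts : ∀ g' : ℝ → ℝ → ℝ, ∀ c, IsSlow l g' c →
      IsSlow l (fun H m => g' H m * gb * (a H m)⁻¹) (c * gb * pa⁻¹) := fun g' c h =>
    (h.mul (IsSlow.const l gb)).mul (has.inv hpa)
  -- If H^e times the reduced second vector is a slow field with nonzero limit, its square
  -- contributes H^(−2e). Together with the prefactor H⁴ this leaves n = 4 − 2e.
  have key : ∀ (e n : ℕ), n + 2 * e = 4 → 0 < n + κ₀ → ∀ (Y : ℝ → ℝ → Space3 → TwoModes)
      (Y₀ : Space3 → TwoModes), IsSlowField volume l Y Y₀ (regularBound N) →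
      ¬ (∀ᵐ ξ, Y₀ ξ = 0) → (∀ᶠ p in l, ∀ᵐ ξ, p.1 ^ e • (regularVector δ Fb Gb 0 gb p.1 p.2 ξ
        - (δ p.1 p.2 * p.1 * gb / a p.1 p.2) • regularVector δ Fa Ga pa ga p.1 p.2 ξ)
        = Y p.1 p.2 ξ) →
      ∃ n : ℕ, 0 < n + κ₀ ∧ ∃ s d, 0 < d ∧ IsSlow l s d ∧ ∀ᶠ p in l,
      p.1 ^ 4 * gramDet (modeVector δ Fa Ga p.1 p.2) (modeVector δ Fb Gb p.1 p.2)
        = p.1 ^ n * (s p.1 p.2 / δ p.1 p.2) := by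
    intro e n hen hnκ Y Y₀ hY hY₀ hYe
    have hpos := fieldInner_self_pos (hY.limit_innerIntegrable hl hbb) hY₀
    obtain ⟨s, d, hd, hs, hG⟩ := hl.exists_isSlow_gramDet hN2 has hpa hR hY hpos hA
      (B := modeVector δ Fb Gb) (h := fun H _ => (H ^ e)⁻¹)
      (t := fun H m => δ H m * H * gb / a H m) (by
        filter_upwards [hYe, ha0, hl.eventually_one_lt] with p h1 h2 h3
        filter_upwards [h1] with ξ h1
        rw [hB p h2 ξ, ← h1, smul_smul, inv_mul_cancel₀ (pow_ne_zero e (by linarith)), one_smul])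
    refine ⟨n, hnκ, s, d, hd, hs, ?_⟩
    filter_upwards [hG, hl.eventually_one_lt] with p h1 h2
    have h3 : p.1 ≠ 0 := by linarith
    rw [h1, ← hen, pow_add, pow_mul']
    field_simp
  have sFa := hl.isSlowField_fieldVector hN hFa
  have sGa := hl.isSlowField_fieldVector hN hGa.isProfile
  have sFb := hl.isSlowField_fieldVector hN hFb
  have sGb := hl.isSlowField_fieldVector hN hGb.isProfile
  have mGa := hl.isSlowField_momentumVector hN hGa
  have mGb := hl.isSlowField_momentumVector hN hGb
  have hpow : ∀ᵐ ξ : Space3, ∀ r : ℝ, ((waveNumber ξ ^ r : ℝ) : ℂ) ≠ 0 := by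
    filter_upwards [ae_waveNumber_pos] with ξ h0 r
    exact_mod_cast (Real.rpow_pos_of_pos h0 r).ne'
  by_cases hFb0 : ∀ᵐ ξ, Fb ξ = 0
  swap
  · -- the second field profile does not vanish
    refine key 0 4 rfl (by push_cast; linarith) _ _ ((sFb.add (.smul hl.isSlow_mul sGb)).add
      (.smul hl.isSlow_inv mGb) |>.add (.smul (hts _ _ hl.isSlow_mul).neg hV)) ?_ ?_
    · intro hcon
      refine hFb0 ?_
      filter_upwards [hcon, hpow] with ξ h1 h2
      rw [zero_smul, zero_smul, zero_mul, zero_mul, neg_zero, zero_smul, add_zero, add_zero,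
        add_zero, tensor_eq_zero_iff, mul_eq_zero] at h1
      rcases h1 with (h1 | h1) | h1
      · exact absurd h1 (h2 _)
      · simpa [reduced] using h1
      · exact absurd h1 one_ne_zero
    · refine Eventually.of_forall fun p => Eventually.of_forall fun ξ => ?_
      simp only [regularVector, div_eq_mul_inv]
      module
  have hGb0 : ¬ ∀ᵐ ξ, Gb ξ = 0 := fun h => hne ⟨hFb0, h⟩
  have hFbz : ∀ᵐ ξ, ∀ H m, fieldVector δ (reduced Fb 0) H m ξ = 0 := by
    filter_upwards [hFb0] with ξ hξ H m
    rw [fieldVector, reduced, hξ]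
    simp [tensor_zero_left]
  set r : ℝ := q * gb * pa⁻¹ with hr
  -- The vector rescaled by H tends to k^(−3/2) ((q + k²) G_b − r F_a): q is the limit of δH², and
  -- k² comes from the momentum amplitude. The constants subtracted below k = 1 cancel because r p_a
  -- = q g_b.
  by_cases hrel : ∀ᵐ ξ, (((q + waveNumber ξ ^ 2 : ℝ) : ℂ)) * Gb ξ = r * Fa ξ
  swap
  · -- the limit of the rescaled vector does not vanish
    refine key 1 2 rfl (by push_cast; linarith) _ _ (((IsSlowField.smul hl.isSlow_mul_sq sGb).add
      mGb).add (.smul (hts _ _ hl.isSlow_mul_sq).neg ((sFa.add (.smul hl.isSlow_mul sGa)).add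
      (.smul hl.isSlow_inv mGa)))) ?_ ?_
    · intro hcon
      refine hrel ?_
      filter_upwards [hcon, hpow, ae_waveNumber_pos] with ξ h1 h2 h0
      rw [zero_smul, zero_smul, add_zero, add_zero, ← hr, ← tensor_smul_left, ← tensor_smul_left,
        ← tensor_add_left, ← tensor_add_left, tensor_eq_zero_iff,
        or_iff_left one_ne_zero, reduced, reduced] at h1
      have e1 : waveNumber ξ ^ (1 / 2 : ℝ) = waveNumber ξ ^ (-(3 / 2) : ℝ) * waveNumber ξ ^ 2 := by
        rw [← Real.rpow_two, ← Real.rpow_add h0]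
        norm_num
      have e2 : r * pa = q * gb := by
        rw [hr]
        field_simp
      rw [e1] at h1
      have e3 : ((waveNumber ξ ^ (-(3 / 2) : ℝ) : ℝ) : ℂ)
          * (((q + waveNumber ξ ^ 2 : ℝ) : ℂ) * Gb ξ - r * Fa ξ) = 0 := by
        have e2' : (r : ℂ) * pa = q * gb := by exact_mod_cast e2
        push_cast at h1 ⊢
        linear_combination h1 - ((waveNumber ξ ^ (-(3 / 2) : ℝ) : ℝ) : ℂ)
          * (lowPass (waveNumber ξ) : ℂ) * e2'
      exact sub_eq_zero.1 ((mul_eq_zero.1 e3).resolve_left (h2 _))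
    · filter_upwards [hl.eventually_one_lt, ha0] with p hp1 hp2
      filter_upwards [hFbz] with ξ hξ
      have hp0 : p.1 ≠ 0 := by linarith
      simp only [regularVector, hξ, pow_one, div_eq_mul_inv, zero_add, smul_sub, smul_add,
        smul_smul, neg_smul]
      rw [show p.1 * (δ p.1 p.2 * p.1) = δ p.1 p.2 * p.1 ^ 2 by ring, mul_inv_cancel₀ hp0, one_smul,
        show p.1 * (δ p.1 p.2 * p.1 * gb * (a p.1 p.2)⁻¹)
          = δ p.1 p.2 * p.1 ^ 2 * gb * (a p.1 p.2)⁻¹ by ring]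
      module
  -- the limit of the rescaled vector vanishes, and one rescales once more
  have hq0 : q ≠ 0 := by
    intro h0
    refine hGb0 ?_
    filter_upwards [hrel, ae_waveNumber_pos] with ξ h1 h2
    rw [hr, h0, zero_mul, zero_mul, Complex.ofReal_zero, zero_mul, zero_add, mul_eq_zero] at h1
    refine h1.resolve_left ?_
    exact_mod_cast (pow_pos h2 2).ne'
  have hκ2 : κ₀ = 2 := by
    have := (mul_eq_zero.1 hl.kappa_mul).resolve_right hq0
    linarith
  have hqe := hq.resolve_left hq0
  have hq1 : 0 < q := by
    have h1 : 0 ≤ q := by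
      refine ge_of_tendsto hl.tendsto_mul_sq ?_
      filter_upwards [hl.delta_pos] with p hp
      positivity
    exact lt_of_le_of_ne h1 (Ne.symm hq0)
  -- The relation makes k² G_b as regular as F_a, which is the additional decay needed for the
  -- difference vector.
  have hD : ∀ᵐ ξ : Space3, 1 ≤ waveNumber ξ →
      waveNumber ξ ^ (3 / 2 : ℝ) * ‖Gb ξ‖ ≤ |r| * N ξ := by
    obtain ⟨-, C, hC⟩ := hFa
    filter_upwards [hrel, hC, ae_waveNumber_pos] with ξ h1 h2 h0 hk
    have h3 := (h2.2 hk)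
    have h4 : waveNumber ξ ^ 2 * ‖Gb ξ‖ ≤ |r| * ‖Fa ξ‖ := by
      have h5 := congrArg norm h1
      rw [norm_mul, norm_mul, Complex.norm_real, Complex.norm_real, Real.norm_eq_abs,
        Real.norm_eq_abs, abs_of_pos (by positivity)] at h5
      rw [← h5]
      gcongr
      linarith
    have e1 : waveNumber ξ ^ (3 / 2 : ℝ) = waveNumber ξ ^ (-(1 / 2) : ℝ) * waveNumber ξ ^ 2 := by
      rw [← Real.rpow_two, ← Real.rpow_add h0]
      norm_num
    calc _ = waveNumber ξ ^ (-(1 / 2) : ℝ) * (waveNumber ξ ^ 2 * ‖Gb ξ‖) := by rw [e1]; ring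
      _ ≤ waveNumber ξ ^ (-(1 / 2) : ℝ) * (|r| * ‖Fa ξ‖) := by gcongr
      _ = |r| * (waveNumber ξ ^ (-(1 / 2) : ℝ) * ‖Fa ξ‖) := by ring
      _ ≤ _ := by gcongr
  have dGb := hl.isSlowField_differenceVector hN hGb hD
  have hs := hts _ _ hl.isSlow_mul_sq
  rw [← hr] at hs
  -- the coefficients that remain after the cancellation
  have c1 : IsSlow l (fun H m => (δ H m * H) * (δ H m * H ^ 2) * 3⁻¹) 0 := by
    simpa using (hl.isSlow_mul.mul hl.isSlow_mul_sq).mul (IsSlow.const l 3⁻¹)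
  have c2 := ((((hl.isSlow_mul_sq.mul (IsSlow.const l (q * ga))).sub
    (c1.mul (IsSlow.const l pa))).mul (IsSlow.const l gb)).mul (IsSlow.const l pa⁻¹)).mul
    (has.inv hpa)
  refine key 2 0 rfl (by rw [hκ2]; norm_num) _ _ ((((dGb.add (.smul c1 sGb)).add
    (.smul c2 sFa)).add (.smul (hs.mul hl.isSlow_mul_sq).neg sGa)).add (.smul hs.neg mGa)) ?_ ?_
  · intro hcon
    refine hGb0 ?_
    filter_upwards [hcon, hpow, ae_waveNumber_pos] with ξ h1 h2 h0
    -- All other terms of the limit have a zero coefficient or the real amplitude 1. The second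
    -- component, which records imaginary parts of amplitudes, contains only k^(1/2) G_b times k.
    have h3 : (((waveNumber ξ ^ (1 / 2 : ℝ) : ℝ) : ℂ) * Gb ξ) * waveNumber ξ = 0 := by
      have h4 := congrArg (fun v : TwoModes => v.snd) h1
      simpa [tensor, mul_comm] using h4
    have h5 : (waveNumber ξ : ℂ) ≠ 0 := by exact_mod_cast h0.ne'
    exact (mul_eq_zero.1 ((mul_eq_zero.1 h3).resolve_right h5)).resolve_left (h2 _)
  · filter_upwards [hl.eventually_one_lt, ha0, hqe] with p hp1 hp2 hp3
    filter_upwards [hFbz, hrel, ae_waveNumber_pos] with ξ hξ hrξ h0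
    have hp0 : p.1 ≠ 0 := by linarith
    have hp0' : (p.1 : ℂ) ≠ 0 := by exact_mod_cast hp0
    -- the cancellation in the field amplitude
    have hcancel : p.1 • momentumVector δ Gb p.1 p.2 ξ = differenceVector δ Gb p.1 p.2 ξ
        + p.1 • (r • fieldVector δ (reduced Fa pa) p.1 p.2 ξ
          - q • fieldVector δ (reduced Gb gb) p.1 p.2 ξ) := by
      have e0 : ((waveNumber ξ ^ (1 / 2 : ℝ) : ℝ) : ℂ) * Gb ξ
          = r * (((waveNumber ξ ^ (-(3 / 2) : ℝ) : ℝ) : ℂ) * reduced Fa pa ξ)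
            + ((-q : ℝ) : ℂ) * (((waveNumber ξ ^ (-(3 / 2) : ℝ) : ℝ) : ℂ) * reduced Gb gb ξ) := by
        have e1 : waveNumber ξ ^ (1 / 2 : ℝ)
            = waveNumber ξ ^ (-(3 / 2) : ℝ) * waveNumber ξ ^ 2 := by
          rw [← Real.rpow_two, ← Real.rpow_add h0]
          norm_num
        have e2 : r * pa = q * gb := by
          rw [hr]
          field_simp
        have e2' : (r : ℂ) * pa = q * gb := by exact_mod_cast e2
        rw [e1, reduced, reduced]
        push_cast at hrξ ⊢
        linear_combination ((waveNumber ξ ^ (-(3 / 2) : ℝ) : ℝ) : ℂ) * hrξ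
          + ((waveNumber ξ ^ (-(3 / 2) : ℝ) : ℝ) : ℂ) * (lowPass (waveNumber ξ) : ℂ) * e2'
      rw [differenceVector, momentumVector, fieldVector, fieldVector, sub_eq_add_neg (r • _),
        ← neg_smul, ← tensor_smul_left r, ← tensor_smul_left (-q), ← tensor_add_left, ← e0,
        ← tensor_smul_right, ← tensor_smul_right, ← tensor_add_right]
      congr 1
      ring
    simp only [regularVector, hξ, div_eq_mul_inv, zero_add]
    have e1 : p.1 ^ 2 • ((δ p.1 p.2 * p.1) • fieldVector δ (reduced Gb gb) p.1 p.2 ξ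
        + p.1⁻¹ • momentumVector δ Gb p.1 p.2 ξ)
        = (p.1 * (δ p.1 p.2 * p.1 ^ 2)) • fieldVector δ (reduced Gb gb) p.1 p.2 ξ
          + p.1 • momentumVector δ Gb p.1 p.2 ξ := by
      rw [smul_add, smul_smul, smul_smul]
      congr 2
      · ring
      · field_simp
    -- Here the exact identity δH²(3 − δ) = 3q is needed. It gives H(δH² − q) = (δH)(δH²)/3 → 0,
    -- whereas δH² → q alone says nothing after multiplication by H.
    have e2 : p.1 * (δ p.1 p.2 * p.1 ^ 2) - p.1 * q
        = δ p.1 p.2 * p.1 * (δ p.1 p.2 * p.1 ^ 2) * 3⁻¹ := by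
      linear_combination ((1 / 3) * p.1) * hp3
    have e3 : p.1 * r - p.1 ^ 2 * (δ p.1 p.2 * p.1 * gb * (a p.1 p.2)⁻¹)
        = (δ p.1 p.2 * p.1 ^ 2 * (q * ga)
          - δ p.1 p.2 * p.1 * (δ p.1 p.2 * p.1 ^ 2) * 3⁻¹ * pa) * gb * pa⁻¹
          * (a p.1 p.2)⁻¹ := by
      rw [← e2, hr]
      field_simp
      rw [ha]
      ring
    rw [smul_sub, e1, hcancel, ← e3, ← e2]
    match_scalars <;> field_simp
    all_goals ring

end

/-! ## The covariance metric as a Gram matrix -/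

section

variable {δ κ : ℝ → ℝ → ℝ} {q κ₀ : ℝ} {l : Filter (ℝ × ℝ)} {N : Space3 → ℝ}

theorem IsRegime.eventually_innerIntegrable (hl : IsRegime δ κ q κ₀ l) (hN : ∀ ξ, 0 ≤ N ξ)
    (hN2 : Integrable fun ξ => N ξ ^ 2) {F G F' G' : Space3 → ℂ} {p g p' g' : ℝ}
    (hF : IsProfile N F p) (hG : IsMomentumProfile N G g) (hF' : IsProfile N F' p')
    (hG' : IsMomentumProfile N G' g') :
    ∀ᶠ x in l, InnerIntegrable (modeVector δ F G x.1 x.2) (modeVector δ F' G' x.1 x.2) := by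
  have hbb := integrable_regularBound_mul_self hN2
  have hib := integrable_infraredBound_mul N
  have hX := hl.isSlowField_infraredVector
  have hR := hl.isSlowField_remainderVector hN
  obtain ⟨V₀, hV⟩ := hl.isSlowField_regularVector hN hF hG
  obtain ⟨W₀, hW⟩ := hl.isSlowField_regularVector hN hF' hG'
  have hV' := hV.add (.smul (hl.isSlow_infraredCoeff p g) hR)
  have hW' := hW.add (.smul (hl.isSlow_infraredCoeff p' g') hR)
  obtain ⟨n, hn, hn'⟩ := hl.isSlow_infrared
  have hn0 : ∀ᶠ x in l, n x.1 x.2 ≠ 0 :=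
    hn.tendsto.eventually_ne (by have := radialConst_pos; positivity)
  filter_upwards [hX.innerIntegrable hV' hib, hX.innerIntegrable hW' hib,
    hV'.innerIntegrable hW' hbb, hl.eventually_one_lt, hl.delta_pos,
    hl.tendsto_delta.eventually_lt_const one_pos, hn0] with x xV xW xVW x1 xδ xδ' xn
  have xX : InnerIntegrable (infraredVector δ x.1 x.2) (infraredVector δ x.1 x.2) := by
    refine Integrable.of_integral_ne_zero ?_
    rw [hn' x.1 x.2 (by linarith) xδ xδ']
    exact div_ne_zero xn xδ.ne'
  have eV : ∀ᵐ ξ, modeVector δ F G x.1 x.2 ξ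
      = (p + δ x.1 x.2 * x.1 * g) • infraredVector δ x.1 x.2 ξ
        + (1 : ℝ) • (regularVector δ F G p g x.1 x.2 ξ
          + (p + δ x.1 x.2 * x.1 * g) • remainderVector δ x.1 x.2 ξ) := by
    refine Eventually.of_forall fun ξ => ?_
    rw [modeVector_eq F G p g]
    module
  have eW : ∀ᵐ ξ, modeVector δ F' G' x.1 x.2 ξ
      = (p' + δ x.1 x.2 * x.1 * g') • infraredVector δ x.1 x.2 ξ
        + (1 : ℝ) • (regularVector δ F' G' p' g' x.1 x.2 ξ
          + (p' + δ x.1 x.2 * x.1 * g') • remainderVector δ x.1 x.2 ξ) := by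
    refine Eventually.of_forall fun ξ => ?_
    rw [modeVector_eq F' G' p' g']
    module
  exact (InnerIntegrable.lin (InnerIntegrable.lin xX xW.symm eW).symm
    (InnerIntegrable.lin xV xVW.symm eW).symm eV)

/-- H times the derivative of H^n s/δ is (H^n/δ)((n + κ) s + H ∂s/∂H), and the bracket tends to (n +
κ₀) d > 0. Being slow is what makes the last term negligible. -/
theorem IsRegime.eventually_hasDerivAt_pos (hl : IsRegime δ κ q κ₀ l) {D s : ℝ → ℝ → ℝ} {d : ℝ}
    {n : ℕ} (hn : 0 < n + κ₀) (hd : 0 < d) (hs : IsSlow l s d)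
    (hD : ∀ᶠ p in l, D p.1 p.2 = p.1 ^ n * (s p.1 p.2 / δ p.1 p.2)) :
    ∀ᶠ p in l, 0 < D p.1 p.2 ∧ ∃ d', 0 < d' ∧ HasDerivAt (fun H => D H p.2) d' p.1 := by
  obtain ⟨U, hU, hUD, hUo⟩ := hl.exists_isOpen _ hD
  obtain ⟨s', hs1, hs2, hs3⟩ := hs
  have hlim : Tendsto (fun p => (n + κ p.1 p.2) * s p.1 p.2 + s' p.1 p.2) l
      (𝓝 ((n + κ₀) * d + 0)) := ((hl.tendsto_kappa.const_add _).mul hs2).add hs3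
  have hpos := hlim.eventually_const_lt (show 0 < (n + κ₀) * d + 0 by rw [add_zero]; positivity)
  filter_upwards [hU, hs1, hs2.eventually_const_lt hd, hpos, hl.delta_pos, hl.eventually_one_lt,
    hl.hasDerivAt] with p hpU h1 h2 h3 h4 h5 h6
  have hp : 0 < p.1 := by linarith
  refine ⟨by rw [hUD hpU]; positivity,
    p.1 ^ n / δ p.1 p.2 / p.1 * ((n + κ p.1 p.2) * s p.1 p.2 + s' p.1 p.2), by positivity, ?_⟩
  have he : (fun H => D H p.2) =ᶠ[𝓝 p.1] fun H => H ^ n * (s H p.2 / δ H p.2) := by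
    filter_upwards [(hUo p.2).mem_nhds hpU] with H hH
    exact hUD hH
  refine HasDerivAt.congr_of_eventuallyEq ?_ he
  refine ((hasDerivAt_pow n p.1).mul (h1.div h6 h4.ne')).congr_deriv ?_
  rcases n with _ | n
  · simp only [CharP.cast_eq_zero, zero_mul, zero_add, pow_zero]
    field_simp
    ring
  · rw [Nat.add_sub_cancel, pow_succ, Pi.div_apply]
    field_simp
    ring

theorem modeVector_eq_tensor {F G : Space3 → ℂ} {H m : ℝ} (hH : 0 < H) {ξ : Space3}
    (hξ : 0 < waveNumber ξ) :
    modeVector δ F G H m ξ = tensor (((waveNumber ξ ^ (-(3 / 2) : ℝ) : ℝ) : ℂ) * F ξ)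
        (fieldAmplitude (δ H m) (H / waveNumber ξ))
      + tensor (((waveNumber ξ ^ (-(3 / 2) : ℝ) : ℝ) : ℂ) * G ξ)
        (H * (δ H m * fieldAmplitude (δ H m) (H / waveNumber ξ)
          + ((waveNumber ξ / H) ^ 2 : ℝ) * momentumAmplitude (δ H m) (H / waveNumber ξ))) := by
  rw [modeVector, fieldVector, fieldVector, momentumVector, add_assoc]
  congr 1
  have e1 : ((waveNumber ξ ^ (1 / 2 : ℝ) : ℝ) : ℂ) * G ξ
      = ((waveNumber ξ ^ 2 : ℝ) : ℂ) * (((waveNumber ξ ^ (-(3 / 2) : ℝ) : ℝ) : ℂ) * G ξ) := by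
    rw [← mul_assoc, ← Complex.ofReal_mul, ← Real.rpow_two, ← Real.rpow_add hξ]
    norm_num
  rw [e1, tensor_smul_left (waveNumber ξ ^ 2), ← tensor_smul_right (δ H m * H),
    ← tensor_smul_right (waveNumber ξ ^ 2), ← tensor_smul_right H⁻¹, ← tensor_add_right]
  have hH' : (H : ℂ) ≠ 0 := by exact_mod_cast hH.ne'
  congr 1
  push_cast
  field_simp

/-- The phase of the common prefactor drops out, and its squared modulus, proportional to k^(−3), is
shared between the two profiles as k^(−3/2) each. -/
theorem modeWeight_eq {A τ τ' : ℂ} {c k : ℝ} (hk : 0 < k) (hA : 2 * ‖A‖ ^ 2 = c / k ^ 3)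
    (F G : ℂ) :
    2 * (A * τ * conj (A * τ')).re * (F * conj G).re
      = c * inner ℝ (tensor (((k ^ (-(3 / 2) : ℝ) : ℝ) : ℂ) * F) τ)
        (tensor (((k ^ (-(3 / 2) : ℝ) : ℝ) : ℂ) * G) τ') := by
  have h1 : A * τ * conj (A * τ') = ((‖A‖ ^ 2 : ℝ) : ℂ) * (τ * conj τ') := by
    rw [map_mul, ← Complex.normSq_eq_norm_sq, ← Complex.mul_conj]
    ring
  have h2 : ((k ^ (-(3 / 2) : ℝ) : ℝ) : ℂ) * F * conj (((k ^ (-(3 / 2) : ℝ) : ℝ) : ℂ) * G)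
      = (((k ^ 3)⁻¹ : ℝ) : ℂ) * (F * conj G) := by
    have : (k ^ 3)⁻¹ = k ^ (-(3 / 2) : ℝ) * k ^ (-(3 / 2) : ℝ) := by
      rw [← Real.rpow_add hk, ← Real.rpow_natCast, ← Real.rpow_neg hk.le]
      norm_num
    rw [this, map_mul, Complex.conj_ofReal]
    push_cast
    ring
  rw [inner_tensor, h1, h2, Complex.re_ofReal_mul, Complex.re_ofReal_mul, ← mul_assoc 2, hA]
  field_simp

theorem two_mul_norm_sq_eq (z : ℂ) : 2 * ‖z‖ ^ 2 = 2 * (z * conj z).re := by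
  rw [Complex.mul_conj, Complex.ofReal_re, Complex.normSq_eq_norm_sq]

theorem weightedProduct_eq {w : ℝ → ℝ} {u v : 𝓢'(Space3, ℂ)} {V W : Space3 → TwoModes} {c : ℝ}
    (h : ∀ᵐ ξ, w (waveNumber ξ) * (fourierFunction u ξ * conj (fourierFunction v ξ)).re
      = c * inner ℝ (V ξ) (W ξ)) :
    weightedProduct w u v = c * fieldInner V W := by
  rw [weightedProduct, integral_congr_ae h, integral_const_mul, fieldInner]

theorem modeVector_zero_right (F : Space3 → ℂ) {H m : ℝ} (hH : 0 < H) {ξ : Space3}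
    (hξ : 0 < waveNumber ξ) :
    modeVector δ F 0 H m ξ = tensor (((waveNumber ξ ^ (-(3 / 2) : ℝ) : ℝ) : ℂ) * F ξ)
      (fieldAmplitude (δ H m) (H / waveNumber ξ)) := by
  rw [modeVector_eq_tensor hH hξ, Pi.zero_apply, mul_zero, tensor_zero_left, add_zero]

theorem modeVector_zero_left (G : Space3 → ℂ) {H m : ℝ} (hH : 0 < H) {ξ : Space3}
    (hξ : 0 < waveNumber ξ) :
    modeVector δ 0 G H m ξ = tensor (((waveNumber ξ ^ (-(3 / 2) : ℝ) : ℝ) : ℂ) * G ξ)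
      (H * (δ H m * fieldAmplitude (δ H m) (H / waveNumber ξ)
        + ((waveNumber ξ / H) ^ 2 : ℝ) * momentumAmplitude (δ H m) (H / waveNumber ξ))) := by
  rw [modeVector_eq_tensor hH hξ, Pi.zero_apply, mul_zero, tensor_zero_left, zero_add]

theorem two_mul_norm_modePrefactor_sq {H k : ℝ} (d : ℝ) (hk : 0 < k) :
    2 * ‖modePrefactor H d k‖ ^ 2 = (Real.Gamma (2 - d))⁻¹ ^ 2 * H ^ 2 / k ^ 3 := by
  rw [norm_modePrefactor_sq hk, mul_div_assoc]

theorem bdFieldField_eq {H m M : ℝ} (hH : 0 < H) (hδ : 0 < δ H m) (hδ' : δ H m < 1 / 2)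
    (hm : modeOrder H M = 3 / 2 - δ H m) (u v : 𝓢'(Space3, ℂ)) :
    bdFieldField H M u v = (Real.Gamma (2 - δ H m))⁻¹ ^ 2 * H ^ 2 * fieldInner
      (modeVector δ (fourierFunction u) 0 H m) (modeVector δ (fourierFunction v) 0 H m) := by
  refine weightedProduct_eq ?_
  filter_upwards [ae_waveNumber_pos] with ξ hξ
  rw [modeVector_zero_right _ hH hξ, modeVector_zero_right _ hH hξ,
    ← modeWeight_eq hξ (two_mul_norm_modePrefactor_sq _ hξ), bdMode_unitTime hH hδ hδ' hm hξ,
    two_mul_norm_sq_eq]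
  generalize modePrefactor H (δ H m) (waveNumber ξ) = A
  generalize fieldAmplitude (δ H m) (H / waveNumber ξ) = τ
  congr 3
  simp only [map_mul, map_neg, Complex.conj_I]
  linear_combination (-(A * τ * (conj A * conj τ))) * Complex.I_mul_I

/-- The field mode carries −i and the momentum mode +i, hence the minus sign. It compensates the
sign in Φ(f) − Π(g), so that `bdCovariance_eq` involves the sum of the field and momentum vectors.
-/
theorem bdFieldMomentum_eq {H m M : ℝ} (hH : 0 < H) (hδ : 0 < δ H m) (hδ' : δ H m < 1 / 2)
    (hm : modeOrder H M = 3 / 2 - δ H m) (u v : 𝓢'(Space3, ℂ)) :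
    bdFieldMomentum H M u v = -((Real.Gamma (2 - δ H m))⁻¹ ^ 2 * H ^ 2) * fieldInner
      (modeVector δ (fourierFunction u) 0 H m) (modeVector δ 0 (fourierFunction v) H m) := by
  refine weightedProduct_eq ?_
  filter_upwards [ae_waveNumber_pos] with ξ hξ
  rw [modeVector_zero_right _ hH hξ, modeVector_zero_left _ hH hξ, neg_mul,
    ← modeWeight_eq hξ (two_mul_norm_modePrefactor_sq _ hξ), bdMode_unitTime hH hδ hδ' hm hξ,
    bdMomentumMode_unitTime hH hδ hδ' hm hξ, ← neg_mul, ← mul_neg, ← Complex.neg_re]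
  generalize (δ H m * fieldAmplitude (δ H m) (H / waveNumber ξ)
    + ((waveNumber ξ / H) ^ 2 : ℝ) * momentumAmplitude (δ H m) (H / waveNumber ξ) : ℂ) = τ'
  generalize modePrefactor H (δ H m) (waveNumber ξ) = A
  generalize fieldAmplitude (δ H m) (H / waveNumber ξ) = τ
  congr 3
  simp only [map_mul, Complex.conj_I]
  linear_combination (A * τ * (conj A * (conj (H : ℂ) * conj τ'))) * Complex.I_mul_I

theorem bdMomentumMomentum_eq {H m M : ℝ} (hH : 0 < H) (hδ : 0 < δ H m) (hδ' : δ H m < 1 / 2)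
    (hm : modeOrder H M = 3 / 2 - δ H m) (u v : 𝓢'(Space3, ℂ)) :
    bdMomentumMomentum H M u v = (Real.Gamma (2 - δ H m))⁻¹ ^ 2 * H ^ 2 * fieldInner
      (modeVector δ 0 (fourierFunction u) H m) (modeVector δ 0 (fourierFunction v) H m) := by
  refine weightedProduct_eq ?_
  filter_upwards [ae_waveNumber_pos] with ξ hξ
  rw [modeVector_zero_left _ hH hξ, modeVector_zero_left _ hH hξ,
    ← modeWeight_eq hξ (two_mul_norm_modePrefactor_sq _ hξ),
    bdMomentumMode_unitTime hH hδ hδ' hm hξ, two_mul_norm_sq_eq]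
  generalize (δ H m * fieldAmplitude (δ H m) (H / waveNumber ξ)
    + ((waveNumber ξ / H) ^ 2 : ℝ) * momentumAmplitude (δ H m) (H / waveNumber ξ) : ℂ) = τ'
  generalize modePrefactor H (δ H m) (waveNumber ξ) = A
  congr 3
  simp only [map_mul, Complex.conj_I]
  linear_combination (-(A * (H * τ') * (conj A * (conj (H : ℂ) * conj τ')))) * Complex.I_mul_I

theorem bdCovariance_eq {H m M : ℝ} (hH : 0 < H) (hδ : 0 < δ H m) (hδ' : δ H m < 1 / 2)
    (hm : modeOrder H M = 3 / 2 - δ H m) {γ γ' : PhasePoint} {F G F' G' : Space3 → ℂ}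
    (hF : fourierFunction γ.f = F) (hG : fourierFunction γ.g = G)
    (hF' : fourierFunction γ'.f = F') (hG' : fourierFunction γ'.g = G')
    (i1 : InnerIntegrable (modeVector δ F 0 H m) (modeVector δ F' 0 H m))
    (i2 : InnerIntegrable (modeVector δ F 0 H m) (modeVector δ 0 G' H m))
    (i3 : InnerIntegrable (modeVector δ F' 0 H m) (modeVector δ 0 G H m))
    (i4 : InnerIntegrable (modeVector δ 0 G H m) (modeVector δ 0 G' H m)) :
    bdCovariance H M γ γ' = (Real.Gamma (2 - δ H m))⁻¹ ^ 2 * H ^ 2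
      * fieldInner (modeVector δ F G H m) (modeVector δ F' G' H m) := by
  have hsum : ∀ (F G : Space3 → ℂ), ∀ᵐ ξ, modeVector δ F G H m ξ
      = (1 : ℝ) • modeVector δ F 0 H m ξ + (1 : ℝ) • modeVector δ 0 G H m ξ := fun F G => by
    filter_upwards [ae_waveNumber_pos] with ξ hξ
    rw [modeVector_zero_right _ hH hξ, modeVector_zero_left _ hH hξ, one_smul, one_smul,
      modeVector_eq_tensor hH hξ]
  have j1 := i1.symm.lin i2.symm (hsum F' G')
  have j2 := i3.lin i4.symm (hsum F' G')
  have e1 := fieldInner_lin i1.symm i2.symm (hsum F' G')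
  have e2 := fieldInner_lin i3 i4.symm (hsum F' G')
  have e3 := fieldInner_lin j1.symm j2.symm (hsum F G)
  rw [fieldInner_comm (modeVector δ F 0 H m), e1, fieldInner_comm (modeVector δ 0 G H m),
    e2] at e3
  rw [bdCovariance, bdFieldField_eq hH hδ hδ' hm, bdFieldMomentum_eq hH hδ hδ' hm,
    bdFieldMomentum_eq hH hδ hδ' hm, bdMomentumMomentum_eq hH hδ hδ' hm, hF, hG, hF', hG', e3,
    fieldInner_comm (modeVector δ F' 0 H m) (modeVector δ F 0 H m),
    fieldInner_comm (modeVector δ 0 G' H m) (modeVector δ F 0 H m),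
    fieldInner_comm (modeVector δ 0 G' H m) (modeVector δ 0 G H m)]
  ring

theorem det_bdCovariance {H m M : ℝ} (hH : 0 < H) (hδ : 0 < δ H m) (hδ' : δ H m < 1 / 2)
    (hm : modeOrder H M = 3 / 2 - δ H m) {γ₁ γ₂ : PhasePoint}
    (hint : ∀ F ∈ ({modeVector δ (fourierFunction γ₁.f) 0 H m,
        modeVector δ (fourierFunction γ₂.f) 0 H m,
        modeVector δ 0 (fourierFunction γ₁.g) H m, modeVector δ 0 (fourierFunction γ₂.g) H m} :
        Set (Space3 → TwoModes)), ∀ G ∈ ({modeVector δ (fourierFunction γ₁.f) 0 H m,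
        modeVector δ (fourierFunction γ₂.f) 0 H m,
        modeVector δ 0 (fourierFunction γ₁.g) H m, modeVector δ 0 (fourierFunction γ₂.g) H m} :
        Set (Space3 → TwoModes)), InnerIntegrable F G) :
    (!![bdCovariance H M γ₁ γ₁, bdCovariance H M γ₁ γ₂;
      bdCovariance H M γ₂ γ₁, bdCovariance H M γ₂ γ₂]).det
      = (Real.Gamma (2 - δ H m))⁻¹ ^ 4 * (H ^ 4
        * gramDet (modeVector δ (fourierFunction γ₁.f) (fourierFunction γ₁.g) H m)
          (modeVector δ (fourierFunction γ₂.f) (fourierFunction γ₂.g) H m)) := by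
  simp only [mem_insert_iff, mem_singleton_iff, forall_eq_or_imp, forall_eq] at hint
  obtain ⟨⟨a1, a2, a3, a4⟩, ⟨b1, b2, b3, b4⟩, ⟨c1, c2, c3, c4⟩, d1, d2, d3, d4⟩ := hint
  rw [Matrix.det_fin_two_of, bdCovariance_eq hH hδ hδ' hm rfl rfl rfl rfl a1 a3 a3 c3,
    bdCovariance_eq hH hδ hδ' hm rfl rfl rfl rfl a2 a4 b3 c4,
    bdCovariance_eq hH hδ hδ' hm rfl rfl rfl rfl b1 b3 a4 d3,
    bdCovariance_eq hH hδ hδ' hm rfl rfl rfl rfl b2 b4 b4 d4, gramDet]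
  ring

/-! ### Shears of the basis of the mode -/

theorem gramDet_comm (V W : Space3 → TwoModes) : gramDet V W = gramDet W V := by
  rw [gramDet, gramDet]
  ring

theorem gramDet_shear {V W X : Space3 → TwoModes} {t : ℝ} (hV : InnerIntegrable V V)
    (hVW : InnerIntegrable V W) (hW : InnerIntegrable W W) (hX : ∀ᵐ ξ, X ξ = W ξ - t • V ξ) :
    gramDet V X = gramDet V W := by
  have hX' : ∀ᵐ ξ, X ξ = (1 : ℝ) • W ξ + (-t) • V ξ := by
    filter_upwards [hX] with ξ hξ
    rw [hξ]
    module
  have jV := hVW.symm.lin hV hX'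
  have jW := hW.lin hVW hX'
  have e1 := fieldInner_lin hVW.symm hV hX'
  have e2 := fieldInner_lin hW hVW hX'
  have e3 := fieldInner_lin jW.symm jV.symm hX'
  rw [fieldInner_comm W X, e2, fieldInner_comm V X, e1] at e3
  rw [gramDet, gramDet, e3, fieldInner_comm V X, e1, fieldInner_comm V W]
  ring

theorem modeVector_sub_smul (F G F' G' : Space3 → ℂ) (t : ℝ) (H m : ℝ) (ξ : Space3) :
    modeVector δ (fun ξ => F ξ - t * F' ξ) (fun ξ => G ξ - t * G' ξ) H m ξ
      = modeVector δ F G H m ξ - t • modeVector δ F' G' H m ξ := by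
  have h : ∀ (a : ℂ) (F F' τ : ℂ), tensor (a * (F - t * F')) τ
      = tensor (a * F) τ - t • tensor (a * F') τ := by
    intro a F F' τ
    rw [← tensor_smul_left, eq_sub_iff_add_eq, ← tensor_add_left]
    congr 1
    ring
  simp only [modeVector, fieldVector, momentumVector, h]
  module

theorem IsProfile.sub_smul {F F' : Space3 → ℂ} {p p' : ℝ} (hF : IsProfile N F p)
    (hF' : IsProfile N F' p') (t : ℝ) :
    IsProfile (fun ξ => (1 + |t|) * N ξ) (fun ξ => F ξ - t * F' ξ) (p - t * p') := by
  obtain ⟨m1, C, hC⟩ := hF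
  obtain ⟨m2, D, hD⟩ := hF'
  refine ⟨m1.sub (m2.const_mul _), C + |t| * D, ?_⟩
  filter_upwards [hC, hD] with ξ h1 h2
  constructor
  · intro hk
    calc _ = ‖(F ξ - p) - t * (F' ξ - p')‖ := by
          congr 1
          push_cast
          ring
      _ ≤ ‖F ξ - p‖ + |t| * ‖F' ξ - p'‖ := by
          refine (norm_sub_le _ _).trans_eq ?_
          rw [norm_mul, Complex.norm_real, Real.norm_eq_abs]
      _ ≤ C * waveNumber ξ + |t| * (D * waveNumber ξ) := by
          gcongr
          exacts [h1.1 hk, h2.1 hk]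
      _ = _ := by ring
  · intro hk
    have h0 := Real.rpow_nonneg (waveNumber_nonneg ξ) (-(1 / 2) : ℝ)
    calc _ ≤ waveNumber ξ ^ (-(1 / 2) : ℝ) * (‖F ξ‖ + |t| * ‖F' ξ‖) := by
          gcongr
          refine (norm_sub_le _ _).trans_eq ?_
          rw [norm_mul, Complex.norm_real, Real.norm_eq_abs]
      _ = waveNumber ξ ^ (-(1 / 2) : ℝ) * ‖F ξ‖
          + |t| * (waveNumber ξ ^ (-(1 / 2) : ℝ) * ‖F' ξ‖) := by ring
      _ ≤ N ξ + |t| * N ξ := by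
          gcongr
          exacts [h1.2 hk, h2.2 hk]
      _ = _ := by ring

theorem IsMomentumProfile.sub_smul {F F' : Space3 → ℂ} {p p' : ℝ} (hF : IsMomentumProfile N F p)
    (hF' : IsMomentumProfile N F' p') (t : ℝ) :
    IsMomentumProfile (fun ξ => (1 + |t|) * N ξ) (fun ξ => F ξ - t * F' ξ) (p - t * p') := by
  obtain ⟨m1, C, hC⟩ := hF
  obtain ⟨m2, D, hD⟩ := hF'
  refine ⟨m1.sub (m2.const_mul _), C + |t| * D, ?_⟩
  filter_upwards [hC, hD] with ξ h1 h2
  constructor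
  · intro hk
    calc _ = ‖(F ξ - p) - t * (F' ξ - p')‖ := by
          congr 1
          push_cast
          ring
      _ ≤ ‖F ξ - p‖ + |t| * ‖F' ξ - p'‖ := by
          refine (norm_sub_le _ _).trans_eq ?_
          rw [norm_mul, Complex.norm_real, Real.norm_eq_abs]
      _ ≤ C * waveNumber ξ + |t| * (D * waveNumber ξ) := by
          gcongr
          exacts [h1.1 hk, h2.1 hk]
      _ = _ := by ring
  · intro hk
    have h0 := Real.rpow_nonneg (waveNumber_nonneg ξ) (1 / 2 : ℝ)
    calc _ ≤ waveNumber ξ ^ (1 / 2 : ℝ) * (‖F ξ‖ + |t| * ‖F' ξ‖) := by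
          gcongr
          refine (norm_sub_le _ _).trans_eq ?_
          rw [norm_mul, Complex.norm_real, Real.norm_eq_abs]
      _ = waveNumber ξ ^ (1 / 2 : ℝ) * ‖F ξ‖
          + |t| * (waveNumber ξ ^ (1 / 2 : ℝ) * ‖F' ξ‖) := by ring
      _ ≤ N ξ + |t| * N ξ := by
          gcongr
          exacts [h1.2 hk, h2.2 hk]
      _ = _ := by ring

theorem IsProfile.mono {N' : Space3 → ℝ} {F : Space3 → ℂ} {p : ℝ} (h : IsProfile N F p)
    (hN : ∀ ξ, N ξ ≤ N' ξ) : IsProfile N' F p := by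
  obtain ⟨m, C, hC⟩ := h
  exact ⟨m, C, hC.mono fun ξ h => ⟨h.1, fun hk => (h.2 hk).trans (hN ξ)⟩⟩

theorem IsMomentumProfile.mono {N' : Space3 → ℝ} {F : Space3 → ℂ} {p : ℝ}
    (h : IsMomentumProfile N F p) (hN : ∀ ξ, N ξ ≤ N' ξ) : IsMomentumProfile N' F p := by
  obtain ⟨m, C, hC⟩ := h
  exact ⟨m, C, hC.mono fun ξ h => ⟨h.1, fun hk => (h.2 hk).trans (hN ξ)⟩⟩

theorem IsProfile.zero (hN : ∀ ξ, 0 ≤ N ξ) : IsProfile N 0 0 := by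
  refine ⟨aestronglyMeasurable_zero, 0, Eventually.of_forall fun ξ => ⟨fun _ => ?_, fun _ => ?_⟩⟩
  · simp
  · simpa using hN ξ

theorem IsMomentumProfile.zero (hN : ∀ ξ, 0 ≤ N ξ) : IsMomentumProfile N 0 0 := by
  refine ⟨aestronglyMeasurable_zero, 0, Eventually.of_forall fun ξ => ⟨fun _ => ?_, fun _ => ?_⟩⟩
  · simp
  · simpa using hN ξ

end

/-! ## The determinant of the covariance matrix grows -/

/-- The determinant of the covariance matrix. -/
def covarianceDet (H M : ℝ) (γ₁ γ₂ : PhasePoint) : ℝ :=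
  (!![bdCovariance H M γ₁ γ₁, bdCovariance H M γ₁ γ₂;
    bdCovariance H M γ₂ γ₁, bdCovariance H M γ₂ γ₂]).det

/-- This is how the symplectic normalization enters the proof: it excludes proportional profiles,
for which the Gram determinant would vanish. -/
theorem symplecticForm_eq_zero {γ₁ γ₂ : PhasePoint} {t : ℝ}
    (hf : ∀ᵐ ξ, fourierFunction γ₂.f ξ = t * fourierFunction γ₁.f ξ)
    (hg : ∀ᵐ ξ, fourierFunction γ₂.g ξ = t * fourierFunction γ₁.g ξ) :
    symplecticForm γ₂ γ₁ = 0 := by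
  rw [symplecticForm, sub_eq_zero, weightedProduct, weightedProduct]
  refine integral_congr_ae ?_
  filter_upwards [hf, hg] with ξ h1 h2
  rw [h1, h2]
  simp only [Complex.mul_re, Complex.mul_im, Complex.conj_re, Complex.conj_im, Complex.ofReal_re,
    Complex.ofReal_im]
  ring

theorem symplecticForm_swap (γ₁ γ₂ : PhasePoint) :
    symplecticForm γ₁ γ₂ = -symplecticForm γ₂ γ₁ := by
  have h : ∀ u v : 𝓢'(Space3, ℂ), weightedProduct (fun _ => 1) u v
      = weightedProduct (fun _ => 1) v u := fun u v => by
    rw [weightedProduct, weightedProduct]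
    congr 1
    ext ξ
    simp only [Complex.mul_re, Complex.conj_re, Complex.conj_im]
    ring
  rw [symplecticForm, symplecticForm, h γ₁.f, h γ₁.g]
  ring

section

variable {δ κ : ℝ → ℝ → ℝ} {q κ₀ : ℝ} {l : Filter (ℝ × ℝ)} {N : Space3 → ℝ}

/-- The shear by t = p₂/p₁ makes the second field average zero and preserves the Gram determinant.
The short-wave bound only grows by the factor 1 + |t|. -/
theorem IsRegime.exists_isSlow_gramDet_of_ne_zero (hl : IsRegime δ κ q κ₀ l) [l.NeBot]
    (hκ : 0 ≤ κ₀) (hq : q = 0 ∨ ∀ᶠ p in l, δ p.1 p.2 * p.1 ^ 2 * (3 - δ p.1 p.2) = 3 * q)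
    (hN : ∀ ξ, 0 ≤ N ξ) (hN2 : Integrable fun ξ => N ξ ^ 2)
    {F₁ G₁ F₂ G₂ : Space3 → ℂ} {p₁ g₁ p₂ g₂ : ℝ} (hF₁ : IsProfile N F₁ p₁)
    (hG₁ : IsMomentumProfile N G₁ g₁) (hF₂ : IsProfile N F₂ p₂) (hG₂ : IsMomentumProfile N G₂ g₂)
    (hp : p₁ ≠ 0)
    (hne : ∀ t : ℝ, ¬ ((∀ᵐ ξ, F₂ ξ = t * F₁ ξ) ∧ ∀ᵐ ξ, G₂ ξ = t * G₁ ξ)) :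
    ∃ n : ℕ, 0 < n + κ₀ ∧ ∃ s d, 0 < d ∧ IsSlow l s d ∧ ∀ᶠ p in l,
      p.1 ^ 4 * gramDet (modeVector δ F₁ G₁ p.1 p.2) (modeVector δ F₂ G₂ p.1 p.2)
        = p.1 ^ n * (s p.1 p.2 / δ p.1 p.2) := by
  set t := p₂ / p₁ with ht
  have hle : ∀ ξ, N ξ ≤ (1 + |t|) * N ξ := fun ξ => by nlinarith [hN ξ, abs_nonneg t]
  have hN' : ∀ ξ, 0 ≤ (1 + |t|) * N ξ := fun ξ => (hN ξ).trans (hle ξ)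
  have hN2' : Integrable fun ξ => ((1 + |t|) * N ξ) ^ 2 := by
    simp only [mul_pow]
    exact hN2.const_mul _
  have hb := hF₂.sub_smul hF₁ t
  rw [ht, div_mul_cancel₀ _ hp, sub_self, ← ht] at hb
  obtain ⟨n, hn, s, d, hd, hs, h⟩ := hl.exists_isSlow_gramDet_modeVector hκ hq hN' hN2'
    (hF₁.mono hle) (hG₁.mono hle) hb (hG₂.sub_smul hG₁ t) hp (by
      rintro ⟨h1, h2⟩
      exact hne t ⟨h1.mono fun ξ h => sub_eq_zero.1 h, h2.mono fun ξ h => sub_eq_zero.1 h⟩)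
  refine ⟨n, hn, s, d, hd, hs, ?_⟩
  filter_upwards [h, hl.eventually_innerIntegrable hN hN2 hF₁ hG₁ hF₁ hG₁,
    hl.eventually_innerIntegrable hN hN2 hF₁ hG₁ hF₂ hG₂,
    hl.eventually_innerIntegrable hN hN2 hF₂ hG₂ hF₂ hG₂] with p h h1 h2 h3
  rw [← h, gramDet_shear h1 h2 h3
    (Eventually.of_forall fun ξ => modeVector_sub_smul F₂ G₂ F₁ G₁ t p.1 p.2 ξ)]

theorem IsRegime.eventually_covarianceDet (hl : IsRegime δ κ q κ₀ l) [l.NeBot]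
    (hκ : 0 ≤ κ₀) (hq : q = 0 ∨ ∀ᶠ p in l, δ p.1 p.2 * p.1 ^ 2 * (3 - δ p.1 p.2) = 3 * q)
    {M : ℝ → ℝ → ℝ} (hM : ∀ᶠ p in l, modeOrder p.1 (M p.1 p.2) = 3 / 2 - δ p.1 p.2)
    (hN : ∀ ξ, 0 ≤ N ξ) (hN2 : Integrable fun ξ => N ξ ^ 2)
    {γ₁ γ₂ : PhasePoint} {p₁ g₁ p₂ g₂ : ℝ} (hF₁ : IsProfile N (fourierFunction γ₁.f) p₁)
    (hG₁ : IsMomentumProfile N (fourierFunction γ₁.g) g₁)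
    (hF₂ : IsProfile N (fourierFunction γ₂.f) p₂)
    (hG₂ : IsMomentumProfile N (fourierFunction γ₂.g) g₂)
    (hp : ¬ (p₁ = 0 ∧ p₂ = 0)) (hω : symplecticForm γ₂ γ₁ ≠ 0) :
    ∀ᶠ p in l, 0 < covarianceDet p.1 (M p.1 p.2) γ₁ γ₂ ∧ ∃ d', 0 < d' ∧
      HasDerivAt (fun H => covarianceDet H (M H p.2) γ₁ γ₂) d' p.1 := by
  have hgram : ∃ n : ℕ, 0 < n + κ₀ ∧ ∃ s d, 0 < d ∧ IsSlow l s d ∧ ∀ᶠ p in l,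
      p.1 ^ 4 * gramDet (modeVector δ (fourierFunction γ₁.f) (fourierFunction γ₁.g) p.1 p.2)
        (modeVector δ (fourierFunction γ₂.f) (fourierFunction γ₂.g) p.1 p.2)
        = p.1 ^ n * (s p.1 p.2 / δ p.1 p.2) := by
    -- The Gram determinant is symmetric, so the phase point with nonzero field average may be taken
    -- as the first one.
    by_cases h1 : p₁ = 0
    · have h2 : p₂ ≠ 0 := fun h => hp ⟨h1, h⟩
      obtain ⟨n, hn, s, d, hd, hs, h⟩ := hl.exists_isSlow_gramDet_of_ne_zero hκ hq hN hN2
        hF₂ hG₂ hF₁ hG₁ h2 (fun t ht => hω (by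
          rw [symplecticForm_swap, symplecticForm_eq_zero ht.1 ht.2, neg_zero]))
      refine ⟨n, hn, s, d, hd, hs, h.mono fun p h => ?_⟩
      rw [gramDet_comm, h]
    · exact hl.exists_isSlow_gramDet_of_ne_zero hκ hq hN hN2 hF₁ hG₁ hF₂ hG₂ h1
        (fun t ht => hω (symplecticForm_eq_zero ht.1 ht.2))
  obtain ⟨n, hn, s, d, hd, hs, h⟩ := hgram
  have hG := (IsRegime.isSlow_Gamma ((IsSlow.const l 2).sub hl.isSlow_delta) (by norm_num)).inv
    (Real.Gamma_pos_of_pos (by norm_num)).ne' |>.pow 4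
  rw [sub_zero, Real.Gamma_two, inv_one, one_pow] at hG
  refine hl.eventually_hasDerivAt_pos (D := fun H m => covarianceDet H (M H m) γ₁ γ₂) hn
    (by rwa [one_mul]) (hG.mul hs) ?_
  have z := IsProfile.zero hN
  have z' := IsMomentumProfile.zero hN
  have I {F G F' G' : Space3 → ℂ} {p g p' g' : ℝ} (hF : IsProfile N F p)
    (hG : IsMomentumProfile N G g) (hF' : IsProfile N F' p')
    (hG' : IsMomentumProfile N G' g') := hl.eventually_innerIntegrable hN hN2 hF hG hF' hG'
  filter_upwards [h, hM, hl.eventually_one_lt, hl.delta_pos,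
    hl.tendsto_delta.eventually_lt_const (show (0 : ℝ) < 1 / 2 by norm_num),
    I hF₁ z' hF₁ z', I hF₁ z' hF₂ z', I hF₁ z' z hG₁, I hF₁ z' z hG₂,
    I hF₂ z' hF₂ z', I hF₂ z' z hG₁, I hF₂ z' z hG₂,
    I z hG₁ z hG₁, I z hG₁ z hG₂, I z hG₂ z hG₂]
    with p h hMp hp1 hδ hδ' i11 i12 i13 i14 i22 i23 i24 i33 i34 i44
  rw [covarianceDet, det_bdCovariance (by linarith) hδ hδ' hMp, h]
  · ring
  · simp only [mem_insert_iff, mem_singleton_iff, forall_eq_or_imp, forall_eq]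
    exact ⟨⟨i11, i12, i13, i14⟩, ⟨i12.symm, i22, i23, i24⟩, ⟨i13.symm, i23.symm, i33, i34⟩,
      i14.symm, i24.symm, i34.symm, i44⟩

end

/-! ## The entropy of a Gaussian state is monotone -/

theorem gaussianEntropy_eq (ν : ℝ) : gaussianEntropy ν
    = ((ν + 1) / 2 * Real.log ((ν + 1) / 2) - (ν - 1) / 2 * Real.log ((ν - 1) / 2))
      / Real.log 2 := by
  rw [gaussianEntropy, Real.logb, Real.logb]
  ring

theorem continuous_gaussianEntropy : Continuous gaussianEntropy := by
  rw [funext gaussianEntropy_eq]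
  have h : ∀ c : ℝ, Continuous fun ν : ℝ => (ν + c) / 2 * Real.log ((ν + c) / 2) := fun c =>
    Real.continuous_mul_log.comp ((continuous_id.add continuous_const).div_const 2)
  simp only [sub_eq_add_neg _ (1 : ℝ)]
  exact ((h 1).sub (h (-1))).div_const (Real.log 2)

/-- Since `Real.log x` is log |x|, the formula also makes sense for ν < 1, with derivative log |(ν +
1)/(ν − 1)| / (2 log 2) > 0. Monotonicity thus holds on all of [0, ∞), and the uncertainty bound ν ≥
1 is not needed. -/
theorem deriv_gaussianEntropy_pos {ν : ℝ} (h0 : 0 < ν) (h1 : ν ≠ 1) :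
    0 < deriv gaussianEntropy ν := by
  have h : ∀ c : ℝ, ν + c ≠ 0 →
      HasDerivAt (fun ν : ℝ => (ν + c) / 2 * Real.log ((ν + c) / 2))
        ((Real.log ((ν + c) / 2) + 1) * (1 / 2)) ν := fun c hc =>
    HasDerivAt.comp (h₂ := fun x => x * Real.log x) ν
      (Real.hasDerivAt_mul_log (div_ne_zero hc two_ne_zero))
      (((hasDerivAt_id ν).add_const c).div_const 2)
  have h2 := ((h 1 (by linarith)).sub (h (-1) (fun h => h1 (by linarith)))).div_const (Real.log 2)
  rw [funext gaussianEntropy_eq]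
  simp only [sub_eq_add_neg _ (1 : ℝ)]
  refine lt_of_lt_of_eq ?_ h2.deriv.symm
  have h4 : Real.log ((ν + -1) / 2) < Real.log ((ν + 1) / 2) := by
    rw [← Real.log_abs]
    refine Real.log_lt_log (abs_pos.2 (div_ne_zero (fun h => h1 (by linarith)) two_ne_zero)) ?_
    rw [abs_lt]
    constructor <;> linarith
  have := Real.log_pos one_lt_two
  refine div_pos ?_ this
  linarith

theorem strictMonoOn_gaussianEntropy : StrictMonoOn gaussianEntropy (Ici 0) := by
  have h1 : StrictMonoOn gaussianEntropy (Icc 0 1) := by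
    refine strictMonoOn_of_deriv_pos (convex_Icc 0 1) continuous_gaussianEntropy.continuousOn ?_
    intro x hx
    rw [interior_Icc] at hx
    exact deriv_gaussianEntropy_pos hx.1 hx.2.ne
  have h2 : StrictMonoOn gaussianEntropy (Ici 1) := by
    refine strictMonoOn_of_deriv_pos (convex_Ici 1) continuous_gaussianEntropy.continuousOn ?_
    intro x hx
    rw [interior_Ici] at hx
    exact deriv_gaussianEntropy_pos (one_pos.trans hx) hx.ne'
  have h3 := h1.union h2 (isGreatest_Icc zero_le_one) isLeast_Ici
  rwa [Icc_union_Ici_eq_Ici zero_le_one] at h3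

theorem strictMonoOn_bdEntropy {M : ℝ → ℝ} {γ₁ γ₂ : PhasePoint} {s : Set ℝ} (hs : Convex ℝ s)
    (h : ∀ H ∈ s, 0 < covarianceDet H (M H) γ₁ γ₂ ∧ ∃ d', 0 < d' ∧
      HasDerivAt (fun H => covarianceDet H (M H) γ₁ γ₂) d' H) :
    StrictMonoOn (fun H => bdEntropy H (M H) γ₁ γ₂) s := by
  have h1 : StrictMonoOn (fun H => covarianceDet H (M H) γ₁ γ₂) s := by
    refine strictMonoOn_of_deriv_pos hs ?_ ?_
    · intro H hH
      obtain ⟨-, d', -, hd⟩ := h H hH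
      exact hd.continuousAt.continuousWithinAt
    · intro H hH
      obtain ⟨-, d', hd', hd⟩ := h H (interior_subset hH)
      rwa [hd.deriv]
  intro H hH H' hH' hlt
  exact strictMonoOn_gaussianEntropy (Real.sqrt_nonneg _) (Real.sqrt_nonneg _)
    (Real.sqrt_lt_sqrt (h H hH).1.le (h1 hH hH' hlt))

/-! ## The regimes of a small mass -/

/-- The difference between `3/2` and the order of the mode functions. -/
def orderDefect (H m : ℝ) : ℝ := 3 / 2 - modeOrder H m

theorem modeOrder_eq (H m : ℝ) : modeOrder H m = 3 / 2 - orderDefect H m := by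
  rw [orderDefect]
  ring

theorem orderDefect_mul {H m : ℝ} (h : m ^ 2 / H ^ 2 ≤ 9 / 4) :
    orderDefect H m * (3 - orderDefect H m) = m ^ 2 / H ^ 2 := by
  have := Real.sq_sqrt (show 0 ≤ 9 / 4 - m ^ 2 / H ^ 2 by linarith)
  rw [orderDefect, modeOrder]
  linarith

theorem orderDefect_pos {H m : ℝ} (hH : 0 < H) (hm : 0 < m) : 0 < orderDefect H m := by
  have h : 0 < m ^ 2 / H ^ 2 := by positivity
  rw [orderDefect, sub_pos, modeOrder, Real.sqrt_lt' (by norm_num)]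
  linarith

theorem tendsto_sqrt_sub :
    Tendsto (fun x : ℝ => 3 / 2 - Real.sqrt (9 / 4 - x ^ 2)) (𝓝 0) (𝓝 0) := by
  have h : Continuous fun x : ℝ => 3 / 2 - Real.sqrt (9 / 4 - x ^ 2) := by fun_prop
  have h2 : (3 : ℝ) / 2 - Real.sqrt (9 / 4 - 0 ^ 2) = 0 := by
    rw [show (9 / 4 - 0 ^ 2 : ℝ) = (3 / 2) ^ 2 by norm_num, Real.sqrt_sq (by norm_num), sub_self]
  simpa only [h2] using h.tendsto 0

theorem tendsto_orderDefect {l : Filter (ℝ × ℝ)} (h : Tendsto (fun p => p.2 / p.1) l (𝓝 0)) :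
    Tendsto (fun p => orderDefect p.1 p.2) l (𝓝 0) := by
  refine (tendsto_sqrt_sub.comp h).congr fun p => ?_
  rw [Function.comp_apply, div_pow, orderDefect, modeOrder]

/-- At fixed m, differentiating δ(3 − δ) = m²/H² implicitly shows that δ has the logarithmic
derivative −(3 − δ)/(3/2 − δ), which tends to −2. -/
theorem hasDerivAt_orderDefect {H m : ℝ} (hH : 0 < H) (h : m ^ 2 / H ^ 2 < 9 / 4) :
    HasDerivAt (fun H => orderDefect H m)
      (-((3 - orderDefect H m) / (3 / 2 - orderDefect H m) * orderDefect H m) / H) H := by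
  have h1 : 0 < 9 / 4 - m ^ 2 / H ^ 2 := by linarith
  have h2 := Real.sqrt_pos.2 h1
  have h3 : HasDerivAt (fun H : ℝ => 9 / 4 - m ^ 2 / H ^ 2) (2 * (m ^ 2 / H ^ 2) / H) H := by
    refine (((hasDerivAt_const H (m ^ 2)).div (hasDerivAt_pow 2 H)
      (by positivity)).const_sub _).congr_deriv ?_
    field_simp
    ring
  refine ((h3.sqrt h1.ne').const_sub (3 / 2)).congr_deriv ?_
  have h4 : 2 * (m ^ 2 / H ^ 2) = 2 * (orderDefect H m * (3 - orderDefect H m)) := by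
    rw [orderDefect_mul h.le]
  rw [h4, ← modeOrder_eq, modeOrder]
  field_simp

/-- The regime of a fixed mass. -/
theorem isRegime_fixedMass {l : Filter (ℝ × ℝ)} {q : ℝ} {a : Filter ℝ} [a.IsCountablyGenerated]
    (hl : l = atTop ×ˢ a) (ha : ∀ᶠ m in a, 0 < m)
    (hq : Tendsto (fun m : ℝ => m ^ 2) a (𝓝 (3 * q))) :
    IsRegime orderDefect (fun H m => (3 - orderDefect H m) / (3 / 2 - orderDefect H m)) q 2 l := by
  subst hl
  have h1 : Tendsto Prod.fst (atTop ×ˢ a) (atTop : Filter ℝ) := tendsto_fst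
  have hm : Tendsto (fun p : ℝ × ℝ => p.2 ^ 2) (atTop ×ˢ a) (𝓝 (3 * q)) := hq.comp tendsto_snd
  have hsq : Tendsto (fun p : ℝ × ℝ => p.2 ^ 2 / p.1 ^ 2) (atTop ×ˢ a) (𝓝 0) :=
    hm.div_atTop ((tendsto_pow_atTop two_ne_zero).comp h1)
  have hδ : Tendsto (fun p : ℝ × ℝ => orderDefect p.1 p.2) (atTop ×ˢ a) (𝓝 0) := by
    refine tendsto_orderDefect ?_
    have := hsq.sqrt
    simp only [← div_pow, Real.sqrt_sq_eq_abs, Real.sqrt_zero] at this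
    exact tendsto_zero_iff_abs_tendsto_zero _ |>.2 this
  have hsm := hsq.eventually_lt_const (show (0 : ℝ) < 9 / 4 by norm_num)
  have hH := h1.eventually (eventually_gt_atTop (0 : ℝ))
  refine ⟨inferInstance, ?_, h1, hδ, ?_, ?_, ?_, by norm_num, by ring, ?_⟩
  · intro s hs
    obtain ⟨A, hA, B, hB, hAB⟩ := mem_prod_iff.1 hs
    obtain ⟨c, hc⟩ := mem_atTop_sets.1 hA
    refine ⟨Ioi c ×ˢ B, prod_mem_prod (Ioi_mem_atTop c) hB,
      (prod_mono (fun x hx => hc x (le_of_lt hx)) Subset.rfl).trans hAB, fun m => ?_⟩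
    by_cases hmB : m ∈ B
    · simpa [hmB] using isOpen_lt' c
    · simp [hmB]
  · filter_upwards [hH, (tendsto_snd (f := atTop) (g := a)).eventually ha] with p hp hp'
    exact orderDefect_pos hp hp'
  · have h3 : Tendsto (fun p : ℝ × ℝ => p.2 ^ 2 / (3 - orderDefect p.1 p.2)) (atTop ×ˢ a)
        (𝓝 (3 * q / (3 - 0))) := hm.div (hδ.const_sub 3) (by norm_num)
    rw [sub_zero, mul_div_cancel_left₀ _ (by norm_num : (3 : ℝ) ≠ 0)] at h3
    refine h3.congr' ?_
    filter_upwards [hsm, hH, hδ.eventually_lt_const (show (0 : ℝ) < 1 by norm_num)] with p h h' h''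
    rw [div_eq_iff (by linarith), mul_right_comm, orderDefect_mul h.le]
    field_simp
  · have := (hδ.const_sub 3).div (hδ.const_sub (3 / 2)) (by norm_num)
    norm_num at this
    exact this
  · filter_upwards [hsm, hH] with p h h'
    exact hasDerivAt_orderDefect h' h

/-- The regime of a fixed ratio of the mass and the Hubble rate. -/
theorem isRegime_fixedRatio {l : Filter (ℝ × ℝ)}
    (hl : l = comap Prod.fst atTop ⊓ comap (fun p : ℝ × ℝ => p.2 * p.1) (𝓝[>] 0)) :
    IsRegime (fun _ r => orderDefect 1 r) (fun _ _ => 0) 0 0 l := by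
  have h1 : Tendsto Prod.fst l atTop := by rw [hl]; exact tendsto_comap.mono_left inf_le_left
  have h2 : Tendsto (fun p : ℝ × ℝ => p.2 * p.1) l (𝓝[>] 0) := by
    rw [hl]; exact tendsto_comap.mono_left inf_le_right
  have h3 : Tendsto (fun p : ℝ × ℝ => p.2 * p.1) l (𝓝 0) := h2.mono_right nhdsWithin_le_nhds
  have hH := h1.eventually (eventually_gt_atTop (0 : ℝ))
  have hr : Tendsto (fun p : ℝ × ℝ => p.2) l (𝓝 0) := by
    have := h3.mul (tendsto_inv_atTop_zero.comp h1)
    rw [mul_zero] at this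
    refine this.congr' ?_
    filter_upwards [hH] with p hp
    simp only [Function.comp_apply]
    field_simp
  have hpos : ∀ᶠ p : ℝ × ℝ in l, 0 < p.2 := by
    filter_upwards [h2.eventually self_mem_nhdsWithin, hH] with p hp hp'
    exact pos_of_mul_pos_left hp hp'.le
  have hδ : Tendsto (fun p : ℝ × ℝ => orderDefect 1 p.2) l (𝓝 0) := by
    refine (tendsto_sqrt_sub.comp hr).congr fun p => ?_
    rw [Function.comp_apply, orderDefect, modeOrder, one_pow, div_one]
  refine ⟨by rw [hl]; infer_instance, ?_, h1, hδ, ?_, ?_, tendsto_const_nhds, by norm_num,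
    by ring, ?_⟩
  · intro s hs
    rw [hl] at hs
    obtain ⟨A, ⟨A', hA', hA⟩, B, ⟨B', hB', hB⟩, rfl⟩ := mem_inf_iff.1 hs
    obtain ⟨c, hc⟩ := mem_atTop_sets.1 hA'
    obtain ⟨e, he, hB''⟩ := (mem_nhdsGT_iff_exists_Ioo_subset).1 hB'
    refine ⟨Prod.fst ⁻¹' (Ioi c) ∩ (fun p : ℝ × ℝ => p.2 * p.1) ⁻¹' (Ioo 0 e), ?_, ?_, fun m => ?_⟩
    · exact inter_mem (h1 (Ioi_mem_atTop c)) (h2 (Ioo_mem_nhdsGT he))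
    · exact inter_subset_inter ((preimage_mono fun x hx => hc x (le_of_lt hx)).trans hA)
        ((preimage_mono hB'').trans hB)
    · exact isOpen_Ioi.inter (isOpen_Ioo.preimage (continuous_const.mul continuous_id))
  · filter_upwards [hpos] with p hp
    exact orderDefect_pos one_pos hp
  -- Here δH² = (rH)²/(3 − δ), and rH → 0 along the filter, so q = 0 although δ does not depend on
  -- H.
  · have h4 := (h3.pow 2).div (hδ.const_sub 3) (by norm_num)
    norm_num at h4
    refine h4.congr' ?_
    filter_upwards [(hr.pow 2).eventually_lt_const (show (0 : ℝ) ^ 2 < 9 / 4 by norm_num),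
      hδ.eventually_lt_const (show (0 : ℝ) < 1 by norm_num)] with p h h'
    have := orderDefect_mul (H := 1) (m := p.2) (by simpa using h.le)
    rw [one_pow, div_one] at this
    simp only [Pi.div_apply]
    rw [div_eq_iff (by linarith)]
    linear_combination (-p.1 ^ 2) * this
  · refine Eventually.of_forall fun p => ?_
    simpa using hasDerivAt_const p.1 (orderDefect 1 p.2)

/-! ## Cutoffs of Schwartz functions -/

/-- The Schwartz function `φ(x) Θ(c x)`. -/
def cutoff (Θ : 𝓢(Space3, ℂ)) (c : ℝ) (φ : 𝓢(Space3, ℂ)) : 𝓢(Space3, ℂ) :=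
  SchwartzMap.smulLeftCLM ℂ (fun x => Θ (c • x)) φ

theorem cutoff_apply (Θ : 𝓢(Space3, ℂ)) (c : ℝ) (φ : 𝓢(Space3, ℂ)) (x : Space3) :
    cutoff Θ c φ x = Θ (c • x) * φ x := by
  have h : Function.HasTemperateGrowth fun x : Space3 => Θ (c • x) := by
    have := Θ.hasTemperateGrowth
    fun_prop
  rw [cutoff, SchwartzMap.smulLeftCLM_apply_apply h, smul_eq_mul]

/-- For i = 0 the mean value inequality gives c‖x‖; for i ≥ 1 the chain rule gives c^i ≤ c. The
growth 1 + ‖x‖ is later absorbed by a Schwartz seminorm with one more power of ‖x‖. -/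
theorem norm_iteratedFDeriv_scaled_sub_le (Θ : 𝓢(Space3, ℂ)) (i : ℕ) :
    ∃ B, 0 ≤ B ∧ ∀ c : ℝ, 0 < c → c ≤ 1 → ∀ x : Space3,
      ‖iteratedFDeriv ℝ i (fun x => Θ (c • x) - Θ 0) x‖ ≤ c * B * (1 + ‖x‖) := by
  rcases i with _ | i
  · refine ⟨SchwartzMap.seminorm ℝ 0 1 Θ, apply_nonneg _ _, fun c hc _ x => ?_⟩
    have h := Convex.norm_image_sub_le_of_norm_fderiv_le (𝕜 := ℝ) (s := (univ : Set Space3))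
      (f := Θ) (C := SchwartzMap.seminorm ℝ 0 1 Θ) (fun x _ => Θ.differentiableAt)
      (fun x _ => by
        simpa only [norm_iteratedFDeriv_one] using Θ.norm_iteratedFDeriv_le_seminorm ℝ 1 x)
      convex_univ (mem_univ 0) (mem_univ (c • x))
    rw [norm_iteratedFDeriv_zero]
    refine h.trans ?_
    rw [sub_zero, norm_smul, Real.norm_eq_abs, abs_of_pos hc]
    have := apply_nonneg (SchwartzMap.seminorm ℝ 0 1) Θ
    nlinarith [norm_nonneg x, mul_nonneg hc.le this]
  · refine ⟨SchwartzMap.seminorm ℝ 0 (i + 1) Θ, apply_nonneg _ _, fun c hc hc' x => ?_⟩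
    have hs : ContDiff ℝ (i + 1 : ℕ) Θ := Θ.smooth _
    have h1 : iteratedFDeriv ℝ (i + 1) (fun x => Θ (c • x) - Θ 0) x
        = c ^ (i + 1) • iteratedFDeriv ℝ (i + 1) Θ (c • x) := by
      have h2 : (fun x => Θ (c • x) - Θ 0) = (fun x => Θ (c • x)) - fun _ => Θ 0 := rfl
      rw [h2, iteratedFDeriv_sub_apply (by fun_prop) contDiffAt_const, iteratedFDeriv_succ_const,
        iteratedFDeriv_comp_const_smul _ hs]
      simp
    rw [h1, norm_smul, norm_pow, Real.norm_eq_abs, abs_of_pos hc]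
    have h2 := Θ.norm_iteratedFDeriv_le_seminorm ℝ (i + 1) (c • x)
    calc _ ≤ c * SchwartzMap.seminorm ℝ 0 (i + 1) Θ := by
          gcongr
          exact pow_le_of_le_one hc.le hc' (by simp)
      _ ≤ _ := le_mul_of_one_le_right (mul_nonneg hc.le (apply_nonneg _ _))
          (by linarith [norm_nonneg x])

theorem tendsto_cutoff {Θ : 𝓢(Space3, ℂ)} (hΘ : Θ 0 = 1) (φ : 𝓢(Space3, ℂ)) :
    Tendsto (fun n : ℕ => cutoff Θ (1 / ((n : ℝ) + 1)) φ) atTop (𝓝 φ) := by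
  rw [(schwartz_withSeminorms ℝ Space3 ℂ).tendsto_nhds]
  rintro ⟨k, m⟩ ε hε
  choose B hB0 hB using norm_iteratedFDeriv_scaled_sub_le Θ
  set S : ℝ := ∑ i ∈ Finset.range (m + 1), (m.choose i : ℝ) * B i
    * (SchwartzMap.seminorm ℝ k (m - i) φ + SchwartzMap.seminorm ℝ (k + 1) (m - i) φ) with hS
  have hS0 : 0 ≤ S := Finset.sum_nonneg fun i _ => by
    have := hB0 i
    positivity
  have hlim : Tendsto (fun n : ℕ => 1 / ((n : ℝ) + 1) * S) atTop (𝓝 0) := by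
    simpa using tendsto_one_div_add_atTop_nhds_zero_nat.mul_const S
  filter_upwards [hlim.eventually_lt_const hε] with n hn
  refine lt_of_le_of_lt ?_ hn
  set c : ℝ := 1 / ((n : ℝ) + 1) with hc
  have hc0 : 0 < c := by positivity
  have hc1 : c ≤ 1 := by
    rw [hc, div_le_one (by positivity)]
    linarith [n.cast_nonneg (α := ℝ)]
  refine SchwartzMap.seminorm_le_bound ℝ k m _ (by positivity) fun x => ?_
  have he : ⇑(cutoff Θ c φ - φ) = fun x => (Θ (c • x) - Θ 0) * φ x := by
    ext x
    rw [sub_apply, cutoff_apply, hΘ]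
    ring
  have hsΘ : ContDiff ℝ (m : ℕ) Θ := Θ.smooth _
  have hsφ : ContDiff ℝ (m : ℕ) φ := φ.smooth _
  have hL := norm_iteratedFDeriv_mul_le (f := fun x => Θ (c • x) - Θ 0) (g := φ) (N := m)
    (by fun_prop) hsφ x le_rfl
  rw [he]
  calc _ ≤ ‖x‖ ^ k * ∑ i ∈ Finset.range (m + 1), (m.choose i : ℝ)
        * ‖iteratedFDeriv ℝ i (fun x => Θ (c • x) - Θ 0) x‖ * ‖iteratedFDeriv ℝ (m - i) φ x‖ := by
        gcongr
    _ ≤ ‖x‖ ^ k * ∑ i ∈ Finset.range (m + 1), (m.choose i : ℝ)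
        * (c * B i * (1 + ‖x‖)) * ‖iteratedFDeriv ℝ (m - i) φ x‖ := by
        gcongr with i
        exact hB i c hc0 hc1 x
    _ = ∑ i ∈ Finset.range (m + 1), (m.choose i : ℝ) * c * B i
        * (‖x‖ ^ k * ‖iteratedFDeriv ℝ (m - i) φ x‖
          + ‖x‖ ^ (k + 1) * ‖iteratedFDeriv ℝ (m - i) φ x‖) := by
        rw [Finset.mul_sum]
        refine Finset.sum_congr rfl fun i _ => ?_
        ring
    _ ≤ ∑ i ∈ Finset.range (m + 1), (m.choose i : ℝ) * c * B i
        * (SchwartzMap.seminorm ℝ k (m - i) φ + SchwartzMap.seminorm ℝ (k + 1) (m - i) φ) := by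
        gcongr with i
        · have := hB0 i
          positivity
        · exact φ.le_seminorm ℝ k (m - i) x
        · exact φ.le_seminorm ℝ (k + 1) (m - i) x
    _ = c * S := by
        rw [hS, Finset.mul_sum]
        refine Finset.sum_congr rfl fun i _ => ?_
        ring

/-- A smooth function with values between zero and one that is one on the closed ball of radius
`r` and has compact support. -/
theorem exists_schwartz_cutoff (x₀ : Space3) {r : ℝ} (hr : 0 < r) :
    ∃ χ : 𝓢(Space3, ℂ), HasCompactSupport χ ∧ (∀ x ∈ Metric.closedBall x₀ r, χ x = 1) ∧
      ∀ x, (χ x).im = 0 := by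
  let b : ContDiffBump x₀ := ⟨r, r + 1, hr, by linarith⟩
  have h1 : HasCompactSupport fun x => (b x : ℂ) :=
    b.hasCompactSupport.comp_left Complex.ofReal_zero
  have h2 : ContDiff ℝ (⊤ : ℕ∞) fun x => (b x : ℂ) :=
    Complex.ofRealCLM.contDiff.comp b.contDiff
  refine ⟨h1.toSchwartzMap h2, h1, fun x hx => ?_, fun x => ?_⟩
  · rw [HasCompactSupport.toSchwartzMap_toFun, b.one_of_mem_closedBall hx, Complex.ofReal_one]
  · rw [HasCompactSupport.toSchwartzMap_toFun, Complex.ofReal_im]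

/-! ## The Fourier transform of a compactly supported distribution -/

/-- The weight that makes the Fourier functions integrable. -/
def decayWeight (ξ : Space3) : ℝ := ((1 + ‖ξ‖) ^ 3)⁻¹

theorem decayWeight_pos (ξ : Space3) : 0 < decayWeight ξ := by
  rw [decayWeight]
  positivity

theorem decayWeight_le_one (ξ : Space3) : decayWeight ξ ≤ 1 := by
  rw [decayWeight]
  exact inv_le_one_of_one_le₀ (one_le_pow₀ (by linarith [norm_nonneg ξ]))

theorem decayWeight_sub_le (ξ ζ : Space3) :
    decayWeight (ξ - ζ) ≤ (1 + ‖ζ‖) ^ 3 * decayWeight ξ := by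
  rw [decayWeight, decayWeight, ← div_eq_mul_inv, inv_eq_one_div,
    div_le_div_iff₀ (by positivity) (by positivity), one_mul, ← mul_pow]
  gcongr
  have := norm_le_norm_sub_add ξ ζ
  nlinarith [norm_nonneg ζ, norm_nonneg (ξ - ζ)]

theorem exists_norm_le_decayWeight (φ : 𝓢(Space3, ℂ)) :
    ∃ C, 0 ≤ C ∧ ∀ x, ‖φ x‖ ≤ C * decayWeight x ∧ ‖fderiv ℝ φ x‖ ≤ C * decayWeight x := by
  set C := 2 ^ 3 * (Finset.Iic (3, 1)).sup (fun m => SchwartzMap.seminorm ℝ m.1 m.2) φ with hC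
  refine ⟨C, by positivity, fun x => ⟨?_, ?_⟩⟩
  · have h := SchwartzMap.one_add_le_sup_seminorm_apply (𝕜 := ℝ) (m := (3, 1)) (k := 3) (n := 0)
      le_rfl zero_le_one φ x
    rw [norm_iteratedFDeriv_zero] at h
    rw [decayWeight, ← div_eq_mul_inv, le_div_iff₀ (by positivity), mul_comm]
    exact h
  · have h := SchwartzMap.one_add_le_sup_seminorm_apply (𝕜 := ℝ) (m := (3, 1)) (k := 3) (n := 1)
      le_rfl le_rfl φ x
    rw [norm_iteratedFDeriv_one] at h
    rw [decayWeight, ← div_eq_mul_inv, le_div_iff₀ (by positivity), mul_comm]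
    exact h

/-- Inside the unit ball F is integrable by assumption. Outside, w‖F‖ ≤ k w² + k^(−1)‖F‖²: the first
term decays like ‖ξ‖^(−5), and the second is below the Sobolev integrand because 2s ≥ −1 and k ≥ 1.
-/
theorem integrable_decayWeight_mul {F : Space3 → ℂ} (hF : LocallyIntegrable F volume) {s : ℝ}
    (hs : -(1 / 2) ≤ s) (h : Integrable fun ξ => waveNumber ξ ^ (2 * s) * ‖F ξ‖ ^ 2) :
    Integrable fun ξ => decayWeight ξ * ‖F ξ‖ := by
  have h1 : Integrable ((Metric.closedBall (0 : Space3) 1).indicator fun ξ => ‖F ξ‖) :=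
    IntegrableOn.integrable_indicator (hF.integrableOn_isCompact (isCompact_closedBall 0 1)).norm
      Metric.isClosed_closedBall.measurableSet
  have h2 : Integrable fun ξ : Space3 => 2 * Real.pi * (1 + ‖ξ‖) ^ (-4 : ℝ) :=
    (integrable_one_add_norm (by simp; norm_num)).const_mul _
  have hm : Continuous decayWeight := by
    unfold decayWeight
    exact Continuous.inv₀ (by fun_prop) fun ξ => by positivity
  refine ((h1.add h2).add h).mono' (hm.aestronglyMeasurable.mul hF.aestronglyMeasurable.norm) ?_
  refine Eventually.of_forall fun ξ => ?_
  have hpi := Real.pi_gt_three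
  have hw := decayWeight_pos ξ
  have hk0 := waveNumber_nonneg ξ
  have e2 : 0 ≤ 2 * Real.pi * (1 + ‖ξ‖) ^ (-4 : ℝ) := by positivity
  have e3 : 0 ≤ waveNumber ξ ^ (2 * s) * ‖F ξ‖ ^ 2 := by positivity
  rw [Real.norm_eq_abs, abs_of_nonneg (by positivity)]
  simp only [Pi.add_apply]
  by_cases hξ : ξ ∈ Metric.closedBall (0 : Space3) 1
  · rw [indicator_of_mem hξ]
    have := mul_le_of_le_one_left (norm_nonneg (F ξ)) (decayWeight_le_one ξ)
    linarith
  · rw [indicator_of_notMem hξ, zero_add]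
    rw [mem_closedBall_zero_iff, not_le] at hξ
    have hk : 1 ≤ waveNumber ξ := by
      rw [waveNumber]
      nlinarith
    have hk' : 0 < waveNumber ξ := by linarith
    have e4 : (waveNumber ξ)⁻¹ ≤ waveNumber ξ ^ (2 * s) := by
      rw [← Real.rpow_neg_one]
      exact Real.rpow_le_rpow_of_exponent_le hk (by linarith)
    have e5 : waveNumber ξ * decayWeight ξ ^ 2 ≤ 2 * Real.pi * (1 + ‖ξ‖) ^ (-4 : ℝ) := by
      rw [Real.rpow_neg (by positivity), waveNumber, mul_assoc, decayWeight]
      gcongr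
      rw [show (4 : ℝ) = ((4 : ℕ) : ℝ) by norm_num, Real.rpow_natCast, inv_pow,
        ← div_eq_mul_inv, inv_eq_one_div, div_le_div_iff₀ (by positivity) (by positivity), one_mul,
        ← pow_mul]
      calc _ ≤ (1 + ‖ξ‖) * (1 + ‖ξ‖) ^ 4 := by
            gcongr
            linarith
        _ = (1 + ‖ξ‖) ^ 5 := by ring
        _ ≤ _ := pow_le_pow_right₀ (by linarith) (by norm_num)
    have e6 : decayWeight ξ * ‖F ξ‖
        ≤ waveNumber ξ * decayWeight ξ ^ 2 + (waveNumber ξ)⁻¹ * ‖F ξ‖ ^ 2 := by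
      have := sq_nonneg (waveNumber ξ * decayWeight ξ - ‖F ξ‖)
      have e7 : waveNumber ξ * decayWeight ξ ^ 2 + (waveNumber ξ)⁻¹ * ‖F ξ‖ ^ 2
          = ((waveNumber ξ * decayWeight ξ) ^ 2 + ‖F ξ‖ ^ 2) / waveNumber ξ := by
        field_simp
      rw [e7, le_div_iff₀ hk']
      have : 0 ≤ waveNumber ξ * decayWeight ξ * ‖F ξ‖ := by positivity
      nlinarith
    have e8 : (waveNumber ξ)⁻¹ * ‖F ξ‖ ^ 2 ≤ waveNumber ξ ^ (2 * s) * ‖F ξ‖ ^ 2 := by gcongr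
    linarith

theorem integrable_mul_of_decay {F g : Space3 → ℂ} (hF : AEStronglyMeasurable F volume)
    (h : Integrable fun ξ => decayWeight ξ * ‖F ξ‖) (hg : Continuous g) {C : ℝ}
    (hgC : ∀ x, ‖g x‖ ≤ C * decayWeight x) : Integrable fun ξ => g ξ * F ξ := by
  refine (h.const_mul C).mono' (hg.aestronglyMeasurable.mul hF) (Eventually.of_forall fun ξ => ?_)
  rw [norm_mul, ← mul_assoc]
  exact mul_le_mul_of_nonneg_right (hgC ξ) (norm_nonneg _)

/-- The definition tests against compactly supported functions only. The cutoffs Θ(x/(n + 1)) φ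
converge to φ in Schwartz space, and the weighted integrability of F allows dominated convergence on
the other side. -/
theorem HasFourierFunction.apply_eq {u : 𝓢'(Space3, ℂ)} {F : Space3 → ℂ}
    (h : HasFourierFunction u F) (hF : Integrable fun ξ => decayWeight ξ * ‖F ξ‖)
    (φ : 𝓢(Space3, ℂ)) : (𝓕 u) φ = ∫ ξ, φ ξ * F ξ := by
  obtain ⟨Θ, h1, h2, -⟩ := exists_schwartz_cutoff 0 one_pos
  have h0 : Θ 0 = 1 := h2 0 (by simp)
  obtain ⟨C, hC0, hC⟩ := exists_norm_le_decayWeight φ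
  have hm := h.1.aestronglyMeasurable
  have hI := integrable_mul_of_decay hm hF φ.continuous fun x => (hC x).1
  have t1 : Tendsto (fun n : ℕ => (𝓕 u) (cutoff Θ (1 / ((n : ℝ) + 1)) φ)) atTop (𝓝 ((𝓕 u) φ)) :=
    ((𝓕 u).continuous.tendsto φ).comp (tendsto_cutoff h0 φ)
  have t2 : Tendsto (fun n : ℕ => ∫ ξ, cutoff Θ (1 / ((n : ℝ) + 1)) φ ξ * F ξ) atTop
      (𝓝 (∫ ξ, φ ξ * F ξ)) := by
    refine tendsto_integral_of_dominated_convergence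
      (fun ξ => SchwartzMap.seminorm ℝ 0 0 Θ * ‖φ ξ * F ξ‖)
      (fun n => (SchwartzMap.continuous _).aestronglyMeasurable.mul hm) (hI.norm.const_mul _)
      (fun n => Eventually.of_forall fun ξ => ?_) (Eventually.of_forall fun ξ => ?_)
    · rw [cutoff_apply, mul_assoc, norm_mul]
      gcongr
      exact Θ.norm_le_seminorm ℝ _
    · have h3 : Tendsto (fun n : ℕ => Θ ((1 / ((n : ℝ) + 1)) • ξ)) atTop (𝓝 (Θ 0)) := by
        refine (Θ.continuous.tendsto 0).comp ?_
        simpa using (tendsto_one_div_add_atTop_nhds_zero_nat (𝕜 := ℝ)).smul_const ξ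
      simp only [cutoff_apply, mul_assoc]
      simpa [h0] using h3.mul_const (φ ξ * F ξ)
  refine tendsto_nhds_unique t1 (t2.congr fun n => (h.2 _ ?_).symm)
  have hc : (1 / ((n : ℝ) + 1)) ≠ 0 := by positivity
  have h4 : HasCompactSupport fun x : Space3 => Θ ((1 / ((n : ℝ) + 1)) • x) :=
    h1.comp_homeomorph (Homeomorph.smulOfNeZero _ hc)
  have h5 : ⇑(cutoff Θ (1 / ((n : ℝ) + 1)) φ) = (fun x => Θ ((1 / ((n : ℝ) + 1)) • x)) * φ :=
    funext fun x => cutoff_apply _ _ _ _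
  rw [h5]
  exact h4.mul_right

/-- The product of Schwartz functions. -/
def schwartzMul (φ ψ : 𝓢(Space3, ℂ)) : 𝓢(Space3, ℂ) :=
  SchwartzMap.pairing (ContinuousLinearMap.mul ℂ ℂ) φ ψ

theorem schwartzMul_apply (φ ψ : 𝓢(Space3, ℂ)) (x : Space3) :
    schwartzMul φ ψ x = φ x * ψ x := rfl

theorem apply_schwartzMul {u : 𝓢'(Space3, ℂ)} {K : Set Space3}
    (hu : Distribution.IsVanishingOn u Kᶜ) {U : Set Space3} (hU : IsOpen U) (hK : K ⊆ U)
    {χ : 𝓢(Space3, ℂ)} (hχ : ∀ x ∈ U, χ x = 1) (φ : 𝓢(Space3, ℂ)) :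
    u (schwartzMul φ χ) = u φ := by
  rw [← sub_eq_zero, ← map_sub]
  refine hu _ (Subset.trans ?_ (compl_subset_compl.2 hK))
  refine closure_minimal (fun x hx hxU => hx ?_) hU.isClosed_compl
  rw [sub_apply, schwartzMul_apply, hχ x hxU, mul_one, sub_self]

theorem norm_sub_le_decayWeight (ψ : 𝓢(Space3, ℂ)) : ∃ C, 0 ≤ C ∧ ∀ (r : ℝ) (ξ ζ ζ' : Space3),
    ‖ζ‖ ≤ r → ‖ζ'‖ ≤ r →
      ‖ψ (ξ - ζ) - ψ (ξ - ζ')‖ ≤ C * (1 + r) ^ 3 * ‖ζ - ζ'‖ * decayWeight ξ := by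
  obtain ⟨C, hC0, hC⟩ := exists_norm_le_decayWeight ψ
  refine ⟨C, hC0, fun r ξ ζ ζ' hζ hζ' => ?_⟩
  have h := Convex.norm_image_sub_le_of_norm_hasFDerivWithin_le (𝕜 := ℝ)
    (f := fun z => ψ (ξ - z)) (f' := fun z => -fderiv ℝ ψ (ξ - z))
    (s := Metric.closedBall (0 : Space3) r) (C := C * ((1 + r) ^ 3 * decayWeight ξ))
    (fun z _ => by
      have h1 := (ψ.hasFDerivAt (ξ - z)).comp z ((hasFDerivAt_id z).const_sub ξ)
      rw [ContinuousLinearMap.comp_neg, ContinuousLinearMap.comp_id] at h1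
      exact h1.hasFDerivWithinAt)
    (fun z hz => by
      rw [norm_neg]
      refine (hC _).2.trans (mul_le_mul_of_nonneg_left ((decayWeight_sub_le ξ z).trans ?_) hC0)
      have := (decayWeight_pos ξ).le
      gcongr
      simpa using hz)
    (convex_closedBall 0 r) (x := ζ') (y := ζ) (by simpa using hζ') (by simpa using hζ)
  refine h.trans_eq ?_
  ring

/-- The correlation of `F` with a Schwartz function. -/
def smoothed (ψ : 𝓢(Space3, ℂ)) (F : Space3 → ℂ) (ζ : Space3) : ℂ := ∫ ξ, ψ (ξ - ζ) * F ξ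

theorem integrable_shift_mul {F : Space3 → ℂ} (hF : AEStronglyMeasurable F volume)
    (hI : Integrable fun ξ => decayWeight ξ * ‖F ξ‖) (ψ : 𝓢(Space3, ℂ)) (ζ : Space3) :
    Integrable fun ξ => ψ (ξ - ζ) * F ξ := by
  obtain ⟨C, hC0, hC⟩ := exists_norm_le_decayWeight ψ
  refine integrable_mul_of_decay hF hI (C := C * (1 + ‖ζ‖) ^ 3) (by fun_prop) fun x => ?_
  refine ((hC _).1.trans (mul_le_mul_of_nonneg_left (decayWeight_sub_le x ζ) hC0)).trans_eq ?_
  ring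

theorem smoothed_lipschitz {F : Space3 → ℂ} (hF : AEStronglyMeasurable F volume)
    (hI : Integrable fun ξ => decayWeight ξ * ‖F ξ‖) (ψ : 𝓢(Space3, ℂ)) :
    ∃ C, 0 ≤ C ∧ ∀ (r : ℝ) (ζ ζ' : Space3), ‖ζ‖ ≤ r → ‖ζ'‖ ≤ r →
      ‖smoothed ψ F ζ - smoothed ψ F ζ'‖ ≤ C * (1 + r) ^ 3 * ‖ζ - ζ'‖ := by
  obtain ⟨C, hC0, hC⟩ := norm_sub_le_decayWeight ψ
  refine ⟨C * ∫ ξ, decayWeight ξ * ‖F ξ‖, mul_nonneg hC0 (integral_nonneg fun ξ =>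
    mul_nonneg (decayWeight_pos ξ).le (norm_nonneg _)), fun r ζ ζ' hζ hζ' => ?_⟩
  rw [smoothed, smoothed, ← integral_sub (integrable_shift_mul hF hI ψ ζ)
    (integrable_shift_mul hF hI ψ ζ')]
  refine (norm_integral_le_of_norm_le (hI.const_mul (C * (1 + r) ^ 3 * ‖ζ - ζ'‖))
    (Eventually.of_forall fun ξ => ?_)).trans_eq ?_
  · rw [← sub_mul, norm_mul, ← mul_assoc]
    exact mul_le_mul_of_nonneg_right (hC r ξ ζ ζ' hζ hζ') (norm_nonneg _)
  · rw [integral_const_mul]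
    ring

theorem continuous_smoothed {F : Space3 → ℂ} (hF : AEStronglyMeasurable F volume)
    (hI : Integrable fun ξ => decayWeight ξ * ‖F ξ‖) (ψ : 𝓢(Space3, ℂ)) :
    Continuous (smoothed ψ F) := by
  obtain ⟨C, hC0, hC⟩ := smoothed_lipschitz hF hI ψ
  refine continuous_iff_continuousAt.2 fun ζ => tendsto_iff_norm_sub_tendsto_zero.2 ?_
  have h1 : Tendsto (fun ζ' => C * (1 + (‖ζ‖ + 1)) ^ 3 * ‖ζ' - ζ‖) (𝓝 ζ) (𝓝 0) := by
    have : Continuous fun ζ' => C * (1 + (‖ζ‖ + 1)) ^ 3 * ‖ζ' - ζ‖ := by fun_prop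
    simpa using this.tendsto ζ
  refine squeeze_zero' (Eventually.of_forall fun _ => norm_nonneg _) ?_ h1
  filter_upwards [Metric.ball_mem_nhds ζ one_pos] with ζ' hζ'
  refine hC (‖ζ‖ + 1) ζ' ζ ?_ (by linarith)
  rw [mem_ball_iff_norm] at hζ'
  linarith [norm_le_norm_add_norm_sub' ζ' ζ]

theorem integral_convolution_mul {F : Space3 → ℂ} (hF : AEStronglyMeasurable F volume)
    (hI : Integrable fun ξ => decayWeight ξ * ‖F ξ‖) (ψ : 𝓢(Space3, ℂ)) {φ : 𝓢(Space3, ℂ)}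
    (hφ : HasCompactSupport φ) :
    ∫ ξ, SchwartzMap.convolution (ContinuousLinearMap.mul ℂ ℂ) φ ψ ξ * F ξ
      = ∫ ζ, φ ζ * smoothed ψ F ζ := by
  obtain ⟨C, hC0, hC⟩ := exists_norm_le_decayWeight ψ
  have h1 : ∀ ξ, SchwartzMap.convolution (ContinuousLinearMap.mul ℂ ℂ) φ ψ ξ * F ξ
      = ∫ ζ, φ ζ * (ψ (ξ - ζ) * F ξ) := fun ξ => by
    rw [SchwartzMap.convolution_apply, MeasureTheory.convolution, ← integral_mul_const]
    refine integral_congr_ae (Eventually.of_forall fun ζ => ?_)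
    simp only [ContinuousLinearMap.mul_apply']
    ring
  have h2 : ∀ ζ, φ ζ * smoothed ψ F ζ = ∫ ξ, φ ζ * (ψ (ξ - ζ) * F ξ) := fun ζ => by
    rw [smoothed, integral_const_mul]
  rw [integral_congr_ae (Eventually.of_forall h1), integral_congr_ae (Eventually.of_forall h2)]
  refine integral_integral_swap ?_
  have h3 : Integrable fun ζ : Space3 => C * (1 + ‖ζ‖) ^ 3 * ‖φ ζ‖ := by
    have hc : Continuous fun ζ : Space3 => C * (1 + ‖ζ‖) ^ 3 * ‖φ ζ‖ := by fun_prop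
    exact hc.integrable_of_hasCompactSupport hφ.norm.mul_left
  refine (hI.mul_prod h3).mono' ?_ (Eventually.of_forall fun p => ?_)
  · have e1 : Continuous fun p : Space3 × Space3 => φ p.2 * ψ (p.1 - p.2) := by fun_prop
    refine (e1.aestronglyMeasurable.mul hF.comp_fst).congr (Eventually.of_forall fun p => ?_)
    simp only [Pi.mul_apply, Function.uncurry]
    ring
  · have h4 := (hC (p.1 - p.2)).1.trans
      (mul_le_mul_of_nonneg_left (decayWeight_sub_le p.1 p.2) hC0)
    rw [Function.uncurry, norm_mul, norm_mul]
    calc _ ≤ ‖φ p.2‖ * (C * ((1 + ‖p.2‖) ^ 3 * decayWeight p.1) * ‖F p.1‖) := by gcongr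
      _ = _ := by ring

/-- Multiplication of u by χ changes nothing, so the Fourier function is reproduced by smoothing it
with the inverse transform of χ. This gives a locally Lipschitz representative, which has a value at
zero. -/
theorem HasFourierFunction.ae_eq_smoothed {u : 𝓢'(Space3, ℂ)} {F : Space3 → ℂ}
    (h : HasFourierFunction u F) (hI : Integrable fun ξ => decayWeight ξ * ‖F ξ‖)
    {χ : 𝓢(Space3, ℂ)} (hχ : ∀ φ, u (schwartzMul φ χ) = u φ) :
    ∀ᵐ ξ, F ξ = smoothed (𝓕⁻ χ) F ξ := by
  have hm := h.1.aestronglyMeasurable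
  refine ae_eq_of_integral_contDiff_smul_eq h.1
    (continuous_smoothed hm hI _).locallyIntegrable fun g hg hg' => ?_
  have h1 : HasCompactSupport fun x => (g x : ℂ) := hg'.comp_left Complex.ofReal_zero
  have h2 : ContDiff ℝ (⊤ : ℕ∞) fun x => (g x : ℂ) := Complex.ofRealCLM.contDiff.comp hg
  set φ := h1.toSchwartzMap h2 with hφ
  have hφg : ∀ x, φ x = (g x : ℂ) := fun x => rfl
  have hφc : HasCompactSupport φ := h1
  simp only [Complex.real_smul, ← hφg]
  rw [← integral_convolution_mul hm hI _ hφc, ← h.apply_eq hI, ← h.apply_eq hI,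
    TemperedDistribution.fourier_apply, TemperedDistribution.fourier_apply,
    SchwartzMap.fourier_convolution, FourierTransform.fourier_fourierInv_eq]
  exact (hχ _).symm

theorem HasFourierFunction.smoothed_zero {u : 𝓢'(Space3, ℂ)} {F : Space3 → ℂ}
    (h : HasFourierFunction u F) (hI : Integrable fun ξ => decayWeight ξ * ‖F ξ‖)
    (χ : 𝓢(Space3, ℂ)) : smoothed (𝓕⁻ χ) F 0 = u χ := by
  simp only [smoothed, sub_zero]
  rw [← h.apply_eq hI, TemperedDistribution.fourier_apply, FourierTransform.fourier_fourierInv_eq]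

theorem hasFourierFunction_fourierFunction {u : 𝓢'(Space3, ℂ)}
    (h : ∃ F, HasFourierFunction u F) : HasFourierFunction u (fourierFunction u) := by
  rw [fourierFunction, dif_pos h]
  exact h.choose_spec

/-- The Fourier transform of a real distribution with compact support is Lipschitz continuous near
zero, where it takes the average of the distribution as its value. -/
theorem exists_fourierFunction_near_zero {u : 𝓢'(Space3, ℂ)} (hu : IsRealDistribution u) {s : ℝ}
    (hs : -(1 / 2) ≤ s) (hS : MemHomogeneousSobolev s u) {x₀ : Space3} {R : ℝ} (hR : 0 < R)
    (hsupp : Distribution.IsVanishingOn u (Metric.closedBall x₀ R)ᶜ) :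
    ∃ p C : ℝ, (∀ᵐ ξ, waveNumber ξ < 1 → ‖fourierFunction u ξ - p‖ ≤ C * waveNumber ξ) ∧
      (p = 0 → HasZeroAverage u) := by
  obtain ⟨χ, hχc, hχ1, hχr⟩ := exists_schwartz_cutoff x₀ (show 0 < R + 1 by linarith)
  have hχ : ∀ φ, u (schwartzMul φ χ) = u φ := fun φ =>
    apply_schwartzMul hsupp Metric.isOpen_ball (Metric.closedBall_subset_ball (lt_add_one R))
      (fun x hx => hχ1 x (Metric.ball_subset_closedBall hx)) φ
  have hF := hasFourierFunction_fourierFunction hS.1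
  set F := fourierFunction u
  have hI := integrable_decayWeight_mul hF.1 hs hS.2
  obtain ⟨C, hC0, hC⟩ := smoothed_lipschitz hF.1.aestronglyMeasurable hI (𝓕⁻ χ)
  have hre : u χ = ((u χ).re : ℂ) := Complex.ext rfl (by rw [hu χ hχr, Complex.ofReal_im])
  refine ⟨(u χ).re, C * (1 + 1) ^ 3 / (2 * Real.pi), ?_, fun h0 => ?_⟩
  · filter_upwards [hF.ae_eq_smoothed hI hχ] with ξ hξ hk
    have hpi := Real.pi_gt_three
    have hξ1 : ‖ξ‖ ≤ 1 := by
      rw [waveNumber] at hk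
      nlinarith [norm_nonneg ξ]
    have := hC 1 ξ 0 hξ1 (by simp)
    rw [hF.smoothed_zero hI, hre, ← hξ, sub_zero] at this
    refine this.trans_eq ?_
    rw [waveNumber]
    field_simp
  · intro K U χ' _ hU hKU hK hχ'
    -- The average is tested with an arbitrary χ′. Both χ and χ′ are 1 near sets that carry u, so
    -- u(χ′) = u(χ′χ) = u(χ).
    rw [← apply_schwartzMul (K := Metric.closedBall x₀ R) hsupp Metric.isOpen_ball
      (Metric.closedBall_subset_ball (lt_add_one R))
      (fun x hx => hχ1 x (Metric.ball_subset_closedBall hx)) χ']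
    have e : schwartzMul χ' χ = schwartzMul χ χ' := by
      ext x
      rw [schwartzMul_apply, schwartzMul_apply, mul_comm]
    rw [e, apply_schwartzMul hK hU hKU hχ', hre, h0, Complex.ofReal_zero]

/-! ## The profiles of a localized mode -/

theorem memLp_waveNumber_mul {F : Space3 → ℂ} (hF : AEStronglyMeasurable F volume) {s : ℝ}
    (h : Integrable fun ξ => waveNumber ξ ^ (2 * s) * ‖F ξ‖ ^ 2) :
    MemLp (fun ξ => waveNumber ξ ^ s * ‖F ξ‖) 2 := by
  have hk := continuous_waveNumber.measurable
  have hm : AEStronglyMeasurable (fun ξ => waveNumber ξ ^ s * ‖F ξ‖) volume :=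
    (hk.pow_const s).aestronglyMeasurable.mul hF.norm
  refine (memLp_two_iff_integrable_sq hm).2 (h.congr (Eventually.of_forall fun ξ => ?_))
  simp only [mul_pow]
  rw [← Real.rpow_natCast (waveNumber ξ ^ s), ← Real.rpow_mul (waveNumber_nonneg ξ), mul_comm s]
  norm_num

/-- A common bound for the short wave lengths of two phase points. -/
def shortWaveBound (γ₁ γ₂ : PhasePoint) (ξ : Space3) : ℝ :=
  waveNumber ξ ^ (-(1 / 2) : ℝ) * ‖fourierFunction γ₁.f ξ‖
    + waveNumber ξ ^ (-(1 / 2) : ℝ) * ‖fourierFunction γ₂.f ξ‖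
    + waveNumber ξ ^ (1 / 2 : ℝ) * ‖fourierFunction γ₁.g ξ‖
    + waveNumber ξ ^ (1 / 2 : ℝ) * ‖fourierFunction γ₂.g ξ‖

theorem shortWaveBound_terms_nonneg (u : 𝓢'(Space3, ℂ)) (s : ℝ) (ξ : Space3) :
    0 ≤ waveNumber ξ ^ s * ‖fourierFunction u ξ‖ :=
  mul_nonneg (Real.rpow_nonneg (waveNumber_nonneg ξ) s) (norm_nonneg _)

theorem shortWaveBound_nonneg (γ₁ γ₂ : PhasePoint) (ξ : Space3) : 0 ≤ shortWaveBound γ₁ γ₂ ξ := by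
  have h := fun u s => shortWaveBound_terms_nonneg u s ξ
  exact add_nonneg (add_nonneg (add_nonneg (h _ _) (h _ _)) (h _ _)) (h _ _)

section

variable {γ₁ γ₂ : PhasePoint} {x₀ : Space3} {R : ℝ}

theorem integrable_shortWaveBound_sq (h₁ : γ₁.IsLocalized x₀ R) (h₂ : γ₂.IsLocalized x₀ R) :
    Integrable fun ξ => shortWaveBound γ₁ γ₂ ξ ^ 2 := by
  have h : ∀ {u : 𝓢'(Space3, ℂ)} {s : ℝ}, MemHomogeneousSobolev s u →
      MemLp (fun ξ => waveNumber ξ ^ s * ‖fourierFunction u ξ‖) 2 := fun hu =>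
    memLp_waveNumber_mul (hasFourierFunction_fourierFunction hu.1).1.aestronglyMeasurable hu.2
  exact ((((h h₁.sobolev_f).add (h h₂.sobolev_f)).add (h h₁.sobolev_g)).add
    (h h₂.sobolev_g)).integrable_sq

theorem PhasePoint.IsLocalized.exists_isProfile {γ : PhasePoint} (h : γ.IsLocalized x₀ R)
    (hR : 0 < R) {N : Space3 → ℝ}
    (hN : ∀ ξ, waveNumber ξ ^ (-(1 / 2) : ℝ) * ‖fourierFunction γ.f ξ‖ ≤ N ξ) :
    ∃ p, IsProfile N (fourierFunction γ.f) p ∧ (p = 0 → HasZeroAverage γ.f) := by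
  obtain ⟨p, C, hC, hp⟩ := exists_fourierFunction_near_zero h.real_f le_rfl h.sobolev_f hR
    h.support_f
  exact ⟨p, ⟨(hasFourierFunction_fourierFunction h.sobolev_f.1).1.aestronglyMeasurable, C,
    hC.mono fun ξ hξ => ⟨hξ, fun _ => hN ξ⟩⟩, hp⟩

theorem PhasePoint.IsLocalized.exists_isMomentumProfile {γ : PhasePoint}
    (h : γ.IsLocalized x₀ R) (hR : 0 < R) {N : Space3 → ℝ}
    (hN : ∀ ξ, waveNumber ξ ^ (1 / 2 : ℝ) * ‖fourierFunction γ.g ξ‖ ≤ N ξ) :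
    ∃ g, IsMomentumProfile N (fourierFunction γ.g) g := by
  obtain ⟨g, C, hC, -⟩ := exists_fourierFunction_near_zero h.real_g (by norm_num) h.sobolev_g hR
    h.support_g
  exact ⟨g, (hasFourierFunction_fourierFunction h.sobolev_g.1).1.aestronglyMeasurable, C,
    hC.mono fun ξ hξ => ⟨hξ, fun _ => hN ξ⟩⟩

/-- In every regime the determinant of the covariance matrix is positive and grows. -/
theorem IsRegime.eventually_covarianceDet_of_isLocalized (hR : 0 < R)
    (h₁ : γ₁.IsLocalized x₀ R) (h₂ : γ₂.IsLocalized x₀ R) (hω : symplecticForm γ₂ γ₁ ≠ 0)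
    (hns : ¬ (HasZeroAverage γ₁.f ∧ HasZeroAverage γ₂.f))
    {δ κ : ℝ → ℝ → ℝ} {q κ₀ : ℝ} {l : Filter (ℝ × ℝ)} (hl : IsRegime δ κ q κ₀ l) [l.NeBot]
    (hκ : 0 ≤ κ₀) (hq : q = 0 ∨ ∀ᶠ p in l, δ p.1 p.2 * p.1 ^ 2 * (3 - δ p.1 p.2) = 3 * q)
    {M : ℝ → ℝ → ℝ} (hM : ∀ᶠ p in l, modeOrder p.1 (M p.1 p.2) = 3 / 2 - δ p.1 p.2) :
    ∀ᶠ p in l, 0 < covarianceDet p.1 (M p.1 p.2) γ₁ γ₂ ∧ ∃ d', 0 < d' ∧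
      HasDerivAt (fun H => covarianceDet H (M H p.2) γ₁ γ₂) d' p.1 := by
  have ht := fun ξ u s => shortWaveBound_terms_nonneg u s ξ
  obtain ⟨p₁, hF₁, hp₁⟩ := h₁.exists_isProfile hR (N := shortWaveBound γ₁ γ₂) fun ξ => by
    rw [shortWaveBound]
    linarith [ht ξ γ₂.f (-(1 / 2)), ht ξ γ₁.g (1 / 2), ht ξ γ₂.g (1 / 2)]
  obtain ⟨p₂, hF₂, hp₂⟩ := h₂.exists_isProfile hR (N := shortWaveBound γ₁ γ₂) fun ξ => by
    rw [shortWaveBound]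
    linarith [ht ξ γ₁.f (-(1 / 2)), ht ξ γ₁.g (1 / 2), ht ξ γ₂.g (1 / 2)]
  obtain ⟨g₁, hG₁⟩ := h₁.exists_isMomentumProfile hR (N := shortWaveBound γ₁ γ₂) fun ξ => by
    rw [shortWaveBound]
    linarith [ht ξ γ₁.f (-(1 / 2)), ht ξ γ₂.f (-(1 / 2)), ht ξ γ₂.g (1 / 2)]
  obtain ⟨g₂, hG₂⟩ := h₂.exists_isMomentumProfile hR (N := shortWaveBound γ₁ γ₂) fun ξ => by
    rw [shortWaveBound]
    linarith [ht ξ γ₁.f (-(1 / 2)), ht ξ γ₂.f (-(1 / 2)), ht ξ γ₁.g (1 / 2)]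
  exact hl.eventually_covarianceDet hκ hq hM (shortWaveBound_nonneg γ₁ γ₂)
    (integrable_shortWaveBound_sq h₁ h₂) hF₁ hG₁ hF₂ hG₂
    (fun h => hns ⟨hp₁ h.1, hp₂ h.2⟩) hω

end

/-- The curve r = H^(−2) runs into the filter: along it rH = 1/H tends to zero from above. -/
theorem neBot_fixedRatio : (comap Prod.fst atTop ⊓ comap (fun p : ℝ × ℝ => p.2 * p.1) (𝓝[>] 0) :
    Filter (ℝ × ℝ)).NeBot := by
  have h : Tendsto (fun H : ℝ => (H, (H ^ 2)⁻¹)) atTop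
      (comap Prod.fst atTop ⊓ comap (fun p : ℝ × ℝ => p.2 * p.1) (𝓝[>] 0)) := by
    refine tendsto_inf.2 ⟨tendsto_comap_iff.2 tendsto_id, tendsto_comap_iff.2 ?_⟩
    refine tendsto_inv_atTop_nhdsGT_zero.congr' ?_
    filter_upwards [eventually_gt_atTop 0] with H hH
    simp only [Function.comp_apply]
    field_simp
  exact h.neBot

end

/-! ### Monotonicity of the entropy in the regimes of small mass -/

theorem proposition2 (γ₁ γ₂ : PhasePoint) (x₀ : Space3) (R : ℝ) (hR : 0 < R)
    (h₁ : γ₁.IsLocalized x₀ R) (h₂ : γ₂.IsLocalized x₀ R)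
    (hω : symplecticForm γ₂ γ₁ = 1)
    (hns : ¬ (HasZeroAverage γ₁.f ∧ HasZeroAverage γ₂.f)) :
    (∀ m : ℝ, 0 < m → ∃ Λ : ℝ, 0 < Λ ∧ ∃ ε : ℝ, 0 < ε ∧
      StrictMonoOn (fun H : ℝ => bdEntropy H m γ₁ γ₂) {H : ℝ | Λ < R * H ∧ m / H < ε}) ∧
    (∃ Λ : ℝ, 0 < Λ ∧ ∃ ε : ℝ, 0 < ε ∧
      (∀ m : ℝ, 0 < m → m * R < ε →
        StrictMonoOn (fun H : ℝ => bdEntropy H m γ₁ γ₂) {H : ℝ | Λ < R * H}) ∧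
      (∀ r : ℝ, 0 < r →
        StrictMonoOn (fun H : ℝ => bdEntropy H (r * H) γ₁ γ₂)
          {H : ℝ | Λ < R * H ∧ r * H * R < ε})) := by
  have hω' : symplecticForm γ₂ γ₁ ≠ 0 := by rw [hω]; exact one_ne_zero
  have hmain := @IsRegime.eventually_covarianceDet_of_isLocalized γ₁ γ₂ x₀ R hR h₁ h₂ hω' hns
  constructor
  · intro m hm
    have hl := isRegime_fixedMass (a := pure m) (q := m ^ 2 / 3) rfl (by simpa using hm)
      (by
        rw [mul_div_cancel₀ _ (by norm_num : (3 : ℝ) ≠ 0)]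
        exact tendsto_pure_nhds _ _)
    have hq : ∀ᶠ p : ℝ × ℝ in atTop ×ˢ pure m,
        orderDefect p.1 p.2 * p.1 ^ 2 * (3 - orderDefect p.1 p.2) = 3 * (m ^ 2 / 3) := by
      have h1 : Tendsto (fun H : ℝ => m ^ 2 / H ^ 2) atTop (𝓝 0) :=
        tendsto_const_nhds.div_atTop (tendsto_pow_atTop two_ne_zero)
      rw [prod_pure, eventually_map]
      filter_upwards [h1.eventually_lt_const (show (0 : ℝ) < 9 / 4 by norm_num),
        eventually_gt_atTop 0] with H hH hH0
      rw [mul_right_comm, orderDefect_mul hH.le]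
      field_simp
    have h := hmain hl (by norm_num) (Or.inr hq) (M := fun _ m => m)
      (Eventually.of_forall fun p => modeOrder_eq _ _)
    rw [prod_pure, eventually_map] at h
    obtain ⟨c, hc⟩ := eventually_atTop.1 h
    -- For a fixed mass a large H alone suffices, so ε = 1 is arbitrary. The maximum with 1 keeps Λ
    -- positive.
    refine ⟨R * max c 1, by positivity, 1, one_pos, ?_⟩
    refine (strictMonoOn_bdEntropy (M := fun _ => m) (convex_Ioi c) fun H hH =>
      hc H (le_of_lt hH)).mono fun H hH => ?_
    exact (le_max_left c 1).trans_lt (lt_of_mul_lt_mul_left hH.1 hR.le)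
  · have hla := isRegime_fixedMass (a := 𝓝[>] (0 : ℝ)) (q := 0) rfl self_mem_nhdsWithin
      (by
        have : Continuous fun m : ℝ => m ^ 2 := by fun_prop
        simpa using (this.tendsto 0).mono_left nhdsWithin_le_nhds)
    have ha := hmain hla (by norm_num) (Or.inl rfl) (M := fun _ m => m)
      (Eventually.of_forall fun p => modeOrder_eq _ _)
    have hlb := isRegime_fixedRatio rfl
    have := neBot_fixedRatio
    have hb := hmain hlb le_rfl (Or.inl rfl) (M := fun H r => r * H) (by
      filter_upwards [hlb.eventually_one_lt] with p hp
      have : p.1 ≠ 0 := by linarith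
      rw [← modeOrder_eq, modeOrder, modeOrder]
      congr 2
      field_simp)
    -- A set of the product filter contains a rectangle {H ≥ c} × (0, e). This is the uniformity in
    -- the mass.
    obtain ⟨A, hA, B, hB, hAB⟩ := mem_prod_iff.1 ha
    obtain ⟨c, hc⟩ := mem_atTop_sets.1 hA
    obtain ⟨e, he, heB⟩ := mem_nhdsGT_iff_exists_Ioo_subset.1 hB
    obtain ⟨A', ⟨A'', hA'', hA'⟩, B', ⟨B'', hB'', hB'⟩, hAB'⟩ := mem_inf_iff.1 hb
    obtain ⟨c', hc'⟩ := mem_atTop_sets.1 hA''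
    obtain ⟨e', he', heB'⟩ := mem_nhdsGT_iff_exists_Ioo_subset.1 hB''
    have he0 : 0 < e := he
    have he0' : 0 < e' := he'
    refine ⟨R * max (max c c') 1, by positivity, R * min e e', by positivity, ?_, ?_⟩
    · intro m hm hmR
      have hme : m < e := by
        rw [mul_comm] at hmR
        exact (lt_of_mul_lt_mul_left hmR hR.le).trans_le (min_le_left _ _)
      refine (strictMonoOn_bdEntropy (M := fun _ => m) (convex_Ioi c) fun H hH =>
        @hAB (H, m) ⟨hc H (le_of_lt hH), heB ⟨hm, hme⟩⟩).mono fun H hH => ?_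
      exact ((le_max_left c c').trans (le_max_left _ 1)).trans_lt
        (lt_of_mul_lt_mul_left hH hR.le)
    · intro r hr
      -- At fixed r the condition rH < e′ bounds H from above, so the admissible Hubble rates lie in
      -- an interval, where a positive derivative suffices.
      refine (strictMonoOn_bdEntropy (M := fun H => r * H) (convex_Ioo (max c' 0) (e' / r))
        fun H hH => ?_).mono fun H hH => ?_
      · have h0 : 0 < H := (le_max_right c' 0).trans_lt hH.1
        have h1 : c' ≤ H := (le_max_left c' 0).trans hH.1.le
        have h2 : r * H < e' := by
          rw [mul_comm, ← lt_div_iff₀ hr]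
          exact hH.2
        have h3 : (H, r) ∈ A' ∩ B' := ⟨hA' (hc' H h1), hB' (heB' ⟨by positivity, h2⟩)⟩
        rw [← hAB'] at h3
        exact h3
      · have h1 : max (max c c') 1 < H := lt_of_mul_lt_mul_left hH.1 hR.le
        have h2 : r * H < min e e' := by
          have := hH.2
          rw [mul_comm (r * H)] at this
          exact lt_of_mul_lt_mul_left this hR.le
        refine ⟨max_lt ?_ ?_, ?_⟩
        · exact ((le_max_right c c').trans (le_max_left _ 1)).trans_lt h1
        · exact one_pos.trans ((le_max_right _ _).trans_lt h1)
        · rw [lt_div_iff₀ hr, mul_comm]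
          exact h2.trans_le (min_le_right _ _)
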